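/- **Setting.** Let $M$ be a connected smooth manifold of dimension $d\ge 2$ (Hausdorff, second countable, without boundary) with a smooth Riemannian metric and Riemannian measure $\nu_M$. Let $m:M\to[0,\infty)$ be a Morse function such that $m^{-1}([0,b])$ is compact for all $b>0$, every critical value is attained at exactly one critical point, and $m$ is onto $[0,\infty)$ if $M$ is non-compact and onto $[0,1]$ if $M$ is compact. Put $J_t=m^{-1}(t)$; for regular $t$, let $\nu_t$ be the Riemannian measure of $J_t$ with the induced metric. Let $X=\operatorname{grad}m/|\operatorname{grad}m|^2$ off the critical points, let $F_\vartheta(t,x)=F_{\vartheta,t}(x)=\eta(t)$ where $\eta'=X(\eta)$, $\eta(\vartheta)=x\in J_\vartheta$, and let $\psi_\vartheta(t,x)=|\det DF_\vartheta(t,x)|$, where the differential is taken on $\mathbb R\times T_xJ_\vartheta$. **$H$-operators.** Let $N$ be $M$ or a level set $J_\vartheta$ of a regular value. A simple $H$-operator on $N$ is $Hf(x)=\varphi(x)f(\Phi(x))$ for $x\in V$ and $Hf(x)=0$ for $x\notin V$, where $\Phi:V\to V'$ is a $C^\infty$ diffeomorphism of open subsets of $N$ and $\varphi\in C^\infty_c(N)$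 has $\operatorname{supp}\varphi\subset V$. An $H$-operator ($T\in\mathcal H(N)$) is a finite combination of simple ones, and it is localized on an open set $U$ if they can be chosen with $V,V'\subset U$. Since $Tf(x)$ is a finite combination of values of $f$, we let $T$ act on all functions and on $L^p$ by the same formula. A family $\{P_U\}_{U\in\mathcal U}$ is a smooth decomposition of identity in $L^p(N,\mu)$ subordinate to an open precompact cover $\mathcal U$, with decomposition constant $C>0$, if: (a) for each compact $K$, all but finitely many $P_U$ with $U\cap K\ne\emptyset$ are zero; (b) $P_U\in\mathcal H(N)$ is localized on $U$; (c) $P_U$ induces a bounded projection on $L^p(\mu)$; (d) $P_UP_{U'}=0$ for $U\ne U'$; (e) $\sum_UP_Uf=f$ unconditionally in $L^p(\mu)$ for all $f$; (f) $\frac1C\|f\|_p\le(\sum_U\|P_Uf\|_p^p)^{1/p}\le C\|f\|_p$ for all $f$. **Latitudinal projections.** Fix $1\le p<\infty$, $\delta>0$ and a smooth $s:\mathbb R\to[0,1]$ with $\operatorname{supp}s\subset(-\delta,\infty)$ and $s^2(t)+s^2(-t)=1$. If $[\vartheta-\delta,\vartheta+\delta]$ contains no critical value, let $E_\vartheta f(y)=f(y)$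 for $m(y)\ge\vartheta+\delta$, $E_\vartheta f(y)=0$ for $m(y)\le\vartheta-\delta$, and otherwise, with $y=F_\vartheta(t,x)$, $$E_\vartheta f(y)=s^2(t-\vartheta)f(y)+s(t-\vartheta)s(\vartheta-t)\Big(\tfrac{\psi_\vartheta(2\vartheta-t,x)}{\psi_\vartheta(t,x)}\Big)^{1/p}f(F_\vartheta(2\vartheta-t,x)).$$ Put $Q_{\vartheta_1,\vartheta_2}=E_{\vartheta_1}-E_{\vartheta_2}$, and $B_p=\sup_{0\le\xi\le1}\|A_\xi\|_{\ell^p_2\to\ell^p_2}$ with $A_\xi=\begin{pmatrix}\xi&\sqrt{\xi(1-\xi)}\\\sqrt{\xi(1-\xi)}&1-\xi\end{pmatrix}$. **Critical level.** Let $z$ be a critical point, $t_z=m(z)$, and $U_z$ an open neighbourhood of $z$. Let $I=(a,b)\subset m(M)$ be an interval such that $t_z\in I$ is the only critical value in $[a,b]$. Let $\tilde J_t\subset J_t$ ($t\in I$) be relatively open sets such that $F_{\vartheta,t}$ is defined on $\tilde J_\vartheta$ and maps it into $\tilde J_t$ for all $\vartheta,t\in I$. Let $V_z\ni z$ be open with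 $\overline{V_z}\subset U_z$, and let $\delta_z>0$ be such that $[t_z-\delta_z,t_z+\delta_z]\subset I$ and, for all $\vartheta,t\in[t_z-\delta_z,t_z+\delta_z]$, $$J_t\setminus\tilde J_t\subset V_z,\qquad J_t\setminus F_{\vartheta,t}(J_\vartheta\setminus V_z)\subset U_z.$$ Let $t_z-\delta_z<\vartheta_1<t_z<\vartheta_2<t_z+\delta_z$, $\vartheta\in[\vartheta_1,\vartheta_2]\setminus\{t_z\}$ and $0<\delta<\min(|t_z-\vartheta_1|,|t_z-\delta_z-\vartheta_1|,|t_z-\vartheta_2|,|t_z+\delta_z-\vartheta_2|)$. Write $Q=Q_{\vartheta_1,\vartheta_2}$, $\psi=\psi_\vartheta$ and $\mu=\psi(\vartheta,\cdot)\nu_\vartheta$ on $J_\vartheta$. **Lifting.** If $P\in\mathcal H(J_\vartheta)$ is localized on an open set $U\subset\tilde J_\vartheta$, put $$\Pi^M_Pf(y)=P\Big(f(F_\vartheta(t,\cdot))\big(\tfrac{\psi(t,\cdot)}{\psi(\vartheta,\cdot)}\big)^{1/p}\Big)(x)\,\big(\tfrac{\psi(\vartheta,x)}{\psi(t,x)}\big)^{1/p}\quad\text{for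 }y=F_\vartheta(t,x),\ (t,x)\in I\times\tilde J_\vartheta,$$ $\Pi^M_Pf(y)=0$ for all other $y\in M$, and $O(U)=\bigcup_{r\in(\vartheta_1-\delta,\vartheta_2+\delta)}F_{\vartheta,r}(U)$. **Theorem.** Let $1\le p<\infty$. (i) Let $U\subset\tilde J_\vartheta$ be open and let $P_U\in\mathcal H(J_\vartheta)$ be localized on $U$ and induce a bounded projection on $L^p(J_\vartheta,\mu)$. Then $P_{O(U)}:=\Pi^M_{P_U}\circ Q=Q\circ\Pi^M_{P_U}$, the two compositions being equal; $O(U)$ is open, $P_{O(U)}\in\mathcal H(M)$ is localized on $O(U)$, and it induces a projection on $L^p(M)$ of norm at most $B_p\|P_U\|$. (ii) Let $\mathcal U$ be a finite open cover of $J_\vartheta$ containing $U_0:=J_\vartheta\cap V_z$ and such that $U\subset\tilde J_\vartheta$ for all $U\in\mathcal U$ with $U\ne U_0$. Let $\{P_U\}_{U\in\mathcal U}$ be a smooth decomposition of identity in $L^p(J_\vartheta,\mu)$ subordinate to $\mathcal U$ with decomposition constant $C$. Put $P_{O(U_0)}=Q-\sum_{U\ne U_0}P_{O(U)}$. Then the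 set $$O(U_0)=\bigcup_{r\in(\vartheta_1-\delta,\vartheta_2+\delta)}J_r\setminus F_{\vartheta,r}(J_\vartheta\setminus U_0)$$ is open and contained in $U_z$, $P_{O(U_0)}\in\mathcal H(M)$ is localized on $O(U_0)$, and it induces a projection on $L^p(M)$ of norm at most $B_p(C^2+1)$. (iii) In the situation of (ii), the sets $O(U)$, $U\in\mathcal U$, are open and precompact and their union is $m^{-1}(\vartheta_1-\delta,\vartheta_2+\delta)$, the family $\{P_{O(U)}\}_{U\in\mathcal U}$ has the properties (a)–(d) on $M$ with respect to these sets, $\sum_{U\in\mathcal U}P_{O(U)}=Q$, and for all $f\in L^p(M)$ $$\frac1{2C}\|Qf\|_p\le\Big(\sum_{U\in\mathcal U}\|P_{O(U)}f\|_p^p\Big)^{1/p}\le B_p\big(C^{3p}+(C^2+1)^p\big)^{1/p}\|Qf\|_p.$$ If $p=2$ and all the projections $P_U$ are orthogonal on $L^2(J_\vartheta,\mu)$, then all the projections $P_{O(U)}$ are orthogonal on $L^2(M)$. -/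

import Mathlib

open Set Filter Topology MeasureTheory Manifold
open scoped ENNReal ContDiff Manifold

universe u v w

noncomputable section

namespace Hestenes

/-! Linear algebra: Gram matrices and the absolute determinant of a linear map. -/

/-- Gram matrix of a finite family of vectors with respect to a bilinear form. -/
def gram {V : Type*} {κ : Type*} (β : V → V → ℝ) (e : κ → V) : Matrix κ κ ℝ :=
  Matrix.of fun i j => β (e i) (e j)

/-- `|det A|` for a linear map `A` between inner product spaces of equal finite dimension, the
inner products being `βV` and `βW`. It is computed in a basis of `V`; the value does not depend
on the basis, and for an orthonormal basis `e` it is `√ det (βW (A eᵢ) (A eⱼ))`. -/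
def absDet {V W : Type*} [AddCommGroup V] [Module ℝ V] [Module.Finite ℝ V]
    [AddCommGroup W] [Module ℝ W] (βV : V → V → ℝ) (βW : W → W → ℝ) (A : V →ₗ[ℝ] W) : ℝ :=
  Real.sqrt ((gram βW fun i => A (Module.finBasis ℝ V i)).det /
    (gram βV (Module.finBasis ℝ V)).det)

/-! The constant `B_p`. -/

/-- The matrix `A_ξ` with rows `(ξ, √(ξ(1-ξ)))` and `(√(ξ(1-ξ)), 1-ξ)`. -/
def awwMatrix (ξ : ℝ) : Matrix (Fin 2) (Fin 2) ℝ :=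
  !![ξ, Real.sqrt (ξ * (1 - ξ)); Real.sqrt (ξ * (1 - ξ)), 1 - ξ]

/-- `B_p = sup_{0 ≤ ξ ≤ 1} ‖A_ξ‖`, the norm being that of operators on two-dimensional `ℓ^p`.
(Changing the sign of the off-diagonal entries does not change the norm.) -/
def awwConst (p : ℝ≥0∞) [Fact (1 ≤ p)] : ℝ :=
  ⨆ ξ : Icc (0 : ℝ) 1, ‖(Matrix.toLpLin p p (awwMatrix ξ)).toContinuousLinearMap‖

/-- A smooth cut-off `s : ℝ → [0,1]` with `supp s ⊆ (-δ, ∞)` and `s²(t) + s²(-t) = 1`. -/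
structure IsCutoff (δ : ℝ) (s : ℝ → ℝ) : Prop where
  smooth : ContDiff ℝ ∞ s
  mem_Icc : ∀ t, s t ∈ Icc (0 : ℝ) 1
  tsupport_subset : tsupport s ⊆ Ioi (-δ)
  sq_add_sq : ∀ t, s t ^ 2 + s (-t) ^ 2 = 1

/-! Operators induced on `L^p`. -/

/-- Operators acting on real functions on `N`. -/
abbrev Op (N : Type*) := (N → ℝ) → (N → ℝ)

/-- The bounded operator `A` on `L^p(μ)` is induced by `T`: it sends the class of `f` to the class
of `T f` for every `p`-integrable `f` (so `T` respects equality almost everywhere). -/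
def Induces {N : Type*} [MeasurableSpace N] {μ : Measure N} {p : ℝ≥0∞} [Fact (1 ≤ p)]
    (T : Op N) (A : Lp ℝ p μ →L[ℝ] Lp ℝ p μ) : Prop :=
  ∀ (f : N → ℝ) (hf : MemLp f p μ), A (hf.toLp f) =ᵐ[μ] T f

/-- `T` is symmetric for the inner product of `L²(μ)`; an idempotent operator on `L²(μ)` is an
orthogonal projection precisely when it is symmetric. -/
def IsSymmetricL2 {N : Type*} [MeasurableSpace N] (μ : Measure N) (T : Op N) : Prop :=
  ∀ f h : N → ℝ, MemLp f 2 μ → MemLp h 2 μ → ∫ x, T f x * h x ∂μ = ∫ x, f x * T h x ∂μ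

/-! Embedded submanifolds.

An embedded submanifold of the `d`-dimensional manifold `M` is presented by a space `N` with its
inclusion `j : N → M`. Only two cases are used: `N = M`, `j = id`, and `N` a level set of a
function on `M` with the subspace topology and `j` the coercion. A function on `N`, or a map from
`N` to itself, is smooth if it is locally the restriction of a smooth one on `M`. -/

section Submanifold

variable (d : ℕ) {M : Type u} [TopologicalSpace M] [ChartedSpace (EuclideanSpace ℝ (Fin d)) M]
  {N : Type v} [TopologicalSpace N] (j : N → M)

/-- Smoothness at `x` of a real function on a submanifold. -/
def SmoothFunAt (φ : N → ℝ) (x : N) : Prop :=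
  ∃ φ' : M → ℝ, ContMDiffAt (𝓡 d) 𝓘(ℝ, ℝ) ∞ φ' (j x) ∧ φ' ∘ j =ᶠ[𝓝 x] φ

/-- Smoothness at `x` of a map from a submanifold to itself. -/
def SmoothMapAt (Φ : N → N) (x : N) : Prop :=
  ∃ Φ' : M → M, ContMDiffAt (𝓡 d) (𝓡 d) ∞ Φ' (j x) ∧ Φ' ∘ j =ᶠ[𝓝 x] j ∘ Φ

/-- The data `(φ, Φ, V)` of a simple `H`-operator on `N`: a diffeomorphism `Φ : V → V'` between
open sets (`V = Φ.source`, `V' = Φ.target`) and a compactly supported smooth function `φ` with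
`supp φ ⊆ V`. -/
structure SimpleH where
  Φ : OpenPartialHomeomorph N N
  φ : N → ℝ
  smooth_map : ∀ x ∈ Φ.source, SmoothMapAt d j Φ x
  smooth_symm : ∀ x ∈ Φ.target, SmoothMapAt d j Φ.symm x
  smooth_fun : ∀ x, SmoothFunAt d j φ x
  hasCompactSupport : HasCompactSupport φ
  tsupport_subset : tsupport φ ⊆ Φ.source

variable {d j} in
/-- `H f (x) = φ(x) f(Φ(x))` for `x ∈ V`, and `0` otherwise. -/
def SimpleH.toOp (H : SimpleH d j) : Op N := fun f =>
  H.Φ.source.indicator fun x => H.φ x * f (H.Φ x)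

/-- `T` is an `H`-operator on `N` localized on `U`: a finite combination of simple `H`-operators
with `V ⊆ U` and `V' ⊆ U` (scalars are absorbed in the functions `φ`). Such a combination maps
`C₀(N)` to itself. Here it is regarded as acting on all functions by the same formula: since
`T f (x)` is a finite combination of values of `f`, its action on `C₀(N)` and its action on all
functions determine each other. -/
def IsLocalizedHOp (U : Set N) (T : Op N) : Prop :=
  ∃ (n : ℕ) (H : Fin n → SimpleH d j),
    (∀ k, (H k).Φ.source ⊆ U ∧ (H k).Φ.target ⊆ U) ∧ ∀ f x, T f x = ∑ k, (H k).toOp f x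

/-- Families of operators `P_i` subordinate to open precompact sets `U_i`: the first four
properties of a smooth decomposition of identity in `L^p(μ)`, `A_i` being the operator on
`L^p(μ)` that is induced by `P_i`. -/
structure IsProjectionFamily [MeasurableSpace N] {κ : Type w} (U : κ → Set N) (P : κ → Op N)
    (p : ℝ≥0∞) [Fact (1 ≤ p)] (μ : Measure N) (A : κ → (Lp ℝ p μ →L[ℝ] Lp ℝ p μ)) : Prop where
  isOpen : ∀ i, IsOpen (U i)
  precompact : ∀ i, IsCompact (closure (U i))
  locallyFinite : ∀ K : Set N, IsCompact K → {i | (U i ∩ K).Nonempty ∧ P i ≠ 0}.Finite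
  localized : ∀ i, IsLocalizedHOp d j (U i) (P i)
  induces : ∀ i, Induces (P i) (A i)
  idempotent : ∀ i, A i ∘L A i = A i
  orthogonal : ∀ i k, i ≠ k → A i ∘L A k = 0

/-- A smooth decomposition of identity in `L^p(μ)`, `1 ≤ p < ∞`, subordinate to the cover `U_i`,
with decomposition constant `C`. -/
structure IsSmoothDecomposition [MeasurableSpace N] {κ : Type w} (U : κ → Set N)
    (P : κ → Op N) (p : ℝ≥0∞) [Fact (1 ≤ p)] (μ : Measure N)
    (A : κ → (Lp ℝ p μ →L[ℝ] Lp ℝ p μ)) (C : ℝ) : Prop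
    extends IsProjectionFamily d j U P p μ A where
  cover : ⋃ i, U i = univ
  hasSum : ∀ f, HasSum (fun i => A i f) f
  pos : 0 < C
  summable : ∀ f, Summable fun i => ‖A i f‖ ^ p.toReal
  lower : ∀ f, 1 / C * ‖f‖ ≤ (∑' i, ‖A i f‖ ^ p.toReal) ^ (1 / p.toReal)
  upper : ∀ f, (∑' i, ‖A i f‖ ^ p.toReal) ^ (1 / p.toReal) ≤ C * ‖f‖

end Submanifold

/-! Riemannian geometry of `M` and of a Morse function. -/

section Riemannian

variable {d : ℕ} {M : Type u} [TopologicalSpace M] [ChartedSpace (EuclideanSpace ℝ (Fin d)) M]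

/-- A critical point of `m`. -/
def IsCrit (d : ℕ) {M : Type u} [TopologicalSpace M]
    [ChartedSpace (EuclideanSpace ℝ (Fin d)) M] (m : M → ℝ) (x : M) : Prop :=
  mfderiv (𝓡 d) 𝓘(ℝ, ℝ) m x = 0

/-- The Hessian of `m` at `x` in the preferred chart at `x`. -/
def hessian (d : ℕ) {M : Type u} [TopologicalSpace M]
    [ChartedSpace (EuclideanSpace ℝ (Fin d)) M] (m : M → ℝ) (x : M) :
    EuclideanSpace ℝ (Fin d) →L[ℝ] EuclideanSpace ℝ (Fin d) →L[ℝ] ℝ :=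
  fderiv ℝ (fderiv ℝ (m ∘ (extChartAt (𝓡 d) x).symm)) (extChartAt (𝓡 d) x x)

/-- Morse functions `m : M → [0,∞)` with compact preimages `m⁻¹([0,b])`, with at most one critical
point on each level, and onto `[0,∞)` or `[0,1]` if `M` is non-compact or compact, respectively. -/
structure IsMorse (d : ℕ) {M : Type u} [TopologicalSpace M]
    [ChartedSpace (EuclideanSpace ℝ (Fin d)) M] (m : M → ℝ) : Prop where
  smooth : ContMDiff (𝓡 d) 𝓘(ℝ, ℝ) ∞ m
  nondegenerate : ∀ x, IsCrit d m x → ∀ v, (∀ w, hessian d m x v w = 0) → v = 0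
  compact_preimage : ∀ b > 0, IsCompact (m ⁻¹' Icc 0 b)
  crit_unique : ∀ x y, IsCrit d m x → IsCrit d m y → m x = m y → x = y
  range_noncompact : ¬ CompactSpace M → range m = Ici 0
  range_compact : CompactSpace M → range m = Icc 0 1

/-- The level set `J_t = m⁻¹(t)`. -/
def level (m : M → ℝ) (t : ℝ) : Set M := m ⁻¹' {t}

variable [IsManifold (𝓡 d) ∞ M]

/-- Smooth Riemannian metrics on `M`. -/
abbrev Metric (d : ℕ) (M : Type u) [TopologicalSpace M]
    [ChartedSpace (EuclideanSpace ℝ (Fin d)) M] [IsManifold (𝓡 d) ∞ M] :=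
  Bundle.ContMDiffRiemannianMetric (𝓡 d) ∞ (EuclideanSpace ℝ (Fin d))
    (fun x : M => TangentSpace (𝓡 d) x)

/-- A local parametrization of the `k`-dimensional submanifold `N`: an injective immersion `σ`
of an open subset of `ℝ^k`. -/
structure LocalParam (d : ℕ) {M : Type u} [TopologicalSpace M]
    [ChartedSpace (EuclideanSpace ℝ (Fin d)) M] {N : Type v} (j : N → M) (k : ℕ) where
  σ : EuclideanSpace ℝ (Fin k) → N
  W : Set (EuclideanSpace ℝ (Fin k))
  isOpen : IsOpen W
  smooth : ContMDiffOn (𝓡 k) (𝓡 d) ∞ (j ∘ σ) W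
  injOn : InjOn σ W
  immersion : ∀ y ∈ W, Function.Injective (mfderiv (𝓡 k) (𝓡 d) (j ∘ σ) y)

variable (g : Metric d M)

/-- The image under `σ` of the measure `√ det (g(∂ᵢσ, ∂ⱼσ)) dy` on the domain of `σ`. -/
def LocalParam.measure {N : Type v} [MeasurableSpace N] {j : N → M} {k : ℕ}
    (c : LocalParam d j k) : Measure N :=
  ((volume.restrict c.W).withDensity fun y => ENNReal.ofReal (Real.sqrt
    (gram (fun v w => g.inner (j (c.σ y)) v w) fun i : Fin k =>
      mfderiv (𝓡 k) (𝓡 d) (j ∘ c.σ) y (EuclideanSpace.single i 1)).det)).map c.σ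

/-- The Riemannian measure of a `k`-dimensional submanifold `N` with the metric inherited from
`M`. The measures given by the local parametrizations are the restrictions of one measure to
the images of the parametrizations, and that measure is their supremum. -/
def riemannianMeasure {N : Type v} [MeasurableSpace N] (j : N → M) (k : ℕ) : Measure N :=
  ⨆ c : LocalParam d j k, c.measure g

/-- The gradient of `m`: the vector that represents the differential. -/
def grad (m : M → ℝ) (x : M) : TangentSpace (𝓡 d) x :=
  Function.invFun (fun v : TangentSpace (𝓡 d) x => g.inner x v) (mfderiv (𝓡 d) 𝓘(ℝ, ℝ) m x)

/-- The renormalized gradient field `X = grad m / |grad m|²`. -/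
def normGrad (m : M → ℝ) (x : M) : TangentSpace (𝓡 d) x :=
  (g.inner x (grad g m x) (grad g m x))⁻¹ • grad g m x

/-- Some integral curve of `X`, free of critical points and defined on an open interval that
contains `ϑ` and `t`, is at `x` at time `ϑ`. -/
def FlowReaches (m : M → ℝ) (ϑ t : ℝ) (x : M) : Prop :=
  ∃ (η : ℝ → M) (a b : ℝ), ϑ ∈ Ioo a b ∧ t ∈ Ioo a b ∧ η ϑ = x ∧
    (∀ r ∈ Ioo a b, ¬ IsCrit d m (η r)) ∧ IsMIntegralCurveOn η (normGrad g m) (Ioo a b)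

open scoped Classical in
/-- `F_{ϑ,t}(x) = η(t)`, where `η' = X(η)` and `η(ϑ) = x` (and `x` where there is no such
curve, which is never used). As `m` grows along these curves at unit speed, `F_{ϑ,t}` maps points
of `J_ϑ` to points of `J_t`. -/
def flow (m : M → ℝ) (ϑ t : ℝ) (x : M) : M :=
  if h : FlowReaches g m ϑ t x then h.choose t else x

/-- The differential at `(t,x)` of `F_ϑ : (t,x) ↦ F_{ϑ,t}(x)` on `ℝ × T_x J_ϑ`, where the tangent
space of the level set is the kernel of the differential of `m`. -/
def flowDeriv (m : M → ℝ) (ϑ t : ℝ) (x : M) :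
    (ℝ × (mfderiv (𝓡 d) 𝓘(ℝ, ℝ) m x).ker) →ₗ[ℝ] TangentSpace (𝓡 d) (flow g m ϑ t x) :=
  (mfderiv (𝓘(ℝ, ℝ).prod (𝓡 d)) (𝓡 d) (fun q : ℝ × M => flow g m ϑ q.1 q.2)
    (t, x)).toLinearMap ∘ₗ
    (LinearMap.prodMap LinearMap.id (mfderiv (𝓡 d) 𝓘(ℝ, ℝ) m x).ker.subtype :
      (ℝ × (mfderiv (𝓡 d) 𝓘(ℝ, ℝ) m x).ker) →ₗ[ℝ] ℝ × TangentSpace (𝓡 d) x)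

instance (x : M) : Module.Finite ℝ (TangentSpace (𝓡 d) x) :=
  inferInstanceAs (Module.Finite ℝ (EuclideanSpace ℝ (Fin d)))

/-- The weight `ψ_ϑ(t,x) = |det DF_ϑ(t,x)|` for `x ∈ J_ϑ`: the density of the Riemannian measure of
`M` in the coordinates `(t,x)`. -/
def flowWeight (m : M → ℝ) (ϑ t : ℝ) (x : M) : ℝ :=
  absDet (fun v w => v.1 * w.1 + g.inner x (v.2 : TangentSpace (𝓡 d) x) w.2)
    (fun v w => g.inner (flow g m ϑ t x) v w) (flowDeriv g m ϑ t x)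

/-- The measure `ψ_ϑ(ϑ,·) ν_ϑ` on `J_ϑ`. -/
def levelMeasure [MeasurableSpace M] (m : M → ℝ) (ϑ : ℝ) : Measure (level m ϑ) :=
  (riemannianMeasure g (Subtype.val : level m ϑ → M) (d - 1)).withDensity
    fun x => ENNReal.ofReal (flowWeight g m ϑ ϑ x)

/-- Extension by zero of a function on `J_ϑ`. -/
def extendZero (m : M → ℝ) (ϑ : ℝ) (h : level m ϑ → ℝ) : M → ℝ :=
  Function.extend Subtype.val h 0

/-! Latitudinal projections and lifting. -/

/-- The operator `E_ϑ` with cut-off `s` and parameters `δ`, `p`. -/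
def aww (m : M → ℝ) (p : ℝ≥0∞) (s : ℝ → ℝ) (δ ϑ : ℝ) : Op M := fun f y =>
  if ϑ + δ ≤ m y then f y
  else if m y ≤ ϑ - δ then 0
  else
    let t := m y
    let x := flow g m t ϑ y
    s (t - ϑ) ^ 2 * f y + s (t - ϑ) * s (ϑ - t) *
      (flowWeight g m ϑ (2 * ϑ - t) x / flowWeight g m ϑ t x) ^ (1 / p.toReal) *
        f (flow g m ϑ (2 * ϑ - t) x)

/-- The latitudinal projection `Q_{ϑ₁,ϑ₂} = E_{ϑ₁} - E_{ϑ₂}`. -/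
def latitudinal (m : M → ℝ) (p : ℝ≥0∞) (s : ℝ → ℝ) (δ ϑ₁ ϑ₂ : ℝ) : Op M :=
  aww g m p s δ ϑ₁ - aww g m p s δ ϑ₂

open scoped Classical in
/-- The global lifting operator `Π^M` of an operator `P` on `J_ϑ`, for the interval `I = (a,b)` and
the sets `S_t ⊆ J_t` in the role of `J̃_t`. If `y = F_ϑ(t,x)` with `t ∈ I` and `x ∈ S_ϑ`, i.e. if
`t = m(y) ∈ I`, `y ∈ S_t` and `x = F_{t,ϑ}(y)`, then
`Π^M f (y) = P(f(F_ϑ(t,·)) (ψ(t,·)/ψ(ϑ,·))^{1/p})(x) (ψ(ϑ,x)/ψ(t,x))^{1/p}`, and `Π^M f (y) = 0` for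
all other `y`. When `P` is localized on `S_ϑ`, only the values of its argument on `S_ϑ` matter. -/
def lift (m : M → ℝ) (p : ℝ≥0∞) (a b : ℝ) (S : ℝ → Set M) (ϑ : ℝ) (P : Op (level m ϑ)) : Op M :=
  fun f y =>
    if m y ∈ Ioo a b ∧ y ∈ S (m y) then
      let t := m y
      let x := flow g m t ϑ y
      extendZero m ϑ (P fun x' => f (flow g m ϑ t x') *
          (flowWeight g m ϑ t x' / flowWeight g m ϑ ϑ x') ^ (1 / p.toReal)) x *
        (flowWeight g m ϑ ϑ x / flowWeight g m ϑ t x) ^ (1 / p.toReal)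
    else 0

/-- `O(U)`, the union of `F_{ϑ,r}(U)` over `r ∈ (c, e)`. -/
def sweep (m : M → ℝ) (ϑ c e : ℝ) (U : Set (level m ϑ)) : Set M :=
  ⋃ r ∈ Ioo c e, flow g m ϑ r '' (Subtype.val '' U)

/-- `O(U₀)`, the union of `J_r \ F_{ϑ,r}(J_ϑ \ U₀)` over `r ∈ (c, e)`. -/
def cosweep (m : M → ℝ) (ϑ c e : ℝ) (U₀ : Set (level m ϑ)) : Set M :=
  ⋃ r ∈ Ioo c e, level m r \ flow g m ϑ r '' (Subtype.val '' U₀ᶜ)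

open scoped Classical in
/-- The family of operators `P_{O(U)}`: it consists of `Π^M ∘ Q` for `U ≠ U₀`, and of the difference
of `Q` and the sum of these operators for `U₀`. -/
def liftedFamily {κ : Type w} [Fintype κ] (i₀ : κ) (Q : Op M) (L : κ → Op M) : κ → Op M := fun i =>
  if i = i₀ then Q - ∑ k ∈ Finset.univ.filter (· ≠ i₀), L k ∘ Q else L i ∘ Q

open scoped Classical in
/-- The corresponding sets `O(U)`, `U ≠ U₀`, and `O(U₀)`. -/
def liftedCover {κ : Type w} (m : M → ℝ) (ϑ c e : ℝ) (i₀ : κ) (U : κ → Set (level m ϑ)) :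
    κ → Set M := fun i =>
  if i = i₀ then cosweep g m ϑ c e (U i) else sweep g m ϑ c e (U i)

/-- The flow near the level of a critical point `z` with critical value `t_z = m(z)`, for a
neighbourhood `Uz` of `z`. Here `I = (a,b)`, the only critical point in `m⁻¹([a,b])` is `z`, the
relatively open sets `S_t ⊆ J_t`, `t ∈ I` (denoted `J̃_t`) are mapped to each other by the flow
`F_{ϑ,t}`, and the neighbourhood `Vz` of `z` and `δz > 0` are as in
`J_t \ J̃_t ⊆ Vz ⊆ closure Vz ⊆ Uz` and `J_t \ F_{ϑ,t}(J_ϑ \ Vz) ⊆ Uz` for `ϑ, t` in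
`[t_z - δz, t_z + δz]`. -/
structure IsCriticalPassage (m : M → ℝ) (z : M) (Uz : Set M) (a b : ℝ) (S : ℝ → Set M)
    (Vz : Set M) (δz : ℝ) : Prop where
  Ioo_subset : Ioo a b ⊆ range m
  crit_iff : ∀ x, m x ∈ Icc a b → (IsCrit d m x ↔ x = z)
  δz_pos : 0 < δz
  Icc_subset : Icc (m z - δz) (m z + δz) ⊆ Ioo a b
  relOpen : ∀ t ∈ Ioo a b, ∃ O : Set M, IsOpen O ∧ S t = level m t ∩ O
  reaches : ∀ ϑ ∈ Ioo a b, ∀ t ∈ Ioo a b, ∀ x ∈ S ϑ, FlowReaches g m ϑ t x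
  flow_mem : ∀ ϑ ∈ Ioo a b, ∀ t ∈ Ioo a b, ∀ x ∈ S ϑ, flow g m ϑ t x ∈ S t
  isOpen_Vz : IsOpen Vz
  mem_Vz : z ∈ Vz
  closure_Vz : closure Vz ⊆ Uz
  diff_subset : ∀ t ∈ Icc (m z - δz) (m z + δz), level m t \ S t ⊆ Vz
  flow_subset : ∀ ϑ ∈ Icc (m z - δz) (m z + δz), ∀ t ∈ Icc (m z - δz) (m z + δz),
    level m t \ flow g m ϑ t '' (level m ϑ \ Vz) ⊆ Uz

end Riemannian

end Hestenes

end

/-!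
Near a regular level `J_ϑ` the manifold has product coordinates `(t, x) ↦ F_ϑ(t, x)`, given by the
flow of the renormalized gradient field, and the Riemannian measure is `ψ_ϑ(t, x) dt dν_ϑ(x)` in
these coordinates. On a tube of flow lines (`IsTube`), multiplying a function by the power `1/p`
of the density `ψ_ϑ(t, x) / ψ_ϑ(ϑ, x)` therefore turns `L^p(M)` isometrically into `L^p(dt;
L^p(J_ϑ, μ))`; the resulting function of `(t, x)` is `hat f`. In these coordinates the lift of an
operator `P` on `J_ϑ` acts as `P` on each fibre `{t} × J_ϑ` (`IsTube.hat_lift`). The latitudinal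
projection acts in `t` only, by a combination of the value at `t` and the value at a reflected
point (`hat_latitudinal`). Hence the two commute (`IsTube.lift_latitudinal`), the products are
projections, and norms are bounded fibrewise. On the pair of points `t`, `2ϑᵢ - t` the operator
`Q` is one of the matrices `A_ξ`, whence the constant `B_p`.

The critical level enters in one place only. The flow lines through `J_ϑ ∩ V_z` may run into the
critical point, so that `P_{U₀}` cannot be lifted. But all the other operators `P_U` can, and
`P_{U₀}` is replaced by `Q - ∑ Π(P_U) Q`. If `P = ∑ P_U` (`U ≠ U₀`), then `1 - P = P_{U₀}` is
localized in a compact subset of `U₀`. Cutting off with a function that is one near that compact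
set and along all flow lines that are not in the tube shows that the difference is an `H`-operator
localized on the complement of the trace of `J_ϑ \ U₀` (`IsTube.isLocalizedHOp_complement`). This
uses the pointwise identity `∑ P_U = 1`, whereas only the identity in `L^p` is given; the
operators preserve continuity and evaluate their argument at finitely many points, and for such
operators the two are equivalent (`IsFiniteEval.eq_of_induces`). The norm estimates for the family
follow from those on `J_ϑ` by integration over the fibres (`IsTube.sum_norm_lift_le`,
`IsTube.norm_lift_le_sum`). For `p = 2` one has `B_p = 1`, so that the lifts of orthogonal
projections are contractive projections, and these are orthogonal.

Two analytic facts underlie the coordinates and are proved from the definitions: the flow of a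
smooth vector field on a manifold depends smoothly on time and on the initial point, and the
measure that is the supremum of the Gram densities of all local parametrizations satisfies the
area formula, so that it disintegrates along the flow.
-/

noncomputable section

namespace Hestenes

/-! ### Smooth dependence of solutions of ordinary differential equations -/

section Nemytskii

variable {K : Type*} [TopologicalSpace K] [CompactSpace K]
  {E F : Type u} [NormedAddCommGroup E] [NormedSpace ℝ E] [NormedAddCommGroup F] [NormedSpace ℝ F]

/-- Pointwise application `(A, h) ↦ (s ↦ A s (h s))` as a continuous bilinear map. -/
def pointwiseApply : C(K, E →L[ℝ] F) →L[ℝ] C(K, E) →L[ℝ] C(K, F) :=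
  LinearMap.mkContinuous₂
    (LinearMap.mk₂ ℝ (fun (A : C(K, E →L[ℝ] F)) (h : C(K, E)) =>
      (⟨fun s => A s (h s), by fun_prop⟩ : C(K, F)))
      (fun _ _ _ => by ext; simp) (fun _ _ _ => by ext; simp)
      (fun _ _ _ => by ext; simp) (fun _ _ _ => by ext; simp)) 1 (by
    intro A h
    rw [one_mul]
    refine (ContinuousMap.norm_le _ (by positivity)).2 fun s => ?_
    have hA : ‖A s‖ ≤ ‖A‖ := A.norm_coe_le_norm s
    have hh : ‖h s‖ ≤ ‖h‖ := h.norm_coe_le_norm s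
    exact ((A s).le_opNorm _).trans (by gcongr))

/-- The superposition operator `γ ↦ v ∘ γ` of a `C^1` map is differentiable. -/
theorem hasFDerivAt_superposition {v : C(E, F)} (hv : ContDiff ℝ 1 v) (γ : C(K, E)) :
    HasFDerivAt (fun γ : C(K, E) => v.comp γ)
      (pointwiseApply ((⟨fderiv ℝ v, hv.continuous_fderiv one_ne_zero⟩ :
        C(E, E →L[ℝ] F)).comp γ)) γ := by
  rw [hasFDerivAt_iff_isLittleO_nhds_zero, Asymptotics.isLittleO_iff]
  intro c hc
  set N : C(K, E) → C(K, E →L[ℝ] F) := fun γ =>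
    (⟨fderiv ℝ v, hv.continuous_fderiv one_ne_zero⟩ : C(E, E →L[ℝ] F)).comp γ with hN
  have hNc : Continuous N := ContinuousMap.continuous_postcomp _
  obtain ⟨ε, hε, hball⟩ := (Metric.continuousAt_iff (f := N) (a := γ)).1
    hNc.continuousAt c hc
  filter_upwards [Metric.ball_mem_nhds (0 : C(K, E)) hε] with h hh
  rw [mem_ball_zero_iff] at hh
  refine (ContinuousMap.norm_le _ (by positivity)).2 fun s => ?_
  have key : ∀ x ∈ segment ℝ (γ s) (γ s + h s), ‖fderiv ℝ v x - fderiv ℝ v (γ s)‖ ≤ c := by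
    intro x hx
    rw [segment_eq_image'] at hx
    obtain ⟨r, hr, rfl⟩ := hx
    have h1 : dist (N (γ + r • h)) (N γ) < c := by
      refine hball ?_
      rw [dist_eq_norm, add_sub_cancel_left, norm_smul, Real.norm_of_nonneg hr.1]
      exact (mul_le_of_le_one_left (norm_nonneg _) hr.2).trans_lt hh
    have h2 := (ContinuousMap.dist_apply_le_dist (f := N (γ + r • h)) (g := N γ) s).trans h1.le
    rw [dist_eq_norm] at h2
    refine le_trans (le_of_eq ?_) h2
    simp [hN]
  have := (convex_segment (γ s) (γ s + h s)).norm_image_sub_le_of_norm_hasFDerivWithin_le'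
    (f := v) (f' := fun x => fderiv ℝ v x) (φ := fderiv ℝ v (γ s)) (C := c)
    (fun x _ => ((hv.differentiable one_ne_zero) x).hasFDerivAt.hasFDerivWithinAt) key
    (left_mem_segment _ _ _) (right_mem_segment _ _ _)
  rw [add_sub_cancel_left] at this
  refine le_trans (le_of_eq ?_)
    (this.trans (mul_le_mul_of_nonneg_left (h.norm_coe_le_norm s) hc.le))
  rfl

theorem contDiff_pointwiseApply (n : ℕ) :
    ContDiff ℝ n (pointwiseApply (K := K) (E := E) (F := F)) := by
  exact ContinuousLinearMap.contDiff _

theorem contDiff_superposition_nat (n : ℕ) : ∀ {F : Type u} [NormedAddCommGroup F]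
    [NormedSpace ℝ F] {v : C(E, F)} (_ : ContDiff ℝ n v),
    ContDiff ℝ n (fun γ : C(K, E) => v.comp γ) := by
  induction n with
  | zero =>
    intro F _ _ v hv
    rw [Nat.cast_zero, contDiff_zero]
    exact ContinuousMap.continuous_postcomp _
  | succ n ih =>
    intro F _ _ v hv
    have hv1 : ContDiff ℝ 1 v := hv.of_le (by exact_mod_cast Nat.le_add_left 1 n)
    have hd : ContDiff ℝ n (fderiv ℝ v) := hv.fderiv_right (by simp)
    rw [Nat.cast_add, Nat.cast_one, contDiff_succ_iff_hasFDerivAt]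
    let w : C(E, E →L[ℝ] F) := ⟨fderiv ℝ v, hv1.continuous_fderiv one_ne_zero⟩
    have hB : ContDiff ℝ n (fun γ : C(K, E) => pointwiseApply (w.comp γ)) :=
      (contDiff_pointwiseApply n).comp (ih (v := w) hd)
    exact ⟨_, hB, fun γ => hasFDerivAt_superposition hv1 γ⟩

/-- The superposition operator `γ ↦ v ∘ γ` on continuous maps of a compact space is smooth if `v`
is. -/
theorem contDiff_superposition {v : C(E, F)} (hv : ContDiff ℝ ∞ v) :
    ContDiff ℝ ∞ (fun γ : C(K, E) => v.comp γ) :=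
  contDiff_infty.2 fun n => contDiff_superposition_nat n (hv.of_le (by exact_mod_cast le_top))

end Nemytskii

section LocalFlow

variable {E : Type u} [NormedAddCommGroup E] [NormedSpace ℝ E]

/-- The primitive `s ↦ ∫₀ˢ u` of a continuous function on `[-1,1]`. -/
def primitive : C(Icc (-1 : ℝ) 1, E) →L[ℝ] C(Icc (-1 : ℝ) 1, E) :=
  LinearMap.mkContinuous
    { toFun := fun u => ⟨fun s => ∫ r in (0 : ℝ)..s, IccExtend (by norm_num) u r, by
        have h : Continuous (IccExtend (by norm_num : (-1 : ℝ) ≤ 1) u) := u.continuous.Icc_extend'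
        exact (intervalIntegral.continuous_primitive (fun a b => h.intervalIntegrable a b) 0).comp
          continuous_subtype_val⟩
      map_add' := fun u w => by
        ext s
        have h : ∀ u : C(Icc (-1 : ℝ) 1, E),
            Continuous (IccExtend (by norm_num : (-1 : ℝ) ≤ 1) u) :=
          fun u => u.continuous.Icc_extend'
        exact intervalIntegral.integral_add ((h u).intervalIntegrable _ _)
          ((h w).intervalIntegrable _ _)
      map_smul' := fun c u => by
        ext s
        exact intervalIntegral.integral_smul c _ } 1 (by
    intro u
    rw [one_mul]
    refine (ContinuousMap.norm_le _ (norm_nonneg _)).2 fun s => ?_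
    have := intervalIntegral.norm_integral_le_of_norm_le_const (a := 0) (b := (s : ℝ))
      (f := IccExtend (by norm_num : (-1 : ℝ) ≤ 1) u) (C := ‖u‖)
      (fun r _ => u.norm_coe_le_norm _)
    refine this.trans (mul_le_of_le_one_right (norm_nonneg _) ?_)
    rw [sub_zero, abs_le]
    exact s.2)

theorem primitive_apply (u : C(Icc (-1 : ℝ) 1, E)) (s : Icc (-1 : ℝ) 1) :
    primitive u s = ∫ r in (0 : ℝ)..s, IccExtend (by norm_num) u r := rfl

/-- The curve `s ↦ γ(rs)`, for `|r| ≤ 1`. -/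
def rescale (r : Icc (-1 : ℝ) 1) (γ : C(Icc (-1 : ℝ) 1, E)) : C(Icc (-1 : ℝ) 1, E) :=
  ⟨fun s => γ ⟨r * s, by
    rw [mem_Icc, ← abs_le, abs_mul]
    exact mul_le_one₀ (abs_le.2 r.2) (abs_nonneg _) (abs_le.2 s.2)⟩, by fun_prop⟩

theorem primitive_rescale (r s : Icc (-1 : ℝ) 1) (u : C(Icc (-1 : ℝ) 1, E)) :
    (r : ℝ) • primitive (rescale r u) s = rescale r (primitive u) s := by
  change (r : ℝ) • (∫ q in (0 : ℝ)..s, IccExtend _ (rescale r u) q) =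
    ∫ q in (0 : ℝ)..(r * s), IccExtend _ u q
  have h0 : ∀ q ∈ uIcc (0 : ℝ) s, IccExtend (by norm_num : (-1 : ℝ) ≤ 1) (rescale r u) q =
      IccExtend (by norm_num : (-1 : ℝ) ≤ 1) u (r * q) := by
    intro q hq
    have hq1 : q ∈ Icc (-1 : ℝ) 1 := by
      have := s.2
      exact uIcc_subset_Icc (by constructor <;> norm_num) this hq
    have hq2 : (r : ℝ) * q ∈ Icc (-1 : ℝ) 1 := by
      rw [mem_Icc, ← abs_le, abs_mul]
      exact mul_le_one₀ (abs_le.2 r.2) (abs_nonneg _) (abs_le.2 hq1)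
    rw [IccExtend_of_mem _ _ hq1, IccExtend_of_mem _ _ hq2]
    rfl
  rw [intervalIntegral.integral_congr h0, intervalIntegral.smul_integral_comp_mul_left]
  simp

variable [CompleteSpace E]

/-- A globally defined smooth vector field has a smooth local flow. The flow `φ(τ,x)` is the
endpoint at `s = 1` of the solution `γ ∈ C([-1,1])` of `γ(s) = x + τ ∫₀ˢ v(γ)`, which depends
smoothly on `(x,τ)` by the inverse function theorem. -/
theorem exists_contDiffOn_localFlow_of_contDiff {v : E → E} (hv : ContDiff ℝ ∞ v) (x₀ : E) :
    ∃ ε > 0, ∃ W : Set E, IsOpen W ∧ x₀ ∈ W ∧ ∃ φ : ℝ × E → E,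
      ContDiffOn ℝ ∞ φ (Ioo (-ε) ε ×ˢ W) ∧ ∀ x ∈ W, φ (0, x) = x ∧
        ∀ t ∈ Ioo (-ε) ε, HasDerivAt (fun t => φ (t, x)) (v (φ (t, x))) t := by
  set Γ := C(Icc (-1 : ℝ) 1, E)
  set N : Γ → Γ := fun γ => (⟨v, hv.continuous⟩ : C(E, E)).comp γ with hN
  have hNs : ContDiff ℝ ∞ N := contDiff_superposition (v := ⟨v, hv.continuous⟩) hv
  let cst : E →L[ℝ] Γ := ContinuousLinearMap.const ℝ _
  have hcst : ∀ x s, cst x s = x := fun x s => rfl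
  set H : E × ℝ × Γ → E × ℝ × Γ := fun q =>
    (q.1, q.2.1, q.2.2 - cst q.1 - q.2.1 • primitive (N q.2.2)) with hH
  have hHs : ContDiff ℝ ∞ H := by
    have h1 : ContDiff ℝ ∞ (fun q : E × ℝ × Γ => primitive (N q.2.2)) :=
      primitive.contDiff.comp (hNs.comp (contDiff_snd.comp contDiff_snd))
    have h2 : ContDiff ℝ ∞ (fun q : E × ℝ × Γ => cst q.1) := cst.contDiff.comp contDiff_fst
    exact contDiff_fst.prodMk ((contDiff_fst.comp contDiff_snd).prodMk
      (((contDiff_snd.comp contDiff_snd).sub h2).sub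
        ((contDiff_fst.comp contDiff_snd).smul h1)))
  set q₀ : E × ℝ × Γ := (x₀, 0, cst x₀) with hq₀
  -- the derivative at `q₀`, a unipotent map
  set y₀ : Γ := primitive (N (cst x₀))
  let D : (E × ℝ × Γ) ≃L[ℝ] (E × ℝ × Γ) :=
    ContinuousLinearEquiv.equivOfInverse
      ((ContinuousLinearMap.fst ℝ _ _).prod
        (((ContinuousLinearMap.fst ℝ _ _).comp (ContinuousLinearMap.snd ℝ _ _)).prod
          (((ContinuousLinearMap.snd ℝ _ _).comp (ContinuousLinearMap.snd ℝ _ _)) -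
            cst.comp (ContinuousLinearMap.fst ℝ _ _) -
            ((ContinuousLinearMap.fst ℝ _ _).comp (ContinuousLinearMap.snd ℝ _ _)).smulRight y₀)))
      ((ContinuousLinearMap.fst ℝ _ _).prod
        (((ContinuousLinearMap.fst ℝ _ _).comp (ContinuousLinearMap.snd ℝ _ _)).prod
          (((ContinuousLinearMap.snd ℝ _ _).comp (ContinuousLinearMap.snd ℝ _ _)) +
            cst.comp (ContinuousLinearMap.fst ℝ _ _) +
            ((ContinuousLinearMap.fst ℝ _ _).comp (ContinuousLinearMap.snd ℝ _ _)).smulRight y₀)))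
      (fun q => by
        refine Prod.ext rfl (Prod.ext rfl ?_)
        change q.2.2 - cst q.1 - q.2.1 • y₀ + cst q.1 + q.2.1 • y₀ = q.2.2
        abel) (fun q => by
        refine Prod.ext rfl (Prod.ext rfl ?_)
        change q.2.2 + cst q.1 + q.2.1 • y₀ - cst q.1 - q.2.1 • y₀ = q.2.2
        abel)
  have hD : HasFDerivAt H (D : (E × ℝ × Γ) →L[ℝ] (E × ℝ × Γ)) q₀ := by
    have h0 : ContDiff ℝ ∞ (fun q : E × ℝ × Γ => primitive (N q.2.2)) :=
      primitive.contDiff.comp (hNs.comp (contDiff_snd.comp contDiff_snd))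
    have h1 : HasFDerivAt (fun q : E × ℝ × Γ => primitive (N q.2.2))
        (fderiv ℝ (fun q : E × ℝ × Γ => primitive (N q.2.2)) q₀) q₀ :=
      DifferentiableAt.hasFDerivAt (h0.differentiable (by simp) q₀)
    have e1 : HasFDerivAt (fun q : E × ℝ × Γ => q.1) (ContinuousLinearMap.fst ℝ E (ℝ × Γ)) q₀ :=
      hasFDerivAt_fst
    have e2 : HasFDerivAt (fun q : E × ℝ × Γ => q.2.1)
        ((ContinuousLinearMap.fst ℝ ℝ Γ).comp (ContinuousLinearMap.snd ℝ E (ℝ × Γ))) q₀ :=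
      hasFDerivAt_fst.comp q₀ hasFDerivAt_snd
    have e3 : HasFDerivAt (fun q : E × ℝ × Γ => q.2.2)
        ((ContinuousLinearMap.snd ℝ ℝ Γ).comp (ContinuousLinearMap.snd ℝ E (ℝ × Γ))) q₀ :=
      hasFDerivAt_snd.comp q₀ hasFDerivAt_snd
    refine (e1.prodMk (e2.prodMk ((e3.sub ((cst.hasFDerivAt).comp q₀ e1)).sub
      (e2.smul h1)))).congr_fderiv ?_
    have hz : q₀.2.1 = 0 := rfl
    rw [hz, zero_smul, zero_add]
    rfl
  have hHat : ∀ q, ContDiffAt ℝ ∞ H q := fun q => hHs.contDiffAt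
  let Ψ := (hHat q₀).toOpenPartialHomeomorph H hD (by simp)
  have hΨ : ∀ q, Ψ q = H q := fun q => rfl
  have hq₀s : q₀ ∈ Ψ.source := (hHat q₀).mem_toOpenPartialHomeomorph_source hD (by simp)
  -- points where the derivative of `H` is invertible
  set G : Set (E × ℝ × Γ) := fderiv ℝ H ⁻¹' range ((↑) : ((E × ℝ × Γ) ≃L[ℝ] (E × ℝ × Γ)) → _)
  have hG : IsOpen G := ContinuousLinearEquiv.isOpen.preimage (hHs.continuous_fderiv (by simp))
  have hGq : q₀ ∈ G := ⟨D, hD.fderiv.symm⟩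
  have hHq₀ : H q₀ = (x₀, 0, 0) := by
    simp [hH, hq₀]
  -- a ball around `q₀` contained in the source of `Ψ` and in `G`
  obtain ⟨ρ, hρ, hball⟩ := Metric.isOpen_iff.1 (Ψ.open_source.inter hG) q₀ ⟨hq₀s, hGq⟩
  set ι : ℝ × E → E × ℝ × Γ := fun q => (q.2, q.1, 0) with hι
  have hιs : ContDiff ℝ ∞ ι := contDiff_snd.prodMk (contDiff_fst.prodMk contDiff_const)
  have htarget : (x₀, 0, (0 : Γ)) ∈ Ψ.target := by
    rw [← hHq₀, ← hΨ]; exact Ψ.map_source hq₀s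
  have hsymm₀ : Ψ.symm (x₀, 0, (0 : Γ)) = q₀ := by
    rw [← hHq₀, ← hΨ]; exact Ψ.left_inv hq₀s
  have hcont : ContinuousAt (fun q => Ψ.symm (ι q)) (0, x₀) := by
    refine ContinuousAt.comp (g := Ψ.symm) ?_ hιs.continuous.continuousAt
    exact Ψ.symm.continuousAt htarget
  have hev : ∀ᶠ q in 𝓝 ((0 : ℝ), x₀), ι q ∈ Ψ.target ∧ Ψ.symm (ι q) ∈ Metric.ball q₀ ρ := by
    refine Filter.Eventually.and (hιs.continuous.continuousAt.preimage_mem_nhds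
      (Ψ.open_target.mem_nhds (show ι (0, x₀) ∈ Ψ.target from htarget))) ?_
    refine hcont.preimage_mem_nhds ?_
    rw [show Ψ.symm (ι (0, x₀)) = q₀ from hsymm₀]
    exact Metric.ball_mem_nhds _ hρ
  obtain ⟨ε, hε, hεs⟩ := Metric.mem_nhds_iff.1 hev
  set γ : ℝ × E → Γ := fun q => (Ψ.symm (ι q)).2.2 with hγ
  have hmem : ∀ t ∈ Ioo (-ε) ε, ∀ x ∈ Metric.ball x₀ ε, ((t, x) : ℝ × E) ∈
      {q | ι q ∈ Ψ.target ∧ Ψ.symm (ι q) ∈ Metric.ball q₀ ρ} := by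
    intro t ht x hx
    refine hεs ?_
    rw [Metric.mem_ball, Prod.dist_eq]
    refine max_lt ?_ hx
    rw [Real.dist_eq, sub_zero, abs_lt]
    exact ht
  have heq : ∀ q, ι q ∈ Ψ.target → Ψ.symm (ι q) = (q.2, q.1, γ q) ∧
      γ q - cst q.2 - q.1 • primitive (N (γ q)) = 0 := by
    intro q hq
    have h := Ψ.right_inv hq
    rw [hΨ] at h
    have h1 : (Ψ.symm (ι q)).1 = q.2 := congrArg Prod.fst h
    have h2 : (Ψ.symm (ι q)).2.1 = q.1 := congrArg (fun z => z.2.1) h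
    have h3 := congrArg (fun z => z.2.2) h
    simp only [hH, h1, h2] at h3
    exact ⟨Prod.ext h1 (Prod.ext h2 rfl), h3⟩
  -- the scaling property of the solutions
  have hscale : ∀ t ∈ Ioo (-ε) ε, ∀ x ∈ Metric.ball x₀ ε, ∀ r : Icc (-1 : ℝ) 1,
      γ (r * t, x) = rescale r (γ (t, x)) := by
    intro t ht x hx r
    have hrt : (r : ℝ) * t ∈ Ioo (-ε) ε := by
      rw [mem_Ioo, ← abs_lt, abs_mul]
      exact (mul_le_of_le_one_left (abs_nonneg _) (abs_le.2 r.2)).trans_lt (abs_lt.2 ht)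
    obtain ⟨ht1, ht2⟩ := hmem t ht x hx
    obtain ⟨hr1, hr2⟩ := hmem _ hrt x hx
    obtain ⟨e1, e2⟩ := heq _ ht1
    obtain ⟨e3, e4⟩ := heq _ hr1
    rw [e1] at ht2
    rw [e3] at hr2
    have hb : ((x, (r : ℝ) * t, rescale r (γ (t, x))) : E × ℝ × Γ) ∈ Metric.ball q₀ ρ := by
      rw [Metric.mem_ball, Prod.dist_eq, Prod.dist_eq] at ht2 hr2 ⊢
      refine max_lt ((le_max_left _ _).trans_lt hr2) (max_lt
        (((le_max_left _ _).trans (le_max_right _ _)).trans_lt hr2) ?_)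
      refine lt_of_le_of_lt ?_ (((le_max_right _ _).trans (le_max_right _ _)).trans_lt ht2)
      rw [ContinuousMap.dist_le dist_nonneg]
      intro s
      exact ContinuousMap.dist_apply_le_dist (f := γ (t, x)) (g := cst x₀) _
    have hs1 := (hball hb).1
    have hs2 := (hball hr2).1
    have hinj : ((x, (r : ℝ) * t, rescale r (γ (t, x))) : E × ℝ × Γ) =
        (x, (r : ℝ) * t, γ (r * t, x)) := by
      refine Ψ.injOn hs1 hs2 ?_
      rw [hΨ, hΨ]
      simp only [hH]
      refine Prod.ext rfl (Prod.ext rfl ?_)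
      simp only
      rw [e4]
      ext s
      have e5 := DFunLike.congr_fun e2 ⟨r * s, by
        rw [mem_Icc, ← abs_le, abs_mul]
        exact mul_le_one₀ (abs_le.2 r.2) (abs_nonneg _) (abs_le.2 s.2)⟩
      have e6 := primitive_rescale r s (N (γ (t, x)))
      have e7 : N (rescale r (γ (t, x))) = rescale r (N (γ (t, x))) := rfl
      rw [e7, mul_comm (r : ℝ) t, mul_smul]
      rw [ContinuousMap.sub_apply, ContinuousMap.sub_apply, ContinuousMap.smul_apply,
        ContinuousMap.smul_apply, e6]
      exact e5
    exact (congrArg (fun z => z.2.2) hinj).symm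
  set one : Icc (-1 : ℝ) 1 := ⟨1, by norm_num⟩ with hone
  refine ⟨ε / 2, by positivity, Metric.ball x₀ ε, Metric.isOpen_ball, Metric.mem_ball_self hε,
    fun q => γ q one, ?_, ?_⟩
  · rintro ⟨t, x⟩ ⟨ht, hx⟩
    have ht' : t ∈ Ioo (-ε) ε := ⟨by linarith [ht.1], by linarith [ht.2]⟩
    obtain ⟨h1, h2⟩ := hmem t ht' x hx
    obtain ⟨Dq, hDq⟩ := (hball h2).2
    have h3 : ContDiffAt ℝ ∞ Ψ.symm (ι (t, x)) := by
      refine Ψ.contDiffAt_symm (f₀' := Dq) h1 ?_ (hHat _)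
      rw [hDq]
      exact (hHs.differentiable (by simp) _).hasFDerivAt
    have h4 : ContDiffAt ℝ ∞ γ (t, x) :=
      contDiffAt_snd.comp (t, x) (contDiffAt_snd.comp (t, x) (h3.comp (t, x) hιs.contDiffAt))
    let ev : Γ →L[ℝ] E := ContinuousMap.evalCLM ℝ one
    exact ((ev.contDiff.contDiffAt.comp (t, x) h4).contDiffWithinAt)
  · intro x hx
    have hhalf : ε / 2 ∈ Ioo (-ε) ε := ⟨by linarith, by linarith⟩
    obtain ⟨h1, -⟩ := hmem _ hhalf x hx
    obtain ⟨-, h2⟩ := heq _ h1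
    have key : ∀ t ∈ Icc (-(ε / 2)) (ε / 2), γ (t, x) one =
        x + (ε / 2) • ∫ r in (0 : ℝ)..(t / (ε / 2)), IccExtend (by norm_num : (-1 : ℝ) ≤ 1)
          (N (γ (ε / 2, x))) r := by
      intro t ht
      have hr : t / (ε / 2) ∈ Icc (-1 : ℝ) 1 :=
        ⟨by rw [le_div_iff₀ (by positivity)]; linarith [ht.1],
          by rw [div_le_iff₀ (by positivity)]; linarith [ht.2]⟩
      have h3 := hscale _ hhalf x hx ⟨_, hr⟩
      have h4 : (((⟨_, hr⟩ : Icc (-1 : ℝ) 1) : ℝ)) * (ε / 2) = t := by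
        change t / (ε / 2) * (ε / 2) = t
        field_simp
      rw [h4] at h3
      rw [h3]
      have h5 : rescale ⟨_, hr⟩ (γ (ε / 2, x)) one = γ (ε / 2, x) ⟨_, hr⟩ := by
        change γ (ε / 2, x) _ = _
        congr 1
        exact Subtype.ext (mul_one _)
      rw [h5]
      have h6 := DFunLike.congr_fun h2 ⟨_, hr⟩
      rw [ContinuousMap.sub_apply, ContinuousMap.sub_apply, ContinuousMap.smul_apply, hcst,
        primitive_apply, ContinuousMap.zero_apply, sub_sub, sub_eq_zero] at h6
      exact h6
    refine ⟨?_, fun t ht => ?_⟩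
    · refine (key 0 ⟨by linarith, by linarith⟩).trans ?_
      simp
    · have hc : Continuous (IccExtend (by norm_num : (-1 : ℝ) ≤ 1) (N (γ (ε / 2, x)))) :=
        (N (γ (ε / 2, x))).continuous.Icc_extend'
      have hr : t / (ε / 2) ∈ Icc (-1 : ℝ) 1 :=
        ⟨by rw [le_div_iff₀ (by positivity)]; linarith [ht.1],
          by rw [div_le_iff₀ (by positivity)]; linarith [ht.2]⟩
      have hder : HasDerivAt (fun t => x + (ε / 2) • ∫ r in (0 : ℝ)..(t / (ε / 2)),
          IccExtend (by norm_num : (-1 : ℝ) ≤ 1) (N (γ (ε / 2, x))) r)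
          ((ε / 2) • ((1 / (ε / 2)) • IccExtend (by norm_num : (-1 : ℝ) ≤ 1)
            (N (γ (ε / 2, x))) (t / (ε / 2)))) t := by
        have h7 := (hc.integral_hasStrictDerivAt 0 (t / (ε / 2))).hasDerivAt
        have h8 : HasDerivAt (fun t : ℝ => t / (ε / 2)) (1 / (ε / 2)) t :=
          (hasDerivAt_id t).div_const _
        exact ((h7.scomp t h8).const_smul (ε / 2)).const_add x
      have h9 : (ε / 2) • ((1 / (ε / 2)) • IccExtend (by norm_num : (-1 : ℝ) ≤ 1)
            (N (γ (ε / 2, x))) (t / (ε / 2))) = v (γ (t, x) one) := by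
        rw [smul_smul, mul_one_div_cancel (by positivity), one_smul, IccExtend_of_mem _ _ hr]
        change v (γ (ε / 2, x) ⟨_, hr⟩) = _
        have h3 := hscale _ hhalf x hx ⟨_, hr⟩
        have h4 : (((⟨_, hr⟩ : Icc (-1 : ℝ) 1) : ℝ)) * (ε / 2) = t := by
          change t / (ε / 2) * (ε / 2) = t
          field_simp
        rw [h4] at h3
        rw [h3]
        congr 1
        change _ = γ (ε / 2, x) _
        congr 1
        exact Subtype.ext (mul_one _).symm
      rw [← h9]
      refine hder.congr_of_eventuallyEq ?_
      filter_upwards [Icc_mem_nhds ht.1 ht.2] with t' ht'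
      exact key t' ht'

/-- A vector field that is smooth on an open set `U` has a smooth local flow in `U`. -/
theorem exists_contDiffOn_localFlow [FiniteDimensional ℝ E] {v : E → E} {U : Set E}
    (hU : IsOpen U) (hv : ContDiffOn ℝ ∞ v U) {x₀ : E} (hx₀ : x₀ ∈ U) :
    ∃ ε > 0, ∃ W : Set E, IsOpen W ∧ x₀ ∈ W ∧ ∃ φ : ℝ × E → E,
      ContDiffOn ℝ ∞ φ (Ioo (-ε) ε ×ˢ W) ∧ ∀ x ∈ W, φ (0, x) = x ∧
        ∀ t ∈ Ioo (-ε) ε, φ (t, x) ∈ U ∧ HasDerivAt (fun t => φ (t, x)) (v (φ (t, x))) t := by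
  obtain ⟨r, hr, hrU⟩ := Metric.isOpen_iff.1 hU x₀ hx₀
  let χ : ContDiffBump x₀ := ⟨r / 4, r / 2, by positivity, by linarith⟩
  have hts : tsupport χ ⊆ U := by
    rw [χ.tsupport_eq]
    exact (Metric.closedBall_subset_ball (by change r / 2 < r; linarith)).trans hrU
  have hw : ContDiff ℝ ∞ (fun x => χ x • v x) := by
    rw [contDiff_iff_contDiffAt]
    intro x
    by_cases hx : x ∈ U
    · exact χ.contDiffAt.smul (hv.contDiffAt (hU.mem_nhds hx))
    · have : (fun x => χ x • v x) =ᶠ[𝓝 x] fun _ => 0 := by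
        filter_upwards [(isClosed_tsupport χ).isOpen_compl.mem_nhds (fun h => hx (hts h))] with y hy
        rw [image_eq_zero_of_notMem_tsupport hy, zero_smul]
      exact contDiffAt_const.congr_of_eventuallyEq this
  obtain ⟨ε, hε, W, hW, hxW, φ, hφ, hφ2⟩ := exists_contDiffOn_localFlow_of_contDiff hw x₀
  have hc : ContinuousAt φ (0, x₀) := (hφ.continuousOn.continuousAt
    ((isOpen_Ioo.prod hW).mem_nhds ⟨⟨by simpa using hε, hε⟩, hxW⟩))
  have hn : ∀ᶠ q in 𝓝 ((0 : ℝ), x₀), φ q ∈ Metric.ball x₀ (r / 4) := by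
    refine hc.preimage_mem_nhds ?_
    rw [(hφ2 x₀ hxW).1]
    exact Metric.ball_mem_nhds _ (by positivity)
  obtain ⟨ε', hε', hb⟩ := Metric.mem_nhds_iff.1 hn
  have hmem : ∀ t ∈ Ioo (-(min ε ε')) (min ε ε'), ∀ x ∈ W ∩ Metric.ball x₀ ε',
      φ (t, x) ∈ Metric.ball x₀ (r / 4) := by
    intro t ht x hx
    have : ((t, x) : ℝ × E) ∈ Metric.ball ((0 : ℝ), x₀) ε' := by
      rw [Metric.mem_ball, Prod.dist_eq]
      refine max_lt ?_ hx.2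
      rw [Real.dist_eq, sub_zero]
      exact (abs_lt.2 ht).trans_le (min_le_right _ _)
    exact hb this
  have hsub : Ioo (-(min ε ε')) (min ε ε') ⊆ Ioo (-ε) ε :=
    Ioo_subset_Ioo (neg_le_neg (min_le_left _ _)) (min_le_left _ _)
  refine ⟨min ε ε', lt_min hε hε', W ∩ Metric.ball x₀ ε', hW.inter Metric.isOpen_ball,
    ⟨hxW, Metric.mem_ball_self hε'⟩, φ, hφ.mono (prod_mono hsub inter_subset_left), ?_⟩
  intro x hx
  refine ⟨(hφ2 x hx.1).1, fun t ht => ?_⟩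
  have h1 := hmem t ht x hx
  refine ⟨hrU (Metric.ball_subset_ball (by linarith) h1), ?_⟩
  have h2 := (hφ2 x hx.1).2 t (hsub ht)
  rwa [χ.one_of_mem_closedBall (Metric.ball_subset_closedBall h1), one_smul] at h2

end LocalFlow

/-! ### Gram determinants -/

section Gram

set_option linter.unusedSectionVars false

variable {V W U : Type*} [AddCommGroup V] [Module ℝ V] [AddCommGroup W] [Module ℝ W]
  [AddCommGroup U] [Module ℝ U] {ι ι' : Type*} [Fintype ι] [DecidableEq ι]
  [Fintype ι'] [DecidableEq ι']

/-- A symmetric positive definite function of two vectors that is linear in the first of them. -/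
structure IsInnerForm (β : V → V → ℝ) : Prop where
  add_left : ∀ x y z, β (x + y) z = β x z + β y z
  smul_left : ∀ (c : ℝ) x z, β (c • x) z = c * β x z
  symm : ∀ x y, β x y = β y x
  pos : ∀ x, x ≠ 0 → 0 < β x x

variable {β : V → V → ℝ} {βW : W → W → ℝ} {βU : U → U → ℝ}

theorem IsInnerForm.sum_left (hβ : IsInnerForm β) (x : ι → ℝ) (e : ι → V) (w : V) :
    β (∑ i, x i • e i) w = ∑ i, x i * β (e i) w := by
  let L : V →ₗ[ℝ] ℝ := ⟨⟨fun v => β v w, fun a b => hβ.add_left a b w⟩,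
    fun c a => hβ.smul_left c a w⟩
  have : L (∑ i, x i • e i) = ∑ i, x i * L (e i) := by simp
  exact this

theorem IsInnerForm.sum_sum (hβ : IsInnerForm β) (x : ι → ℝ) (y : ι' → ℝ) (e : ι → V)
    (e' : ι' → V) :
    β (∑ i, x i • e i) (∑ j, y j • e' j) = ∑ i, ∑ j, x i * y j * β (e i) (e' j) := by
  rw [hβ.sum_left]
  refine Finset.sum_congr rfl fun i _ => ?_
  rw [hβ.symm, hβ.sum_left, Finset.mul_sum]
  refine Finset.sum_congr rfl fun j _ => ?_
  rw [hβ.symm, mul_assoc]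

theorem IsInnerForm.nonneg (hβ : IsInnerForm β) (x : V) : 0 ≤ β x x := by
  by_cases hx : x = 0
  · have := hβ.smul_left 0 x x
    rw [zero_smul, zero_mul] at this
    have h2 := hβ.smul_left 0 x 0
    rw [hx]
    rw [zero_smul, zero_mul] at h2
    exact h2.ge
  · exact (hβ.pos x hx).le

theorem gram_posSemidef (hβ : IsInnerForm β) (e : ι → V) : (gram β e).PosSemidef := by
  refine Matrix.PosSemidef.of_dotProduct_mulVec_nonneg ?_ fun x => ?_
  · ext i j
    simp [gram, hβ.symm (e i)]
  · have : star x ⬝ᵥ (gram β e).mulVec x = β (∑ i, x i • e i) (∑ i, x i • e i) := by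
      rw [hβ.sum_sum]
      simp only [dotProduct, Matrix.mulVec, gram, Matrix.of_apply, Finset.mul_sum, star_trivial]
      exact Finset.sum_congr rfl fun i _ => Finset.sum_congr rfl fun j _ => by ring
    rw [this]
    exact hβ.nonneg _

theorem gram_det_nonneg (hβ : IsInnerForm β) (e : ι → V) : 0 ≤ (gram β e).det :=
  (gram_posSemidef hβ e).det_nonneg

theorem gram_det_pos (hβ : IsInnerForm β) {e : ι → V} (he : LinearIndependent ℝ e) :
    0 < (gram β e).det := by
  refine Matrix.PosDef.det_pos (Matrix.PosDef.of_dotProduct_mulVec_pos ?_ fun {x} hx => ?_)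
  · exact (gram_posSemidef hβ e).1
  · have : star x ⬝ᵥ (gram β e).mulVec x = β (∑ i, x i • e i) (∑ i, x i • e i) := by
      rw [hβ.sum_sum]
      simp only [dotProduct, Matrix.mulVec, gram, Matrix.of_apply, Finset.mul_sum, star_trivial]
      exact Finset.sum_congr rfl fun i _ => Finset.sum_congr rfl fun j _ => by ring
    rw [this]
    refine hβ.pos _ fun h0 => hx ?_
    exact funext (Fintype.linearIndependent_iff.1 he x h0)

theorem gram_reindex (e : ι → V) (σ : ι' ≃ ι) : (gram β (e ∘ σ)).det = (gram β e).det := by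
  rw [← Matrix.det_submatrix_equiv_self σ (gram β e)]
  rfl

theorem gram_comp_linearMap (hβ : IsInnerForm β) (b : Module.Basis ι ℝ W) (L : W →ₗ[ℝ] V)
    (T : W →ₗ[ℝ] W) :
    (gram β fun i => L (T (b i))).det = (LinearMap.det T) ^ 2 * (gram β fun i => L (b i)).det := by
  set P := LinearMap.toMatrix b b T with hP
  have h1 : ∀ i, L (T (b i)) = ∑ j, P j i • L (b j) := by
    intro i
    conv_lhs => rw [← b.sum_repr (T (b i)), map_sum]
    simp only [hP, LinearMap.toMatrix_apply, map_smul]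
  have h2 : gram β (fun i => L (T (b i))) = P.transpose * gram β (fun i => L (b i)) * P := by
    ext i j
    simp only [gram, Matrix.of_apply, h1, hβ.sum_sum, Matrix.mul_apply, Matrix.transpose_apply,
      Finset.sum_mul]
    rw [Finset.sum_comm]
    exact Finset.sum_congr rfl fun k _ => Finset.sum_congr rfl fun l _ => by ring
  rw [h2, Matrix.det_mul, Matrix.det_mul, Matrix.det_transpose, hP, LinearMap.det_toMatrix]
  ring

/-- The quotient of Gram determinants that defines `absDet` does not depend on the basis. -/
theorem gram_ratio_basis (hV : IsInnerForm β) (hW : IsInnerForm βW) (A : V →ₗ[ℝ] W)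
    (b : Module.Basis ι ℝ V) (b' : Module.Basis ι' ℝ V) :
    (gram βW fun i => A (b' i)).det / (gram β b').det =
      (gram βW fun i => A (b i)).det / (gram β b).det := by
  let σ : ι' ≃ ι := b'.indexEquiv b
  let b'' := b'.reindex σ
  have e1 : (gram βW fun i => A (b' i)).det = (gram βW fun i => A (b'' i)).det := by
    rw [← gram_reindex (fun i => A (b'' i)) σ]
    congr 2; ext i; simp [b'']
  have e2 : (gram β b').det = (gram β b'').det := by
    rw [← gram_reindex b'' σ]
    congr 2; ext i; simp [b'']
  let T : V ≃ₗ[ℝ] V := b.equiv b'' (Equiv.refl _)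
  have hT : ∀ i, b'' i = T (b i) := fun i => by simp [T]
  have hd : LinearMap.det (T : V →ₗ[ℝ] V) ≠ 0 := T.isUnit_det'.ne_zero
  have e3 : (gram βW fun i => A (b'' i)).det =
      LinearMap.det (T : V →ₗ[ℝ] V) ^ 2 * (gram βW fun i => A (b i)).det := by
    rw [← gram_comp_linearMap hW]
    congr 2; ext i; rw [hT]; rfl
  have e4 : (gram β b'').det = LinearMap.det (T : V →ₗ[ℝ] V) ^ 2 * (gram β b).det := by
    have := gram_comp_linearMap hV b LinearMap.id (T : V →ₗ[ℝ] V)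
    simp only [LinearMap.id_apply] at this
    rw [show (gram β b) = gram β (fun i => b i) from rfl, ← this]
    congr 2; ext i; rw [hT]; rfl
  rw [e1, e2, e3, e4, mul_div_mul_left _ _ (pow_ne_zero 2 hd)]

variable [Module.Finite ℝ V]

theorem absDet_eq (hV : IsInnerForm β) (hW : IsInnerForm βW) (A : V →ₗ[ℝ] W)
    (b : Module.Basis ι ℝ V) :
    absDet β βW A = Real.sqrt ((gram βW fun i => A (b i)).det / (gram β b).det) := by
  rw [absDet, gram_ratio_basis hV hW A b]

theorem absDet_pos (hV : IsInnerForm β) (hW : IsInnerForm βW) {A : V →ₗ[ℝ] W}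
    (hA : Function.Injective A) : 0 < absDet β βW A := by
  refine Real.sqrt_pos.2 (div_pos (gram_det_pos hW ?_) (gram_det_pos hV ?_))
  · exact (Module.finBasis ℝ V).linearIndependent.map' A (LinearMap.ker_eq_bot.2 hA)
  · exact (Module.finBasis ℝ V).linearIndependent

/-- Multiplicativity of `absDet`. -/
theorem absDet_comp [Module.Finite ℝ W] (hV : IsInnerForm β)
    (hW : IsInnerForm βW) (hU : IsInnerForm βU)
    (A : V ≃ₗ[ℝ] W) (C : W →ₗ[ℝ] U) :
    absDet β βU (C ∘ₗ (A : V →ₗ[ℝ] W)) = absDet βW βU C * absDet β βW (A : V →ₗ[ℝ] W) := by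
  let b := Module.finBasis ℝ V
  have hb : (fun i => (A : V →ₗ[ℝ] W) (b i)) = b.map A := by ext i; simp
  have hpos : 0 < (gram βW (b.map A)).det := gram_det_pos hW (b.map A).linearIndependent
  have hCpos : (fun i => (C ∘ₗ (A : V →ₗ[ℝ] W)) (b i)) = fun i => C ((b.map A) i) := by
    ext i; simp
  rw [absDet_eq hV hU _ b, absDet_eq hW hU _ (b.map A), absDet_eq hV hW _ b, hb, hCpos,
    ← Real.sqrt_mul (div_nonneg (gram_det_nonneg hU _) hpos.le)]
  rw [div_mul_div_cancel₀ hpos.ne']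

theorem absDet_id (hV : IsInnerForm β) : absDet β β (LinearMap.id : V →ₗ[ℝ] V) = 1 := by
  have h := gram_det_pos hV (Module.finBasis ℝ V).linearIndependent
  rw [absDet]
  simp only [LinearMap.id_apply]
  rw [show gram β (fun i => Module.finBasis ℝ V i) = gram β (Module.finBasis ℝ V) from rfl,
    div_self h.ne', Real.sqrt_one]

theorem IsInnerForm.restrict (hV : IsInnerForm β) (p : Submodule ℝ V) :
    IsInnerForm (fun v w : p => β v w) where
  add_left x y z := hV.add_left x y z
  smul_left c x z := hV.smul_left c x z
  symm x y := hV.symm x y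
  pos x hx := hV.pos x (fun h => hx (Subtype.ext h))

theorem IsInnerForm.prod_real (hV : IsInnerForm β) :
    IsInnerForm (fun v w : ℝ × V => v.1 * w.1 + β v.2 w.2) where
  add_left x y z := by simp only [Prod.fst_add, Prod.snd_add, hV.add_left]; ring
  smul_left c x z := by
    simp only [Prod.smul_fst, Prod.smul_snd, hV.smul_left, smul_eq_mul]; ring
  symm x y := by rw [hV.symm]; ring
  pos x hx := by
    by_cases h : x.2 = 0
    · have h1 : x.1 ≠ 0 := fun h1 => hx (Prod.ext h1 h)
      have := hV.nonneg x.2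
      have h2 := mul_self_pos.2 h1
      linarith
    · have := hV.pos _ h
      have h2 := mul_self_nonneg x.1
      linarith

/-- The Gram determinant of a family augmented by an orthogonal unit vector. -/
theorem gram_option_prod (hV : IsInnerForm β) {k : ℕ} (e : Fin k → V) :
    (gram (fun v w : ℝ × V => v.1 * w.1 + β v.2 w.2)
      (Fin.cons (1, 0) fun i => (0, e i) : Fin (k + 1) → ℝ × V)).det = (gram β e).det := by
  have hz : ∀ v, β 0 v = 0 := fun v => by
    have := hV.smul_left 0 v v
    rwa [zero_smul, zero_mul] at this
  rw [Matrix.det_succ_row_zero, Fin.sum_univ_succ]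
  simp only [gram, Matrix.of_apply, Fin.cons_zero, Fin.cons_succ, hz]
  simp only [Fin.val_zero, pow_zero, one_mul, mul_zero, add_zero, mul_one, zero_mul,
    Finset.sum_const_zero]
  congr 1
  ext i j
  simp

end Gram

/-! ### The metric and the renormalized gradient in coordinates -/

section Metric

variable {d : ℕ} {M : Type u} [TopologicalSpace M] [ChartedSpace (EuclideanSpace ℝ (Fin d)) M]
  [IsManifold (𝓡 d) ∞ M] (g : Metric d M)

theorem isInnerForm_metric (x : M) :
    IsInnerForm (fun v w : TangentSpace (𝓡 d) x => g.inner x v w) where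
  add_left v w z := by simp
  smul_left c v w := by simp
  symm v w := g.symm x v w
  pos v hv := g.pos x v hv

theorem isInnerForm_flowSource (m : M → ℝ) (x : M) :
    IsInnerForm (fun v w : ℝ × (mfderiv (𝓡 d) 𝓘(ℝ, ℝ) m x).ker =>
      v.1 * w.1 + g.inner x (v.2 : TangentSpace (𝓡 d) x) w.2) :=
  ((isInnerForm_metric g x).restrict _).prod_real

variable {F : Type*} [NormedAddCommGroup F] [NormedSpace ℝ F]

/-- Images of a smooth vector field under a smooth map from a vector space to `M` form a smooth
section along the map. -/
theorem contMDiffOn_mfderiv_apply {U : Set F} (hU : IsOpen U) {f : F → M}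
    (hf : ContMDiffOn 𝓘(ℝ, F) (𝓡 d) ∞ f U) {v : F → F} (hv : ContDiffOn ℝ ∞ v U) :
    ContMDiffOn 𝓘(ℝ, F) (𝓡 d).tangent ∞
      (fun u => (⟨f u, mfderiv 𝓘(ℝ, F) (𝓡 d) f u (v u)⟩ : TangentBundle (𝓡 d) M)) U := by
  have h1 : ContMDiffOn 𝓘(ℝ, F) 𝓘(ℝ, F).tangent ∞
      (fun u => (⟨u, v u⟩ : TangentBundle 𝓘(ℝ, F) F)) U :=
    contMDiffOn_vectorSpace_iff_contDiffOn.2 hv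
  have h2 := hf.contMDiffOn_tangentMapWithin (m := ∞) (by simp) hU.uniqueMDiffOn
  refine (h2.comp h1 (fun u hu => hu)).congr fun u hu => ?_
  simp only [Function.comp, tangentMapWithin]
  rw [mfderivWithin_of_isOpen hU hu]

/-- The metric of two smooth sections along a smooth map is smooth. -/
theorem contMDiffOn_metric_apply {EB HB B : Type*} [NormedAddCommGroup EB] [NormedSpace ℝ EB]
    [TopologicalSpace HB] {IB : ModelWithCorners ℝ EB HB} [TopologicalSpace B] [ChartedSpace HB B]
    {U : Set B} {f : B → M} {v w : ∀ u, TangentSpace (𝓡 d) (f u)}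
    (hv : ContMDiffOn IB (𝓡 d).tangent ∞ (fun u => (⟨f u, v u⟩ : TangentBundle (𝓡 d) M)) U)
    (hw : ContMDiffOn IB (𝓡 d).tangent ∞ (fun u => (⟨f u, w u⟩ : TangentBundle (𝓡 d) M)) U) :
    ContMDiffOn IB 𝓘(ℝ, ℝ) ∞ (fun u => g.inner (f u) (v u) (w u)) U := by
  have hf : ContMDiffOn IB (𝓡 d) ∞ f U := fun u hu => by
    have := hv u hu
    rw [Bundle.contMDiffWithinAt_totalSpace] at this
    exact this.1
  intro u hu
  have h : ContMDiffWithinAt IB ((𝓡 d).prod 𝓘(ℝ)) ∞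
      (fun u ↦ Bundle.TotalSpace.mk' ℝ (E := Bundle.Trivial M ℝ) (f u)
        (g.inner (f u) (v u) (w u))) U u := by
    apply ContMDiffWithinAt.clm_bundle_apply₂ (F₁ := EuclideanSpace ℝ (Fin d))
      (F₂ := EuclideanSpace ℝ (Fin d))
    · exact ContMDiffAt.comp_contMDiffWithinAt u g.contMDiff.contMDiffAt (hf u hu)
    · exact hv u hu
    · exact hw u hu
  rw [Bundle.contMDiffWithinAt_totalSpace] at h
  exact h.2

theorem contDiffOn_metric_mfderiv {U : Set F} (hU : IsOpen U) {f : F → M}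
    (hf : ContMDiffOn 𝓘(ℝ, F) (𝓡 d) ∞ f U) (v w : F) :
    ContDiffOn ℝ ∞ (fun u => g.inner (f u) (mfderiv 𝓘(ℝ, F) (𝓡 d) f u v)
      (mfderiv 𝓘(ℝ, F) (𝓡 d) f u w)) U :=
  contMDiffOn_iff_contDiffOn.1 (contMDiffOn_metric_apply g
    (contMDiffOn_mfderiv_apply hU hf contDiffOn_const)
    (contMDiffOn_mfderiv_apply hU hf contDiffOn_const))

theorem inner_grad (m : M → ℝ) (x : M) :
    (g.inner x (grad g m x) : TangentSpace (𝓡 d) x →L[ℝ] ℝ) = mfderiv (𝓡 d) 𝓘(ℝ, ℝ) m x := by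
  let E := EuclideanSpace ℝ (Fin d)
  let L : E →ₗ[ℝ] (E →L[ℝ] ℝ) := (g.inner x : E →L[ℝ] E →L[ℝ] ℝ).toLinearMap
  have hinj : Function.Injective L := by
    rw [← LinearMap.ker_eq_bot, LinearMap.ker_eq_bot']
    intro v hv
    by_contra h
    have := g.pos x v h
    have h2 : g.inner x v v = 0 := DFunLike.congr_fun hv v
    exact this.ne' h2
  have hfin : Module.finrank ℝ E = Module.finrank ℝ (E →L[ℝ] ℝ) := by
    rw [← (LinearMap.toContinuousLinearMap (𝕜 := ℝ) (E := E) (F' := ℝ)).finrank_eq]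
    exact (Subspace.dual_finrank_eq (K := ℝ) (V := E)).symm
  have hsurj : Function.Surjective L :=
    (LinearMap.injective_iff_surjective_of_finrank_eq_finrank hfin).1 hinj
  exact Function.invFun_eq (f := fun v : TangentSpace (𝓡 d) x => g.inner x v)
    (hsurj (mfderiv (𝓡 d) 𝓘(ℝ, ℝ) m x : E →L[ℝ] ℝ))

theorem inner_grad_apply (m : M → ℝ) (x : M) (v : TangentSpace (𝓡 d) x) :
    g.inner x (grad g m x) v = mfderiv (𝓡 d) 𝓘(ℝ, ℝ) m x v :=
  DFunLike.congr_fun (inner_grad g m x) v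

theorem inner_grad_pos {m : M → ℝ} {x : M} (hx : ¬ IsCrit d m x) :
    0 < g.inner x (grad g m x) (grad g m x) := by
  refine g.pos x _ fun h => hx ?_
  rw [IsCrit, ← inner_grad g m x, h, map_zero]
  rfl

theorem mfderiv_normGrad {m : M → ℝ} {x : M} (hx : ¬ IsCrit d m x) :
    mfderiv (𝓡 d) 𝓘(ℝ, ℝ) m x (normGrad g m x) = (1 : ℝ) := by
  rw [normGrad, map_smul, ← inner_grad_apply g]
  exact inv_mul_cancel₀ (inner_grad_pos g hx).ne'

/-- In an inverse chart `f`, the gradient is obtained from the differential of `m ∘ f` by inverting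
the Gram matrix of the metric. -/
theorem contDiffOn_inverse_metric {U : Set (EuclideanSpace ℝ (Fin d))}
    (hU : IsOpen U) {f : EuclideanSpace ℝ (Fin d) → M}
    (hf : ContMDiffOn 𝓘(ℝ, EuclideanSpace ℝ (Fin d)) (𝓡 d) ∞ f U)
    (hfi : ∀ u ∈ U, Function.Bijective
      (mfderiv 𝓘(ℝ, EuclideanSpace ℝ (Fin d)) (𝓡 d) f u))
    {m : M → ℝ} (hm : ContMDiff (𝓡 d) 𝓘(ℝ, ℝ) ∞ m) :
    ∃ n : EuclideanSpace ℝ (Fin d) → EuclideanSpace ℝ (Fin d), ContDiffOn ℝ ∞ n U ∧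
      ∀ u ∈ U, mfderiv 𝓘(ℝ, EuclideanSpace ℝ (Fin d)) (𝓡 d) f u (n u) = grad g m (f u) := by
  let E := EuclideanSpace ℝ (Fin d)
  let D : E → E →L[ℝ] E := fun u => mfderiv 𝓘(ℝ, E) (𝓡 d) f u
  let G : E → E →L[ℝ] E →L[ℝ] ℝ := fun u =>
    ((ContinuousLinearMap.compL ℝ E E ℝ).flip (D u)).comp
      ((g.inner (f u) : E →L[ℝ] E →L[ℝ] ℝ).comp (D u))
  have hG : ∀ u v w, G u v w = g.inner (f u) (mfderiv 𝓘(ℝ, E) (𝓡 d) f u v)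
      (mfderiv 𝓘(ℝ, E) (𝓡 d) f u w) := fun u v w => rfl
  have hGs : ContDiffOn ℝ ∞ G U := by
    rw [contDiffOn_clm_apply]
    intro v
    rw [contDiffOn_clm_apply]
    intro w
    exact contDiffOn_metric_mfderiv g hU hf v w
  have hGinv : ∀ u ∈ U, ∃ e : E ≃L[ℝ] (E →L[ℝ] ℝ), (e : E →L[ℝ] (E →L[ℝ] ℝ)) = G u := by
    intro u hu
    have hinj : Function.Injective (G u).toLinearMap := by
      rw [← LinearMap.ker_eq_bot, LinearMap.ker_eq_bot']
      intro v hv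
      by_contra h
      have h2 : G u v v = 0 := DFunLike.congr_fun hv v
      rw [hG] at h2
      refine (g.pos (f u) _ fun h3 => h ?_).ne' h2
      exact (hfi u hu).1 (h3.trans (map_zero _).symm)
    have hfin : Module.finrank ℝ E = Module.finrank ℝ (E →L[ℝ] ℝ) := by
      rw [← (LinearMap.toContinuousLinearMap (𝕜 := ℝ) (E := E) (F' := ℝ)).finrank_eq]
      exact (Subspace.dual_finrank_eq (K := ℝ) (V := E)).symm
    have hsurj : Function.Surjective (G u).toLinearMap :=
      (LinearMap.injective_iff_surjective_of_finrank_eq_finrank hfin).1 hinj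
    refine ⟨(LinearEquiv.ofBijective (G u).toLinearMap ⟨hinj, hsurj⟩).toContinuousLinearEquiv, ?_⟩
    ext v w
    rfl
  refine ⟨fun u => (G u).inverse (fderiv ℝ (m ∘ f) u), ?_, ?_⟩
  · have h1 : ContDiffOn ℝ ∞ (fun u => (G u).inverse) U := by
      intro u hu
      obtain ⟨e, he⟩ := hGinv u hu
      have h2 : ContDiffAt ℝ ∞ ContinuousLinearMap.inverse (G u) := by
        rw [← he]; exact contDiffAt_map_inverse e
      exact h2.comp_contDiffWithinAt u (hGs u hu)
    have h3 : ContDiffOn ℝ ∞ (m ∘ f) U := contMDiffOn_iff_contDiffOn.1 (hm.comp_contMDiffOn hf)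
    exact h1.clm_apply (h3.fderiv_of_isOpen hU (by simp))
  · intro u hu
    obtain ⟨e, he⟩ := hGinv u hu
    -- the preimage of the gradient under the differential of `f`
    obtain ⟨n, hn⟩ : ∃ n : E, mfderiv 𝓘(ℝ, E) (𝓡 d) f u n = grad g m (f u) :=
      (hfi u hu).2 (grad g m (f u))
    have hfd : MDifferentiableAt 𝓘(ℝ, E) (𝓡 d) f u :=
      (hf.contMDiffAt (hU.mem_nhds hu)).mdifferentiableAt (by simp)
    have hd : fderiv ℝ (m ∘ f) u = G u n := by
      ext w
      refine Eq.trans ?_ (hG u n w).symm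
      rw [hn, inner_grad_apply, ← mfderiv_eq_fderiv,
        mfderiv_comp u (hm.mdifferentiableAt (by simp)) hfd]
      rfl
    have h4 : (G u).inverse (fderiv ℝ (m ∘ f) u) = n := by
      rw [hd, ← he, ContinuousLinearMap.inverse_equiv]
      exact e.symm_apply_apply n
    simp only [h4]
    exact hn

end Metric

/-! ### The flow of the renormalized gradient -/

section Field

variable {d : ℕ} {M : Type u} [TopologicalSpace M] [ChartedSpace (EuclideanSpace ℝ (Fin d)) M]
  [IsManifold (𝓡 d) ∞ M] (g : Metric d M) {m : M → ℝ}

theorem bijective_mfderiv_extChartAt_symm (p : M) {u : EuclideanSpace ℝ (Fin d)}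
    (hu : u ∈ (extChartAt (𝓡 d) p).target) :
    Function.Bijective (mfderiv 𝓘(ℝ, EuclideanSpace ℝ (Fin d)) (𝓡 d)
      (extChartAt (𝓡 d) p).symm u) := by
  have h := isInvertible_mfderivWithin_extChartAt_symm (I := 𝓡 d) (x := p) hu
  rw [ModelWithCorners.range_eq_univ, mfderivWithin_univ] at h
  obtain ⟨e, he⟩ := h
  rw [← he]
  exact e.bijective

theorem contMDiff_grad (hm : ContMDiff (𝓡 d) 𝓘(ℝ, ℝ) ∞ m) :
    ContMDiff (𝓡 d) (𝓡 d).tangent ∞ (fun x => (⟨x, grad g m x⟩ : TangentBundle (𝓡 d) M)) := by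
  intro p
  set φ := extChartAt (𝓡 d) p
  have hU : IsOpen φ.target := isOpen_extChartAt_target p
  have hf : ContMDiffOn 𝓘(ℝ, EuclideanSpace ℝ (Fin d)) (𝓡 d) ∞ φ.symm φ.target :=
    contMDiffOn_extChartAt_symm p
  obtain ⟨n, hn, hn2⟩ := contDiffOn_inverse_metric g hU hf
    (fun u hu => bijective_mfderiv_extChartAt_symm p hu) hm
  have h1 := contMDiffOn_mfderiv_apply hU hf hn
  have h2 : ContMDiffOn (𝓡 d) 𝓘(ℝ, EuclideanSpace ℝ (Fin d)) ∞ φ (chartAt _ p).source :=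
    contMDiffOn_extChartAt
  have h3 := h1.comp h2 (fun x hx => φ.map_source (by rwa [extChartAt_source]))
  refine (h3.congr fun x hx => ?_).contMDiffAt
    ((chartAt _ p).open_source.mem_nhds (mem_chart_source _ p))
  have hx' : x ∈ φ.source := by rwa [extChartAt_source]
  simp only [Function.comp]
  rw [hn2 _ (φ.map_source hx'), φ.left_inv hx']

include g in
theorem isOpen_notCrit (hm : ContMDiff (𝓡 d) 𝓘(ℝ, ℝ) ∞ m) : IsOpen {x : M | ¬ IsCrit d m x} := by
  have h := contMDiffOn_metric_apply g (contMDiff_grad g hm).contMDiffOn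
    (contMDiff_grad g hm).contMDiffOn (U := univ)
  have hc : Continuous (fun x : M => g.inner x (grad g m x) (grad g m x)) :=
    continuousOn_univ.1 h.continuousOn
  have : {x : M | ¬ IsCrit d m x} = {x | 0 < g.inner x (grad g m x) (grad g m x)} := by
    ext x
    refine ⟨fun hx => inner_grad_pos g hx, fun hx h0 => ?_⟩
    have h1 := inner_grad_apply g m x (grad g m x)
    rw [h0] at h1
    exact (mem_ofPred.1 hx).ne' h1
  rw [this]
  exact isOpen_lt continuous_const hc

theorem contMDiffAt_normGrad (hm : ContMDiff (𝓡 d) 𝓘(ℝ, ℝ) ∞ m) {p : M} (hp : ¬ IsCrit d m p) :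
    ContMDiffAt (𝓡 d) (𝓡 d).tangent ∞
      (fun x => (⟨x, normGrad g m x⟩ : TangentBundle (𝓡 d) M)) p := by
  have h1 := contMDiff_grad g hm p
  have h2 : ContMDiffAt (𝓡 d) 𝓘(ℝ, ℝ) ∞
      (fun x : M => (g.inner x (grad g m x) (grad g m x))⁻¹) p := by
    have h := contMDiffOn_metric_apply g (contMDiff_grad g hm).contMDiffOn
      (contMDiff_grad g hm).contMDiffOn (U := univ)
    exact (contMDiffOn_univ.1 h p).inv₀ (inner_grad_pos g hp).ne'
  exact h2.smul_section h1

/-- `η` is an integral curve of the renormalized gradient on `(a,b)` without critical points. -/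
structure IsFlowLine (m : M → ℝ) (η : ℝ → M) (a b : ℝ) : Prop where
  notCrit : ∀ r ∈ Ioo a b, ¬ IsCrit d m (η r)
  curve : IsMIntegralCurveOn η (normGrad g m) (Ioo a b)

variable {g} {η ζ : ℝ → M} {a b a' b' t₀ : ℝ}

theorem IsFlowLine.mono (h : IsFlowLine g m η a b) (ha : a ≤ a') (hb : b' ≤ b) :
    IsFlowLine g m η a' b' :=
  ⟨fun r hr => h.notCrit r (Ioo_subset_Ioo ha hb hr), h.curve.mono (Ioo_subset_Ioo ha hb)⟩

theorem IsFlowLine.shift (h : IsFlowLine g m η a b) (c : ℝ) :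
    IsFlowLine g m (fun t => η (t + c)) (a - c) (b - c) := by
  have hs : Ioo (a - c) (b - c) = {t | t + c ∈ Ioo a b} := by
    ext t; simp only [mem_Ioo, mem_ofPred_eq]; constructor <;> rintro ⟨h1, h2⟩ <;>
      constructor <;> linarith
  refine ⟨fun r hr => h.notCrit _ (by rw [hs] at hr; exact hr), ?_⟩
  rw [hs]
  exact h.curve.comp_add c

theorem IsFlowLine.continuousOn (h : IsFlowLine g m η a b) : ContinuousOn η (Ioo a b) :=
  h.curve.continuousOn

theorem IsFlowLine.eqOn [T2Space M] (hm : ContMDiff (𝓡 d) 𝓘(ℝ, ℝ) ∞ m) (h : IsFlowLine g m η a b)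
    (h' : IsFlowLine g m ζ a b) (ht₀ : t₀ ∈ Ioo a b) (h0 : η t₀ = ζ t₀) : EqOn η ζ (Ioo a b) := by
  intro t ht
  refine (isPreconnected_Ioo.induction₂ (s := Ioo a b)
    (fun s t => (η s = ζ s ↔ η t = ζ t)) ?_ ?_ ?_ ht₀ ht).1 h0
  · intro t ht
    rw [isOpen_Ioo.nhdsWithin_eq ht]
    by_cases heq : η t = ζ t
    · have hv := (contMDiffAt_normGrad g hm (h.notCrit t ht)).of_le (n := ∞) (m := 1) (by simp)
      have := isMIntegralCurveAt_eventuallyEq_of_contMDiffAt_boundaryless hv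
        (h.curve.isMIntegralCurveAt (isOpen_Ioo.mem_nhds ht))
        (h'.curve.isMIntegralCurveAt (isOpen_Ioo.mem_nhds ht)) heq
      filter_upwards [this] with s hs
      simp [heq, hs]
    · have h1 := (h.continuousOn.continuousAt (isOpen_Ioo.mem_nhds ht))
      have h2 := (h'.continuousOn.continuousAt (isOpen_Ioo.mem_nhds ht))
      filter_upwards [(h1.prodMk h2).preimage_mem_nhds (isClosed_diagonal.isOpen_compl.mem_nhds
        (show (η t, ζ t) ∈ (diagonal M)ᶜ from heq))] with s hs
      have hs' : η s ≠ ζ s := hs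
      simp [heq, hs']
  · exact fun _ _ _ _ _ _ h1 h2 => h1.trans h2
  · exact fun _ _ _ _ h1 => h1.symm

theorem IsFlowLine.m_eq (hm : ContMDiff (𝓡 d) 𝓘(ℝ, ℝ) ∞ m) (h : IsFlowLine g m η a b) {s t : ℝ}
    (hs : s ∈ Ioo a b) (ht : t ∈ Ioo a b) : m (η t) = m (η s) + (t - s) := by
  have hd : ∀ t ∈ Ioo a b, HasDerivAt (fun t => m (η t)) 1 t := by
    intro t ht
    have h1 := (h.curve.isMIntegralCurveAt (isOpen_Ioo.mem_nhds ht)).hasMFDerivAt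
    have h2 : HasMFDerivAt (𝓡 d) 𝓘(ℝ, ℝ) m (η t) (mfderiv (𝓡 d) 𝓘(ℝ, ℝ) m (η t)) :=
      (hm.mdifferentiableAt (by simp)).hasMFDerivAt
    have h3 : HasFDerivAt (fun t => m (η t)) (ContinuousLinearMap.toSpanSingleton ℝ (1 : ℝ)) t := by
      refine hasMFDerivAt_iff_hasFDerivAt.1 ((h2.comp t h1).congr_mfderiv ?_)
      have h4 := mfderiv_normGrad g (h.notCrit t ht)
      have h5 : ((1 : ℝ →L[ℝ] ℝ) 1) • normGrad g m (η t) = normGrad g m (η t) := one_smul ℝ _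
      refine ContinuousLinearMap.ext_ring ?_
      refine ((congrArg (mfderiv (𝓡 d) 𝓘(ℝ, ℝ) m (η t)) h5).trans h4).trans ?_
      exact (one_smul ℝ (1 : ℝ)).symm
    exact h3
  have h2 : ∀ t ∈ Ioo a b, HasDerivAt (fun t => m (η s) + (t - s)) 1 t := fun t _ =>
    ((hasDerivAt_id t).sub_const s).const_add _
  refine isOpen_Ioo.eqOn_of_deriv_eq isPreconnected_Ioo
    (fun t ht => (hd t ht).differentiableAt.differentiableWithinAt)
    (fun t ht => (h2 t ht).differentiableAt.differentiableWithinAt)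
    (fun t ht => by rw [(hd t ht).deriv, (h2 t ht).deriv]) hs (by simp) ht

/-- Two flow lines that meet extend to a common flow line. -/
theorem IsFlowLine.glue [T2Space M] (hm : ContMDiff (𝓡 d) 𝓘(ℝ, ℝ) ∞ m) (h : IsFlowLine g m η a b)
    (h' : IsFlowLine g m ζ a' b') (ht₀ : t₀ ∈ Ioo a b) (ht₀' : t₀ ∈ Ioo a' b') (h0 : η t₀ = ζ t₀) :
    ∃ ξ, IsFlowLine g m ξ (min a a') (max b b') ∧ EqOn ξ η (Ioo a b) ∧ EqOn ξ ζ (Ioo a' b') := by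
  classical
  set ξ := (Ioo a b).piecewise η ζ
  have e1 : EqOn ξ η (Ioo a b) := piecewise_eqOn _ _ _
  have e2 : EqOn ξ ζ (Ioo a' b') := by
    intro t ht
    by_cases hmem : t ∈ Ioo a b
    · rw [e1 hmem]
      exact (h.mono (le_max_left a a') (min_le_left b b')).eqOn hm
        (h'.mono (le_max_right a a') (min_le_right b b'))
        ⟨max_lt ht₀.1 ht₀'.1, lt_min ht₀.2 ht₀'.2⟩ h0
        ⟨max_lt hmem.1 ht.1, lt_min hmem.2 ht.2⟩
    · exact piecewise_eq_of_notMem _ _ _ hmem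
  have hcov : ∀ t ∈ Ioo (min a a') (max b b'), t ∈ Ioo a b ∨ t ∈ Ioo a' b' := by
    intro t ht
    by_contra hcon
    simp only [mem_Ioo, not_or, not_and_or, not_lt, min_lt_iff, lt_max_iff] at hcon ht ht₀ ht₀'
    rcases hcon with ⟨h1 | h1, h2 | h2⟩ <;> rcases ht with ⟨h3 | h3, h4 | h4⟩ <;> linarith
  refine ⟨ξ, ⟨fun t ht => ?_, ?_⟩, e1, e2⟩
  · rcases hcov t ht with hh | hh
    · rw [e1 hh]; exact h.notCrit t hh
    · rw [e2 hh]; exact h'.notCrit t hh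
  · refine IsMIntegralCurveAt.isMIntegralCurveOn fun t ht => ?_
    have key : ∀ {χ : ℝ → M} {c e : ℝ}, EqOn ξ χ (Ioo c e) → IsFlowLine g m χ c e → t ∈ Ioo c e →
        IsMIntegralCurveAt ξ (normGrad g m) t := by
      intro χ c e he hχ ht
      refine IsMIntegralCurveOn.isMIntegralCurveAt (s := Ioo c e) (fun s hs => ?_)
        (isOpen_Ioo.mem_nhds ht)
      have := (hχ.curve s hs).congr_of_eventuallyEq
        (eventually_nhdsWithin_of_forall fun r hr => he hr) (he hs)
      rwa [he hs]
    rcases hcov t ht with hh | hh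
    · exact key e1 h hh
    · exact key e2 h' hh

end Field

section Flow

variable {d : ℕ} {M : Type u} [TopologicalSpace M] [ChartedSpace (EuclideanSpace ℝ (Fin d)) M]
  [IsManifold (𝓡 d) ∞ M] {g : Metric d M} {m : M → ℝ} {ϑ t r : ℝ} {x : M}

theorem flowReaches_iff : FlowReaches g m ϑ t x ↔
    ∃ (η : ℝ → M) (a b : ℝ), ϑ ∈ Ioo a b ∧ t ∈ Ioo a b ∧ η ϑ = x ∧ IsFlowLine g m η a b :=
  ⟨fun ⟨η, a, b, h1, h2, h3, h4, h5⟩ => ⟨η, a, b, h1, h2, h3, h4, h5⟩,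
    fun ⟨η, a, b, h1, h2, h3, h4⟩ => ⟨η, a, b, h1, h2, h3, h4.1, h4.2⟩⟩

theorem IsFlowLine.reaches {η : ℝ → M} {a b : ℝ} (h : IsFlowLine g m η a b) (hϑ : ϑ ∈ Ioo a b)
    (ht : t ∈ Ioo a b) : FlowReaches g m ϑ t (η ϑ) :=
  flowReaches_iff.2 ⟨η, a, b, hϑ, ht, rfl, h⟩

variable [T2Space M] (hm : ContMDiff (𝓡 d) 𝓘(ℝ, ℝ) ∞ m)
include hm

theorem IsFlowLine.flow_eq {η : ℝ → M} {a b : ℝ} (h : IsFlowLine g m η a b) (hϑ : ϑ ∈ Ioo a b)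
    (ht : t ∈ Ioo a b) : flow g m ϑ t (η ϑ) = η t := by
  have hr := h.reaches hϑ ht
  rw [flow, dif_pos hr]
  obtain ⟨a', b', h1, h2, h3, h4, h5⟩ := hr.choose_spec
  have h' : IsFlowLine g m hr.choose a' b' := ⟨h4, h5⟩
  exact (h'.mono (le_max_right a a') (min_le_right b b')).eqOn hm
    (h.mono (le_max_left a a') (min_le_left b b'))
    ⟨max_lt hϑ.1 h1.1, lt_min hϑ.2 h1.2⟩ h3 ⟨max_lt ht.1 h2.1, lt_min ht.2 h2.2⟩

theorem flow_spec (h : FlowReaches g m ϑ t x) : ∃ (η : ℝ → M) (a b : ℝ), ϑ ∈ Ioo a b ∧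
    t ∈ Ioo a b ∧ η ϑ = x ∧ η t = flow g m ϑ t x ∧ IsFlowLine g m η a b := by
  obtain ⟨η, a, b, h1, h2, rfl, h4⟩ := flowReaches_iff.1 h
  exact ⟨η, a, b, h1, h2, rfl, (h4.flow_eq hm h1 h2).symm, h4⟩

theorem FlowReaches.symm (h : FlowReaches g m ϑ t x) :
    FlowReaches g m t ϑ (flow g m ϑ t x) ∧ flow g m t ϑ (flow g m ϑ t x) = x := by
  obtain ⟨η, a, b, h1, h2, rfl, h4, h5⟩ := flow_spec hm h
  rw [← h4]
  exact ⟨h5.reaches h2 h1, h5.flow_eq hm h2 h1⟩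

theorem FlowReaches.self (h : FlowReaches g m ϑ t x) :
    FlowReaches g m ϑ ϑ x ∧ flow g m ϑ ϑ x = x := by
  obtain ⟨η, a, b, h1, h2, rfl, h4, h5⟩ := flow_spec hm h
  exact ⟨h5.reaches h1 h1, h5.flow_eq hm h1 h1⟩

theorem FlowReaches.m_flow (h : FlowReaches g m ϑ t x) : m (flow g m ϑ t x) = m x + (t - ϑ) := by
  obtain ⟨η, a, b, h1, h2, rfl, h4, h5⟩ := flow_spec hm h
  rw [← h4]
  exact h5.m_eq hm h1 h2

theorem FlowReaches.notCrit (h : FlowReaches g m ϑ t x) :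
    ¬ IsCrit d m x ∧ ¬ IsCrit d m (flow g m ϑ t x) := by
  obtain ⟨η, a, b, h1, h2, rfl, h4, h5⟩ := flow_spec hm h
  rw [← h4]
  exact ⟨h5.notCrit _ h1, h5.notCrit _ h2⟩

theorem FlowReaches.trans (h : FlowReaches g m ϑ t x) (h' : FlowReaches g m t r (flow g m ϑ t x)) :
    FlowReaches g m ϑ r x ∧ flow g m ϑ r x = flow g m t r (flow g m ϑ t x) := by
  obtain ⟨η, a, b, h1, h2, rfl, h4, h5⟩ := flow_spec hm h
  obtain ⟨ζ, a', b', h1', h2', h3', h4', h5'⟩ := flow_spec hm h'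
  obtain ⟨ξ, hξ, e1, e2⟩ := h5.glue hm h5' h2 h1' (h4.trans h3'.symm)
  rw [← h4', ← e2 h2', ← e1 h1]
  have i1 : ϑ ∈ Ioo (min a a') (max b b') := ⟨min_lt_of_left_lt h1.1, lt_max_of_lt_left h1.2⟩
  have i2 : r ∈ Ioo (min a a') (max b b') := ⟨min_lt_of_right_lt h2'.1, lt_max_of_lt_right h2'.2⟩
  exact ⟨hξ.reaches i1 i2, hξ.flow_eq hm i1 i2⟩

/-- Two times reached from the same point are reached from each other. -/
theorem FlowReaches.between (h : FlowReaches g m ϑ t x) (h' : FlowReaches g m ϑ r x) :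
    FlowReaches g m t r (flow g m ϑ t x) ∧ flow g m t r (flow g m ϑ t x) = flow g m ϑ r x := by
  obtain ⟨h1, h2⟩ := h.symm hm
  have := h1.trans hm (r := r) (by rwa [h2])
  rw [h2] at this
  exact this

theorem flowReaches_shift (c : ℝ) (h : FlowReaches g m ϑ t x) :
    FlowReaches g m (ϑ - c) (t - c) x ∧ flow g m (ϑ - c) (t - c) x = flow g m ϑ t x := by
  obtain ⟨η, a, b, h1, h2, rfl, h4, h5⟩ := flow_spec hm h
  have h6 := h5.shift c
  have i1 : ϑ - c ∈ Ioo (a - c) (b - c) := ⟨by linarith [h1.1], by linarith [h1.2]⟩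
  have i2 : t - c ∈ Ioo (a - c) (b - c) := ⟨by linarith [h2.1], by linarith [h2.2]⟩
  have h7 := h6.reaches i1 i2
  have h8 := h6.flow_eq hm i1 i2
  simp only [sub_add_cancel] at h7 h8
  exact ⟨h7, h8.trans h4⟩

theorem flowReaches_shift_iff (c : ℝ) :
    FlowReaches g m (ϑ - c) (t - c) x ↔ FlowReaches g m ϑ t x := by
  refine ⟨fun h => ?_, fun h => (flowReaches_shift hm c h).1⟩
  have := (flowReaches_shift hm (-c) h).1
  simpa using this

theorem flow_shift (c : ℝ) : flow g m (ϑ - c) (t - c) x = flow g m ϑ t x := by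
  by_cases h : FlowReaches g m ϑ t x
  · exact (flowReaches_shift hm c h).2
  · have h' : ¬ FlowReaches g m (ϑ - c) (t - c) x := by rwa [flowReaches_shift_iff hm]
    rw [flow, flow, dif_neg h, dif_neg h']

theorem flow_eq_zero : flow g m ϑ t x = flow g m 0 (t - ϑ) x := by
  rw [← flow_shift hm ϑ, sub_self]

theorem flowReaches_iff_zero : FlowReaches g m ϑ t x ↔ FlowReaches g m 0 (t - ϑ) x := by
  rw [← flowReaches_shift_iff hm ϑ, sub_self]

end Flow

/-! ### Smoothness of the flow -/

section FlowSmooth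

variable {d : ℕ} {M : Type u} [TopologicalSpace M] [ChartedSpace (EuclideanSpace ℝ (Fin d)) M]
  [IsManifold (𝓡 d) ∞ M] (g : Metric d M) {m : M → ℝ}

/-- The pairs `(τ,x)` such that the flow of `x` is defined up to time `τ`. -/
def flowDomain (m : M → ℝ) : Set (ℝ × M) := {q | FlowReaches g m 0 q.1 q.2}

variable [T2Space M] (hm : ContMDiff (𝓡 d) 𝓘(ℝ, ℝ) ∞ m)
include hm

/-- Flow box: near a point that is not critical, the flow exists for a short time and is smooth. -/
theorem exists_flowBox {p : M} (hp : ¬ IsCrit d m p) :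
    ∃ ε > 0, ∃ W : Set M, IsOpen W ∧ p ∈ W ∧ Ioo (-ε) ε ×ˢ W ⊆ flowDomain g m ∧
      ContMDiffOn (𝓘(ℝ, ℝ).prod (𝓡 d)) (𝓡 d) ∞ (fun q : ℝ × M => flow g m 0 q.1 q.2)
        (Ioo (-ε) ε ×ˢ W) := by
  let E := EuclideanSpace ℝ (Fin d)
  let φ := extChartAt (𝓡 d) p
  have hf : ContMDiffOn 𝓘(ℝ, E) (𝓡 d) ∞ φ.symm φ.target := contMDiffOn_extChartAt_symm p
  let U : Set E := φ.target ∩ φ.symm ⁻¹' {x | ¬ IsCrit d m x}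
  have hU : IsOpen U :=
    hf.continuousOn.isOpen_inter_preimage (isOpen_extChartAt_target p) (isOpen_notCrit g hm)
  have hfU : ContMDiffOn 𝓘(ℝ, E) (𝓡 d) ∞ φ.symm U := hf.mono inter_subset_left
  obtain ⟨n, hn, hn2⟩ := contDiffOn_inverse_metric g hU hfU
    (fun u hu => bijective_mfderiv_extChartAt_symm p hu.1) hm
  have hG : ContDiffOn ℝ ∞ (fun u => g.inner (φ.symm u)
      (mfderiv 𝓘(ℝ, E) (𝓡 d) φ.symm u (n u)) (mfderiv 𝓘(ℝ, E) (𝓡 d) φ.symm u (n u))) U :=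
    contMDiffOn_iff_contDiffOn.1 (contMDiffOn_metric_apply g
      (contMDiffOn_mfderiv_apply hU hfU hn) (contMDiffOn_mfderiv_apply hU hfU hn))
  have hGpos : ∀ u ∈ U, g.inner (φ.symm u)
      (mfderiv 𝓘(ℝ, E) (𝓡 d) φ.symm u (n u)) (mfderiv 𝓘(ℝ, E) (𝓡 d) φ.symm u (n u)) ≠ 0 := by
    intro u hu
    rw [hn2 u hu]
    exact (inner_grad_pos g hu.2).ne'
  let v : E → E := fun u => (g.inner (φ.symm u) (mfderiv 𝓘(ℝ, E) (𝓡 d) φ.symm u (n u))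
    (mfderiv 𝓘(ℝ, E) (𝓡 d) φ.symm u (n u)))⁻¹ • n u
  have hv : ContDiffOn ℝ ∞ v U := (hG.inv hGpos).smul hn
  have hv2 : ∀ u ∈ U, mfderiv 𝓘(ℝ, E) (𝓡 d) φ.symm u (v u) = normGrad g m (φ.symm u) := by
    intro u hu
    refine ((mfderiv 𝓘(ℝ, E) (𝓡 d) φ.symm u).map_smul _ _).trans ?_
    rw [hn2 u hu]
    rfl
  have hpU : φ p ∈ U := by
    refine ⟨mem_extChartAt_target p, ?_⟩
    rw [mem_preimage, extChartAt_to_inv]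
    exact hp
  obtain ⟨ε, hε, W', hW', hpW', ψ, hψ, hψ2⟩ := exists_contDiffOn_localFlow hU hv hpU
  let W : Set M := (chartAt E p).source ∩ φ ⁻¹' W'
  have hφs : ContMDiffOn (𝓡 d) 𝓘(ℝ, E) ∞ φ (chartAt E p).source := contMDiffOn_extChartAt
  have hW : IsOpen W := hφs.continuousOn.isOpen_inter_preimage (chartAt E p).open_source hW'
  have hline : ∀ x ∈ W, IsFlowLine g m (fun t => φ.symm (ψ (t, φ x))) (-ε) ε := by
    intro x hx
    refine ⟨fun r hr => ((hψ2 _ hx.2).2 r hr).1.2, ?_⟩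
    refine IsMIntegralCurveAt.isMIntegralCurveOn fun t ht => ?_
    refine IsMIntegralCurveOn.isMIntegralCurveAt (s := Ioo (-ε) ε) (fun r hr => ?_)
      (isOpen_Ioo.mem_nhds ht)
    refine HasMFDerivAt.hasMFDerivWithinAt ?_
    obtain ⟨h1, h2⟩ := (hψ2 _ hx.2).2 r hr
    have h3 : HasMFDerivAt 𝓘(ℝ, E) (𝓡 d) φ.symm (ψ (r, φ x))
        (mfderiv 𝓘(ℝ, E) (𝓡 d) φ.symm (ψ (r, φ x))) :=
      ((hfU.contMDiffAt (hU.mem_nhds h1)).mdifferentiableAt (by simp)).hasMFDerivAt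
    have h4 : HasMFDerivAt 𝓘(ℝ, ℝ) 𝓘(ℝ, E) (fun t => ψ (t, φ x)) r
        ((1 : ℝ →L[ℝ] ℝ).smulRight (v (ψ (r, φ x)))) := by
      refine hasMFDerivAt_iff_hasFDerivAt.2 (h2.hasFDerivAt.congr_fderiv ?_)
      exact ContinuousLinearMap.ext_ring rfl
    refine (h3.comp r h4).congr_mfderiv ?_
    refine ContinuousLinearMap.ext_ring ?_
    have h5 := hv2 _ h1
    have h6 : ((1 : ℝ →L[ℝ] ℝ) 1) • v (ψ (r, φ x)) = v (ψ (r, φ x)) := one_smul ℝ _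
    refine ((congrArg (mfderiv 𝓘(ℝ, E) (𝓡 d) φ.symm (ψ (r, φ x))) h6).trans h5).trans ?_
    exact (one_smul ℝ _).symm
  have h0 : (0 : ℝ) ∈ Ioo (-ε) ε := ⟨by simpa using hε, hε⟩
  have hstart : ∀ x ∈ W, φ.symm (ψ (0, φ x)) = x := by
    intro x hx
    rw [(hψ2 _ hx.2).1]
    exact φ.left_inv (by rw [extChartAt_source]; exact hx.1)
  refine ⟨ε, hε, W, hW, ⟨mem_chart_source _ p, hpW'⟩, ?_, ?_⟩
  · rintro ⟨t, x⟩ ⟨ht, hx⟩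
    have := (hline x hx).reaches h0 ht
    simp only [hstart x hx] at this
    exact this
  · have h1 : ContMDiffOn (𝓘(ℝ, ℝ).prod (𝓡 d)) 𝓘(ℝ, ℝ × E) ∞ (fun q : ℝ × M => (q.1, φ q.2))
        (Ioo (-ε) ε ×ˢ W) := by
      refine ContMDiffOn.prodMk_space contMDiffOn_fst ?_
      exact (hφs.mono inter_subset_left).comp contMDiffOn_snd (fun q hq => hq.2)
    have h2 : ContMDiffOn 𝓘(ℝ, ℝ × E) 𝓘(ℝ, E) ∞ ψ (Ioo (-ε) ε ×ˢ W') := hψ.contMDiffOn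
    have h3 := h2.comp h1 (fun q hq => ⟨hq.1, hq.2.2⟩)
    have h4 := hfU.comp h3 (fun q hq => ((hψ2 _ hq.2.2).2 q.1 hq.1).1)
    refine h4.congr ?_
    rintro ⟨t, x⟩ ⟨ht, hx⟩
    have := (hline x hx).flow_eq hm h0 ht
    simp only [hstart x hx] at this
    exact this

/-- The flow is smooth on a neighbourhood of every point of its domain. -/
theorem exists_open_flow {q₀ : ℝ × M} (hq₀ : q₀ ∈ flowDomain g m) :
    ∃ O : Set (ℝ × M), IsOpen O ∧ q₀ ∈ O ∧ O ⊆ flowDomain g m ∧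
      ContMDiffOn (𝓘(ℝ, ℝ).prod (𝓡 d)) (𝓡 d) ∞ (fun q : ℝ × M => flow g m 0 q.1 q.2) O := by
  obtain ⟨τ₀, x₀⟩ := q₀
  obtain ⟨η, a, b, ha, hb, hx, h4, hη⟩ := flow_spec hm (show FlowReaches g m 0 τ₀ x₀ from hq₀)
  let good : ℝ → Prop := fun τ => ∃ O : Set (ℝ × M), IsOpen O ∧ (τ, x₀) ∈ O ∧
    O ⊆ flowDomain g m ∧
      ContMDiffOn (𝓘(ℝ, ℝ).prod (𝓡 d)) (𝓡 d) ∞ (fun q : ℝ × M => flow g m 0 q.1 q.2) O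
  have hflow : ∀ τ ∈ Ioo a b, flow g m 0 τ x₀ = η τ := by
    intro τ hτ
    rw [← hx]
    exact hη.flow_eq hm ha hτ
  have hbase : good 0 := by
    obtain ⟨ε, hε, W, hW, hpW, h1, h2⟩ := exists_flowBox g hm
      (p := x₀) (by rw [← hx]; exact hη.notCrit 0 ha)
    exact ⟨_, isOpen_Ioo.prod hW, ⟨⟨by simpa using hε, hε⟩, hpW⟩, h1, h2⟩
  have hstep : ∀ τs ∈ Ioo a b, ∀ᶠ τ in 𝓝 τs, (good τs ↔ good τ) := by
    intro τs hτs
    obtain ⟨ε, hε, W, hW, hpW, h1, h2⟩ := exists_flowBox g hm (hη.notCrit τs hτs)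
    have hprop : ∀ τ τ', τ ∈ Ioo a b → |τ' - τ| < ε → η τ ∈ W → good τ → good τ' := by
      rintro τ τ' hτ hd hW' ⟨O, hO, hmem, hOD, hOs⟩
      have hc : ContMDiffOn (𝓘(ℝ, ℝ).prod (𝓡 d)) (𝓡 d) ∞ (fun q : ℝ × M => flow g m 0 τ q.2)
          ((fun q : ℝ × M => ((τ, q.2) : ℝ × M)) ⁻¹' O) := by
        have hi : ContMDiff (𝓘(ℝ, ℝ).prod (𝓡 d)) (𝓘(ℝ, ℝ).prod (𝓡 d)) ∞
            (fun q : ℝ × M => ((τ, q.2) : ℝ × M)) := contMDiff_const.prodMk contMDiff_snd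
        exact hOs.comp hi.contMDiffOn (fun q hq => hq)
      have hO' : IsOpen ((fun q : ℝ × M => ((τ, q.2) : ℝ × M)) ⁻¹' O) :=
        hO.preimage (continuous_const.prodMk continuous_snd)
      let O' : Set (ℝ × M) := ((fun q : ℝ × M => ((τ, q.2) : ℝ × M)) ⁻¹' O ∩
        (fun q : ℝ × M => flow g m 0 τ q.2) ⁻¹' W) ∩ {q | |q.1 - τ| < ε}
      have hO'o : IsOpen O' := (hc.continuousOn.isOpen_inter_preimage hO' hW).inter
        (isOpen_lt (by fun_prop) continuous_const)
      have htr : ∀ q ∈ O', FlowReaches g m 0 q.1 q.2 ∧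
          flow g m 0 q.1 q.2 = flow g m 0 (q.1 - τ) (flow g m 0 τ q.2) := by
        rintro q ⟨⟨hq1, hq2⟩, hq3⟩
        have r1 : FlowReaches g m 0 τ q.2 := hOD hq1
        have r2 : FlowReaches g m 0 (q.1 - τ) (flow g m 0 τ q.2) :=
          h1 (show (q.1 - τ, flow g m 0 τ q.2) ∈ Ioo (-ε) ε ×ˢ W from ⟨abs_lt.1 hq3, hq2⟩)
        rw [← flowReaches_iff_zero hm] at r2
        have := r1.trans hm r2
        rwa [flow_eq_zero hm (ϑ := τ)] at this
      refine ⟨O', hO'o, ⟨⟨hmem, ?_⟩, hd⟩, fun q hq => (htr q hq).1, ?_⟩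
      · rw [mem_preimage, hflow τ hτ]
        exact hW'
      · have hi : ContMDiffOn (𝓘(ℝ, ℝ).prod (𝓡 d)) (𝓘(ℝ, ℝ).prod (𝓡 d)) ∞
            (fun q : ℝ × M => ((q.1 - τ, flow g m 0 τ q.2) : ℝ × M)) O' := by
          refine ContMDiffOn.prodMk (contMDiffOn_fst.sub contMDiffOn_const) ?_
          exact hc.mono (fun q hq => hq.1.1)
        refine (h2.comp hi (fun q hq => ⟨abs_lt.1 hq.2, hq.1.2⟩)).congr fun q hq => ?_
        exact (htr q hq).2
    have hcη : ContinuousAt η τs := hη.continuousOn.continuousAt (isOpen_Ioo.mem_nhds hτs)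
    filter_upwards [isOpen_Ioo.mem_nhds hτs, hcη.preimage_mem_nhds (hW.mem_nhds hpW),
      Metric.ball_mem_nhds τs hε] with τ t1 t2 t3
    rw [Metric.mem_ball, Real.dist_eq] at t3
    exact ⟨hprop τs τ hτs t3 hpW, hprop τ τs t1 (by rwa [abs_sub_comm]) t2⟩
  have := isPreconnected_Ioo.induction₂ (s := Ioo a b) (fun s t => (good s ↔ good t))
    (fun t ht => mem_nhdsWithin_of_mem_nhds (hstep t ht)) (fun _ _ _ _ _ _ h1 h2 => h1.trans h2)
    (fun _ _ _ _ h1 => h1.symm) ha hb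
  exact this.1 hbase

theorem isOpen_flowDomain : IsOpen (flowDomain g m) :=
  isOpen_iff_forall_mem_open.2 fun _ hq =>
    let ⟨O, h1, h2, h3, _⟩ := exists_open_flow g hm hq; ⟨O, h3, h1, h2⟩

theorem contMDiffOn_flow :
    ContMDiffOn (𝓘(ℝ, ℝ).prod (𝓡 d)) (𝓡 d) ∞ (fun q : ℝ × M => flow g m 0 q.1 q.2)
      (flowDomain g m) := fun _ hq =>
  let ⟨_, h1, h2, _, h4⟩ := exists_open_flow g hm hq
  (h4.contMDiffAt (h1.mem_nhds h2)).contMDiffWithinAt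

/-- Composition of the flow with a smooth time and a smooth starting point. -/
theorem contMDiffAt_flow_comp {EB HB B : Type*} [NormedAddCommGroup EB] [NormedSpace ℝ EB]
    [TopologicalSpace HB] {IB : ModelWithCorners ℝ EB HB} [TopologicalSpace B] [ChartedSpace HB B]
    {ϑ t : B → ℝ} {x : B → M} {y : B} (hϑ : ContMDiffAt IB 𝓘(ℝ, ℝ) ∞ ϑ y)
    (ht : ContMDiffAt IB 𝓘(ℝ, ℝ) ∞ t y)
    (hx : ContMDiffAt IB (𝓡 d) ∞ x y) (hr : FlowReaches g m (ϑ y) (t y) (x y)) :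
    ContMDiffAt IB (𝓡 d) ∞ (fun z => flow g m (ϑ z) (t z) (x z)) y := by
  have h0 : (t y - ϑ y, x y) ∈ flowDomain g m := (flowReaches_iff_zero hm).1 hr
  have h1 : ContMDiffAt (𝓘(ℝ, ℝ).prod (𝓡 d)) (𝓡 d) ∞ (fun q : ℝ × M => flow g m 0 q.1 q.2)
      (t y - ϑ y, x y) :=
    (contMDiffOn_flow g hm).contMDiffAt ((isOpen_flowDomain g hm).mem_nhds h0)
  have h2 : ContMDiffAt IB (𝓘(ℝ, ℝ).prod (𝓡 d)) ∞ (fun z => ((t z - ϑ z, x z) : ℝ × M)) y :=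
    (ht.sub hϑ).prodMk hx
  refine (h1.comp y h2).congr_of_eventuallyEq (Eventually.of_forall fun z => ?_)
  exact flow_eq_zero hm

/-- The condition that the flow is defined is open. -/
theorem eventually_flowReaches {B : Type*} [TopologicalSpace B]
    {ϑ t : B → ℝ} {x : B → M} {y : B} (hϑ : ContinuousAt ϑ y) (ht : ContinuousAt t y)
    (hx : ContinuousAt x y) (hr : FlowReaches g m (ϑ y) (t y) (x y)) :
    ∀ᶠ z in 𝓝 y, FlowReaches g m (ϑ z) (t z) (x z) := by
  have h0 : (t y - ϑ y, x y) ∈ flowDomain g m := (flowReaches_iff_zero hm).1 hr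
  have h2 : ContinuousAt (fun z => ((t z - ϑ z, x z) : ℝ × M)) y := (ht.sub hϑ).prodMk hx
  filter_upwards [h2.preimage_mem_nhds ((isOpen_flowDomain g hm).mem_nhds h0)] with z hz
  exact (flowReaches_iff_zero hm).2 hz

/-- In a compact slab without critical points, the flow runs from every point to every level. -/
theorem flowReaches_of_regular {c e : ℝ} (hK : IsCompact (m ⁻¹' Icc c e))
    (hreg : ∀ x, m x ∈ Icc c e → ¬ IsCrit d m x) {x : M} (hx : m x ∈ Icc c e) {t : ℝ}
    (ht : t ∈ Icc c e) : FlowReaches g m (m x) t x := by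
  -- a uniform existence time on the slab
  obtain ⟨ε, hε, hu⟩ : ∃ ε > 0, ∀ y ∈ m ⁻¹' Icc c e, ∀ τ ∈ Ioo (-ε) ε,
      FlowReaches g m 0 τ y := by
    refine hK.induction_on (p := fun A => ∃ ε > 0, ∀ y ∈ A, ∀ τ ∈ Ioo (-ε) ε,
      FlowReaches g m 0 τ y) ⟨1, one_pos, by simp⟩ ?_ ?_ ?_
    · rintro A A' hA ⟨ε, hε, h⟩
      exact ⟨ε, hε, fun y hy => h y (hA hy)⟩
    · rintro A A' ⟨ε, hε, h⟩ ⟨ε', hε', h'⟩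
      refine ⟨min ε ε', lt_min hε hε', fun y hy τ hτ => ?_⟩
      rcases hy with hy | hy
      · exact h y hy τ ⟨by linarith [hτ.1, min_le_left ε ε'], hτ.2.trans_le (min_le_left _ _)⟩
      · exact h' y hy τ ⟨by linarith [hτ.1, min_le_right ε ε'], hτ.2.trans_le (min_le_right _ _)⟩
    · intro y hy
      obtain ⟨ε, hε, W, hW, hyW, h1, -⟩ := exists_flowBox g hm (hreg y hy)
      exact ⟨W, mem_nhdsWithin_of_mem_nhds (hW.mem_nhds hyW), ε, hε,
        fun z hz τ hτ => h1 (show (τ, z) ∈ Ioo (-ε) ε ×ˢ W from ⟨hτ, hz⟩)⟩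
  have key : ∀ n : ℕ, ∀ τ : ℝ, m x + τ ∈ Icc c e → |τ| ≤ n * (ε / 2) →
      FlowReaches g m 0 τ x := by
    intro n
    induction n with
    | zero =>
      intro τ _ h
      have : τ = 0 := by simpa using h
      rw [this]
      exact hu x hx 0 ⟨by simpa using hε, hε⟩
    | succ n ih =>
      intro τ hτ h
      set τ' : ℝ := τ * (n / (n + 1)) with hτ'
      have hn : (0 : ℝ) < n + 1 := by positivity
      have hfr0 : (0 : ℝ) ≤ n / (n + 1) := by positivity
      have hfr1 : (n : ℝ) / (n + 1) ≤ 1 := by rw [div_le_one hn]; linarith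
      have h1 : m x + τ' ∈ Icc c e := by
        have hconv := convex_Icc c e hx hτ (sub_nonneg.2 hfr1) hfr0 (by ring)
        simp only [smul_eq_mul] at hconv
        have : (1 - (n : ℝ) / (n + 1)) * m x + n / (n + 1) * (m x + τ) = m x + τ' := by
          rw [hτ']; ring
        rwa [this] at hconv
      have h2 : |τ'| ≤ n * (ε / 2) := by
        rw [hτ', abs_mul, abs_of_nonneg hfr0, mul_div_assoc', div_le_iff₀ hn]
        push_cast at h
        nlinarith [abs_nonneg τ, (Nat.cast_nonneg n : (0 : ℝ) ≤ n)]
      have h3 : |τ - τ'| < ε := by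
        have e1 : τ - τ' = τ * (1 / (n + 1)) := by
          rw [hτ']; field_simp; ring
        rw [e1, abs_mul, abs_of_nonneg (by positivity : (0 : ℝ) ≤ 1 / (n + 1)), mul_one_div,
          div_lt_iff₀ hn]
        push_cast at h
        nlinarith
      have r1 := ih τ' h1 h2
      have r2 := hu (flow g m 0 τ' x) (by
        rw [mem_preimage, r1.m_flow hm, sub_zero]; exact h1) (τ - τ') (abs_lt.1 h3)
      rw [← flowReaches_iff_zero hm] at r2
      exact (r1.trans hm r2).1
  rw [flowReaches_iff_zero hm]
  obtain ⟨n, hn⟩ := exists_nat_ge (|t - m x| / (ε / 2))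
  refine key n _ (by simpa using ht) ?_
  rwa [div_le_iff₀ (by positivity)] at hn

end FlowSmooth

/-! ### The Jacobian of the flow -/

section GramSmooth

variable {d : ℕ} {M : Type u} [TopologicalSpace M] [ChartedSpace (EuclideanSpace ℝ (Fin d)) M]
  [IsManifold (𝓡 d) ∞ M] (g : Metric d M) {F : Type*} [NormedAddCommGroup F] [NormedSpace ℝ F]

theorem contDiffOn_gram_det {U : Set F} (hU : IsOpen U) {f : F → M}
    (hf : ContMDiffOn 𝓘(ℝ, F) (𝓡 d) ∞ f U) {ι : Type*} [Fintype ι] [DecidableEq ι] (e : ι → F) :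
    ContDiffOn ℝ ∞ (fun u => (gram (fun v w => g.inner (f u) v w)
      fun i => mfderiv 𝓘(ℝ, F) (𝓡 d) f u (e i)).det) U := by
  simp only [Matrix.det_apply, gram, Matrix.of_apply]
  refine ContDiffOn.sum fun σ _ => ContDiffOn.const_smul _ ?_
  exact contDiffOn_prod fun i _ => contDiffOn_metric_mfderiv g hU hf _ _

end GramSmooth

section Jacobian

variable {d : ℕ} {M : Type u} [TopologicalSpace M] [ChartedSpace (EuclideanSpace ℝ (Fin d)) M]
  [IsManifold (𝓡 d) ∞ M] (g : Metric d M) (m : M → ℝ)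

/-- The differential at `y` of the flow map `x ↦ F_{0,τ}(x)` of `M`, regarded as an endomorphism of
the model space. -/
def flowDiff (τ : ℝ) (y : M) : EuclideanSpace ℝ (Fin d) →L[ℝ] EuclideanSpace ℝ (Fin d) :=
  mfderiv (𝓡 d) (𝓡 d) (fun x => flow g m 0 τ x) y

/-- The metric at `x`, regarded as a form on the model space. -/
def form (x : M) (v w : EuclideanSpace ℝ (Fin d)) : ℝ :=
  (g.inner x : EuclideanSpace ℝ (Fin d) →L[ℝ] EuclideanSpace ℝ (Fin d) →L[ℝ] ℝ) v w

/-- The Jacobian of the flow map `y ↦ F_{0,τ}(y)` of `M` with respect to the metric. -/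
def flowJac (τ : ℝ) (y : M) : ℝ :=
  absDet (form g y) (form g (flow g m 0 τ y)) (flowDiff g m τ y).toLinearMap

theorem isInnerForm_form (x : M) : IsInnerForm (form g x) :=
  isInnerForm_metric g x

variable {m} [T2Space M] (hm : ContMDiff (𝓡 d) 𝓘(ℝ, ℝ) ∞ m) {ϑ s t τ : ℝ} {x y : M}
include hm

theorem mdifferentiableAt_flow (h : FlowReaches g m 0 τ y) :
    MDifferentiableAt (𝓡 d) (𝓡 d) (fun x => flow g m 0 τ x) y :=
  (contMDiffAt_flow_comp g hm contMDiffAt_const contMDiffAt_const contMDiffAt_id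
    h).mdifferentiableAt (by simp)

/-- The chain rule for the flow. -/
theorem mfderiv_flow_add (h : FlowReaches g m 0 s y)
    (h' : FlowReaches g m 0 t (flow g m 0 s y)) :
    flowDiff g m (s + t) y = (flowDiff g m t (flow g m 0 s y)).comp (flowDiff g m s y) := by
  have h1 := (mdifferentiableAt_flow g hm h).hasMFDerivAt
  have h2 := (mdifferentiableAt_flow g hm h').hasMFDerivAt
  have h3 := h2.comp y h1
  have hev : (fun x => flow g m 0 (s + t) x) =ᶠ[𝓝 y]
      (fun x => flow g m 0 t x) ∘ fun x => flow g m 0 s x := by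
    have e1 := eventually_flowReaches g hm (ϑ := fun _ => (0 : ℝ)) (t := fun _ => s) (x := id)
      continuousAt_const continuousAt_const continuousAt_id h
    have e2 := eventually_flowReaches g hm (ϑ := fun _ => (0 : ℝ)) (t := fun _ => t)
      (x := fun x => flow g m 0 s x) continuousAt_const continuousAt_const h1.continuousAt h'
    filter_upwards [e1, e2] with z hz1 hz2
    have h4 : FlowReaches g m s (s + t) (flow g m 0 s z) := by
      rw [flowReaches_iff_zero hm, add_sub_cancel_left]; exact hz2
    have h5 := (FlowReaches.trans (x := z) hm hz1 h4).2
    rw [h5, flow_eq_zero hm, add_sub_cancel_left]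
    rfl
  exact (h3.congr_of_eventuallyEq hev).mfderiv

theorem mfderiv_flow_zero (hy : ¬ IsCrit d m y) :
    flowDiff g m 0 y = ContinuousLinearMap.id ℝ (EuclideanSpace ℝ (Fin d)) := by
  obtain ⟨ε, hε, W, hW, hyW, h1, -⟩ := exists_flowBox g hm hy
  have hev : (fun x => flow g m 0 0 x) =ᶠ[𝓝 y] id := by
    filter_upwards [hW.mem_nhds hyW] with z hz
    have : FlowReaches g m 0 0 z := h1 (show (0, z) ∈ _ from ⟨⟨by simpa using hε, hε⟩, hz⟩)
    exact (this.self hm).2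
  exact ((hasMFDerivAt_id y).congr_of_eventuallyEq hev).mfderiv

theorem flow_zero_of_notCrit (hy : ¬ IsCrit d m y) :
    FlowReaches g m 0 0 y ∧ flow g m 0 0 y = y := by
  obtain ⟨ε, hε, W, hW, hyW, h1, -⟩ := exists_flowBox g hm hy
  exact FlowReaches.self hm
    (h1 (show ((0 : ℝ), y) ∈ _ from ⟨⟨by simpa using hε, hε⟩, hyW⟩) : FlowReaches g m 0 0 y)

/-- The differential of a flow map is invertible. -/
theorem exists_equiv_mfderiv_flow (h : FlowReaches g m 0 τ y) :
    ∃ e : EuclideanSpace ℝ (Fin d) ≃ₗ[ℝ] EuclideanSpace ℝ (Fin d),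
      (e : EuclideanSpace ℝ (Fin d) →ₗ[ℝ] EuclideanSpace ℝ (Fin d)) =
      (flowDiff g m τ y).toLinearMap := by
  have hs := h.symm hm
  have hs1 : FlowReaches g m 0 (-τ) (flow g m 0 τ y) := by
    have := hs.1
    rwa [flowReaches_iff_zero hm, zero_sub] at this
  have h1 := mfderiv_flow_add g hm h hs1
  rw [add_neg_cancel, mfderiv_flow_zero g hm (h.notCrit hm).1] at h1
  have hinj : Function.Injective (flowDiff g m τ y).toLinearMap := by
    intro v w hvw
    have h2 := DFunLike.congr_fun h1 v
    have h3 := DFunLike.congr_fun h1 w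
    exact h2.trans ((congrArg (flowDiff g m (-τ) (flow g m 0 τ y)) hvw).trans h3.symm)
  exact ⟨LinearEquiv.ofInjectiveEndo _ hinj, by ext; rfl⟩

theorem flowJac_pos (h : FlowReaches g m 0 τ y) : 0 < flowJac g m τ y := by
  obtain ⟨e, he⟩ := exists_equiv_mfderiv_flow g hm h
  rw [flowJac, ← he]
  exact absDet_pos (isInnerForm_form g _) (isInnerForm_form g _) e.injective

theorem flowJac_zero (hy : ¬ IsCrit d m y) : flowJac g m 0 y = 1 := by
  rw [flowJac, mfderiv_flow_zero g hm hy, (flow_zero_of_notCrit g hm hy).2]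
  exact absDet_id (isInnerForm_form g _)

/-- The cocycle property of the Jacobian. -/
theorem flowJac_add (h : FlowReaches g m 0 s y) (h' : FlowReaches g m 0 t (flow g m 0 s y)) :
    flowJac g m (s + t) y = flowJac g m t (flow g m 0 s y) * flowJac g m s y := by
  obtain ⟨e, he⟩ := exists_equiv_mfderiv_flow g hm h
  have h4 : FlowReaches g m s (s + t) (flow g m 0 s y) := by
    rw [flowReaches_iff_zero hm, add_sub_cancel_left]; exact h'
  have h5 := (h.trans hm h4).2
  rw [flow_eq_zero hm (ϑ := s), add_sub_cancel_left] at h5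
  rw [flowJac, mfderiv_flow_add g hm h h', h5, flowJac, flowJac,
    ContinuousLinearMap.toLinearMap_comp, ← he]
  exact absDet_comp (isInnerForm_form g _) (isInnerForm_form g _) (isInnerForm_form g _) e _

/-- The cocycle property for times `ϑ, t, s` on one flow line. -/
theorem flowJac_flow (h : FlowReaches g m ϑ t x) (h' : FlowReaches g m ϑ s x) :
    flowJac g m (s - ϑ) x = flowJac g m (s - t) (flow g m ϑ t x) * flowJac g m (t - ϑ) x := by
  have h1 := (h.between hm h').1
  rw [flowReaches_iff_zero hm, flow_eq_zero hm] at h1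
  have h2 := flowJac_add g hm ((flowReaches_iff_zero hm).1 h) h1
  rw [flow_eq_zero hm (ϑ := ϑ), ← h2]
  congr 1; ring

/-- The Jacobian of the flow is smooth. -/
theorem contMDiffOn_flowJac : ContMDiffOn (𝓘(ℝ, ℝ).prod (𝓡 d)) 𝓘(ℝ, ℝ) ∞
    (fun q : ℝ × M => flowJac g m q.1 q.2) (flowDomain g m) := by
  rintro ⟨τ₀, y₀⟩ hq₀
  let E := EuclideanSpace ℝ (Fin d)
  let φ := extChartAt (𝓡 d) y₀
  have hf : ContMDiffOn 𝓘(ℝ, E) (𝓡 d) ∞ φ.symm φ.target := contMDiffOn_extChartAt_symm y₀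
  have hφs : ContMDiffOn (𝓡 d) 𝓘(ℝ, E) ∞ φ (chartAt E y₀).source := contMDiffOn_extChartAt
  have hT : IsOpen φ.target := isOpen_extChartAt_target y₀
  let b : Module.Basis (Fin d) ℝ E := (EuclideanSpace.basisFun (Fin d) ℝ).toBasis
  -- the flow in coordinates
  let ι : ℝ × E → ℝ × M := fun q => (q.1, φ.symm q.2)
  have hι : ContMDiffOn 𝓘(ℝ, ℝ × E) (𝓘(ℝ, ℝ).prod (𝓡 d)) ∞ ι (Prod.snd ⁻¹' φ.target) := by
    refine ContMDiffOn.prodMk contDiff_fst.contMDiff.contMDiffOn ?_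
    exact hf.comp contDiff_snd.contMDiff.contMDiffOn (fun q hq => hq)
  let U : Set (ℝ × E) := Prod.snd ⁻¹' φ.target ∩ ι ⁻¹' flowDomain g m
  have hU : IsOpen U := hι.continuousOn.isOpen_inter_preimage (hT.preimage continuous_snd)
    (isOpen_flowDomain g hm)
  have hFs : ContMDiffOn 𝓘(ℝ, ℝ × E) (𝓡 d) ∞ (fun q => flow g m 0 (ι q).1 (ι q).2) U :=
    (contMDiffOn_flow g hm).comp (hι.mono inter_subset_left) (fun q hq => hq.2)
  have hnum := contDiffOn_gram_det g hU hFs (fun i : Fin d => ((0, b i) : ℝ × E))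
  have hden := contDiffOn_gram_det g hT hf (fun i : Fin d => b i)
  have hbasis : ∀ u ∈ φ.target, ∃ b' : Module.Basis (Fin d) ℝ E,
      ∀ i, b' i = mfderiv 𝓘(ℝ, E) (𝓡 d) φ.symm u (b i) := by
    intro u hu
    exact ⟨b.map (LinearEquiv.ofBijective (mfderiv 𝓘(ℝ, E) (𝓡 d) φ.symm u : E →L[ℝ] E).toLinearMap
      (bijective_mfderiv_extChartAt_symm y₀ hu)), fun i => rfl⟩
  have hdpos : ∀ u ∈ φ.target, 0 < (gram (fun v w => g.inner (φ.symm u) v w)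
      fun i => mfderiv 𝓘(ℝ, E) (𝓡 d) φ.symm u (b i)).det := by
    intro u hu
    obtain ⟨b', hb'⟩ := hbasis u hu
    have h1 := gram_det_pos (isInnerForm_form g (φ.symm u)) b'.linearIndependent
    have h2 : (b' : Fin d → E) = fun i => mfderiv 𝓘(ℝ, E) (𝓡 d) φ.symm u (b i) := funext hb'
    rw [h2] at h1
    exact h1
  have hJ : ∀ q ∈ U, flowJac g m (ι q).1 (ι q).2 = Real.sqrt
      ((gram (fun v w => g.inner (flow g m 0 (ι q).1 (ι q).2) v w) fun i =>
        mfderiv 𝓘(ℝ, ℝ × E) (𝓡 d) (fun q => flow g m 0 (ι q).1 (ι q).2) q ((0, b i) : ℝ × E)).det /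
      (gram (fun v w => g.inner (φ.symm q.2) v w)
        fun i => mfderiv 𝓘(ℝ, E) (𝓡 d) φ.symm q.2 (b i)).det) := by
    rintro ⟨τ, u⟩ ⟨hu, hr⟩
    obtain ⟨b', hb'⟩ := hbasis u hu
    rw [flowJac, absDet_eq (isInnerForm_form g _) (isInnerForm_form g _) _ b']
    have hd : ∀ v : E, mfderiv 𝓘(ℝ, ℝ × E) (𝓡 d) (fun q => flow g m 0 (ι q).1 (ι q).2) (τ, u)
        ((0, v) : ℝ × E) = mfderiv (𝓡 d) (𝓡 d) (fun x => flow g m 0 τ x) (φ.symm u)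
          (mfderiv 𝓘(ℝ, E) (𝓡 d) φ.symm u v) := by
      intro v
      have k1 := ((hFs.contMDiffAt (hU.mem_nhds ⟨hu, hr⟩)).mdifferentiableAt
        (by simp)).hasMFDerivAt
      have k2 : HasMFDerivAt 𝓘(ℝ, E) 𝓘(ℝ, ℝ × E) (fun v : E => ((τ, v) : ℝ × E)) u
          (ContinuousLinearMap.inr ℝ ℝ E) :=
        hasMFDerivAt_iff_hasFDerivAt.2 (hasFDerivAt_prodMk_right τ u)
      have k3 := k1.comp u k2
      have k4 := (mdifferentiableAt_flow g hm hr).hasMFDerivAt.comp u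
        ((hf.contMDiffAt (hT.mem_nhds hu)).mdifferentiableAt (by simp)).hasMFDerivAt
      exact DFunLike.congr_fun (hasMFDerivAt_unique k3 k4) v
    have e1 : (b' : Fin d → E) = fun i => mfderiv 𝓘(ℝ, E) (𝓡 d) φ.symm u (b i) := funext hb'
    simp only [hd]
    rw [e1]
    rfl
  have hmem : (τ₀, φ y₀) ∈ U := by
    refine ⟨mem_extChartAt_target y₀, ?_⟩
    change (τ₀, φ.symm (φ y₀)) ∈ flowDomain g m
    rw [extChartAt_to_inv]
    exact hq₀
  have hsm : ContDiffAt ℝ ∞ (fun q => flowJac g m (ι q).1 (ι q).2) (τ₀, φ y₀) := by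
    have h1 := hnum.contDiffAt (hU.mem_nhds hmem)
    have h2 : ContDiffAt ℝ ∞ (fun q : ℝ × E => (gram (fun v w => g.inner (φ.symm q.2) v w)
        fun i => mfderiv 𝓘(ℝ, E) (𝓡 d) φ.symm q.2 (b i)).det) (τ₀, φ y₀) :=
      (hden.contDiffAt (hT.mem_nhds hmem.1)).comp (τ₀, φ y₀) contDiffAt_snd
    have hpos := flowJac_pos g hm (show FlowReaches g m 0 (ι (τ₀, φ y₀)).1 (ι (τ₀, φ y₀)).2
      from hmem.2)
    rw [hJ _ hmem] at hpos
    have h3 := ((h1.div h2 (hdpos _ hmem.1).ne')).sqrt (Real.sqrt_pos.1 hpos).ne'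
    refine h3.congr_of_eventuallyEq ?_
    filter_upwards [hU.mem_nhds hmem] with q hq
    exact hJ q hq
  have hκ : ContMDiffAt (𝓘(ℝ, ℝ).prod (𝓡 d)) 𝓘(ℝ, ℝ × E) ∞
      (fun q : ℝ × M => ((q.1, φ q.2) : ℝ × E)) (τ₀, y₀) := by
    refine ContMDiffAt.prodMk_space contMDiffAt_fst ?_
    exact ContMDiffAt.comp (τ₀, y₀) (hφs.contMDiffAt ((chartAt E y₀).open_source.mem_nhds
      (mem_chart_source _ y₀))) contMDiffAt_snd
  refine ((hsm.contMDiffAt.comp (τ₀, y₀) hκ).congr_of_eventuallyEq ?_).contMDiffWithinAt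
  have hs : ∀ᶠ q : ℝ × M in 𝓝 (τ₀, y₀), q.2 ∈ (chartAt E y₀).source :=
    continuousAt_snd.preimage_mem_nhds ((chartAt E y₀).open_source.mem_nhds (mem_chart_source _ y₀))
  filter_upwards [hs] with q hq
  have : φ.symm (φ q.2) = q.2 := φ.left_inv (by rw [extChartAt_source]; exact hq)
  simp only [Function.comp, ι, this]

theorem contMDiffAt_flowJac_comp {EB HB B : Type*} [NormedAddCommGroup EB] [NormedSpace ℝ EB]
    [TopologicalSpace HB] {IB : ModelWithCorners ℝ EB HB} [TopologicalSpace B] [ChartedSpace HB B]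
    {τ : B → ℝ} {x : B → M} {y : B} (hτ : ContMDiffAt IB 𝓘(ℝ, ℝ) ∞ τ y)
    (hx : ContMDiffAt IB (𝓡 d) ∞ x y) (hr : FlowReaches g m 0 (τ y) (x y)) :
    ContMDiffAt IB 𝓘(ℝ, ℝ) ∞ (fun z => flowJac g m (τ z) (x z)) y := by
  have h1 := (contMDiffOn_flowJac g hm).contMDiffAt ((isOpen_flowDomain g hm).mem_nhds
    (show (τ y, x y) ∈ flowDomain g m from hr))
  exact ContMDiffAt.comp (g := fun q : ℝ × M => flowJac g m q.1 q.2) (f := fun z => (τ z, x z)) y h1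
    (hτ.prodMk hx)

/-- The differential of a flow map preserves the renormalized gradient. -/
theorem mfderiv_flow_normGrad (h : FlowReaches g m ϑ t x) :
    flowDiff g m (t - ϑ) x (normGrad g m x) =
      normGrad g m (flow g m ϑ t x) := by
  obtain ⟨η, a, b, h1, h2, rfl, h4, h5⟩ := flow_spec hm h
  rw [← h4]
  have k1 : HasMFDerivAt 𝓘(ℝ, ℝ) (𝓡 d) η ϑ _ :=
    (h5.curve.isMIntegralCurveAt (isOpen_Ioo.mem_nhds h1)).hasMFDerivAt
  have k2 := (mdifferentiableAt_flow g hm ((flowReaches_iff_zero hm).1 h)).hasMFDerivAt.comp ϑ k1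
  have h6 := h5.shift (t - ϑ)
  have i1 : ϑ ∈ Ioo (a - (t - ϑ)) (b - (t - ϑ)) :=
    ⟨by linarith [h2.1], by linarith [h2.2]⟩
  have k3 : HasMFDerivAt 𝓘(ℝ, ℝ) (𝓡 d) (fun s => η (s + (t - ϑ))) ϑ _ :=
    (h6.curve.isMIntegralCurveAt (isOpen_Ioo.mem_nhds i1)).hasMFDerivAt
  have hev : (fun x => flow g m 0 (t - ϑ) x) ∘ η =ᶠ[𝓝 ϑ] fun s => η (s + (t - ϑ)) := by
    filter_upwards [isOpen_Ioo.mem_nhds h1, isOpen_Ioo.mem_nhds i1] with s hs hs'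
    have hs2 : s + (t - ϑ) ∈ Ioo a b := ⟨by linarith [hs'.1], by linarith [hs'.2]⟩
    have := h5.flow_eq hm hs hs2
    rw [flow_eq_zero hm, add_sub_cancel_left] at this
    exact this
  have k4 := DFunLike.congr_fun (hasMFDerivAt_unique k2 (k3.congr_of_eventuallyEq hev)) (1 : ℝ)
  have e1 : ((1 : ℝ →L[ℝ] ℝ) 1) • normGrad g m (η ϑ) = normGrad g m (η ϑ) := one_smul ℝ _
  have e2 : ((1 : ℝ →L[ℝ] ℝ) 1) • normGrad g m (η (ϑ + (t - ϑ))) =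
    normGrad g m (η (ϑ + (t - ϑ))) := one_smul ℝ _
  refine (congrArg (flowDiff g m (t - ϑ) (η ϑ)) e1).symm.trans
    (k4.trans (e2.trans ?_))
  rw [add_sub_cancel]

theorem mfderiv_flow_prod (h : FlowReaches g m ϑ t x) (r : ℝ) (v : EuclideanSpace ℝ (Fin d)) :
    (mfderiv (𝓘(ℝ, ℝ).prod (𝓡 d)) (𝓡 d) (fun q : ℝ × M => flow g m ϑ q.1 q.2) (t, x)
      ((r, v) : ℝ × EuclideanSpace ℝ (Fin d)) : EuclideanSpace ℝ (Fin d)) =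
    flowDiff g m (t - ϑ) x (r • (show EuclideanSpace ℝ (Fin d) from normGrad g m x) + v) := by
  let E := EuclideanSpace ℝ (Fin d)
  have k0 : HasMFDerivAt (𝓘(ℝ, ℝ).prod (𝓡 d)) (𝓡 d) (fun q : ℝ × M => flow g m ϑ q.1 q.2)
      (t, x) _ :=
    ((contMDiffAt_flow_comp g hm (ϑ := fun _ : ℝ × M => ϑ) contMDiffAt_const contMDiffAt_fst
      contMDiffAt_snd h).mdifferentiableAt (by simp)).hasMFDerivAt
  let D : ℝ × E →L[ℝ] E :=
    mfderiv (𝓘(ℝ, ℝ).prod (𝓡 d)) (𝓡 d) (fun q : ℝ × M => flow g m ϑ q.1 q.2) (t, x)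
  let C : E →L[ℝ] E := flowDiff g m (t - ϑ) x
  let X : E := normGrad g m x
  change D (r, v) = C (r • X + v)
  have hC : ∀ v, D (0, v) = C v := by
    intro v
    have k1 := k0.comp x ((hasMFDerivAt_const (I := 𝓡 d) (I' := 𝓘(ℝ, ℝ)) t x).prodMk
      (hasMFDerivAt_id x))
    have k2 := (mdifferentiableAt_flow g hm ((flowReaches_iff_zero hm).1 h)).hasMFDerivAt
    have hev : (fun x => flow g m 0 (t - ϑ) x) =
        (fun q : ℝ × M => flow g m ϑ q.1 q.2) ∘ (fun y : M => (t, id y)) := by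
      ext y
      exact (flow_eq_zero hm).symm
    have k3 := k1.congr_of_eventuallyEq (Filter.EventuallyEq.of_eq hev)
    exact DFunLike.congr_fun (hasMFDerivAt_unique k3 k2) v
  have hX : D (1, 0) = C X := by
    refine Eq.trans ?_ (mfderiv_flow_normGrad g hm h).symm
    obtain ⟨η, a, b, h1, h2, rfl, h4, h5⟩ := flow_spec hm h
    rw [← h4]
    have k1 := k0.comp t ((hasMFDerivAt_id (I := 𝓘(ℝ, ℝ)) t).prodMk
      (hasMFDerivAt_const (I := 𝓘(ℝ, ℝ)) (I' := 𝓡 d) (η ϑ) t))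
    have k2 : HasMFDerivAt 𝓘(ℝ, ℝ) (𝓡 d) η t _ :=
      (h5.curve.isMIntegralCurveAt (isOpen_Ioo.mem_nhds h2)).hasMFDerivAt
    have hev : (fun q : ℝ × M => flow g m ϑ q.1 q.2) ∘ (fun s : ℝ => (id s, η ϑ)) =ᶠ[𝓝 t] η := by
      filter_upwards [isOpen_Ioo.mem_nhds h2] with s hs
      exact h5.flow_eq hm h1 hs
    have k3 := DFunLike.congr_fun (hasMFDerivAt_unique k1 (k2.congr_of_eventuallyEq hev)) (1 : ℝ)
    exact k3.trans (one_smul ℝ _)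
  have : ((r, v) : ℝ × E) = r • (1, 0) + (0, v) := by simp
  rw [this, map_add, map_smul, hC, hX, map_add, map_smul]

end Jacobian

section Weight

/-- The Gram determinant of a family augmented by a vector orthogonal to it. -/
theorem gram_cons_orthogonal {V : Type*} [AddCommGroup V] [Module ℝ V] {β : V → V → ℝ}
    {k : ℕ} (x : V) (e : Fin k → V) (h : ∀ i, β x (e i) = 0) :
    (gram β (Fin.cons x e : Fin (k + 1) → V)).det = β x x * (gram β e).det := by
  rw [Matrix.det_succ_row_zero, Fin.sum_univ_succ]
  simp only [gram, Matrix.of_apply, Fin.cons_zero, Fin.cons_succ, h]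
  simp only [Fin.val_zero, pow_zero, one_mul, mul_zero, add_zero, zero_mul,
    Finset.sum_const_zero]
  congr 1

variable {d : ℕ} {M : Type u} [TopologicalSpace M] [ChartedSpace (EuclideanSpace ℝ (Fin d)) M]
  [IsManifold (𝓡 d) ∞ M] (g : Metric d M) {m : M → ℝ} {x : M}

set_option linter.unusedSectionVars false

/-- The renormalized gradient as a vector of the model space. -/
def normGradE (m : M → ℝ) (x : M) : EuclideanSpace ℝ (Fin d) := normGrad g m x

theorem form_normGrad (hx : ¬ IsCrit d m x) : form g x (normGradE g m x) (normGradE g m x) =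
    (g.inner x (grad g m x) (grad g m x))⁻¹ := by
  change g.inner x (normGrad g m x) (normGrad g m x) = _
  have := inner_grad_pos g hx
  rw [normGrad]
  simp only [map_smul, smul_apply, smul_eq_mul]
  field_simp

theorem form_normGrad_pos (hx : ¬ IsCrit d m x) :
    0 < form g x (normGradE g m x) (normGradE g m x) := by
  rw [form_normGrad g hx]
  exact inv_pos.2 (inner_grad_pos g hx)

theorem form_normGrad_left {v : EuclideanSpace ℝ (Fin d)}
    (hv : (mfderiv (𝓡 d) 𝓘(ℝ, ℝ) m x : EuclideanSpace ℝ (Fin d) →L[ℝ] ℝ) v = 0) :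
    form g x (normGradE g m x) v = 0 := by
  change g.inner x (normGrad g m x) (v : TangentSpace (𝓡 d) x) = 0
  have h : g.inner x (grad g m x) (v : TangentSpace (𝓡 d) x) = 0 :=
    (inner_grad_apply g m x v).trans hv
  rw [normGrad, map_smul]
  exact (congrArg ((g.inner x (grad g m x) (grad g m x))⁻¹ • ·) h).trans (smul_zero _)

/-- The map `(r, v) ↦ r X + v` from `ℝ × T_x J` to `T_x M`, `J` being the level set of `x`. -/
def flowFrame (m : M → ℝ) (x : M) :
    (ℝ × (mfderiv (𝓡 d) 𝓘(ℝ, ℝ) m x).ker) →ₗ[ℝ] EuclideanSpace ℝ (Fin d) :=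
  LinearMap.coprod (LinearMap.toSpanSingleton ℝ _ (normGradE g m x))
    (mfderiv (𝓡 d) 𝓘(ℝ, ℝ) m x).ker.subtype

theorem flowFrame_apply (r : ℝ) (v : (mfderiv (𝓡 d) 𝓘(ℝ, ℝ) m x).ker) :
    flowFrame g m x (r, v) = r • normGradE g m x + (show EuclideanSpace ℝ (Fin d) from v.1) := rfl

theorem bijective_flowFrame (hx : ¬ IsCrit d m x) : Function.Bijective (flowFrame g m x) := by
  let D : EuclideanSpace ℝ (Fin d) →L[ℝ] ℝ := mfderiv (𝓡 d) 𝓘(ℝ, ℝ) m x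
  have h1 : D (normGradE g m x) = 1 := mfderiv_normGrad g hx
  constructor
  · rw [← LinearMap.ker_eq_bot, LinearMap.ker_eq_bot']
    rintro ⟨r, v⟩ h
    rw [flowFrame_apply] at h
    have hv : D v.1 = 0 := v.2
    have h2 : D (r • normGradE g m x + (show EuclideanSpace ℝ (Fin d) from v.1)) = 0 := by
      refine (congrArg D h).trans (map_zero D)
    rw [map_add, map_smul, h1, hv] at h2
    have hr : r = 0 := by simpa using h2
    subst hr
    rw [zero_smul, zero_add] at h
    exact Prod.ext rfl (Subtype.ext h)
  · intro w
    refine ⟨(D w, ⟨w - D w • normGradE g m x, ?_⟩), ?_⟩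
    · change D (w - D w • normGradE g m x) = 0
      rw [map_sub, map_smul, h1]; simp
    · rw [flowFrame_apply]
      exact add_sub_cancel _ w

theorem absDet_flowFrame :
    absDet (fun v w : ℝ × (mfderiv (𝓡 d) 𝓘(ℝ, ℝ) m x).ker =>
      v.1 * w.1 + g.inner x (v.2 : TangentSpace (𝓡 d) x) w.2) (form g x) (flowFrame g m x) =
      Real.sqrt (form g x (normGradE g m x) (normGradE g m x)) := by
  let b := Module.finBasis ℝ (mfderiv (𝓡 d) 𝓘(ℝ, ℝ) m x).ker
  set k := Module.finrank ℝ (mfderiv (𝓡 d) 𝓘(ℝ, ℝ) m x).ker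
  let σ : Unit ⊕ Fin k ≃ Fin (k + 1) := (Equiv.sumComm _ _).trans
    ((Equiv.optionEquivSumPUnit _).symm.trans (finSuccEquiv k).symm)
  let b' := ((Module.Basis.singleton Unit ℝ).prod b).reindex σ
  have h0 : (b' : Fin (k + 1) → _) = Fin.cons (1, 0) fun i => (0, b i) := by
    ext1 i
    refine Fin.cases ?_ (fun i => ?_) i
    · simp [b', σ, Module.Basis.prod_apply]
    · simp [b', σ, Module.Basis.prod_apply]
  have h1 : (fun i => flowFrame g m x (b' i)) = Fin.cons (normGradE g m x)
      fun i => (show EuclideanSpace ℝ (Fin d) from (b i).1) := by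
    ext1 i
    rw [h0]
    refine Fin.cases ?_ (fun i => ?_) i
    · rw [Fin.cons_zero, Fin.cons_zero, flowFrame_apply, one_smul]
      exact add_zero _
    · rw [Fin.cons_succ, Fin.cons_succ, flowFrame_apply, zero_smul, zero_add]
  have hpos := gram_det_pos ((isInnerForm_metric g x).restrict _) b.linearIndependent
  rw [absDet_eq (isInnerForm_flowSource g m x) (isInnerForm_form g x) _ b', h1, h0,
    gram_option_prod ((isInnerForm_metric g x).restrict _) b, gram_cons_orthogonal _ _
      (fun i => form_normGrad_left g (b i).2)]
  congr 1
  exact mul_div_cancel_right₀ _ hpos.ne'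

variable [T2Space M] (hm : ContMDiff (𝓡 d) 𝓘(ℝ, ℝ) ∞ m) {ϑ t : ℝ}
include hm

/-- The weight is the product of the Jacobian of the flow and the length of `X`. -/
theorem flowWeight_eq (h : FlowReaches g m ϑ t x) : flowWeight g m ϑ t x =
    flowJac g m (t - ϑ) x * Real.sqrt (form g x (normGradE g m x) (normGradE g m x)) := by
  have hx := (h.notCrit hm).1
  let A := LinearEquiv.ofBijective (flowFrame g m x) (bijective_flowFrame g hx)
  have h1 := absDet_comp (isInnerForm_flowSource g m x) (isInnerForm_form g x)
    (isInnerForm_form g (flow g m 0 (t - ϑ) x)) A (flowDiff g m (t - ϑ) x).toLinearMap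
  have h2 := absDet_flowFrame g (m := m) (x := x)
  rw [← h2, flowJac]
  refine Eq.trans ?_ h1
  rw [flowWeight]
  have h3 : flow g m ϑ t x = flow g m 0 (t - ϑ) x := flow_eq_zero hm
  have h4 : (flowDeriv g m ϑ t x : _ →ₗ[ℝ] EuclideanSpace ℝ (Fin d)) =
      (flowDiff g m (t - ϑ) x).toLinearMap ∘ₗ (A : _ →ₗ[ℝ] EuclideanSpace ℝ (Fin d)) := by
    refine LinearMap.ext fun q => ?_
    obtain ⟨r, v⟩ := q
    exact mfderiv_flow_prod g hm h r v.1
  rw [← h3]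
  exact congrArg (absDet (fun v w : ℝ × (mfderiv (𝓡 d) 𝓘(ℝ, ℝ) m x).ker =>
      v.1 * w.1 + g.inner x (v.2 : TangentSpace (𝓡 d) x) w.2) (form g (flow g m ϑ t x))) h4

theorem flowWeight_self (hx : ¬ IsCrit d m x) : flowWeight g m ϑ ϑ x =
    Real.sqrt (form g x (normGradE g m x) (normGradE g m x)) := by
  have h := (flow_zero_of_notCrit g hm hx).1
  rw [flowWeight_eq g hm ((flowReaches_iff_zero hm).2 (by rwa [sub_self])), sub_self,
    flowJac_zero g hm hx, one_mul]

theorem flowWeight_eq_mul (h : FlowReaches g m ϑ t x) :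
    flowWeight g m ϑ t x = flowJac g m (t - ϑ) x * flowWeight g m ϑ ϑ x := by
  rw [flowWeight_eq g hm h, flowWeight_self g hm (h.notCrit hm).1]

theorem flowWeight_pos (h : FlowReaches g m ϑ t x) : 0 < flowWeight g m ϑ t x := by
  rw [flowWeight_eq g hm h]
  exact mul_pos (flowJac_pos g hm ((flowReaches_iff_zero hm).1 h))
    (Real.sqrt_pos.2 (form_normGrad_pos g (h.notCrit hm).1))

theorem continuousOn_form_normGrad : ContinuousOn
    (fun x => form g x (normGradE g m x) (normGradE g m x)) {x | ¬ IsCrit d m x} := by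
  have h : ContMDiffOn (𝓡 d) (𝓡 d).tangent ∞
      (fun x => (⟨x, normGrad g m x⟩ : TangentBundle (𝓡 d) M)) {x | ¬ IsCrit d m x} :=
    fun x hx => (contMDiffAt_normGrad g hm hx).contMDiffWithinAt
  exact (contMDiffOn_metric_apply g h h).continuousOn

end Weight

/-! ### The Riemannian measure in a slice chart -/

section Slice

set_option linter.unusedSectionVars false

variable {d k : ℕ} {M : Type u} [TopologicalSpace M] [ChartedSpace (EuclideanSpace ℝ (Fin d)) M]
  [IsManifold (𝓡 d) ∞ M] (g : Metric d M)
  {N : Type v} {j : N → M}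

/-- The density of the Riemannian measure in a local parametrization. -/
def LocalParam.density (c : LocalParam d j k) (y : EuclideanSpace ℝ (Fin k)) : ℝ :=
  Real.sqrt (gram (fun v w => g.inner (j (c.σ y)) v w) fun i : Fin k =>
      mfderiv (𝓡 k) (𝓡 d) (j ∘ c.σ) y (EuclideanSpace.single i 1)).det

/-- The differential of a parametrization, between the model spaces. -/
def LocalParam.diff (c : LocalParam d j k) (y : EuclideanSpace ℝ (Fin k)) :
    EuclideanSpace ℝ (Fin k) →L[ℝ] EuclideanSpace ℝ (Fin d) :=
  mfderiv (𝓡 k) (𝓡 d) (j ∘ c.σ) y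

theorem LocalParam.density_eq (c : LocalParam d j k) (y : EuclideanSpace ℝ (Fin k)) :
    c.density g y = Real.sqrt (gram (form g (j (c.σ y))) fun i : Fin k =>
      c.diff y (EuclideanSpace.single i 1)).det := rfl

theorem LocalParam.density_pos (c : LocalParam d j k) {y : EuclideanSpace ℝ (Fin k)}
    (hy : y ∈ c.W) : 0 < c.density g y := by
  rw [c.density_eq]
  refine Real.sqrt_pos.2 (gram_det_pos (isInnerForm_form g _) ?_)
  have h := (EuclideanSpace.basisFun (Fin k) ℝ).toBasis.linearIndependent.map'
    (c.diff y).toLinearMap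
    (LinearMap.ker_eq_bot.2 (c.immersion y hy))
  have e : (fun i : Fin k => c.diff y (EuclideanSpace.single i 1)) =
      (c.diff y).toLinearMap ∘ (EuclideanSpace.basisFun (Fin k) ℝ).toBasis := by
    ext1 i
    simp
  rw [e]
  exact h

theorem LocalParam.continuousOn_density (c : LocalParam d j k) :
    ContinuousOn (c.density g) c.W :=
  (contDiffOn_gram_det g c.isOpen c.smooth
    (fun i : Fin k => EuclideanSpace.single i (1 : ℝ))).continuousOn.sqrt

variable [TopologicalSpace N]

/-- A parametrization is a slice chart if its image is open in `N` and its inverse is the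
restriction of a smooth map `ρ` on an open set `O` of `M`. -/
structure LocalParam.IsSlice (c : LocalParam d j k) (ρ : M → EuclideanSpace ℝ (Fin k))
    (O : Set M) : Prop where
  isOpen_image : IsOpen (c.σ '' c.W)
  isOpen : IsOpen O
  smooth : ContMDiffOn (𝓡 d) (𝓡 k) ∞ ρ O
  mem : ∀ y ∈ c.W, j (c.σ y) ∈ O
  leftInv : ∀ y ∈ c.W, ρ (j (c.σ y)) = y

/-- A smooth map with a smooth left inverse is a parametrization. -/
def LocalParam.ofLeftInverse (j : N → M) (σ : EuclideanSpace ℝ (Fin k) → N)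
    {W : Set (EuclideanSpace ℝ (Fin k))} (hW : IsOpen W)
    (hσ : ContMDiffOn (𝓡 k) (𝓡 d) ∞ (j ∘ σ) W) (ρ : M → EuclideanSpace ℝ (Fin k)) {O : Set M}
    (hO : IsOpen O) (hρ : ContMDiffOn (𝓡 d) (𝓡 k) ∞ ρ O) (hmem : ∀ y ∈ W, j (σ y) ∈ O)
    (hl : ∀ y ∈ W, ρ (j (σ y)) = y) : LocalParam d j k where
  σ := σ
  W := W
  isOpen := hW
  smooth := hσ
  injOn y hy y' hy' h := by rw [← hl y hy, h, hl y' hy']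
  immersion y hy := by
    have h1 := ((hρ.contMDiffAt (hO.mem_nhds (hmem y hy))).mdifferentiableAt
      (by simp)).hasMFDerivAt
    have h2 := ((hσ.contMDiffAt (hW.mem_nhds hy)).mdifferentiableAt (by simp)).hasMFDerivAt
    have h3 := (h1.comp y h2).congr_of_eventuallyEq (f₁ := id) (by
      filter_upwards [hW.mem_nhds hy] with y' hy'
      exact (hl y' hy').symm)
    have h4 := hasMFDerivAt_unique h3 (hasMFDerivAt_id y)
    intro v w hvw
    have h5 := DFunLike.congr_fun h4 v
    have h6 := DFunLike.congr_fun h4 w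
    exact h5.symm.trans ((congrArg (mfderiv (𝓡 d) (𝓡 k) ρ (j (σ y))) hvw).trans h6)

theorem LocalParam.isSlice_ofLeftInverse {σ : EuclideanSpace ℝ (Fin k) → N}
    {W : Set (EuclideanSpace ℝ (Fin k))} (hW : IsOpen W)
    (hσ : ContMDiffOn (𝓡 k) (𝓡 d) ∞ (j ∘ σ) W) {ρ : M → EuclideanSpace ℝ (Fin k)} {O : Set M}
    (hO : IsOpen O) (hρ : ContMDiffOn (𝓡 d) (𝓡 k) ∞ ρ O) (hmem : ∀ y ∈ W, j (σ y) ∈ O)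
    (hl : ∀ y ∈ W, ρ (j (σ y)) = y) (hop : IsOpen (σ '' W)) :
    (LocalParam.ofLeftInverse j σ hW hσ ρ hO hρ hmem hl).IsSlice ρ O :=
  ⟨hop, hO, hρ, hmem, hl⟩

variable [MeasurableSpace N] [BorelSpace N]

theorem LocalParam.continuousOn_σ (c : LocalParam d j k) (hj : IsInducing j) :
    ContinuousOn c.σ c.W :=
  hj.continuousOn_iff.2 c.smooth.continuousOn

theorem LocalParam.measure_eq (c : LocalParam d j k) : c.measure g =
    ((volume.restrict c.W).withDensity fun y => ENNReal.ofReal (c.density g y)).map c.σ := rfl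

theorem LocalParam.aemeasurable_density (c : LocalParam d j k) :
    AEMeasurable (fun y => ENNReal.ofReal (c.density g y)) (volume.restrict c.W) :=
  ((c.continuousOn_density g).aemeasurable c.isOpen.measurableSet).ennreal_ofReal

theorem LocalParam.aemeasurable_σ (c : LocalParam d j k) (hj : IsInducing j) :
    AEMeasurable c.σ
      ((volume.restrict c.W).withDensity fun y => ENNReal.ofReal (c.density g y)) :=
  ((c.continuousOn_σ hj).aemeasurable c.isOpen.measurableSet).mono_ac
    (withDensity_absolutelyContinuous _ _)

theorem LocalParam.lintegral_measure (c : LocalParam d j k) (hj : IsInducing j) {f : N → ℝ≥0∞}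
    (hf : Measurable f) : ∫⁻ x, f x ∂c.measure g =
      ∫⁻ y in c.W, ENNReal.ofReal (c.density g y) * f (c.σ y) := by
  rw [c.measure_eq, lintegral_map' hf.aemeasurable (c.aemeasurable_σ g hj),
    lintegral_withDensity_eq_lintegral_mul₀ (g := fun y => f (c.σ y)) (c.aemeasurable_density g)
      (hf.comp_aemeasurable ((c.continuousOn_σ hj).aemeasurable c.isOpen.measurableSet))]
  rfl

variable {g} in
/-- Every parametrization measures subsets of the image of a slice chart at most as the slice chart
does. -/
theorem LocalParam.measure_le_of_isSlice {c : LocalParam d j k} {ρ : M → EuclideanSpace ℝ (Fin k)}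
    {O : Set M} (hc : c.IsSlice ρ O) (hj : IsInducing j) (c' : LocalParam d j k) {A : Set N}
    (hA : MeasurableSet A) (hAc : A ⊆ c.σ '' c.W) : c'.measure g A ≤ c.measure g A := by
  let E := EuclideanSpace ℝ (Fin k)
  let W₁ : Set E := c'.W ∩ c'.σ ⁻¹' (c.σ '' c.W)
  have hW₁ : IsOpen W₁ := (c'.continuousOn_σ hj).isOpen_inter_preimage c'.isOpen hc.isOpen_image
  let T : E → E := fun y => ρ (j (c'.σ y))
  have hT : ContDiffOn ℝ ∞ T W₁ := by
    refine contMDiffOn_iff_contDiffOn.1 ?_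
    refine hc.smooth.comp (c'.smooth.mono inter_subset_left) ?_
    rintro y ⟨-, u, hu, huy⟩
    change j (c'.σ y) ∈ O
    rw [← huy]
    exact hc.mem u hu
  have hTW : ∀ y ∈ W₁, T y ∈ c.W ∧ c.σ (T y) = c'.σ y := by
    rintro y ⟨-, u, hu, huy⟩
    have : T y = u := by
      change ρ (j (c'.σ y)) = u
      rw [← huy, hc.leftInv u hu]
    rw [this]
    exact ⟨hu, huy⟩
  have hTd : ∀ y ∈ W₁, HasFDerivAt T (fderiv ℝ T y) y := fun y hy =>
    ((hT.contDiffAt (hW₁.mem_nhds hy)).differentiableAt (by simp)).hasFDerivAt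
  have hinj : InjOn T W₁ := by
    intro y hy y' hy' h
    refine c'.injOn hy.1 hy'.1 ?_
    rw [← (hTW y hy).2, ← (hTW y' hy').2, h]
  have hdens : ∀ y ∈ W₁, c'.density g y = |(fderiv ℝ T y).det| * c.density g (T y) := by
    intro y hy
    have hd : c'.diff y = (c.diff (T y)).comp (fderiv ℝ T y) := by
      have h1 := ((c.smooth.contMDiffAt (c.isOpen.mem_nhds (hTW y hy).1)).mdifferentiableAt
        (by simp)).hasMFDerivAt
      have h2 := ((c'.smooth.contMDiffAt (c'.isOpen.mem_nhds hy.1)).mdifferentiableAt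
        (by simp)).hasMFDerivAt
      have h3 := h1.comp y (hTd y hy).hasMFDerivAt
      refine hasMFDerivAt_unique h2 (h3.congr_of_eventuallyEq ?_)
      filter_upwards [hW₁.mem_nhds hy] with y' hy'
      exact congrArg j (hTW y' hy').2.symm
    rw [c'.density_eq, c.density_eq, (hTW y hy).2]
    have h4 := gram_comp_linearMap (isInnerForm_form g (j (c'.σ y)))
      (EuclideanSpace.basisFun (Fin k) ℝ).toBasis (c.diff (T y)).toLinearMap
      (fderiv ℝ T y).toLinearMap
    have e1 : (fun i : Fin k => c'.diff y (EuclideanSpace.single i 1)) = fun i =>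
        (c.diff (T y)).toLinearMap ((fderiv ℝ T y).toLinearMap
          ((EuclideanSpace.basisFun (Fin k) ℝ).toBasis i)) := by
      ext1 i; rw [hd]; simp
    have e2 : (fun i : Fin k => c.diff (T y) (EuclideanSpace.single i 1)) = fun i =>
        (c.diff (T y)).toLinearMap ((EuclideanSpace.basisFun (Fin k) ℝ).toBasis i) := by
      ext1 i; simp
    rw [e1, e2, h4, Real.sqrt_mul (sq_nonneg _), Real.sqrt_sq_eq_abs]
  have key : ∀ c'' : LocalParam d j k, c''.measure g A =
      ∫⁻ y in c''.W, ENNReal.ofReal (c''.density g y) * A.indicator 1 (c''.σ y) := by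
    intro c''
    rw [← lintegral_indicator_one hA, c''.lintegral_measure g hj (measurable_one.indicator hA)]
  rw [key c', key c]
  calc ∫⁻ y in c'.W, ENNReal.ofReal (c'.density g y) * A.indicator 1 (c'.σ y)
      = ∫⁻ y in W₁, ENNReal.ofReal (c'.density g y) * A.indicator 1 (c'.σ y) := by
        rw [← lintegral_indicator c'.isOpen.measurableSet, ← lintegral_indicator hW₁.measurableSet]
        congr 1
        ext1 y
        by_cases hy : y ∈ W₁
        · rw [indicator_of_mem hy, indicator_of_mem hy.1]
        · rw [indicator_of_notMem hy]
          by_cases hy' : y ∈ c'.W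
          · rw [indicator_of_mem hy', indicator_of_notMem, mul_zero]
            exact fun h => hy ⟨hy', hAc h⟩
          · rw [indicator_of_notMem hy']
    _ = ∫⁻ y in W₁, ENNReal.ofReal |(fderiv ℝ T y).det| *
          (ENNReal.ofReal (c.density g (T y)) * A.indicator 1 (c.σ (T y))) := by
        refine setLIntegral_congr_fun hW₁.measurableSet fun y hy => ?_
        rw [hdens y hy, (hTW y hy).2, ENNReal.ofReal_mul (abs_nonneg _), mul_assoc]
    _ = ∫⁻ y in T '' W₁, ENNReal.ofReal (c.density g y) * A.indicator 1 (c.σ y) :=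
        (lintegral_image_eq_lintegral_abs_det_fderiv_mul volume hW₁.measurableSet
          (fun y hy => (hTd y hy).hasFDerivWithinAt) hinj
          (fun y => ENNReal.ofReal (c.density g y) * A.indicator 1 (c.σ y))).symm
    _ ≤ ∫⁻ y in c.W, ENNReal.ofReal (c.density g y) * A.indicator 1 (c.σ y) :=
        lintegral_mono_set (by rintro _ ⟨y, hy, rfl⟩; exact (hTW y hy).1)

theorem LocalParam.measure_compl_image (c : LocalParam d j k) (hj : IsInducing j)
    (ho : MeasurableSet (c.σ '' c.W)) : c.measure g (c.σ '' c.W)ᶜ = 0 := by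
  rw [← lintegral_indicator_one ho.compl, c.lintegral_measure g hj
    (measurable_one.indicator ho.compl)]
  refine (setLIntegral_congr_fun (g := fun _ => 0) c.isOpen.measurableSet fun y hy => ?_).trans
    (by simp)
  simp only
  rw [indicator_of_notMem, mul_zero]
  exact fun h => h ⟨y, hy, rfl⟩

/-- The Riemannian measure on the image of a slice chart is the measure of the slice chart. -/
theorem riemannianMeasure_restrict {c : LocalParam d j k} {ρ : M → EuclideanSpace ℝ (Fin k)}
    {O : Set M} (hc : c.IsSlice ρ O) (hj : IsInducing j) :
    (riemannianMeasure g j k).restrict (c.σ '' c.W) = c.measure g := by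
  have ho := hc.isOpen_image.measurableSet
  have hself : (c.measure g).restrict (c.σ '' c.W) = c.measure g :=
    Measure.restrict_eq_self_of_ae_mem (c.measure_compl_image g hj ho)
  refine le_antisymm ?_ ?_
  · have h1 : riemannianMeasure g j k ≤ c.measure g + (⊤ : Measure N).restrict (c.σ '' c.W)ᶜ := by
      refine iSup_le fun c' => Measure.le_iff.2 fun A hA => ?_
      rw [← measure_inter_add_sdiff A ho, Measure.add_apply, Measure.restrict_apply hA]
      refine add_le_add ((LocalParam.measure_le_of_isSlice hc hj c' (hA.inter ho)
        inter_subset_right).trans (measure_mono inter_subset_left)) ?_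
      exact Measure.le_iff'.1 le_top _
    refine (Measure.restrict_mono_measure h1 _).trans ?_
    rw [Measure.restrict_add, hself, Measure.restrict_restrict ho, inter_compl_self,
      Measure.restrict_empty, add_zero]
  · rw [← hself]
    exact Measure.restrict_mono_measure (le_iSup (fun c : LocalParam d j k => c.measure g) c) _

theorem LocalParam.measure_le (c : LocalParam d j k) :
    c.measure g ≤ riemannianMeasure g j k :=
  le_iSup (fun c : LocalParam d j k => c.measure g) c

/-- The restriction of a parametrization to a smaller open set. -/
def LocalParam.restr (c : LocalParam d j k) {W : Set (EuclideanSpace ℝ (Fin k))} (hW : IsOpen W) :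
    LocalParam d j k where
  σ := c.σ
  W := c.W ∩ W
  isOpen := c.isOpen.inter hW
  smooth := c.smooth.mono inter_subset_left
  injOn := c.injOn.mono inter_subset_left
  immersion y hy := c.immersion y hy.1

theorem LocalParam.IsSlice.restr {c : LocalParam d j k} {ρ : M → EuclideanSpace ℝ (Fin k)}
    {O : Set M} (hc : c.IsSlice ρ O) (hj : IsInducing j) {W : Set (EuclideanSpace ℝ (Fin k))}
    (hW : IsOpen W) : (c.restr hW).IsSlice ρ O where
  isOpen_image := by
    have h1 : ContinuousOn (fun x => ρ (j x)) (c.σ '' c.W) := by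
      refine hc.smooth.continuousOn.comp hj.continuous.continuousOn ?_
      rintro _ ⟨y, hy, rfl⟩
      exact hc.mem y hy
    have h2 : c.σ '' (c.W ∩ W) = c.σ '' c.W ∩ (fun x => ρ (j x)) ⁻¹' W := by
      ext x
      constructor
      · rintro ⟨y, ⟨hy, hy'⟩, rfl⟩
        refine ⟨⟨y, hy, rfl⟩, ?_⟩
        change ρ (j (c.σ y)) ∈ W
        rwa [hc.leftInv y hy]
      · rintro ⟨⟨y, hy, rfl⟩, hy'⟩
        change ρ (j (c.σ y)) ∈ W at hy'
        rw [hc.leftInv y hy] at hy'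
        exact ⟨y, ⟨hy, hy'⟩, rfl⟩
    change IsOpen (c.σ '' (c.W ∩ W))
    rw [h2]
    exact h1.isOpen_inter_preimage hc.isOpen_image hW
  isOpen := hc.isOpen
  smooth := hc.smooth
  mem y hy := hc.mem y hy.1
  leftInv y hy := hc.leftInv y hy.1

/-- A slice chart can be shrunk around a point so that its image has finite measure and lies in a
given open set. -/
theorem LocalParam.IsSlice.exists_small {c : LocalParam d j k} {ρ : M → EuclideanSpace ℝ (Fin k)}
    {O : Set M} (hc : c.IsSlice ρ O) (hj : IsInducing j) {x : N} (hx : x ∈ c.σ '' c.W) {V : Set N}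
    (hV : IsOpen V) (hxV : x ∈ V) : ∃ c' : LocalParam d j k, c'.IsSlice ρ O ∧ x ∈ c'.σ '' c'.W ∧
      c'.σ '' c'.W ⊆ V ∧ riemannianMeasure g j k (c'.σ '' c'.W) < ⊤ := by
  obtain ⟨y, hy, rfl⟩ := hx
  have h1 : IsOpen (c.W ∩ c.σ ⁻¹' V) := (c.continuousOn_σ hj).isOpen_inter_preimage c.isOpen hV
  have h2 : ∀ᶠ u in 𝓝 y, c.density g u < c.density g y + 1 :=
    ((c.continuousOn_density g).continuousAt (c.isOpen.mem_nhds hy)).eventually_lt_const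
      (lt_add_one _)
  obtain ⟨r, hr, hball⟩ := Metric.mem_nhds_iff.1 (inter_mem h2 (h1.mem_nhds ⟨hy, hxV⟩))
  have hs := hc.restr hj (W := Metric.ball y r) Metric.isOpen_ball
  have hW : (c.restr (W := Metric.ball y r) Metric.isOpen_ball).W = Metric.ball y r :=
    inter_eq_right.2 fun u hu => (hball hu).2.1
  have hdens : ∀ u ∈ (c.restr (W := Metric.ball y r) Metric.isOpen_ball).W,
      (c.restr (W := Metric.ball y r) Metric.isOpen_ball).density g u ≤ c.density g y + 1 :=
    fun u hu => (hball hu.2).1.le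
  refine ⟨_, hs, ⟨y, ⟨hy, Metric.mem_ball_self hr⟩, rfl⟩, ?_, ?_⟩
  · rintro _ ⟨u, hu, rfl⟩
    exact (hball hu.2).2.2
  · have h3 := congrArg (fun μ : Measure N => μ univ) (riemannianMeasure_restrict g hs hj)
    simp only [Measure.restrict_apply_univ] at h3
    rw [h3, ← lintegral_one, LocalParam.lintegral_measure g _ hj measurable_const]
    refine (setLIntegral_mono' (g := fun _ => ENNReal.ofReal (c.density g y + 1))
      (LocalParam.isOpen _).measurableSet fun u hu => ?_).trans_lt ?_
    · rw [mul_one]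
      exact ENNReal.ofReal_le_ofReal (hdens u hu)
    · rw [setLIntegral_const, hW]
      exact ENNReal.mul_lt_top ENNReal.ofReal_lt_top measure_ball_lt_top

end Slice

/-! ### Slice charts of the manifold and of regular level sets -/

section InverseFunction

variable {E F : Type*} [NormedAddCommGroup E] [NormedSpace ℝ E] [CompleteSpace E]
  [NormedAddCommGroup F] [NormedSpace ℝ F]

/-- The inverse function theorem with a smooth inverse on a full neighbourhood. -/
theorem exists_smooth_localInverse {f : E → F} {U : Set E} (hU : IsOpen U) (hf : ContDiffOn ℝ ∞ f U)
    {a : E} (ha : a ∈ U) {f' : E ≃L[ℝ] F} (hf' : HasFDerivAt f (f' : E →L[ℝ] F) a) :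
    ∃ e : OpenPartialHomeomorph E F, a ∈ e.source ∧ e.source ⊆ U ∧ (∀ x, e x = f x) ∧
      ContDiffOn ℝ ∞ e.symm e.target := by
  have hfa := hf.contDiffAt (hU.mem_nhds ha)
  let e₀ := hfa.toOpenPartialHomeomorph f hf' (by simp)
  let G : Set (E →L[ℝ] F) := range ContinuousLinearEquiv.toContinuousLinearMap
  have hG : IsOpen (U ∩ fderiv ℝ f ⁻¹' G) :=
    (hf.continuousOn_fderiv_of_isOpen hU (by simp)).isOpen_inter_preimage hU
      ContinuousLinearEquiv.isOpen
  refine ⟨e₀.restrOpen _ hG, ?_, ?_, fun x => rfl, ?_⟩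
  · rw [OpenPartialHomeomorph.restrOpen_source]
    exact ⟨hfa.mem_toOpenPartialHomeomorph_source hf' (by simp), ha, f', hf'.fderiv.symm⟩
  · rw [OpenPartialHomeomorph.restrOpen_source]
    exact fun x hx => hx.2.1
  · intro y hy
    have hx := (e₀.restrOpen _ hG).map_target hy
    rw [OpenPartialHomeomorph.restrOpen_source] at hx
    obtain ⟨-, hxU, L, hL⟩ := hx
    have h1 := hf.contDiffAt (hU.mem_nhds hxU)
    have h2 : HasFDerivAt (e₀.restrOpen _ hG) (L : E →L[ℝ] F) ((e₀.restrOpen _ hG).symm y) := by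
      have := (h1.differentiableAt (by simp)).hasFDerivAt
      rwa [← hL] at this
    exact ((e₀.restrOpen _ hG).contDiffAt_symm hy h2 h1).contDiffWithinAt

/-- A non-zero functional on `ℝ^(k+1)` is the first component of an isomorphism onto `ℝ × ℝ^k`. -/
theorem exists_equiv_fst_eq {k : ℕ} {D : EuclideanSpace ℝ (Fin (k + 1)) →L[ℝ] ℝ} (hD : D ≠ 0) :
    ∃ A : EuclideanSpace ℝ (Fin (k + 1)) ≃L[ℝ] ℝ × EuclideanSpace ℝ (Fin k),
      ∀ w, (A w).1 = D w := by
  let E := EuclideanSpace ℝ (Fin (k + 1))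
  obtain ⟨X, hX⟩ : ∃ X, D X = 1 := by
    obtain ⟨v, hv⟩ : ∃ v, D v ≠ 0 := by
      by_contra! h
      exact hD (ContinuousLinearMap.ext h)
    exact ⟨(D v)⁻¹ • v, by rw [map_smul, smul_eq_mul, inv_mul_cancel₀ hv]⟩
  let K := LinearMap.ker D.toLinearMap
  have hsurj : Function.Surjective D.toLinearMap := fun r =>
    ⟨r • X, by change D (r • X) = r; rw [map_smul, hX, smul_eq_mul, mul_one]⟩
  have hfin : Module.finrank ℝ K = Module.finrank ℝ (EuclideanSpace ℝ (Fin k)) := by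
    have h1 := LinearMap.finrank_range_add_finrank_ker D.toLinearMap
    rw [LinearMap.range_eq_top.2 hsurj, finrank_top, finrank_euclideanSpace, Fintype.card_fin,
      Module.finrank_self] at h1
    rw [finrank_euclideanSpace, Fintype.card_fin]
    change 1 + Module.finrank ℝ K = k + 1 at h1
    omega
  let e : K ≃ₗ[ℝ] EuclideanSpace ℝ (Fin k) := LinearEquiv.ofFinrankEq _ _ hfin
  let pr : E →ₗ[ℝ] K := LinearMap.codRestrict K
    (LinearMap.id - D.toLinearMap.smulRight X) (fun w => by
      change D (w - D w • X) = 0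
      rw [map_sub, map_smul, hX, smul_eq_mul, mul_one, sub_self])
  have hpr : ∀ w, ((pr w : K) : E) = w - D w • X := fun w => rfl
  let A : E ≃ₗ[ℝ] ℝ × EuclideanSpace ℝ (Fin k) :=
    { (LinearMap.prod D.toLinearMap (e.toLinearMap ∘ₗ pr)) with
      invFun := fun q => q.1 • X + (e.symm q.2 : K)
      left_inv := by
        intro w
        change D w • X + ((e.symm (e (pr w)) : K) : E) = w
        rw [e.symm_apply_apply, hpr, add_sub_cancel]
      right_inv := by
        rintro ⟨r, v⟩
        have h0 : D ((e.symm v : K) : E) = 0 := (e.symm v).2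
        have h1 : D (r • X + ((e.symm v : K) : E)) = r := by
          rw [map_add, map_smul, hX, h0, smul_eq_mul, mul_one, add_zero]
        have h2 : pr (r • X + ((e.symm v : K) : E)) = e.symm v := by
          apply Subtype.ext
          rw [hpr, h1, add_sub_cancel_left]
        change (D (r • X + ((e.symm v : K) : E)), e (pr (r • X + ((e.symm v : K) : E)))) = (r, v)
        rw [h1, h2, e.apply_symm_apply] }
  exact ⟨A.toContinuousLinearEquiv, fun w => rfl⟩

end InverseFunction

section Charts

set_option linter.unusedSectionVars false

/-- Charts are slice charts. -/
theorem exists_chartSlice {d : ℕ} {M : Type u} [TopologicalSpace M]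
    [ChartedSpace (EuclideanSpace ℝ (Fin d)) M] [IsManifold (𝓡 d) ∞ M] (p : M) :
    ∃ (c : LocalParam d (id : M → M) d) (ρ : M → EuclideanSpace ℝ (Fin d)) (O : Set M),
      c.IsSlice ρ O ∧ p ∈ c.σ '' c.W := by
  let φ := extChartAt (𝓡 d) p
  have hs : φ.source = (chartAt (EuclideanSpace ℝ (Fin d)) p).source := extChartAt_source _ _
  have hmem : ∀ y ∈ φ.target, (id : M → M) (φ.symm y) ∈ φ.source := fun y hy => φ.map_target hy
  have hl : ∀ y ∈ φ.target, φ ((id : M → M) (φ.symm y)) = y := fun y hy => φ.right_inv hy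
  have hO : IsOpen φ.source := isOpen_extChartAt_source p
  have hρ : ContMDiffOn (𝓡 d) (𝓡 d) ∞ φ φ.source := by rw [hs]; exact contMDiffOn_extChartAt
  refine ⟨_, φ, φ.source, LocalParam.isSlice_ofLeftInverse (j := id) (σ := φ.symm)
    (isOpen_extChartAt_target p) (contMDiffOn_extChartAt_symm p) hO hρ hmem hl ?_, ?_⟩
  · rw [φ.symm_image_target_eq_source]; exact isOpen_extChartAt_source p
  · exact ⟨φ p, mem_extChartAt_target p, extChartAt_to_inv p⟩

variable {k : ℕ} {M : Type u} [TopologicalSpace M]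
    [ChartedSpace (EuclideanSpace ℝ (Fin (k + 1))) M] [IsManifold (𝓡 (k + 1)) ∞ M] {m : M → ℝ}

/-- Level sets have slice charts at points that are not critical. -/
theorem exists_levelSlice (hm : ContMDiff (𝓡 (k + 1)) 𝓘(ℝ, ℝ) ∞ m) {ϑ : ℝ} (x : level m ϑ)
    (hx : ¬ IsCrit (k + 1) m x.1) :
    ∃ (c : LocalParam (k + 1) (Subtype.val : level m ϑ → M) k)
      (ρ : M → EuclideanSpace ℝ (Fin k)) (O : Set M), c.IsSlice ρ O ∧ x ∈ c.σ '' c.W := by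
  classical
  let E := EuclideanSpace ℝ (Fin (k + 1))
  let E' := EuclideanSpace ℝ (Fin k)
  let φ := extChartAt (𝓡 (k + 1)) x.1
  have hφs : ContMDiffOn 𝓘(ℝ, E) (𝓡 (k + 1)) ∞ φ.symm φ.target := contMDiffOn_extChartAt_symm x.1
  have hφ : ContMDiffOn (𝓡 (k + 1)) 𝓘(ℝ, E) ∞ φ φ.source := by
    rw [extChartAt_source]; exact contMDiffOn_extChartAt
  have hT : IsOpen φ.target := isOpen_extChartAt_target x.1
  let mh : E → ℝ := fun u => m (φ.symm u)
  have hmh : ContDiffOn ℝ ∞ mh φ.target :=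
    contMDiffOn_iff_contDiffOn.1 (hm.comp_contMDiffOn hφs)
  have hu₀ : φ x.1 ∈ φ.target := mem_extChartAt_target x.1
  let D : E →L[ℝ] ℝ := fderiv ℝ mh (φ x.1)
  have hDm : HasFDerivAt mh D (φ x.1) :=
    ((hmh.contDiffAt (hT.mem_nhds hu₀)).differentiableAt (by simp)).hasFDerivAt
  have hD : D ≠ 0 := by
    intro h0
    apply hx
    rw [IsCrit]
    have h1 : HasMFDerivAt (𝓡 (k + 1)) 𝓘(ℝ, ℝ) (mh ∘ φ) x.1 _ :=
      HasMFDerivAt.comp (I' := 𝓘(ℝ, E)) x.1 hDm.hasMFDerivAt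
        ((hφ.contMDiffAt ((isOpen_extChartAt_source x.1).mem_nhds
          (mem_extChartAt_source x.1))).mdifferentiableAt (by simp)).hasMFDerivAt
    have h2 : m =ᶠ[𝓝 x.1] mh ∘ φ := by
      filter_upwards [extChartAt_source_mem_nhds (I := 𝓡 (k + 1)) x.1] with y hy
      exact congrArg m (φ.left_inv hy).symm
    rw [(h1.congr_of_eventuallyEq h2).mfderiv, h0]
    exact ContinuousLinearMap.zero_comp _
  obtain ⟨A, hA⟩ := exists_equiv_fst_eq hD
  let Ψ : E → ℝ × E' := fun u => (mh u, (A u).2)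
  have hΨ : ContDiffOn ℝ ∞ Ψ φ.target := hmh.prodMk (contDiff_snd.comp A.contDiff).contDiffOn
  have hΨd : HasFDerivAt Ψ (A : E →L[ℝ] ℝ × E') (φ x.1) := by
    have h1 : HasFDerivAt (fun u => (A u).2) ((ContinuousLinearMap.snd ℝ ℝ E').comp
      (A : E →L[ℝ] ℝ × E')) (φ x.1) :=
      ((ContinuousLinearMap.snd ℝ ℝ E').comp (A : E →L[ℝ] ℝ × E')).hasFDerivAt
    have h2 := hDm.prodMk h1
    have e : (A : E →L[ℝ] ℝ × E') = D.prod ((ContinuousLinearMap.snd ℝ ℝ E').comp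
      (A : E →L[ℝ] ℝ × E')) := by
      ext w
      · exact hA w
      · rfl
    rw [e]
    exact h2
  obtain ⟨e, he1, he2, he3, he4⟩ := exists_smooth_localInverse hT hΨ hu₀ hΨd
  let W : Set E' := {v | (ϑ, v) ∈ e.target}
  have hW : IsOpen W := e.open_target.preimage (by fun_prop : Continuous fun v : E' => (ϑ, v))
  have hes : ∀ v ∈ W, e.symm (ϑ, v) ∈ e.source := fun v hv => e.map_target hv
  have hlev : ∀ v ∈ W, m (φ.symm (e.symm (ϑ, v))) = ϑ := by
    intro v hv
    have := e.right_inv hv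
    rw [he3] at this
    exact congrArg Prod.fst this
  let σ : E' → level m ϑ := fun v =>
    if h : v ∈ W then ⟨φ.symm (e.symm (ϑ, v)), hlev v h⟩ else x
  have hσ : ∀ v ∈ W, (σ v : M) = φ.symm (e.symm (ϑ, v)) := fun v hv => by simp only [σ, dif_pos hv]
  have hσs : ContMDiffOn (𝓡 k) (𝓡 (k + 1)) ∞ (Subtype.val ∘ σ) W := by
    have h1 : ContMDiffOn 𝓘(ℝ, E') (𝓡 (k + 1)) ∞ (fun v => φ.symm (e.symm (ϑ, v))) W := by
      refine hφs.comp (t := φ.target) ?_ (fun v hv => he2 (hes v hv))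
      refine ContDiffOn.contMDiffOn ?_
      exact he4.comp (contDiff_const.prodMk contDiff_id).contDiffOn (fun v hv => hv)
    exact h1.congr hσ
  let O : Set M := φ.source ∩ φ ⁻¹' e.source
  have hO : IsOpen O := hφ.continuousOn.isOpen_inter_preimage (isOpen_extChartAt_source x.1)
    e.open_source
  let ρ : M → E' := fun y => (A (φ y)).2
  have hρ : ContMDiffOn (𝓡 (k + 1)) (𝓡 k) ∞ ρ O :=
    (contDiff_snd.comp A.contDiff).contMDiff.comp_contMDiffOn (hφ.mono inter_subset_left)
  have hφe : ∀ v ∈ W, φ (σ v) = e.symm (ϑ, v) := fun v hv => by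
    rw [hσ v hv, φ.right_inv (he2 (hes v hv))]
  have hmem : ∀ v ∈ W, (σ v : M) ∈ O := fun v hv =>
    ⟨by rw [hσ v hv]; exact φ.map_target (he2 (hes v hv)), by
      change φ (σ v) ∈ e.source
      rw [hφe v hv]; exact hes v hv⟩
  have hl : ∀ v ∈ W, ρ (σ v) = v := by
    intro v hv
    have := e.right_inv hv
    rw [he3] at this
    change (A (φ (σ v))).2 = v
    rw [hφe v hv]
    exact congrArg Prod.snd this
  have himg : σ '' W = Subtype.val ⁻¹' O := by
    ext y
    constructor
    · rintro ⟨v, hv, rfl⟩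
      exact hmem v hv
    · rintro ⟨hy1, hy2⟩
      have h1 : e (φ y) = (ϑ, ρ y) := by
        rw [he3]
        refine Prod.ext ?_ rfl
        change m (φ.symm (φ y)) = ϑ
        rw [φ.left_inv hy1]
        exact y.2
      have h2 : ρ y ∈ W := by
        change (ϑ, ρ y) ∈ e.target
        rw [← h1]
        exact e.map_source hy2
      refine ⟨ρ y, h2, Subtype.ext ?_⟩
      rw [hσ _ h2, ← h1, e.left_inv hy2, φ.left_inv hy1]
  refine ⟨_, ρ, O, LocalParam.isSlice_ofLeftInverse (j := Subtype.val) hW hσs hO hρ hmem hl ?_, ?_⟩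
  · rw [himg]
    exact hO.preimage continuous_subtype_val
  · change x ∈ σ '' W
    rw [himg]
    exact ⟨mem_extChartAt_source x.1, he1⟩

end Charts

section Null

set_option linter.unusedSectionVars false

theorem measurableSet_inter_preimage {X Y : Type*} [TopologicalSpace X] [MeasurableSpace X]
    [OpensMeasurableSpace X] [TopologicalSpace Y] [MeasurableSpace Y] [BorelSpace Y] {f : X → Y}
    {s : Set X} (hf : ContinuousOn f s) (hs : MeasurableSet s) {A : Set Y} (hA : MeasurableSet A) :
    MeasurableSet (s ∩ f ⁻¹' A) := by
  have h := (continuousOn_iff_continuous_domRestrict.1 hf).measurable hA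
  have h2 := hs.subtype_image h
  convert h2 using 1
  ext x
  simp [and_comm]

variable {d : ℕ} {M : Type u} [TopologicalSpace M] [SecondCountableTopology M]
  [ChartedSpace (EuclideanSpace ℝ (Fin d)) M] [IsManifold (𝓡 d) ∞ M]
  [MeasurableSpace M] [BorelSpace M] (g : Metric d M)

/-- Diffeomorphisms between open sets preserve null sets. -/
theorem riemannianMeasure_preimage_null (Φ : OpenPartialHomeomorph M M)
    (h1 : ContMDiffOn (𝓡 d) (𝓡 d) ∞ Φ Φ.source) (h2 : ContMDiffOn (𝓡 d) (𝓡 d) ∞ Φ.symm Φ.target)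
    {A : Set M} (hA : riemannianMeasure g (id : M → M) d A = 0) :
    riemannianMeasure g (id : M → M) d (Φ.source ∩ Φ ⁻¹' A) = 0 := by
  have hj : IsInducing (id : M → M) := IsInducing.id
  set ν := riemannianMeasure g (id : M → M) d
  set A' := toMeasurable ν A
  have hA' : ν A' = 0 := by rw [measure_toMeasurable, hA]
  have hA'm : MeasurableSet A' := measurableSet_toMeasurable _ _
  have hloc : ∀ x ∈ Φ.source, ∃ V ∈ 𝓝[Φ.source] x, ν (V ∩ Φ ⁻¹' A') = 0 := by
    intro x hx
    obtain ⟨c₀, ρ, O, hc₀, hxc₀⟩ := exists_chartSlice (d := d) x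
    obtain ⟨c, hc, hxc, hcV, -⟩ := hc₀.exists_small g hj hxc₀ Φ.open_source hx
    refine ⟨c.σ '' c.W, mem_nhdsWithin_of_mem_nhds (hc.isOpen_image.mem_nhds hxc), ?_⟩
    have hcs : ∀ y ∈ c.W, c.σ y ∈ Φ.source := fun y hy => hcV ⟨y, hy, rfl⟩
    let c' : LocalParam d (id : M → M) d :=
      LocalParam.ofLeftInverse id (fun y => Φ (c.σ y)) c.isOpen
      (h1.comp c.smooth hcs) (fun z => ρ (Φ.symm z)) (O := Φ.target ∩ Φ.symm ⁻¹' O)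
      (h2.continuousOn.isOpen_inter_preimage Φ.open_target hc.isOpen)
      (hc.smooth.comp (h2.mono inter_subset_left) (fun z hz => hz.2))
      (fun y hy => ⟨Φ.map_source (hcs y hy), by
        change Φ.symm (Φ (c.σ y)) ∈ O
        rw [Φ.left_inv (hcs y hy)]; exact hc.mem y hy⟩)
      (fun y hy => by
        change ρ (Φ.symm (Φ (c.σ y))) = y
        rw [Φ.left_inv (hcs y hy)]; exact hc.leftInv y hy)
    have k1 : c'.measure g A' = 0 := le_antisymm ((c'.measure_le g A').trans hA'.le) bot_le
    rw [← lintegral_indicator_one hA'm, c'.lintegral_measure g hj (measurable_one.indicator hA'm),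
      lintegral_eq_zero_iff' (f := fun y => ENNReal.ofReal (c'.density g y) *
        A'.indicator 1 (c'.σ y)) (((c'.aemeasurable_density g)).mul
        ((measurable_one.indicator hA'm).comp_aemeasurable
          ((c'.continuousOn_σ hj).aemeasurable c'.isOpen.measurableSet)))] at k1
    have hB : MeasurableSet (c.σ '' c.W ∩ Φ ⁻¹' A') := measurableSet_inter_preimage
      (Φ.continuousOn.mono hcV) hc.isOpen_image.measurableSet hA'm
    have k2 : ν (c.σ '' c.W ∩ Φ ⁻¹' A') = c.measure g (c.σ '' c.W ∩ Φ ⁻¹' A') := by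
      rw [← riemannianMeasure_restrict g hc hj, Measure.restrict_apply hB]
      congr 1
      rw [inter_right_comm, inter_self]
    rw [k2, ← lintegral_indicator_one hB, c.lintegral_measure g hj (measurable_one.indicator hB)]
    refine (lintegral_congr_ae ?_).trans lintegral_zero
    have k1' := (ae_restrict_iff' c'.isOpen.measurableSet).1 k1
    refine (ae_restrict_iff' c.isOpen.measurableSet).2 ?_
    filter_upwards [k1'] with y hy hyW
    have k3 := hy hyW
    have k4 : ENNReal.ofReal (c'.density g y) ≠ 0 := by
      rw [Ne, ENNReal.ofReal_eq_zero, not_le]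
      exact c'.density_pos g hyW
    have k5 : A'.indicator (1 : M → ℝ≥0∞) (Φ (c.σ y)) = 0 :=
      (mul_eq_zero.1 k3).resolve_left k4
    have k6 : Φ (c.σ y) ∉ A' := fun h => by
      rw [indicator_of_mem h] at k5
      exact one_ne_zero k5
    rw [indicator_of_notMem (fun h => k6 h.2), mul_zero]
  refine measure_null_of_locally_null _ fun x hx => ?_
  obtain ⟨V, hV, hV0⟩ := hloc x hx.1
  refine ⟨V ∩ (Φ.source ∩ Φ ⁻¹' A), ?_, measure_mono_null ?_ hV0⟩
  · exact inter_mem (nhdsWithin_mono _ inter_subset_left hV) self_mem_nhdsWithin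
  · rintro y ⟨hy1, -, hy2⟩
    exact ⟨hy1, subset_toMeasurable _ _ hy2⟩

theorem aemeasurable_of_diffeo (Φ : OpenPartialHomeomorph M M) (μ : Measure M) :
    AEMeasurable Φ (μ.restrict Φ.source) :=
  Φ.continuousOn.aemeasurable Φ.open_source.measurableSet

theorem absolutelyContinuous_map_diffeo (Φ : OpenPartialHomeomorph M M)
    (h1 : ContMDiffOn (𝓡 d) (𝓡 d) ∞ Φ Φ.source) (h2 : ContMDiffOn (𝓡 d) (𝓡 d) ∞ Φ.symm Φ.target) :
    ((riemannianMeasure g (id : M → M) d).restrict Φ.source).map Φ ≪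
      riemannianMeasure g (id : M → M) d := by
  refine Measure.AbsolutelyContinuous.mk fun A hA h0 => ?_
  rw [Measure.map_apply_of_aemeasurable (aemeasurable_of_diffeo Φ _) hA]
  rw [Measure.restrict_apply₀' Φ.open_source.measurableSet.nullMeasurableSet, inter_comm]
  exact riemannianMeasure_preimage_null g Φ h1 h2 h0

end Null

/-! ### The Riemannian measure in tubes of flow lines -/

section Sweep

variable {d : ℕ} {M : Type u} [TopologicalSpace M] [ChartedSpace (EuclideanSpace ℝ (Fin d)) M]
  [IsManifold (𝓡 d) ∞ M] (g : Metric d M) {m : M → ℝ} [T2Space M]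
  (hm : ContMDiff (𝓡 d) 𝓘(ℝ, ℝ) ∞ m) {ϑ a b : ℝ} {U : Set (level m ϑ)}

include hm

theorem mem_sweep_iff (hU : ∀ x ∈ U, ∀ t ∈ Ioo a b, FlowReaches g m ϑ t x) {y : M} :
    y ∈ sweep g m ϑ a b U ↔ m y ∈ Ioo a b ∧ FlowReaches g m (m y) ϑ y ∧
      flow g m (m y) ϑ y ∈ Subtype.val '' U := by
  constructor
  · intro hy
    simp only [sweep, mem_iUnion] at hy
    obtain ⟨r, hr, _, ⟨x, hx, rfl⟩, rfl⟩ := hy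
    have h1 := hU x hx r hr
    have h2 : m (flow g m ϑ r x) = r := by
      have h3 : m x.1 = ϑ := x.2
      rw [h1.m_flow hm, h3, add_sub_cancel]
    have h3 := h1.symm hm
    rw [h2, h3.2]
    exact ⟨hr, h3.1, x, hx, rfl⟩
  · rintro ⟨h1, h2, x, hx, hxy⟩
    simp only [sweep, mem_iUnion]
    refine ⟨m y, h1, x, ⟨x, hx, rfl⟩, ?_⟩
    rw [hxy, (h2.symm hm).2]

theorem m_flow_level {x : level m ϑ} {t : ℝ} (h : FlowReaches g m ϑ t x) :
    m (flow g m ϑ t x) = t := by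
  have h3 : m x.1 = ϑ := x.2
  rw [h.m_flow hm, h3, add_sub_cancel]

theorem isOpen_sweep (hUo : IsOpen U) (hU : ∀ x ∈ U, ∀ t ∈ Ioo a b, FlowReaches g m ϑ t x) :
    IsOpen (sweep g m ϑ a b U) := by
  obtain ⟨O, hO, rfl⟩ := isOpen_induced_iff.1 hUo
  refine isOpen_iff_mem_nhds.2 fun y hy => ?_
  obtain ⟨h1, h2, x, hx, hxy⟩ := (mem_sweep_iff g hm hU).1 hy
  have hmc : ContinuousAt m y := hm.continuous.continuousAt
  have e1 := hmc.preimage_mem_nhds (isOpen_Ioo.mem_nhds h1)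
  have e2 := eventually_flowReaches g hm (ϑ := m) (t := fun _ => ϑ) (x := id) hmc
    continuousAt_const continuousAt_id h2
  have e3 : ContinuousAt (fun z => flow g m (m z) ϑ z) y :=
    (contMDiffAt_flow_comp g hm (hm y) contMDiffAt_const contMDiffAt_id h2).continuousAt
  have e4 := e3.preimage_mem_nhds
    (hO.mem_nhds (show flow g m (m y) ϑ y ∈ O by rw [← hxy]; exact hx))
  filter_upwards [e1, e2, e4] with z h1 h2 h4
  have h5 : m (flow g m (m z) ϑ z) = ϑ := by
    rw [FlowReaches.m_flow (x := z) hm h2, add_sub_cancel]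
  exact (mem_sweep_iff g hm hU).2 ⟨h1, h2, ⟨_, h5⟩, h4, rfl⟩

end Sweep

section Cons

/-- The splitting `ℝ^(k+1) = ℝ × ℝ^k`. -/
def euclideanCons (k : ℕ) : EuclideanSpace ℝ (Fin (k + 1)) ≃L[ℝ] ℝ × EuclideanSpace ℝ (Fin k) :=
  LinearEquiv.toContinuousLinearEquiv
    { toFun := fun u => (u 0, WithLp.toLp 2 fun i => u i.succ)
      map_add' := fun _ _ => rfl
      map_smul' := fun _ _ => rfl
      invFun := fun q => WithLp.toLp 2 (Fin.cons q.1 q.2.ofLp : Fin (k + 1) → ℝ)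
      left_inv := fun u => by
        ext i
        refine Fin.cases ?_ (fun i => ?_) i <;> rfl
      right_inv := fun q => rfl }

theorem euclideanCons_single_zero (k : ℕ) :
    euclideanCons k (EuclideanSpace.single 0 1) = (1, 0) := by
  refine Prod.ext ?_ ?_
  · change EuclideanSpace.single (0 : Fin (k + 1)) (1 : ℝ) 0 = 1
    simp
  · ext i
    change EuclideanSpace.single (0 : Fin (k + 1)) (1 : ℝ) i.succ = 0
    simp

theorem euclideanCons_single_succ (k : ℕ) (i : Fin k) :
    euclideanCons k (EuclideanSpace.single i.succ 1) = (0, EuclideanSpace.single i 1) := by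
  refine Prod.ext ?_ ?_
  · change EuclideanSpace.single (i.succ : Fin (k + 1)) (1 : ℝ) 0 = 0
    simp
  · ext l
    change EuclideanSpace.single (i.succ : Fin (k + 1)) (1 : ℝ) l.succ = EuclideanSpace.single i 1 l
    simp

theorem measurePreserving_euclideanCons (k : ℕ) :
    MeasurePreserving (euclideanCons k) volume volume := by
  have h1 := EuclideanSpace.volume_preserving_symm_measurableEquiv_toLp (Fin (k + 1))
  have h2 := volume_preserving_piFinSuccAbove (fun _ : Fin (k + 1) => ℝ) 0
  have h3 := (EuclideanSpace.volume_preserving_symm_measurableEquiv_toLp (Fin k)).symm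
  have h4 := (MeasurePreserving.id (volume : Measure ℝ)).prod h3
  exact h4.comp (h2.comp h1)

end Cons

section Tube

variable {k : ℕ} {M : Type u} [TopologicalSpace M] [T2Space M]
    [ChartedSpace (EuclideanSpace ℝ (Fin (k + 1))) M] [IsManifold (𝓡 (k + 1)) ∞ M]
    (g : Metric (k + 1) M) {m : M → ℝ} (hm : ContMDiff (𝓡 (k + 1)) 𝓘(ℝ, ℝ) ∞ m) {ϑ a b : ℝ}

include hm

/-- The parametrization of a tube of flow lines obtained from a slice chart of a level set. -/
theorem exists_tubeSlice {c : LocalParam (k + 1) (Subtype.val : level m ϑ → M) k}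
    {ρ : M → EuclideanSpace ℝ (Fin k)} {O : Set M} (hc : c.IsSlice ρ O)
    (hU : ∀ x ∈ c.σ '' c.W, ∀ t ∈ Ioo a b, FlowReaches g m ϑ t x) :
    ∃ (c' : LocalParam (k + 1) (id : M → M) (k + 1))
      (ρ' : M → EuclideanSpace ℝ (Fin (k + 1))) (O' : Set M), c'.IsSlice ρ' O' ∧
      c'.W = euclideanCons k ⁻¹' (Ioo a b ×ˢ c.W) ∧
      (∀ u, c'.σ u = flow g m ϑ (euclideanCons k u).1 (c.σ (euclideanCons k u).2)) ∧
      c'.σ '' c'.W = sweep g m ϑ a b (c.σ '' c.W) := by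
  let κ := euclideanCons k
  let W : Set (EuclideanSpace ℝ (Fin (k + 1))) := κ ⁻¹' (Ioo a b ×ˢ c.W)
  have hW : IsOpen W := (isOpen_Ioo.prod c.isOpen).preimage κ.continuous
  let σ : EuclideanSpace ℝ (Fin (k + 1)) → M := fun u => flow g m ϑ (κ u).1 (c.σ (κ u).2)
  have hr : ∀ u ∈ W, FlowReaches g m ϑ (κ u).1 (c.σ (κ u).2) := fun u hu =>
    hU _ ⟨_, hu.2, rfl⟩ _ hu.1
  have hσ : ContMDiffOn (𝓡 (k + 1)) (𝓡 (k + 1)) ∞ (id ∘ σ) W := by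
    intro u hu
    refine ContMDiffAt.contMDiffWithinAt ?_
    refine contMDiffAt_flow_comp g hm contMDiffAt_const
      (contDiff_fst.comp κ.contDiff).contMDiff.contMDiffAt ?_ (hr u hu)
    exact ContMDiffAt.comp (g := Subtype.val ∘ c.σ) u
      (c.smooth.contMDiffAt (c.isOpen.mem_nhds hu.2))
      (contDiff_snd.comp κ.contDiff).contMDiff.contMDiffAt
  let O' : Set M := {y | FlowReaches g m (m y) ϑ y ∧ flow g m (m y) ϑ y ∈ O}
  have hfl : ∀ y, FlowReaches g m (m y) ϑ y →
      ContMDiffAt (𝓡 (k + 1)) (𝓡 (k + 1)) ∞ (fun z => flow g m (m z) ϑ z) y := fun y hy =>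
    contMDiffAt_flow_comp g hm (hm y) contMDiffAt_const contMDiffAt_id hy
  have hO' : IsOpen O' := by
    refine isOpen_iff_mem_nhds.2 fun y hy => ?_
    exact inter_mem (eventually_flowReaches g hm (ϑ := m) (t := fun _ => ϑ) (x := id)
      hm.continuous.continuousAt continuousAt_const continuousAt_id hy.1)
      ((hfl y hy.1).continuousAt.preimage_mem_nhds (hc.isOpen.mem_nhds hy.2))
  let ρ' : M → EuclideanSpace ℝ (Fin (k + 1)) := fun y => κ.symm (m y, ρ (flow g m (m y) ϑ y))
  have hρ' : ContMDiffOn (𝓡 (k + 1)) (𝓡 (k + 1)) ∞ ρ' O' := by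
    intro y hy
    refine ContMDiffAt.contMDiffWithinAt ?_
    refine ContMDiffAt.comp (g := κ.symm) (I' := 𝓘(ℝ, ℝ × EuclideanSpace ℝ (Fin k))) y
      κ.symm.contDiff.contMDiff.contMDiffAt ?_
    refine ContMDiffAt.prodMk_space (hm y) ?_
    exact ContMDiffAt.comp (g := ρ) y (hc.smooth.contMDiffAt (hc.isOpen.mem_nhds hy.2)) (hfl y hy.1)
  have hback : ∀ u ∈ W, m (σ u) = (κ u).1 ∧ FlowReaches g m (m (σ u)) ϑ (σ u) ∧
      flow g m (m (σ u)) ϑ (σ u) = c.σ (κ u).2 := by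
    intro u hu
    have h1 : m (σ u) = (κ u).1 := m_flow_level g hm (hr u hu)
    rw [h1]
    exact ⟨rfl, (hr u hu).symm hm⟩
  have hmem : ∀ u ∈ W, id (σ u) ∈ O' := fun u hu => by
    obtain ⟨h1, h2, h3⟩ := hback u hu
    refine ⟨h2, ?_⟩
    rw [id, h3]
    exact hc.mem _ hu.2
  have hl : ∀ u ∈ W, ρ' (id (σ u)) = u := fun u hu => by
    obtain ⟨h1, h2, h3⟩ := hback u hu
    change κ.symm (m (σ u), ρ (flow g m (m (σ u)) ϑ (σ u))) = u
    rw [h3, h1, hc.leftInv _ hu.2]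
    exact κ.symm_apply_apply u
  have himg : σ '' W = sweep g m ϑ a b (c.σ '' c.W) := by
    ext y
    constructor
    · rintro ⟨u, hu, rfl⟩
      simp only [sweep, mem_iUnion]
      exact ⟨_, hu.1, _, ⟨_, ⟨_, hu.2, rfl⟩, rfl⟩, rfl⟩
    · intro hy
      simp only [sweep, mem_iUnion] at hy
      obtain ⟨r, hr, _, ⟨_, ⟨v, hv, rfl⟩, rfl⟩, rfl⟩ := hy
      refine ⟨κ.symm (r, v), ?_, ?_⟩
      · change κ (κ.symm (r, v)) ∈ Ioo a b ×ˢ c.W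
        rw [κ.apply_symm_apply]
        exact ⟨hr, hv⟩
      · change flow g m ϑ (κ (κ.symm (r, v))).1 (c.σ (κ (κ.symm (r, v))).2) = _
        rw [κ.apply_symm_apply]
  refine ⟨_, ρ', O', LocalParam.isSlice_ofLeftInverse (j := id) hW hσ hO' hρ' hmem hl ?_, rfl,
    fun u => rfl, himg⟩
  rw [himg]
  exact isOpen_sweep g hm hc.isOpen_image hU

theorem density_tubeSlice {c : LocalParam (k + 1) (Subtype.val : level m ϑ → M) k}
    (hU : ∀ x ∈ c.σ '' c.W, ∀ t ∈ Ioo a b, FlowReaches g m ϑ t x)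
    {c' : LocalParam (k + 1) (id : M → M) (k + 1)}
    (hσ : ∀ u, c'.σ u = flow g m ϑ (euclideanCons k u).1 (c.σ (euclideanCons k u).2))
    {u : EuclideanSpace ℝ (Fin (k + 1))} (hu : euclideanCons k u ∈ Ioo a b ×ˢ c.W) :
    c'.density g u = flowJac g m ((euclideanCons k u).1 - ϑ) (c.σ (euclideanCons k u).2) *
      (flowWeight g m ϑ ϑ (c.σ (euclideanCons k u).2) * c.density g (euclideanCons k u).2) := by
  let κ := euclideanCons k
  let E := EuclideanSpace ℝ (Fin (k + 1))
  set t := (euclideanCons k u).1 with ht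
  set v := (euclideanCons k u).2 with hv
  set x : M := (c.σ v : M) with hx
  have hr : FlowReaches g m ϑ t x := hU _ ⟨_, hu.2, rfl⟩ _ hu.1
  have hcrit := (hr.notCrit hm).1
  let X : E := normGradE g m x
  let C : E →L[ℝ] E := flowDiff g m (t - ϑ) x
  have hcd : HasMFDerivAt (𝓡 k) (𝓡 (k + 1)) (Subtype.val ∘ c.σ) v (c.diff v) :=
    ((c.smooth.contMDiffAt (c.isOpen.mem_nhds hu.2)).mdifferentiableAt (by simp)).hasMFDerivAt
  let A : E →L[ℝ] E := ((ContinuousLinearMap.fst ℝ ℝ (EuclideanSpace ℝ (Fin k))).comp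
      (κ : E →L[ℝ] ℝ × EuclideanSpace ℝ (Fin k))).smulRight X + (c.diff v).comp
      ((ContinuousLinearMap.snd ℝ ℝ (EuclideanSpace ℝ (Fin k))).comp
          (κ : E →L[ℝ] ℝ × EuclideanSpace ℝ (Fin k)))
  have hA : ∀ w, A w = (κ w).1 • X + c.diff v (κ w).2 := fun w => rfl
  have hdiff : ∀ w, c'.diff u w = C (A w) := by
    intro w
    have k0 : HasMFDerivAt (𝓘(ℝ, ℝ).prod (𝓡 (k + 1))) (𝓡 (k + 1))
        (fun q : ℝ × M => flow g m ϑ q.1 q.2) (t, x) _ :=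
      ((contMDiffAt_flow_comp g hm (ϑ := fun _ : ℝ × M => ϑ) contMDiffAt_const contMDiffAt_fst
      contMDiffAt_snd hr).mdifferentiableAt (by simp)).hasMFDerivAt
    have k1 : HasMFDerivAt 𝓘(ℝ, E) 𝓘(ℝ, ℝ) (fun u : E => (κ u).1) u
        ((ContinuousLinearMap.fst ℝ ℝ (EuclideanSpace ℝ (Fin k))).comp
          (κ : E →L[ℝ] ℝ × EuclideanSpace ℝ (Fin k))) :=
      ContinuousLinearMap.hasMFDerivAt (E := E)
        ((ContinuousLinearMap.fst ℝ ℝ (EuclideanSpace ℝ (Fin k))).comp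
          (κ : E →L[ℝ] ℝ × EuclideanSpace ℝ (Fin k)))
    have k2 : HasMFDerivAt 𝓘(ℝ, E) (𝓡 k) (fun u : E => (κ u).2) u
        ((ContinuousLinearMap.snd ℝ ℝ (EuclideanSpace ℝ (Fin k))).comp
          (κ : E →L[ℝ] ℝ × EuclideanSpace ℝ (Fin k))) :=
      ContinuousLinearMap.hasMFDerivAt (E := E)
        ((ContinuousLinearMap.snd ℝ ℝ (EuclideanSpace ℝ (Fin k))).comp
          (κ : E →L[ℝ] ℝ × EuclideanSpace ℝ (Fin k)))
    have k3 := HasMFDerivAt.comp (g := Subtype.val ∘ c.σ) u hcd k2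
    have k4 := HasMFDerivAt.comp (g := fun q : ℝ × M => flow g m ϑ q.1 q.2) u k0 (k1.prodMk k3)
    have k5 : HasMFDerivAt 𝓘(ℝ, E) (𝓡 (k + 1)) (id ∘ c'.σ) u _ :=
      k4.congr_of_eventuallyEq (Filter.EventuallyEq.of_eq (funext hσ))
    have k6 : c'.diff u w = _ := DFunLike.congr_fun k5.mfderiv w
    rw [k6]
    exact mfderiv_flow_prod g hm hr (κ w).1 (c.diff v (κ w).2)
  let D : E →L[ℝ] ℝ := mfderiv (𝓡 (k + 1)) 𝓘(ℝ, ℝ) m x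
  have hDX : D X = 1 := mfderiv_normGrad g hcrit
  have hDc : ∀ w, D (c.diff v w) = 0 := by
    intro w
    have k1 : HasMFDerivAt (𝓡 (k + 1)) 𝓘(ℝ, ℝ) m x D :=
      (hm.mdifferentiableAt (by simp)).hasMFDerivAt
    have k2 := HasMFDerivAt.comp (g := m) v k1 hcd
    have k3 : m ∘ (Subtype.val ∘ c.σ) = fun _ => ϑ := funext fun y => (c.σ y).2
    have k4 := k2.congr_of_eventuallyEq (Filter.EventuallyEq.of_eq k3.symm)
    exact DFunLike.congr_fun (hasMFDerivAt_unique k4 (hasMFDerivAt_const ϑ v)) w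
  have hAinj : Function.Injective A.toLinearMap := by
    rw [← LinearMap.ker_eq_bot, LinearMap.ker_eq_bot']
    intro w hw
    have h1 : A w = 0 := hw
    rw [hA] at h1
    have h2 := congrArg D h1
    rw [map_add, map_smul, hDX, hDc, map_zero, add_zero, smul_eq_mul, mul_one] at h2
    rw [h2, zero_smul, zero_add] at h1
    have h3 : (κ w).2 = 0 := by
      refine c.immersion v hu.2 ?_
      exact h1.trans (map_zero (c.diff v)).symm
    exact κ.map_eq_zero_iff.1 (Prod.ext h2 h3)
  let bs := (EuclideanSpace.basisFun (Fin (k + 1)) ℝ).toBasis.map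
    (LinearEquiv.ofInjectiveEndo A.toLinearMap hAinj)
  have hbs : ∀ i, bs i = A (EuclideanSpace.single i 1) := fun i => by
    simp [bs]
  have hbs2 : (bs : Fin (k + 1) → E) =
      Fin.cons X (fun i => c.diff v (EuclideanSpace.single i 1)) := by
    ext1 i
    rw [hbs, hA]
    refine Fin.cases ?_ (fun i => ?_) i
    · rw [Fin.cons_zero, show κ (EuclideanSpace.single 0 1) = (1, 0) from
        euclideanCons_single_zero k, one_smul, map_zero, add_zero]
    · rw [Fin.cons_succ,
        show κ (EuclideanSpace.single i.succ 1) = (0, EuclideanSpace.single i 1) from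
        euclideanCons_single_succ k i, zero_smul, zero_add]
  have hpos := gram_det_pos (isInnerForm_form g x) bs.linearIndependent
  have hJ : flowJac g m (t - ϑ) x = _ := absDet_eq (isInnerForm_form g x)
    (isInnerForm_form g (flow g m 0 (t - ϑ) x)) C.toLinearMap bs
  rw [c'.density_eq, hσ, hJ, flowWeight_self g hm hcrit, c.density_eq]
  change _ = _ * (_ * Real.sqrt (gram (form g x) _).det)
  rw [← Real.sqrt_mul (form_normGrad_pos g hcrit).le, ← gram_cons_orthogonal _ _
    (fun i => form_normGrad_left g (hDc _)), ← Real.sqrt_mul (div_nonneg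
      (gram_det_nonneg (isInnerForm_form g _) _) hpos.le)]
  have e1 : (Fin.cons (normGradE g m x) fun i => c.diff v (EuclideanSpace.single i 1) :
    Fin (k + 1) → E) = bs := hbs2.symm
  rw [e1, div_mul_cancel₀ _ hpos.ne']
  have e2 : (fun i => c'.diff u (EuclideanSpace.single i 1)) = fun i => C.toLinearMap (bs i) := by
    ext1 i
    rw [hdiff, hbs]
    rfl
  rw [e2, ← flow_eq_zero hm]
  rfl

end Tube

section FlowMeasurable

variable {d : ℕ} {M : Type u} [TopologicalSpace M] [ChartedSpace (EuclideanSpace ℝ (Fin d)) M]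
  [IsManifold (𝓡 d) ∞ M] (g : Metric d M) {m : M → ℝ} [T2Space M]
  (hm : ContMDiff (𝓡 d) 𝓘(ℝ, ℝ) ∞ m) {ϑ : ℝ}

/-- The pairs `(t, x)` such that the flow line of `x`, which is at `x` at time `ϑ`, exists up to
time `t`. -/
def reachSet (m : M → ℝ) (ϑ : ℝ) : Set (ℝ × M) := {q | FlowReaches g m ϑ q.1 q.2}

/-- The density of the Riemannian measure in the coordinates `(t, x)`, where `J_ϑ` carries the
measure `ψ_ϑ(ϑ, ·) ν_ϑ`; it is set to zero where the flow is not defined. -/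
def tubeDensity (m : M → ℝ) (ϑ : ℝ) : ℝ × M → ℝ≥0∞ :=
  (reachSet g m ϑ).indicator fun q => ENNReal.ofReal (flowJac g m (q.1 - ϑ) q.2)

include hm

theorem isOpen_reachSet : IsOpen (reachSet g m ϑ) :=
  isOpen_iff_mem_nhds.2 fun _ hq => eventually_flowReaches g hm (ϑ := fun _ => ϑ) (t := Prod.fst)
    (x := Prod.snd) continuousAt_const continuousAt_fst continuousAt_snd hq

theorem continuousOn_flow : ContinuousOn (fun q : ℝ × M => flow g m ϑ q.1 q.2) (reachSet g m ϑ) :=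
  fun _ hq => (contMDiffAt_flow_comp g hm (ϑ := fun _ : ℝ × M => ϑ) (t := Prod.fst) (x := Prod.snd)
    contMDiffAt_const contMDiffAt_fst contMDiffAt_snd hq).continuousAt.continuousWithinAt

theorem continuousOn_flowJac : ContinuousOn (fun q : ℝ × M => flowJac g m (q.1 - ϑ) q.2)
    (reachSet g m ϑ) :=
  fun _ hq => (contMDiffAt_flowJac_comp g hm (τ := fun q : ℝ × M => q.1 - ϑ) (x := Prod.snd)
    (contMDiffAt_fst.sub contMDiffAt_const) contMDiffAt_snd
    ((flowReaches_iff_zero hm).1 hq)).continuousAt.continuousWithinAt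

theorem continuous_flowWeight_self (hreg : ∀ x, m x = ϑ → ¬ IsCrit d m x) :
    Continuous (fun x : level m ϑ => flowWeight g m ϑ ϑ x) := by
  have h : (fun x : level m ϑ => flowWeight g m ϑ ϑ x) =
      fun x : level m ϑ => Real.sqrt (form g x.1 (normGradE g m x.1) (normGradE g m x.1)) :=
    funext fun x => flowWeight_self g hm (hreg x.1 x.2)
  rw [h]
  exact Real.continuous_sqrt.comp
    ((continuousOn_form_normGrad g hm).comp_continuous continuous_subtype_val
      fun x => hreg x.1 x.2)

variable [SecondCountableTopology M] [MeasurableSpace M] [BorelSpace M]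

/-- The flow is the identity off the open set where it is defined, so that it is measurable
everywhere. -/
theorem measurable_flow : Measurable (fun q : ℝ × M => flow g m ϑ q.1 q.2) := by
  classical
  have h : (fun q : ℝ × M => flow g m ϑ q.1 q.2) =
      (reachSet g m ϑ).piecewise (fun q : ℝ × M => flow g m ϑ q.1 q.2) Prod.snd := by
    ext q
    by_cases hq : q ∈ reachSet g m ϑ
    · rw [piecewise_eq_of_mem _ _ _ hq]
    · rw [piecewise_eq_of_notMem _ _ _ hq]
      exact dif_neg hq
  rw [h]
  exact ContinuousOn.measurable_piecewise (continuousOn_flow g hm) continuous_snd.continuousOn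
    (isOpen_reachSet g hm).measurableSet

theorem measurable_tubeDensity : Measurable (tubeDensity g m ϑ) := by
  classical
  have h : tubeDensity g m ϑ = (reachSet g m ϑ).piecewise
      (fun q => ENNReal.ofReal (flowJac g m (q.1 - ϑ) q.2)) (fun _ => 0) := by
    ext q
    simp [tubeDensity, indicator, piecewise]
  rw [h]
  exact ContinuousOn.measurable_piecewise
    (ENNReal.continuous_ofReal.comp_continuousOn (continuousOn_flowJac g hm))
    continuous_const.continuousOn (isOpen_reachSet g hm).measurableSet

end FlowMeasurable

section LevelMeasure

set_option linter.unusedSectionVars false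

variable {k : ℕ} {M : Type u} [TopologicalSpace M] [T2Space M] [SecondCountableTopology M]
    [ChartedSpace (EuclideanSpace ℝ (Fin (k + 1))) M] [IsManifold (𝓡 (k + 1)) ∞ M]
    [MeasurableSpace M] [BorelSpace M]
    (g : Metric (k + 1) M) {m : M → ℝ} (hm : ContMDiff (𝓡 (k + 1)) 𝓘(ℝ, ℝ) ∞ m) {ϑ a b : ℝ}
    (hreg : ∀ x, m x = ϑ → ¬ IsCrit (k + 1) m x)

include hm hreg

theorem lintegral_levelMeasure_slice {c : LocalParam (k + 1) (Subtype.val : level m ϑ → M) k}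
    {ρ : M → EuclideanSpace ℝ (Fin k)} {O : Set M} (hc : c.IsSlice ρ O) {h : level m ϑ → ℝ≥0∞}
    (hh : Measurable h) :
    ∫⁻ x in c.σ '' c.W, h x ∂levelMeasure g m ϑ = ∫⁻ y in c.W, ENNReal.ofReal (c.density g y) *
      (ENNReal.ofReal (flowWeight g m ϑ ϑ (c.σ y)) * h (c.σ y)) := by
  have h1 : levelMeasure g m ϑ = (riemannianMeasure g (Subtype.val : level m ϑ → M) k).withDensity
    fun x => ENNReal.ofReal (flowWeight g m ϑ ϑ x) := rfl
  have h2 : Measurable fun x : level m ϑ => ENNReal.ofReal (flowWeight g m ϑ ϑ x) :=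
    (continuous_flowWeight_self g hm hreg).measurable.ennreal_ofReal
  rw [h1, restrict_withDensity hc.isOpen_image.measurableSet,
    riemannianMeasure_restrict g hc IsInducing.subtypeVal,
    lintegral_withDensity_eq_lintegral_mul _ h2 hh,
    c.lintegral_measure g IsInducing.subtypeVal (h2.mul hh)]
  rfl

/-- Points of a regular level set have small slice neighbourhoods of finite measure. -/
theorem exists_small_levelSlice (x : level m ϑ) {V : Set (level m ϑ)} (hV : IsOpen V)
    (hxV : x ∈ V) :
    ∃ (c : LocalParam (k + 1) (Subtype.val : level m ϑ → M) k)
      (ρ : M → EuclideanSpace ℝ (Fin k)) (O : Set M), c.IsSlice ρ O ∧ x ∈ c.σ '' c.W ∧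
      c.σ '' c.W ⊆ V ∧ levelMeasure g m ϑ (c.σ '' c.W) < ⊤ := by
  obtain ⟨c₀, ρ, O, hc₀, hx₀⟩ := exists_levelSlice hm x (hreg x.1 x.2)
  have hcont := continuous_flowWeight_self g hm hreg
  let V' := V ∩ {y | flowWeight g m ϑ ϑ y < flowWeight g m ϑ ϑ x + 1}
  have hV' : IsOpen V' := hV.inter (isOpen_lt hcont continuous_const)
  obtain ⟨c, hc, hx, hcV, hfin⟩ := hc₀.exists_small g IsInducing.subtypeVal hx₀ hV' ⟨hxV,
    lt_add_one (flowWeight g m ϑ ϑ x)⟩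
  refine ⟨c, ρ, O, hc, hx, hcV.trans inter_subset_left, ?_⟩
  have h1 : levelMeasure g m ϑ = (riemannianMeasure g (Subtype.val : level m ϑ → M) k).withDensity
    fun x => ENNReal.ofReal (flowWeight g m ϑ ϑ x) := rfl
  rw [h1, withDensity_apply _ hc.isOpen_image.measurableSet]
  refine (setLIntegral_mono' (g := fun _ => ENNReal.ofReal (flowWeight g m ϑ ϑ x + 1))
    hc.isOpen_image.measurableSet fun y hy =>
      ENNReal.ofReal_le_ofReal (hcV hy).2.le).trans_lt ?_
  rw [setLIntegral_const]
  exact ENNReal.mul_lt_top ENNReal.ofReal_lt_top hfin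

theorem isLocallyFiniteMeasure_levelMeasure : IsLocallyFiniteMeasure (levelMeasure g m ϑ) :=
  ⟨fun x => by
    obtain ⟨c, ρ, O, hc, hx, -, hfin⟩ :=
      exists_small_levelSlice g hm hreg x isOpen_univ (mem_univ x)
    exact ⟨_, hc.isOpen_image.mem_nhds hx, hfin⟩⟩

theorem isOpenPosMeasure_levelMeasure : (levelMeasure g m ϑ).IsOpenPosMeasure := by
  refine ⟨fun V hV hne h0 => ?_⟩
  obtain ⟨x, hxV⟩ := hne
  obtain ⟨c, ρ, O, hc, ⟨y₀, hy₀, -⟩, hcV, -⟩ := exists_small_levelSlice g hm hreg x hV hxV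
  have h1 : ∫⁻ x in c.σ '' c.W, 1 ∂levelMeasure g m ϑ = 0 := by
    rw [setLIntegral_one]
    exact measure_mono_null hcV h0
  rw [lintegral_levelMeasure_slice g hm hreg hc measurable_const] at h1
  simp only [mul_one] at h1
  have h2 : AEMeasurable (fun y => ENNReal.ofReal (c.density g y) *
      ENNReal.ofReal (flowWeight g m ϑ ϑ (c.σ y))) (volume.restrict c.W) := by
    refine (c.aemeasurable_density g).mul ?_
    exact ((continuous_flowWeight_self g hm hreg).measurable.ennreal_ofReal).comp_aemeasurable
      ((c.continuousOn_σ IsInducing.subtypeVal).aemeasurable c.isOpen.measurableSet)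
  have h3 := (ae_restrict_iff' c.isOpen.measurableSet).1 ((lintegral_eq_zero_iff' h2).1 h1)
  have h4 : volume c.W = 0 := by
    refine measure_mono_null ?_ h3
    intro y hy h
    have hr : FlowReaches g m ϑ ϑ (c.σ y) := (flowReaches_iff_zero hm).2 (by
      rw [sub_self]
      exact (flow_zero_of_notCrit g hm (hreg _ (c.σ y).2)).1)
    rcases mul_eq_zero.1 (h hy) with h5 | h5
    · exact (c.density_pos g hy).not_ge (ENNReal.ofReal_eq_zero.1 h5)
    · exact (flowWeight_pos g hm hr).not_ge (ENNReal.ofReal_eq_zero.1 h5)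
  exact (c.isOpen.measure_pos volume ⟨y₀, hy₀⟩).ne' h4

/-- The Riemannian measure of the tube over a slice chart of a level set. -/
theorem restrict_sweep_slice {c : LocalParam (k + 1) (Subtype.val : level m ϑ → M) k}
    {ρ : M → EuclideanSpace ℝ (Fin k)} {O : Set M} (hc : c.IsSlice ρ O)
    (hU : ∀ x ∈ c.σ '' c.W, ∀ t ∈ Ioo a b, FlowReaches g m ϑ t x) :
    (riemannianMeasure g (id : M → M) (k + 1)).restrict (sweep g m ϑ a b (c.σ '' c.W)) =
      (((volume.restrict (Ioo a b)).prod ((levelMeasure g m ϑ).restrict (c.σ '' c.W))).withDensity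
        fun q => tubeDensity g m ϑ (q.1, q.2)).map fun q => flow g m ϑ q.1 q.2 := by
  have := isLocallyFiniteMeasure_levelMeasure g hm hreg
  obtain ⟨c', ρ', O', hc', hW', hσ', himg⟩ := exists_tubeSlice g hm hc hU
  have hι : Measurable (fun q : ℝ × level m ϑ => ((q.1, q.2.1) : ℝ × M)) := by fun_prop
  have hF : Measurable (fun q : ℝ × level m ϑ => flow g m ϑ q.1 q.2) :=
    (measurable_flow g hm (ϑ := ϑ)).comp hι
  have hw : Measurable (fun q : ℝ × level m ϑ => tubeDensity g m ϑ (q.1, q.2)) :=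
    (measurable_tubeDensity g hm (ϑ := ϑ)).comp hι
  refine Measure.ext fun A hA => ?_
  have hI : Measurable (A.indicator (1 : M → ℝ≥0∞)) := measurable_one.indicator hA
  have hIF : Measurable (fun q : ℝ × level m ϑ => A.indicator (1 : M → ℝ≥0∞)
    (flow g m ϑ q.1 q.2)) := hI.comp hF
  have hcσ := (c.continuousOn_σ IsInducing.subtypeVal).aemeasurable (μ := volume)
    c.isOpen.measurableSet
  rw [← himg, riemannianMeasure_restrict g hc' IsInducing.id, ← lintegral_indicator_one hA,
    ← lintegral_indicator_one hA, c'.lintegral_measure g IsInducing.id hI]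
  rw [lintegral_map hI hF, lintegral_withDensity_eq_lintegral_mul _ hw hIF,
    lintegral_prod _ (hw.mul hIF).aemeasurable]
  have e1 : ∀ t, ∫⁻ x in c.σ '' c.W, tubeDensity g m ϑ (t, x) *
      A.indicator 1 (flow g m ϑ t x) ∂levelMeasure g m ϑ =
      ∫⁻ y in c.W, ENNReal.ofReal (c.density g y) * (ENNReal.ofReal (flowWeight g m ϑ ϑ (c.σ y)) *
        (tubeDensity g m ϑ (t, c.σ y) * A.indicator 1 (flow g m ϑ t (c.σ y)))) := fun t =>
    lintegral_levelMeasure_slice g hm hreg hc ((hw.mul hIF).comp measurable_prodMk_left)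
  refine Eq.trans ?_ (lintegral_congr fun t => (e1 t).symm)
  have hsnd : AEMeasurable (fun q : ℝ × EuclideanSpace ℝ (Fin k) => c.σ q.2)
      ((volume.restrict (Ioo a b)).prod (volume.restrict c.W)) := hcσ.comp_snd
  have hpair : AEMeasurable
      (fun q : ℝ × EuclideanSpace ℝ (Fin k) => ((q.1, c.σ q.2) : ℝ × level m ϑ))
      ((volume.restrict (Ioo a b)).prod (volume.restrict c.W)) :=
    measurable_fst.aemeasurable.prodMk hsnd
  have hG : AEMeasurable (fun q : ℝ × EuclideanSpace ℝ (Fin k) => ENNReal.ofReal (c.density g q.2) *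
      (ENNReal.ofReal (flowWeight g m ϑ ϑ (c.σ q.2)) *
        (tubeDensity g m ϑ (q.1, c.σ q.2) * A.indicator 1 (flow g m ϑ q.1 (c.σ q.2)))))
      ((volume.restrict (Ioo a b)).prod (volume.restrict c.W)) := by
    refine ((c.aemeasurable_density g).comp_snd).mul (AEMeasurable.mul ?_ ?_)
    · exact (continuous_flowWeight_self g hm hreg).measurable.ennreal_ofReal.comp_aemeasurable hsnd
    · exact (hw.mul hIF).comp_aemeasurable hpair
  have hmp := measurePreserving_euclideanCons k
  have hemb : MeasurableEmbedding (euclideanCons k) :=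
    (euclideanCons k).toHomeomorph.measurableEmbedding
  refine Eq.trans ?_ (lintegral_prod _ hG)
  rw [Measure.prod_restrict, hW']
  refine Eq.trans ?_ (hmp.setLIntegral_comp_preimage_emb hemb _ _)
  refine setLIntegral_congr_fun ((isOpen_Ioo.prod c.isOpen).preimage
    (euclideanCons k).continuous).measurableSet fun u hu => ?_
  have hu' : euclideanCons k u ∈ Ioo a b ×ˢ c.W := hu
  have hr : FlowReaches g m ϑ (euclideanCons k u).1 (c.σ (euclideanCons k u).2) :=
    hU _ ⟨_, hu'.2, rfl⟩ _ hu'.1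
  have hJ := flowJac_pos g hm ((flowReaches_iff_zero hm).1 hr)
  rw [density_tubeSlice g hm hU hσ' hu', hσ', tubeDensity, indicator_of_mem (show
    ((euclideanCons k u).1, (c.σ (euclideanCons k u).2 : M)) ∈ reachSet g m ϑ from hr),
    ENNReal.ofReal_mul hJ.le, ENNReal.ofReal_mul
      (flowWeight_pos g hm (hr.self hm).1).le]
  ring

/-- Fubini's theorem for the flow: the Riemannian measure of a tube of flow lines. -/
theorem restrict_sweep {U : Set (level m ϑ)} (hUo : IsOpen U)
    (hU : ∀ x ∈ U, ∀ t ∈ Ioo a b, FlowReaches g m ϑ t x) :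
    (riemannianMeasure g (id : M → M) (k + 1)).restrict (sweep g m ϑ a b U) =
      (((volume.restrict (Ioo a b)).prod ((levelMeasure g m ϑ).restrict U)).withDensity
        fun q => tubeDensity g m ϑ (q.1, q.2)).map fun q => flow g m ϑ q.1 q.2 := by
  have := isLocallyFiniteMeasure_levelMeasure g hm hreg
  have hι : Measurable (fun q : ℝ × level m ϑ => ((q.1, q.2.1) : ℝ × M)) := by fun_prop
  have hF : Measurable (fun q : ℝ × level m ϑ => flow g m ϑ q.1 q.2) :=
    (measurable_flow g hm (ϑ := ϑ)).comp hι
  set F := fun q : ℝ × level m ϑ => flow g m ϑ q.1 q.2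
  set τ := fun q : ℝ × level m ϑ => tubeDensity g m ϑ (q.1, q.2)
  have hch : ∀ x : U, ∃ (c : LocalParam (k + 1) (Subtype.val : level m ϑ → M) k)
      (ρ : M → EuclideanSpace ℝ (Fin k)) (O : Set M), c.IsSlice ρ O ∧ x.1 ∈ c.σ '' c.W ∧
      c.σ '' c.W ⊆ U := fun x => by
    obtain ⟨c, ρ, O, h1, h2, h3, -⟩ := exists_small_levelSlice g hm hreg x.1 hUo x.2
    exact ⟨c, ρ, O, h1, h2, h3⟩
  choose c ρ O hc hxc hcU using hch
  obtain ⟨T, hT, hTU⟩ := TopologicalSpace.isOpen_iUnion_countable (fun x : U => (c x).σ '' (c x).W)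
    fun x => (hc x).isOpen_image
  have hcov : ⋃ x ∈ T, (c x).σ '' (c x).W = U := by
    rw [hTU]
    refine Subset.antisymm (iUnion_subset hcU) fun x hx => mem_iUnion.2 ⟨⟨x, hx⟩, hxc _⟩
  have hsw : sweep g m ϑ a b U = ⋃ x ∈ T, sweep g m ϑ a b ((c x).σ '' (c x).W) := by
    conv_lhs => rw [← hcov]
    ext y
    simp only [sweep, mem_iUnion, mem_image]
    constructor
    · rintro ⟨r, hr, _, ⟨z, ⟨i, hi, v, hv, rfl⟩, rfl⟩, rfl⟩
      exact ⟨i, hi, r, hr, _, ⟨_, ⟨v, hv, rfl⟩, rfl⟩, rfl⟩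
    · rintro ⟨i, hi, r, hr, _, ⟨_, ⟨v, hv, rfl⟩, rfl⟩, rfl⟩
      exact ⟨r, hr, _, ⟨_, ⟨i, hi, v, hv, rfl⟩, rfl⟩, rfl⟩
  have hSo := (isOpen_sweep g hm hUo hU).measurableSet
  set lam := (((volume.restrict (Ioo a b)).prod ((levelMeasure g m ϑ).restrict U)).withDensity
    τ).map F
  have hlam : lam.restrict (sweep g m ϑ a b U) = lam := by
    refine Measure.restrict_eq_self_of_ae_mem ?_
    refine (ae_map_iff hF.aemeasurable (p := fun y => y ∈ sweep g m ϑ a b U) hSo).2 ?_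
    refine (withDensity_absolutelyContinuous _ _).ae_le ?_
    rw [Measure.prod_restrict]
    refine ae_restrict_of_forall_mem (measurableSet_Ioo.prod hUo.measurableSet) ?_
    rintro ⟨t, x⟩ ⟨ht, hx⟩
    simp only [sweep, mem_iUnion]
    exact ⟨t, ht, x, ⟨x, hx, rfl⟩, rfl⟩
  rw [← hlam, hsw]
  refine (Measure.restrict_biUnion_congr hT).2 fun i _ => ?_
  have hUi : ∀ x ∈ (c i).σ '' (c i).W, ∀ t ∈ Ioo a b, FlowReaches g m ϑ t x :=
    fun x hx => hU x (hcU i hx)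
  have hSi := (isOpen_sweep g hm (hc i).isOpen_image hUi).measurableSet
  rw [restrict_sweep_slice g hm hreg (hc i) hUi, Measure.restrict_map hF hSi,
    restrict_withDensity (hF hSi)]
  congr 2
  rw [Measure.prod_restrict, Measure.prod_restrict, Measure.restrict_restrict (hF hSi)]
  congr 1
  ext ⟨t, x⟩
  constructor
  · rintro ⟨ht, hx⟩
    refine ⟨?_, ht, hcU i hx⟩
    simp only [mem_preimage, sweep, mem_iUnion]
    exact ⟨t, ht, x, ⟨x, hx, rfl⟩, rfl⟩
  · rintro ⟨h1, ht, hx⟩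
    obtain ⟨-, -, y, hy, hxy⟩ := (mem_sweep_iff g hm hUi).1 h1
    have hr := hU x hx t ht
    have h2 : m (flow g m ϑ t x) = t := m_flow_level g hm hr
    simp only [F, h2, (hr.symm hm).2] at hxy
    refine ⟨ht, ?_⟩
    rwa [← Subtype.ext hxy]

end LevelMeasure

/-! ### Functions on a tube in flow coordinates -/

section Hat

set_option linter.unusedSectionVars false

variable {d : ℕ} {M : Type u} [TopologicalSpace M] [ChartedSpace (EuclideanSpace ℝ (Fin d)) M]
  [IsManifold (𝓡 d) ∞ M] (g : Metric d M) {m : M → ℝ}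

/-- A tube of flow lines: all flow lines that start in the open subset `U` of the regular level set
`J_ϑ` exist for all times in `(a, b)`. -/
structure IsTube (m : M → ℝ) (ϑ a b : ℝ) (U : Set (level m ϑ)) : Prop where
  isOpen : IsOpen U
  reaches : ∀ x ∈ U, ∀ t ∈ Ioo a b, FlowReaches g m ϑ t x
  regular : ∀ x, m x = ϑ → ¬ IsCrit d m x

/-- A function `f` in the coordinates `(t, x)` of a tube, multiplied by the power of the density
that makes the passage to these coordinates isometric in `L^p`, and extended by zero. -/
def hat (m : M → ℝ) (p : ℝ≥0∞) (ϑ : ℝ) (U : Set (level m ϑ)) (f : M → ℝ) (t : ℝ) :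
    level m ϑ → ℝ :=
  U.indicator fun x => flowJac g m (t - ϑ) x ^ (1 / p.toReal) * f (flow g m ϑ t x)

variable {g} {ϑ a b : ℝ} {U : Set (level m ϑ)} {p : ℝ≥0∞}

theorem hat_of_mem {f : M → ℝ} {t : ℝ} {x : level m ϑ} (hx : x ∈ U) :
    hat g m p ϑ U f t x = flowJac g m (t - ϑ) x ^ (1 / p.toReal) * f (flow g m ϑ t x) :=
  indicator_of_mem hx _

theorem hat_of_notMem {f : M → ℝ} {t : ℝ} {x : level m ϑ} (hx : x ∉ U) :
    hat g m p ϑ U f t x = 0 :=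
  indicator_of_notMem hx _

theorem toReal_pos_of_fact [hp1 : Fact (1 ≤ p)] (hp : p ≠ ⊤) : 0 < p.toReal :=
  ENNReal.toReal_pos (zero_lt_one.trans_le hp1.out).ne' hp

variable (hd : 1 ≤ d) [T2Space M] [SecondCountableTopology M] [MeasurableSpace M] [BorelSpace M]
  (hm : ContMDiff (𝓡 d) 𝓘(ℝ, ℝ) ∞ m)

section

include hd hm

theorem sigmaFinite_levelMeasure (hreg : ∀ x, m x = ϑ → ¬ IsCrit d m x) :
    SigmaFinite (levelMeasure g m ϑ) := by
  obtain ⟨k, rfl⟩ := Nat.exists_eq_add_of_le' hd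
  have := isLocallyFiniteMeasure_levelMeasure g hm hreg
  infer_instance

theorem isFiniteMeasure_levelMeasure (hreg : ∀ x, m x = ϑ → ¬ IsCrit d m x)
    (hc : CompactSpace (level m ϑ)) : IsFiniteMeasure (levelMeasure g m ϑ) := by
  obtain ⟨k, rfl⟩ := Nat.exists_eq_add_of_le' hd
  have := isLocallyFiniteMeasure_levelMeasure g hm hreg
  infer_instance

theorem isOpenPos_levelMeasure (hreg : ∀ x, m x = ϑ → ¬ IsCrit d m x) :
    (levelMeasure g m ϑ).IsOpenPosMeasure := by
  obtain ⟨k, rfl⟩ := Nat.exists_eq_add_of_le' hd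
  exact isOpenPosMeasure_levelMeasure g hm hreg

theorem IsTube.restrict_sweep (h : IsTube g m ϑ a b U) :
    (riemannianMeasure g (id : M → M) d).restrict (sweep g m ϑ a b U) =
      (((volume.restrict (Ioo a b)).prod ((levelMeasure g m ϑ).restrict U)).withDensity
        fun q => tubeDensity g m ϑ (q.1, q.2)).map fun q => flow g m ϑ q.1 q.2 := by
  obtain ⟨k, rfl⟩ := Nat.exists_eq_add_of_le' hd
  exact Hestenes.restrict_sweep g hm h.regular h.isOpen h.reaches

end

section

include hm

theorem measurable_flow_level : Measurable (fun q : ℝ × level m ϑ => flow g m ϑ q.1 q.2) :=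
  (measurable_flow g hm).comp (by fun_prop : Measurable fun q : ℝ × level m ϑ => (q.1, q.2.1))

theorem measurable_tubeDensity_level :
    Measurable (fun q : ℝ × level m ϑ => tubeDensity g m ϑ (q.1, q.2)) :=
  (measurable_tubeDensity g hm).comp
    (by fun_prop : Measurable fun q : ℝ × level m ϑ => (q.1, q.2.1))

end

theorem IsTube.tubeDensity_eq (h : IsTube g m ϑ a b U) {t : ℝ} (ht : t ∈ Ioo a b) {x : level m ϑ}
    (hx : x ∈ U) : tubeDensity g m ϑ (t, x) = ENNReal.ofReal (flowJac g m (t - ϑ) x) :=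
  indicator_of_mem (show (t, (x : M)) ∈ reachSet g m ϑ from h.reaches x hx t ht) _

include hm in
theorem IsTube.flowJac_pos (h : IsTube g m ϑ a b U) {t : ℝ} (ht : t ∈ Ioo a b) {x : level m ϑ}
    (hx : x ∈ U) : 0 < flowJac g m (t - ϑ) x :=
  Hestenes.flowJac_pos g hm ((flowReaches_iff_zero hm).1 (h.reaches x hx t ht))

include hm in
theorem IsTube.enorm_hat_rpow (h : IsTube g m ϑ a b U) (hp : 0 < p.toReal) (f : M → ℝ) {t : ℝ}
    (ht : t ∈ Ioo a b) {x : level m ϑ} (hx : x ∈ U) : ‖hat g m p ϑ U f t x‖ₑ ^ p.toReal =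
      tubeDensity g m ϑ (t, x) * ‖f (flow g m ϑ t x)‖ₑ ^ p.toReal := by
  have hJ := h.flowJac_pos hm ht hx
  rw [hat_of_mem hx, h.tubeDensity_eq ht hx, enorm_mul, ENNReal.mul_rpow_of_nonneg _ _ hp.le]
  congr 1
  rw [Real.enorm_of_nonneg (Real.rpow_nonneg hJ.le _), ← ENNReal.ofReal_rpow_of_pos hJ,
    ← ENNReal.rpow_mul, one_div_mul_cancel hp.ne', ENNReal.rpow_one]

variable {f f' : M → ℝ}

section

include hd hm

/-- The product measure of a tube is absolutely continuous with respect to the Riemannian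
measure. -/
theorem IsTube.aestronglyMeasurable_comp (h : IsTube g m ϑ a b U)
    (hf : AEStronglyMeasurable f (riemannianMeasure g (id : M → M) d)) :
    AEStronglyMeasurable (fun q : ℝ × level m ϑ => f (flow g m ϑ q.1 q.2))
      ((volume.restrict (Ioo a b)).prod ((levelMeasure g m ϑ).restrict U)) := by
  have := sigmaFinite_levelMeasure (g := g) hd hm h.regular
  have h1 := hf.mono_measure (Measure.restrict_le_self (s := sweep g m ϑ a b U))
  rw [h.restrict_sweep hd hm] at h1
  have h2 := h1.comp_measurable (measurable_flow_level (g := g) hm)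
  refine h2.mono_ac (withDensity_absolutelyContinuous'
    (measurable_tubeDensity_level hm).aemeasurable ?_)
  rw [Measure.prod_restrict]
  refine ae_restrict_of_forall_mem (measurableSet_Ioo.prod h.isOpen.measurableSet) ?_
  rintro ⟨t, x⟩ ⟨ht, hx⟩
  rw [h.tubeDensity_eq ht hx]
  exact (ENNReal.ofReal_pos.2 (h.flowJac_pos hm ht hx)).ne'

theorem IsTube.aestronglyMeasurable_hat (h : IsTube g m ϑ a b U)
    (hf : AEStronglyMeasurable f (riemannianMeasure g (id : M → M) d)) :
    AEStronglyMeasurable (fun q : ℝ × level m ϑ => hat g m p ϑ U f q.1 q.2)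
      ((volume.restrict (Ioo a b)).prod (levelMeasure g m ϑ)) := by
  have := sigmaFinite_levelMeasure (g := g) hd hm h.regular
  have h1 : (fun q : ℝ × level m ϑ => hat g m p ϑ U f q.1 q.2) =
      (univ ×ˢ U).indicator fun q => flowJac g m (q.1 - ϑ) q.2 ^ (1 / p.toReal) *
        f (flow g m ϑ q.1 q.2) := by
    ext ⟨t, x⟩
    by_cases hx : x ∈ U
    · rw [hat_of_mem hx, indicator_of_mem (show (t, x) ∈ univ ×ˢ U from ⟨mem_univ _, hx⟩)]
    · rw [hat_of_notMem hx, indicator_of_notMem fun h => hx h.2]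
  rw [h1, aestronglyMeasurable_indicator_iff (MeasurableSet.univ.prod h.isOpen.measurableSet)]
  have h2 : ((volume.restrict (Ioo a b)).prod (levelMeasure g m ϑ)).restrict (univ ×ˢ U) =
      (volume.restrict (Ioo a b)).prod ((levelMeasure g m ϑ).restrict U) := by
    rw [← Measure.prod_restrict, Measure.restrict_univ]
  rw [h2]
  have h3 := h.aestronglyMeasurable_comp hd hm hf
  have h4 : AEStronglyMeasurable (fun q : ℝ × level m ϑ =>
      (tubeDensity g m ϑ (q.1, q.2)).toReal ^ (1 / p.toReal))
      ((volume.restrict (Ioo a b)).prod ((levelMeasure g m ϑ).restrict U)) :=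
    ((measurable_tubeDensity_level hm).ennreal_toReal.pow_const _).aestronglyMeasurable
  refine (h4.mul h3).congr ?_
  rw [Measure.prod_restrict]
  refine ae_restrict_of_forall_mem (measurableSet_Ioo.prod h.isOpen.measurableSet) ?_
  rintro ⟨t, x⟩ ⟨ht, hx⟩
  simp only [Pi.mul_apply]
  rw [h.tubeDensity_eq ht hx, ENNReal.toReal_ofReal (h.flowJac_pos hm ht hx).le]

theorem IsTube.aestronglyMeasurable_fibre (h : IsTube g m ϑ a b U)
    (hf : AEStronglyMeasurable f (riemannianMeasure g (id : M → M) d)) :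
    ∀ᵐ t ∂(volume.restrict (Ioo a b)),
      AEStronglyMeasurable (hat g m p ϑ U f t) (levelMeasure g m ϑ) := by
  have := sigmaFinite_levelMeasure (g := g) hd hm h.regular
  exact (h.aestronglyMeasurable_hat hd hm hf).prodMk_left

/-- The passage to flow coordinates is isometric in `L^p`. -/
theorem IsTube.lintegral_rpow (h : IsTube g m ϑ a b U) (hp : 0 < p.toReal)
    (hf : AEStronglyMeasurable f (riemannianMeasure g (id : M → M) d)) :
    ∫⁻ y in sweep g m ϑ a b U, ‖f y‖ₑ ^ p.toReal ∂riemannianMeasure g (id : M → M) d =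
      ∫⁻ t in Ioo a b, ∫⁻ x, ‖hat g m p ϑ U f t x‖ₑ ^ p.toReal ∂levelMeasure g m ϑ := by
  have := sigmaFinite_levelMeasure (g := g) hd hm h.regular
  have hτ := measurable_tubeDensity_level (g := g) (ϑ := ϑ) hm
  have h1 := hf.mono_measure (Measure.restrict_le_self (s := sweep g m ϑ a b U))
  rw [h.restrict_sweep hd hm] at h1 ⊢
  rw [lintegral_map' (h1.enorm.pow_const _) (measurable_flow_level hm).aemeasurable]
  have h2 := h1.comp_measurable (measurable_flow_level (g := g) hm)
  have h3 := h.aestronglyMeasurable_comp hd hm hf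
  rw [lintegral_withDensity_eq_lintegral_mul₀ hτ.aemeasurable (h3.enorm.pow_const _),
    lintegral_prod _ (hτ.aemeasurable.mul (h3.enorm.pow_const _))]
  refine setLIntegral_congr_fun measurableSet_Ioo fun t ht => ?_
  rw [← lintegral_indicator h.isOpen.measurableSet]
  congr 1
  ext x
  by_cases hx : x ∈ U
  · rw [indicator_of_mem hx, h.enorm_hat_rpow hm hp f ht hx]
    rfl
  · rw [indicator_of_notMem hx, hat_of_notMem hx, enorm_zero, ENNReal.zero_rpow_of_pos hp]

/-- Almost every fibre of an `L^p` function on `M` is in `L^p` of the level set. -/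
theorem IsTube.memLp_fibre [Fact (1 ≤ p)] (hp : p ≠ ⊤) (h : IsTube g m ϑ a b U)
    (hf : MemLp f p (riemannianMeasure g (id : M → M) d)) :
    ∀ᵐ t ∂(volume.restrict (Ioo a b)), MemLp (hat g m p ϑ U f t) p (levelMeasure g m ϑ) := by
  have := sigmaFinite_levelMeasure (g := g) hd hm h.regular
  have hp0 := toReal_pos_of_fact hp
  have hpz : p ≠ 0 := (zero_lt_one.trans_le (Fact.out : 1 ≤ p)).ne'
  have h1 := h.lintegral_rpow hd hm hp0 hf.1
  have h2 : ∫⁻ t in Ioo a b, ∫⁻ x, ‖hat g m p ϑ U f t x‖ₑ ^ p.toReal ∂levelMeasure g m ϑ ≠ ⊤ := by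
    rw [← h1]
    refine ((setLIntegral_le_lintegral _ _).trans_lt ?_).ne
    exact (eLpNorm_lt_top_iff_lintegral_rpow_enorm_lt_top hpz hp).1 hf.2
  have h3 : AEMeasurable (fun t => ∫⁻ x, ‖hat g m p ϑ U f t x‖ₑ ^ p.toReal ∂levelMeasure g m ϑ)
      (volume.restrict (Ioo a b)) :=
    ((h.aestronglyMeasurable_hat hd hm hf.1).enorm.pow_const _).lintegral_prod_right'
  filter_upwards [ae_lt_top' h3 h2, h.aestronglyMeasurable_fibre hd hm hf.1] with t ht1 ht2
  exact ⟨ht2, (eLpNorm_lt_top_iff_lintegral_rpow_enorm_lt_top hpz hp).2 ht1⟩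

end

end Hat

/-! ### Latitudinal projections and lifted operators in flow coordinates -/

section Cutoff

variable {δ : ℝ} {s : ℝ → ℝ}

theorem IsCutoff.eq_zero (hs : IsCutoff δ s) {t : ℝ} (ht : t ≤ -δ) : s t = 0 := by
  by_contra h
  exact (not_lt.2 ht) (hs.tsupport_subset (subset_tsupport s h))

theorem IsCutoff.sq_eq_one (hs : IsCutoff δ s) {t : ℝ} (ht : δ ≤ t) : s t ^ 2 = 1 := by
  have := hs.sq_add_sq t
  rw [hs.eq_zero (neg_le_neg ht)] at this
  simpa using this

theorem IsCutoff.sq_neg (hs : IsCutoff δ s) (t : ℝ) : s (-t) ^ 2 = 1 - s t ^ 2 := by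
  linarith [hs.sq_add_sq t]

theorem IsCutoff.exists_lt (hs : IsCutoff δ s) (hδ : 0 < δ) :
    ∃ δ' > 0, δ' < δ ∧ ∀ t ≤ -δ', s t = 0 := by
  have h1 : -δ ∉ tsupport s := fun h => absurd (hs.tsupport_subset h) (lt_irrefl (-δ))
  obtain ⟨ε, hε, hb⟩ := Metric.isOpen_iff.1 (isClosed_tsupport s).isOpen_compl (-δ) h1
  refine ⟨δ - min (ε / 2) (δ / 2), ?_, ?_, fun t ht => ?_⟩
  · have := min_le_right (ε / 2) (δ / 2)
    linarith
  · have : 0 < min (ε / 2) (δ / 2) := by positivity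
    linarith
  · by_cases h : t ≤ -δ
    · exact hs.eq_zero h
    · have h2 := min_le_left (ε / 2) (δ / 2)
      have h3 : t ∈ (tsupport s)ᶜ := hb (by
        rw [Metric.mem_ball, Real.dist_eq, abs_lt]
        constructor <;> linarith)
      exact image_eq_zero_of_notMem_tsupport h3

/-- The coefficient of the reflected term in a latitudinal projection. -/
def crossCoeff (s : ℝ → ℝ) (t : ℝ) : ℝ := s t * s (-t)

theorem crossCoeff_neg (s : ℝ → ℝ) (t : ℝ) : crossCoeff s (-t) = crossCoeff s t := by
  rw [crossCoeff, crossCoeff, neg_neg, mul_comm]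

theorem IsCutoff.crossCoeff_eq_zero (hs : IsCutoff δ s) {t : ℝ} (ht : t ∉ Ioo (-δ) δ) :
    crossCoeff s t = 0 := by
  rw [mem_Ioo, not_and_or, not_lt, not_lt] at ht
  rcases ht with h | h
  · rw [crossCoeff, hs.eq_zero h, zero_mul]
  · rw [crossCoeff, hs.eq_zero (neg_le_neg h), mul_zero]

end Cutoff

section Shift

set_option linter.unusedSectionVars false

variable {d : ℕ} {M : Type u} [TopologicalSpace M] [ChartedSpace (EuclideanSpace ℝ (Fin d)) M]
  [IsManifold (𝓡 d) ∞ M] (g : Metric d M) {m : M → ℝ}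

/-- A slab between two levels that is compact and contains no critical point. -/
structure IsRegularSlab (d : ℕ) {M : Type u} [TopologicalSpace M]
    [ChartedSpace (EuclideanSpace ℝ (Fin d)) M] (m : M → ℝ) (c e : ℝ) : Prop where
  compact : IsCompact (m ⁻¹' Icc c e)
  regular : ∀ x, m x ∈ Icc c e → ¬ IsCrit d m x

/-- Translation by time `τ` along the flow, weighted so as to be isometric in `L^p`. -/
def shift (m : M → ℝ) (p : ℝ≥0∞) (τ : ℝ) (f : M → ℝ) (y : M) : ℝ :=
  flowJac g m τ y ^ (1 / p.toReal) * f (flow g m 0 τ y)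

variable {g} {p : ℝ≥0∞} {s : ℝ → ℝ} {δ ϑ ϑ₁ ϑ₂ a b : ℝ} {U : Set (level m ϑ)} {f : M → ℝ}
  [T2Space M] (hm : ContMDiff (𝓡 d) 𝓘(ℝ, ℝ) ∞ m)

include hm

theorem hat_eq_shift {t : ℝ} {x : level m ϑ} (hx : x ∈ U) :
    hat g m p ϑ U f t x = shift g m p (t - ϑ) f x := by
  rw [hat_of_mem hx, shift, flow_eq_zero hm]

theorem IsRegularSlab.reaches {c e : ℝ} (h : IsRegularSlab d m c e) {x : M} (hx : m x ∈ Icc c e)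
    {t : ℝ} (ht : t ∈ Icc c e) : FlowReaches g m (m x) t x :=
  flowReaches_of_regular g hm h.compact h.regular hx ht

theorem flowJac_rpow_mul_shift {σ τ : ℝ} {y : M} (h : FlowReaches g m 0 τ y)
    (h' : FlowReaches g m 0 σ (flow g m 0 τ y)) :
    flowJac g m τ y ^ (1 / p.toReal) * shift g m p σ f (flow g m 0 τ y) =
      shift g m p (τ + σ) f y := by
  have h4 : FlowReaches g m τ (τ + σ) (flow g m 0 τ y) := by
    rw [flowReaches_iff_zero hm, add_sub_cancel_left]; exact h'
  have h5 := (FlowReaches.trans (x := y) hm h h4).2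
  rw [flow_eq_zero hm (ϑ := τ), add_sub_cancel_left] at h5
  rw [shift, shift, flowJac_add g hm h h', h5, Real.mul_rpow (flowJac_pos g hm h').le
    (flowJac_pos g hm h).le]
  ring

/-- The operator `E_ϑ` in terms of the reflection of the slab around `J_ϑ`. -/
theorem aww_apply (hs : IsCutoff δ s) (hreg : IsRegularSlab d m (ϑ - δ) (ϑ + δ)) (y : M) :
    aww g m p s δ ϑ f y = s (m y - ϑ) ^ 2 * f y +
      crossCoeff s (m y - ϑ) * shift g m p (2 * (ϑ - m y)) f y := by
  rw [aww]
  split_ifs with h1 h2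
  · rw [hs.sq_eq_one (by linarith), hs.crossCoeff_eq_zero (fun h => by linarith [h.2])]
    ring
  · rw [hs.eq_zero (by linarith), hs.crossCoeff_eq_zero (fun h => by linarith [h.1])]
    ring
  · push Not at h1 h2
    have hy : m y ∈ Icc (ϑ - δ) (ϑ + δ) := ⟨h2.le, h1.le⟩
    have hϑ : ϑ ∈ Icc (ϑ - δ) (ϑ + δ) := ⟨by linarith, by linarith⟩
    have hr : 2 * ϑ - m y ∈ Icc (ϑ - δ) (ϑ + δ) := ⟨by linarith, by linarith⟩
    have k1 : FlowReaches g m (m y) ϑ y := hreg.reaches hm hy hϑ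
    have k2 : FlowReaches g m (m y) (2 * ϑ - m y) y := hreg.reaches hm hy hr
    have k3 := (k1.symm hm).1
    have k4 := k1.between hm k2
    have e1 : flow g m ϑ (2 * ϑ - m y) (flow g m (m y) ϑ y) =
        flow g m 0 (2 * (ϑ - m y)) y := by
      rw [k4.2, flow_eq_zero hm]
      congr 1; ring
    have e2 : flowWeight g m ϑ (2 * ϑ - m y) (flow g m (m y) ϑ y) /
        flowWeight g m ϑ (m y) (flow g m (m y) ϑ y) = flowJac g m (2 * (ϑ - m y)) y := by
      rw [flowWeight_eq_mul g hm k4.1, flowWeight_eq_mul g hm k3]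
      have k5 := flowJac_flow g hm k3 k4.1
      rw [(k1.symm hm).2] at k5
      have p1 := flowJac_pos g hm ((flowReaches_iff_zero hm).1 k3)
      have p2 := flowWeight_pos g hm (k3.self hm).1
      rw [k5, mul_div_mul_right _ _ p2.ne', mul_div_cancel_right₀ _ p1.ne']
      congr 1; ring
    simp only []
    rw [e1, e2, crossCoeff, neg_sub, shift]
    ring

theorem latitudinal_apply (hs : IsCutoff δ s) (h1 : IsRegularSlab d m (ϑ₁ - δ) (ϑ₁ + δ))
    (h2 : IsRegularSlab d m (ϑ₂ - δ) (ϑ₂ + δ)) (y : M) :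
    latitudinal g m p s δ ϑ₁ ϑ₂ f y = (s (m y - ϑ₁) ^ 2 - s (m y - ϑ₂) ^ 2) * f y +
      crossCoeff s (m y - ϑ₁) * shift g m p (2 * (ϑ₁ - m y)) f y -
      crossCoeff s (m y - ϑ₂) * shift g m p (2 * (ϑ₂ - m y)) f y := by
  rw [latitudinal, Pi.sub_apply, Pi.sub_apply, aww_apply hm hs h1, aww_apply hm hs h2]
  ring

theorem hat_shift (h : IsTube g m ϑ a b U) {t t' : ℝ} (ht : t ∈ Ioo a b) (ht' : t' ∈ Ioo a b)
    {x : level m ϑ} (hx : x ∈ U) : flowJac g m (t - ϑ) x ^ (1 / p.toReal) *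
      shift g m p (t' - t) f (flow g m ϑ t x) = hat g m p ϑ U f t' x := by
  have h1 := h.reaches x hx t ht
  have h2 := (h1.between hm (h.reaches x hx t' ht')).1
  rw [flowReaches_iff_zero hm] at h1 h2
  rw [flow_eq_zero hm] at h2 ⊢
  rw [flowJac_rpow_mul_shift hm h1 h2, hat_eq_shift hm hx]
  congr 1; ring

/-- In flow coordinates, `E_{ϑ₁}` combines the values at the times `t` and `2ϑ₁ - t` only. The
reflected time may be outside the tube, but then the coefficient vanishes. -/
theorem hat_aww (hs : IsCutoff δ s) (h1 : IsRegularSlab d m (ϑ₁ - δ) (ϑ₁ + δ))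
    (h : IsTube g m ϑ a b U) (hI : Ioo (ϑ₁ - δ) (ϑ₁ + δ) ⊆ Ioo a b) {t : ℝ} (ht : t ∈ Ioo a b)
    (x : level m ϑ) : hat g m p ϑ U (aww g m p s δ ϑ₁ f) t x =
      s (t - ϑ₁) ^ 2 * hat g m p ϑ U f t x +
      crossCoeff s (t - ϑ₁) * hat g m p ϑ U f (2 * ϑ₁ - t) x := by
  by_cases hx : x ∈ U
  · have hmt : m (flow g m ϑ t x) = t := m_flow_level g hm (h.reaches x hx t ht)
    rw [hat_of_mem hx, aww_apply hm hs h1, hmt]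
    by_cases hc : t - ϑ₁ ∈ Ioo (-δ) δ
    · have ht' : 2 * ϑ₁ - t ∈ Ioo a b := hI ⟨by linarith [hc.2], by linarith [hc.1]⟩
      rw [← hat_shift hm h ht ht' hx, hat_of_mem hx, show 2 * ϑ₁ - t - t = 2 * (ϑ₁ - t) by ring]
      ring
    · rw [hs.crossCoeff_eq_zero hc, hat_of_mem hx]
      ring
  · simp only [hat_of_notMem hx, mul_zero, add_zero]

/-- In flow coordinates, `Q` acts by scalar coefficients that depend on the time only. -/
theorem hat_latitudinal (hs : IsCutoff δ s) (h1 : IsRegularSlab d m (ϑ₁ - δ) (ϑ₁ + δ))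
    (h2 : IsRegularSlab d m (ϑ₂ - δ) (ϑ₂ + δ)) (h : IsTube g m ϑ a b U)
    (hI₁ : Ioo (ϑ₁ - δ) (ϑ₁ + δ) ⊆ Ioo a b) (hI₂ : Ioo (ϑ₂ - δ) (ϑ₂ + δ) ⊆ Ioo a b) {t : ℝ}
    (ht : t ∈ Ioo a b) : hat g m p ϑ U (latitudinal g m p s δ ϑ₁ ϑ₂ f) t =
      (s (t - ϑ₁) ^ 2 - s (t - ϑ₂) ^ 2) • hat g m p ϑ U f t +
      crossCoeff s (t - ϑ₁) • hat g m p ϑ U f (2 * ϑ₁ - t) +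
      (-crossCoeff s (t - ϑ₂)) • hat g m p ϑ U f (2 * ϑ₂ - t) := by
  ext x
  have e : hat g m p ϑ U (latitudinal g m p s δ ϑ₁ ϑ₂ f) t x =
      hat g m p ϑ U (aww g m p s δ ϑ₁ f) t x - hat g m p ϑ U (aww g m p s δ ϑ₂ f) t x := by
    by_cases hx : x ∈ U
    · simp only [hat_of_mem hx, latitudinal, Pi.sub_apply]; ring
    · simp only [hat_of_notMem hx, sub_zero]
  rw [e, hat_aww hm hs h1 h hI₁ ht, hat_aww hm hs h2 h hI₂ ht]
  simp only [Pi.add_apply, Pi.smul_apply, smul_eq_mul]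
  ring

/-- `E_ϑ` is idempotent. -/
theorem aww_aww (hs : IsCutoff δ s) (hreg : IsRegularSlab d m (ϑ - δ) (ϑ + δ)) :
    aww g m p s δ ϑ (aww g m p s δ ϑ f) = aww g m p s δ ϑ f := by
  ext y
  rw [aww_apply (f := aww g m p s δ ϑ f) hm hs hreg y, aww_apply (f := f) hm hs hreg y]
  have hsq := hs.sq_neg (m y - ϑ)
  by_cases hc : m y - ϑ ∈ Ioo (-δ) δ
  · have hy : m y ∈ Icc (ϑ - δ) (ϑ + δ) := ⟨by linarith [hc.1], by linarith [hc.2]⟩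
    have hr : 2 * ϑ - m y ∈ Icc (ϑ - δ) (ϑ + δ) := ⟨by linarith [hc.2], by linarith [hc.1]⟩
    have k2 : FlowReaches g m (m y) (2 * ϑ - m y) y := hreg.reaches hm hy hr
    have k3 : FlowReaches g m 0 (2 * (ϑ - m y)) y := by
      rw [flowReaches_iff_zero hm] at k2
      convert k2 using 1; ring
    set z := flow g m 0 (2 * (ϑ - m y)) y with hz
    have hmz : m z = 2 * ϑ - m y := by
      rw [hz, k3.m_flow hm]; ring
    have k4 : FlowReaches g m 0 (2 * (ϑ - m z)) z := by
      have h5 := (k3.symm hm).1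
      rw [flowReaches_iff_zero hm] at h5
      rw [hmz]
      convert h5 using 1; ring
    have k5 := flowJac_rpow_mul_shift (p := p) (f := f) hm k3 k4
    rw [hmz, show 2 * (ϑ - m y) + 2 * (ϑ - (2 * ϑ - m y)) = 0 by ring] at k5
    have k6 : shift g m p 0 f y = f y := by
      have hcr := (k3.notCrit hm).1
      rw [shift, flowJac_zero g hm hcr, (flow_zero_of_notCrit g hm hcr).2, Real.one_rpow, one_mul]
    have k7 : shift g m p (2 * (ϑ - m y)) (aww g m p s δ ϑ f) y =
        (1 - s (m y - ϑ) ^ 2) * shift g m p (2 * (ϑ - m y)) f y +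
          crossCoeff s (m y - ϑ) * f y := by
      have e : ∀ f', shift g m p (2 * (ϑ - m y)) f' y =
        flowJac g m (2 * (ϑ - m y)) y ^ (1 / p.toReal) * f' z := fun _ => rfl
      rw [e, e, aww_apply (f := f) hm hs hreg z, hmz,
        show 2 * ϑ - m y - ϑ = -(m y - ϑ) by ring, crossCoeff_neg, hsq]
      rw [k6, ← hz] at k5
      linear_combination (crossCoeff s (m y - ϑ)) * k5
    rw [k7]
    have hcc : crossCoeff s (m y - ϑ) ^ 2 = s (m y - ϑ) ^ 2 * (1 - s (m y - ϑ) ^ 2) := by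
      rw [crossCoeff, mul_pow, hsq]
    linear_combination (f y) * hcc
  · rw [hs.crossCoeff_eq_zero hc]
    have h01 : s (m y - ϑ) ^ 2 * s (m y - ϑ) ^ 2 = s (m y - ϑ) ^ 2 := by
      rw [mem_Ioo, not_and_or, not_lt, not_lt] at hc
      rcases hc with h | h
      · rw [hs.eq_zero h]; ring
      · rw [hs.sq_eq_one h]; ring
    linear_combination (f y) * h01

theorem aww_congr_of_le (hs : IsCutoff δ s) (hreg : IsRegularSlab d m (ϑ - δ) (ϑ + δ)) {f' : M → ℝ}
    (h : ∀ y, ϑ - δ ≤ m y → f y = f' y) : aww g m p s δ ϑ f = aww g m p s δ ϑ f' := by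
  ext y
  rw [aww_apply (f := f) hm hs hreg y, aww_apply (f := f') hm hs hreg y]
  by_cases hc : m y - ϑ ∈ Ioo (-δ) δ
  · have hy : m y ∈ Icc (ϑ - δ) (ϑ + δ) := ⟨by linarith [hc.1], by linarith [hc.2]⟩
    have hr : 2 * ϑ - m y ∈ Icc (ϑ - δ) (ϑ + δ) := ⟨by linarith [hc.2], by linarith [hc.1]⟩
    have k2 : FlowReaches g m (m y) (2 * ϑ - m y) y := hreg.reaches hm hy hr
    have k3 : FlowReaches g m 0 (2 * (ϑ - m y)) y := by
      rw [flowReaches_iff_zero hm] at k2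
      convert k2 using 1; ring
    rw [h y hy.1, shift, shift, h _ (by rw [k3.m_flow hm]; linarith [hc.2])]
  · rw [hs.crossCoeff_eq_zero hc]
    by_cases h1 : ϑ - δ ≤ m y
    · rw [h y h1, zero_mul, zero_mul]
    · rw [hs.eq_zero (by linarith)]
      ring

theorem aww_eq_self (hs : IsCutoff δ s) (hreg : IsRegularSlab d m (ϑ - δ) (ϑ + δ)) {y : M}
    (h : ϑ + δ ≤ m y) : aww g m p s δ ϑ f y = f y := by
  rw [aww_apply hm hs hreg, hs.crossCoeff_eq_zero (fun h => by linarith [h.2]),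
    hs.sq_eq_one (by linarith)]
  ring

theorem aww_eq_zero (hs : IsCutoff δ s) (hreg : IsRegularSlab d m (ϑ - δ) (ϑ + δ)) {y : M}
    (h : m y ≤ ϑ - δ) : aww g m p s δ ϑ f y = 0 := by
  rw [aww_apply hm hs hreg, hs.crossCoeff_eq_zero (fun h => by linarith [h.1]),
    hs.eq_zero (by linarith)]
  ring

theorem aww_sub (hs : IsCutoff δ s) (hreg : IsRegularSlab d m (ϑ - δ) (ϑ + δ)) (f' : M → ℝ) :
    aww g m p s δ ϑ (f - f') = aww g m p s δ ϑ f - aww g m p s δ ϑ f' := by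
  ext y
  rw [Pi.sub_apply, aww_apply hm hs hreg, aww_apply hm hs hreg, aww_apply hm hs hreg, shift, shift,
    shift]
  simp only [Pi.sub_apply]
  ring

/-- A latitudinal projection is idempotent. -/
theorem latitudinal_latitudinal (hs : IsCutoff δ s) (h1 : IsRegularSlab d m (ϑ₁ - δ) (ϑ₁ + δ))
    (h2 : IsRegularSlab d m (ϑ₂ - δ) (ϑ₂ + δ)) (h12 : ϑ₁ + δ ≤ ϑ₂ - δ) :
    latitudinal g m p s δ ϑ₁ ϑ₂ (latitudinal g m p s δ ϑ₁ ϑ₂ f) =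
      latitudinal g m p s δ ϑ₁ ϑ₂ f := by
  have e : ∀ f, latitudinal g m p s δ ϑ₁ ϑ₂ f = aww g m p s δ ϑ₁ f - aww g m p s δ ϑ₂ f :=
    fun f => rfl
  have h21 : aww g m p s δ ϑ₂ (aww g m p s δ ϑ₁ f) = aww g m p s δ ϑ₂ f :=
    aww_congr_of_le hm hs h2 fun y hy => aww_eq_self hm hs h1 (by linarith)
  have h12' : aww g m p s δ ϑ₁ (aww g m p s δ ϑ₂ f) = aww g m p s δ ϑ₂ f := by
    ext y
    by_cases hy : ϑ₁ + δ ≤ m y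
    · exact aww_eq_self hm hs h1 hy
    · push Not at hy
      rw [aww_eq_zero (y := y) (f := f) hm hs h2 (by linarith)]
      by_cases hy2 : m y ≤ ϑ₁ - δ
      · exact aww_eq_zero hm hs h1 hy2
      · push Not at hy2
        have hy' : m y ∈ Icc (ϑ₁ - δ) (ϑ₁ + δ) := ⟨hy2.le, hy.le⟩
        have hr : 2 * ϑ₁ - m y ∈ Icc (ϑ₁ - δ) (ϑ₁ + δ) := ⟨by linarith, by linarith⟩
        have k2 : FlowReaches g m (m y) (2 * ϑ₁ - m y) y := h1.reaches hm hy' hr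
        have k3 : FlowReaches g m 0 (2 * (ϑ₁ - m y)) y := by
          rw [flowReaches_iff_zero hm] at k2
          convert k2 using 1; ring
        rw [aww_apply hm hs h1, aww_eq_zero (y := y) (f := f) hm hs h2 (by linarith), shift,
          aww_eq_zero (f := f) hm hs h2 (by rw [k3.m_flow hm]; linarith)]
        ring
  rw [e, e, aww_sub hm hs h1, aww_sub hm hs h2, aww_aww hm hs h1, aww_aww hm hs h2, h21, h12']
  abel

end Shift

section LocalOp

variable {N : Type*} {T T' : Set N} {P P' : Op N}

/-- A linear operator on functions such that `P f` depends only on the values of `f` on `T` and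
vanishes off `T`. -/
structure IsLocalOp (T : Set N) (P : Op N) : Prop where
  congr : ∀ f f', EqOn f f' T → P f = P f'
  zero_off : ∀ f x, x ∉ T → P f x = 0
  add : ∀ f f', P (f + f') = P f + P f'
  smul : ∀ (c : ℝ) f, P (c • f) = c • P f

theorem IsLocalOp.mono (h : IsLocalOp T P) (hT : T ⊆ T') : IsLocalOp T' P :=
  ⟨fun f f' hf => h.congr f f' (hf.mono hT), fun f x hx => h.zero_off f x fun hx' => hx (hT hx'),
    h.add, h.smul⟩

theorem IsLocalOp.comp (h : IsLocalOp T P) (h' : IsLocalOp T P') : IsLocalOp T (P ∘ P') where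
  congr f f' hf := by simp only [Function.comp_apply, h'.congr f f' hf]
  zero_off f x hx := h.zero_off _ x hx
  add f f' := by simp only [Function.comp_apply, h'.add, h.add]
  smul c f := by simp only [Function.comp_apply, h'.smul, h.smul]

theorem IsLocalOp.sum {ι : Type*} (s : Finset ι) {P : ι → Op N} (h : ∀ i ∈ s, IsLocalOp T (P i)) :
    IsLocalOp T (∑ i ∈ s, P i) where
  congr f f' hf := by
    simp only [Finset.sum_apply]
    exact Finset.sum_congr rfl fun i hi => (h i hi).congr f f' hf
  zero_off f x hx := by
    simp only [Finset.sum_apply]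
    exact Finset.sum_eq_zero fun i hi => (h i hi).zero_off f x hx
  add f f' := by
    simp only [Finset.sum_apply]
    rw [← Finset.sum_add_distrib]
    exact Finset.sum_congr rfl fun i hi => (h i hi).add f f'
  smul c f := by
    simp only [Finset.sum_apply]
    rw [Finset.smul_sum]
    exact Finset.sum_congr rfl fun i hi => (h i hi).smul c f

end LocalOp

theorem IsLocalizedHOp.isLocalOp {d : ℕ} {M : Type u} [TopologicalSpace M]
    [ChartedSpace (EuclideanSpace ℝ (Fin d)) M] {N : Type v} [TopologicalSpace N] {j : N → M}
    {U : Set N} {P : Op N} (h : IsLocalizedHOp d j U P) : IsLocalOp U P := by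
  obtain ⟨n, H, hH, hP⟩ := h
  refine ⟨fun f f' hf => ?_, fun f x hx => ?_, fun f f' => ?_, fun c f => ?_⟩
  · ext x
    rw [hP, hP]
    refine Finset.sum_congr rfl fun k _ => ?_
    by_cases hx : x ∈ (H k).Φ.source
    · simp only [SimpleH.toOp, indicator_of_mem hx, hf ((hH k).2 ((H k).Φ.map_source hx))]
    · simp only [SimpleH.toOp, indicator_of_notMem hx]
  · rw [hP]
    exact Finset.sum_eq_zero fun k _ => indicator_of_notMem (fun h => hx ((hH k).1 h)) _
  · ext x
    rw [Pi.add_apply, hP, hP, hP, ← Finset.sum_add_distrib]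
    refine Finset.sum_congr rfl fun k _ => ?_
    by_cases hx : x ∈ (H k).Φ.source
    · simp only [SimpleH.toOp, indicator_of_mem hx, Pi.add_apply, mul_add]
    · simp only [SimpleH.toOp, indicator_of_notMem hx, add_zero]
  · ext x
    rw [Pi.smul_apply, hP, hP, smul_eq_mul, Finset.mul_sum]
    refine Finset.sum_congr rfl fun k _ => ?_
    by_cases hx : x ∈ (H k).Φ.source
    · simp only [SimpleH.toOp, indicator_of_mem hx, Pi.smul_apply, smul_eq_mul]
      ring
    · simp only [SimpleH.toOp, indicator_of_notMem hx, mul_zero]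

section Lift

set_option linter.unusedSectionVars false

variable {d : ℕ} {M : Type u} [TopologicalSpace M] [ChartedSpace (EuclideanSpace ℝ (Fin d)) M]
  [IsManifold (𝓡 d) ∞ M] {g : Metric d M} {m : M → ℝ} {p : ℝ≥0∞} {s : ℝ → ℝ}
  {δ ϑ ϑ₁ ϑ₂ a b : ℝ} {T : Set (level m ϑ)} {S : ℝ → Set M} {f f' : M → ℝ} {P P' : Op (level m ϑ)}
  [T2Space M] [SecondCountableTopology M] [MeasurableSpace M] [BorelSpace M]
  (hm : ContMDiff (𝓡 d) 𝓘(ℝ, ℝ) ∞ m) (h : IsTube g m ϑ a b T)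

include hm

/-- A tube is a union of flow lines. -/
theorem flow_mem_sweep_iff (hT : ∀ x ∈ T, ∀ t ∈ Ioo a b, FlowReaches g m ϑ t x) {y : M} {τ : ℝ}
    (hy : m y ∈ Ioo a b) (hτ : m y + τ ∈ Ioo a b) (hr : FlowReaches g m 0 τ y) :
    flow g m 0 τ y ∈ sweep g m ϑ a b T ↔ y ∈ sweep g m ϑ a b T := by
  have hmf : m (flow g m 0 τ y) = m y + τ := by rw [hr.m_flow hm, sub_zero]
  have hr' : FlowReaches g m (m y) (m y + τ) y := by
    rwa [flowReaches_iff_zero hm, add_sub_cancel_left]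
  have e : flow g m 0 τ y = flow g m (m y) (m y + τ) y := by
    rw [flow_eq_zero hm (ϑ := m y), add_sub_cancel_left]
  rw [mem_sweep_iff g hm hT, mem_sweep_iff g hm hT, hmf, e]
  constructor
  · rintro ⟨-, h2, h3⟩
    have h4 := hr'.trans hm h2
    exact ⟨hy, h4.1, by rw [h4.2]; exact h3⟩
  · rintro ⟨-, h2, h3⟩
    have h4 := hr'.between hm h2
    exact ⟨hτ, h4.1, by rw [h4.2]; exact h3⟩

include h

theorem IsTube.flow_mem_sweep {t : ℝ} (ht : t ∈ Ioo a b) {x : level m ϑ} (hx : x ∈ T) :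
    flow g m ϑ t x ∈ sweep g m ϑ a b T :=
  mem_iUnion₂.2 ⟨t, ht, x, mem_image_of_mem _ hx, rfl⟩

/-- A function is determined by its values off the tube and by its representation in flow
coordinates. -/
theorem IsTube.ext_hat (hoff : ∀ y ∉ sweep g m ϑ a b T, f y = f' y)
    (hhat : ∀ t ∈ Ioo a b, hat g m p ϑ T f t = hat g m p ϑ T f' t) : f = f' := by
  ext y
  by_cases hy : y ∈ sweep g m ϑ a b T
  · obtain ⟨t, ht, _, ⟨x, hx, rfl⟩, rfl⟩ := mem_iUnion₂.1 hy
    have := congrFun (hhat t ht) x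
    rw [hat_of_mem hx, hat_of_mem hx] at this
    exact mul_left_cancel₀ (Real.rpow_pos_of_pos (h.flowJac_pos hm ht hx) _).ne' this
  · exact hoff y hy

variable (hS : ∀ y, (m y ∈ Ioo a b ∧ y ∈ S (m y)) ↔ y ∈ sweep g m ϑ a b T)

include hS

theorem IsTube.lift_eq_zero {y : M} (hy : y ∉ sweep g m ϑ a b T) :
    lift g m p a b S ϑ P f y = 0 := by
  rw [lift, if_neg fun h' => hy ((hS y).1 h')]

/-- In flow coordinates a lifted operator acts fibrewise. -/
theorem IsTube.hat_lift (hP : IsLocalOp T P) {t : ℝ} (ht : t ∈ Ioo a b) :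
    hat g m p ϑ T (lift g m p a b S ϑ P f) t = P (hat g m p ϑ T f t) := by
  ext x
  by_cases hx : x ∈ T
  · have hr := h.reaches x hx t ht
    have hmy : m (flow g m ϑ t x) = t := m_flow_level g hm hr
    have hw : ∀ x' ∈ T, flowWeight g m ϑ t x' / flowWeight g m ϑ ϑ x' =
        flowJac g m (t - ϑ) x' := by
      intro x' hx'
      have hr' := h.reaches x' hx' t ht
      rw [flowWeight_eq_mul g hm hr', mul_div_cancel_right₀ _
        (flowWeight_pos g hm (hr'.self hm).1).ne']
    rw [hat_of_mem hx, lift, if_pos ((hS _).2 (h.flow_mem_sweep hm ht hx))]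
    simp only [hmy, (hr.symm hm).2]
    have hJ := h.flowJac_pos hm ht hx
    rw [extendZero, Subtype.val_injective.extend_apply,
      ← inv_div (flowWeight g m ϑ t x), hw x hx,
      Real.inv_rpow hJ.le]
    have e : P (fun x' : level m ϑ => f (flow g m ϑ t x') *
        (flowWeight g m ϑ t x' / flowWeight g m ϑ ϑ x') ^ (1 / p.toReal)) =
        P (hat g m p ϑ T f t) := by
      refine hP.congr _ _ fun x' hx' => ?_
      rw [hw x' hx', hat_of_mem hx', mul_comm]
    rw [e]
    have := (Real.rpow_pos_of_pos hJ (1 / p.toReal)).ne'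
    field_simp
  · rw [hat_of_notMem hx, hP.zero_off _ _ hx]

theorem IsTube.lift_comp (hP : IsLocalOp T P) (hP' : IsLocalOp T P') :
    lift g m p a b S ϑ P (lift g m p a b S ϑ P' f) = lift g m p a b S ϑ (P ∘ P') f := by
  refine h.ext_hat (p := p) hm (fun y hy => ?_) fun t ht => ?_
  · rw [h.lift_eq_zero hm hS hy, h.lift_eq_zero hm hS hy]
  · rw [h.hat_lift hm hS hP ht, h.hat_lift hm hS hP' ht, h.hat_lift hm hS (hP.comp hP') ht,
      Function.comp_apply]

theorem IsTube.lift_sum {ι : Type*} (u : Finset ι) {P : ι → Op (level m ϑ)} :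
    lift g m p a b S ϑ (∑ i ∈ u, P i) f = ∑ i ∈ u, lift g m p a b S ϑ (P i) f := by
  ext y
  rw [Finset.sum_apply]
  by_cases hy : y ∈ sweep g m ϑ a b T
  · obtain ⟨t, ht, _, ⟨x, hx, rfl⟩, rfl⟩ := mem_iUnion₂.1 hy
    have hr := h.reaches x hx t ht
    simp only [lift, if_pos ((hS _).2 hy)]
    rw [← Finset.sum_mul]
    congr 1
    simp only [m_flow_level g hm hr, (hr.symm hm).2, extendZero,
      Subtype.val_injective.extend_apply, Finset.sum_apply]
  · rw [h.lift_eq_zero hm hS hy]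
    exact (Finset.sum_eq_zero fun i _ => h.lift_eq_zero hm hS hy).symm

/-- Lifted operators act along the level sets and the latitudinal projection acts along the flow
lines, so that they commute. -/
theorem IsTube.lift_latitudinal (hP : IsLocalOp T P) (hs : IsCutoff δ s)
    (h1 : IsRegularSlab d m (ϑ₁ - δ) (ϑ₁ + δ)) (h2 : IsRegularSlab d m (ϑ₂ - δ) (ϑ₂ + δ))
    (hI₁ : Ioo (ϑ₁ - δ) (ϑ₁ + δ) ⊆ Ioo a b) (hI₂ : Ioo (ϑ₂ - δ) (ϑ₂ + δ) ⊆ Ioo a b) :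
    lift g m p a b S ϑ P (latitudinal g m p s δ ϑ₁ ϑ₂ f) =
      latitudinal g m p s δ ϑ₁ ϑ₂ (lift g m p a b S ϑ P f) := by
  refine h.ext_hat (p := p) hm (fun y hy => ?_) fun t ht => ?_
  · have key : ∀ ϑ₀, IsRegularSlab d m (ϑ₀ - δ) (ϑ₀ + δ) → Ioo (ϑ₀ - δ) (ϑ₀ + δ) ⊆ Ioo a b →
        crossCoeff s (m y - ϑ₀) *
          shift g m p (2 * (ϑ₀ - m y)) (lift g m p a b S ϑ P f) y = 0 := by
      intro ϑ₀ h0 hI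
      by_cases hc : m y - ϑ₀ ∈ Ioo (-δ) δ
      · have hy1 : m y ∈ Ioo (ϑ₀ - δ) (ϑ₀ + δ) := ⟨by linarith [hc.1], by linarith [hc.2]⟩
        have hr1 : m y + 2 * (ϑ₀ - m y) ∈ Ioo (ϑ₀ - δ) (ϑ₀ + δ) :=
          ⟨by linarith [hc.2], by linarith [hc.1]⟩
        have k2 := h0.reaches (g := g) hm (Ioo_subset_Icc_self hy1) (Ioo_subset_Icc_self hr1)
        rw [flowReaches_iff_zero hm, add_sub_cancel_left] at k2
        rw [shift, h.lift_eq_zero hm hS (fun h' =>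
          hy ((flow_mem_sweep_iff hm h.reaches (hI hy1) (hI hr1) k2).1 h')), mul_zero, mul_zero]
      · rw [hs.crossCoeff_eq_zero hc, zero_mul]
    rw [h.lift_eq_zero hm hS hy, latitudinal_apply hm hs h1 h2, h.lift_eq_zero hm hS hy,
      key ϑ₁ h1 hI₁, key ϑ₂ h2 hI₂]
    ring
  · rw [h.hat_lift hm hS hP ht, hat_latitudinal hm hs h1 h2 h hI₁ hI₂ ht,
      hat_latitudinal hm hs h1 h2 h hI₁ hI₂ ht, hP.add, hP.add, hP.smul, hP.smul, hP.smul,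
      h.hat_lift hm hS hP ht]
    congr 1
    · congr 1
      by_cases hc : t - ϑ₁ ∈ Ioo (-δ) δ
      · rw [h.hat_lift hm hS hP (hI₁ ⟨by linarith [hc.2], by linarith [hc.1]⟩)]
      · rw [hs.crossCoeff_eq_zero hc, zero_smul, zero_smul]
    · by_cases hc : t - ϑ₂ ∈ Ioo (-δ) δ
      · rw [h.hat_lift hm hS hP (hI₂ ⟨by linarith [hc.2], by linarith [hc.1]⟩)]
      · rw [hs.crossCoeff_eq_zero hc, neg_zero, zero_smul, zero_smul]

end Lift

section Passage

set_option linter.unusedSectionVars false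

variable {d : ℕ} {M : Type u} [TopologicalSpace M] [ChartedSpace (EuclideanSpace ℝ (Fin d)) M]
  [IsManifold (𝓡 d) ∞ M] {g : Metric d M} {m : M → ℝ} [T2Space M] {z : M} {Uz Vz : Set M}
  {a b δz ϑ : ℝ} {S : ℝ → Set M} (hm : ContMDiff (𝓡 d) 𝓘(ℝ, ℝ) ∞ m)
  (h : IsCriticalPassage g m z Uz a b S Vz δz)

include hm h

theorem IsCriticalPassage.isTube (hϑ : ϑ ∈ Ioo a b) (hϑz : ϑ ≠ m z) :
    IsTube g m ϑ a b (Subtype.val ⁻¹' S ϑ) where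
  isOpen := by
    obtain ⟨O, hO, e⟩ := h.relOpen ϑ hϑ
    convert hO.preimage continuous_subtype_val using 1
    ext x
    have hx : x.1 ∈ level m ϑ := x.2
    simp only [mem_preimage, e, mem_inter_iff, hx, true_and]
  reaches x hx t ht := h.reaches ϑ hϑ t ht x hx
  regular x hx hc := hϑz (by
    rw [← hx, (h.crit_iff x (by rw [hx]; exact Ioo_subset_Icc_self hϑ)).1 hc])

theorem IsCriticalPassage.mem_sweep_iff (hϑ : ϑ ∈ Ioo a b) (y : M) :
    (m y ∈ Ioo a b ∧ y ∈ S (m y)) ↔ y ∈ sweep g m ϑ a b (Subtype.val ⁻¹' S ϑ) := by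
  constructor
  · rintro ⟨h1, h2⟩
    have h3 := h.reaches _ h1 _ hϑ y h2
    have h4 : m (flow g m (m y) ϑ y) = ϑ := by rw [h3.m_flow hm, add_sub_cancel]
    exact (Hestenes.mem_sweep_iff g hm fun x hx t ht => h.reaches ϑ hϑ t ht x hx).2
      ⟨h1, h3, ⟨_, h4⟩, h.flow_mem _ h1 _ hϑ y h2, rfl⟩
  · intro hy
    obtain ⟨t, ht, _, ⟨x, hx, rfl⟩, rfl⟩ := mem_iUnion₂.1 hy
    rw [m_flow_level g hm (h.reaches ϑ hϑ t ht x hx)]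
    exact ⟨ht, h.flow_mem ϑ hϑ t ht x hx⟩

end Passage

/-! ### Operators on `L^p` induced by operators on functions -/

section Induces

variable {N : Type*} [MeasurableSpace N] {μ : Measure N} {p : ℝ≥0∞} [Fact (1 ≤ p)] {T T' : Op N}
  {A A' : Lp ℝ p μ →L[ℝ] Lp ℝ p μ} {f f' : N → ℝ}

theorem Induces.memLp (h : Induces T A) (hf : MemLp f p μ) : MemLp (T f) p μ :=
  (Lp.memLp (A (hf.toLp f))).ae_eq (h f hf)

theorem Induces.toLp_eq (h : Induces T A) (hf : MemLp f p μ) :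
    (h.memLp hf).toLp (T f) = A (hf.toLp f) :=
  Lp.ext ((MemLp.coeFn_toLp _).trans (h f hf).symm)

theorem Induces.comp (h : Induces T A) (h' : Induces T' A') : Induces (T ∘ T') (A ∘L A') := by
  intro f hf
  rw [ContinuousLinearMap.comp_apply, ← h'.toLp_eq hf]
  exact h _ (h'.memLp hf)

theorem Induces.sub (h : Induces T A) (h' : Induces T' A') : Induces (T - T') (A - A') := by
  intro f hf
  rw [sub_apply]
  filter_upwards [Lp.coeFn_sub (A (hf.toLp f)) (A' (hf.toLp f)), h f hf, h' f hf] with x h1 h2 h3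
  rw [h1, Pi.sub_apply, h2, h3, Pi.sub_apply, Pi.sub_apply]

theorem induces_zero : Induces (0 : Op N) (0 : Lp ℝ p μ →L[ℝ] Lp ℝ p μ) := by
  intro f hf
  exact Lp.coeFn_zero _ _ _

theorem Induces.add (h : Induces T A) (h' : Induces T' A') : Induces (T + T') (A + A') := by
  intro f hf
  rw [add_apply]
  filter_upwards [Lp.coeFn_add (A (hf.toLp f)) (A' (hf.toLp f)), h f hf, h' f hf] with x h1 h2 h3
  rw [h1, Pi.add_apply, h2, h3, Pi.add_apply, Pi.add_apply]

theorem induces_sum {ι : Type*} (s : Finset ι) {T : ι → Op N}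
    {A : ι → (Lp ℝ p μ →L[ℝ] Lp ℝ p μ)} (h : ∀ i ∈ s, Induces (T i) (A i)) :
    Induces (∑ i ∈ s, T i) (∑ i ∈ s, A i) := by
  classical
  induction s using Finset.induction_on with
  | empty => simpa using induces_zero
  | insert i s hi ih =>
    rw [Finset.sum_insert hi, Finset.sum_insert hi]
    exact (h i (Finset.mem_insert_self i s)).add
      (ih fun k hk => h k (Finset.mem_insert_of_mem hk))

theorem Induces.unique (h : Induces T A) (h' : Induces T A') : A = A' := by
  ext1 f
  have e : (Lp.memLp f).toLp f = f := Lp.toLp_coeFn f _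
  have := (h _ (Lp.memLp f)).trans (h' _ (Lp.memLp f)).symm
  rw [e] at this
  exact Lp.ext this

theorem Induces.norm_eq (h : Induces T A) (hf : MemLp f p μ) :
    ‖A (hf.toLp f)‖ = (eLpNorm (T f) p μ).toReal := by
  rw [Lp.norm_def, eLpNorm_congr_ae (h f hf)]

theorem Induces.eLpNorm_le (h : Induces T A) (hf : MemLp f p μ) :
    eLpNorm (T f) p μ ≤ ENNReal.ofReal ‖A‖ * eLpNorm f p μ := by
  have h1 := A.le_opNorm (hf.toLp f)
  rw [h.norm_eq hf, Lp.norm_toLp] at h1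
  rw [← ENNReal.ofReal_toReal (h.memLp hf).2.ne, ← ENNReal.ofReal_toReal hf.2.ne,
    ← ENNReal.ofReal_mul (norm_nonneg _)]
  exact ENNReal.ofReal_le_ofReal h1

/-- A linear operator on functions that preserves measurability and null functions and is bounded
for the `L^p` norm induces a bounded operator on `L^p`. -/
theorem exists_induces {c : ℝ} (hc : 0 ≤ c) (hadd : ∀ f f', T (f + f') = T f + T f')
    (hsmul : ∀ (r : ℝ) f, T (r • f) = r • T f)
    (hmeas : ∀ f, AEStronglyMeasurable f μ → AEStronglyMeasurable (T f) μ)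
    (hae : ∀ f f', f =ᵐ[μ] f' → T f =ᵐ[μ] T f')
    (hb : ∀ f, MemLp f p μ → eLpNorm (T f) p μ ≤ ENNReal.ofReal c * eLpNorm f p μ) :
    ∃ A : Lp ℝ p μ →L[ℝ] Lp ℝ p μ, Induces T A ∧ ‖A‖ ≤ c := by
  have hT : ∀ f, MemLp f p μ → MemLp (T f) p μ := fun f hf => ⟨hmeas f hf.1,
    (hb f hf).trans_lt (ENNReal.mul_lt_top ENNReal.ofReal_lt_top hf.2)⟩
  let L : Lp ℝ p μ →ₗ[ℝ] Lp ℝ p μ :=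
    { toFun := fun f => (hT f (Lp.memLp f)).toLp (T f)
      map_add' := fun f f' => by
        rw [← MemLp.toLp_add]
        refine (MemLp.toLp_eq_toLp_iff _ _).2 ?_
        rw [← hadd]
        exact hae _ _ (Lp.coeFn_add f f')
      map_smul' := fun r f => by
        rw [RingHom.id_apply, ← MemLp.toLp_const_smul]
        refine (MemLp.toLp_eq_toLp_iff _ _).2 ?_
        rw [← hsmul]
        exact hae _ _ (Lp.coeFn_smul r f) }
  have hL : ∀ f, ‖L f‖ ≤ c * ‖f‖ := by
    intro f
    change ‖(hT f (Lp.memLp f)).toLp (T f)‖ ≤ _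
    rw [Lp.norm_toLp, Lp.norm_def]
    have := ENNReal.toReal_mono
      (ENNReal.mul_lt_top ENNReal.ofReal_lt_top (Lp.memLp f).2).ne (hb f (Lp.memLp f))
    rwa [ENNReal.toReal_mul, ENNReal.toReal_ofReal hc] at this
  refine ⟨L.mkContinuous c hL, fun f hf => ?_, L.mkContinuous_norm_le hc hL⟩
  exact (MemLp.coeFn_toLp (hT _ (Lp.memLp (hf.toLp f)))).trans (hae _ _ (MemLp.coeFn_toLp hf))

end Induces

/-! ### `H`-operators -/

section HOp

variable {d : ℕ} {M : Type u} [TopologicalSpace M] [ChartedSpace (EuclideanSpace ℝ (Fin d)) M]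
  {N : Type v} [TopologicalSpace N] {j : N → M} {U U' : Set N} {T T' : Op N}

theorem IsLocalizedHOp.mono (h : IsLocalizedHOp d j U T) (hU : U ⊆ U') :
    IsLocalizedHOp d j U' T := by
  obtain ⟨n, H, hH, hT⟩ := h
  exact ⟨n, H, fun k => ⟨(hH k).1.trans hU, (hH k).2.trans hU⟩, hT⟩

theorem IsLocalizedHOp.add (h : IsLocalizedHOp d j U T) (h' : IsLocalizedHOp d j U T') :
    IsLocalizedHOp d j U (T + T') := by
  obtain ⟨n, H, hH, hT⟩ := h
  obtain ⟨n', H', hH', hT'⟩ := h'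
  refine ⟨n + n', Fin.append H H', fun k => ?_, fun f x => ?_⟩
  · refine Fin.addCases (fun i => ?_) (fun i => ?_) k
    · simpa using hH i
    · simpa using hH' i
  · simp [Fin.sum_univ_add, hT, hT']

theorem isLocalizedHOp_zero : IsLocalizedHOp d j U (0 : Op N) :=
  ⟨0, Fin.elim0, fun k => k.elim0, fun f x => by simp⟩

theorem IsLocalizedHOp.sum {ι : Type*} (s : Finset ι) {T : ι → Op N}
    (h : ∀ i ∈ s, IsLocalizedHOp d j U (T i)) : IsLocalizedHOp d j U (∑ i ∈ s, T i) := by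
  classical
  induction s using Finset.induction_on with
  | empty => simpa using isLocalizedHOp_zero
  | insert i s hi ih =>
    rw [Finset.sum_insert hi]
    exact (h i (Finset.mem_insert_self i s)).add
      (ih fun k hk => h k (Finset.mem_insert_of_mem hk))

theorem SmoothFunAt.mul {φ χ : N → ℝ} {x : N} (h : SmoothFunAt d j φ x) (h' : SmoothFunAt d j χ x) :
    SmoothFunAt d j (φ * χ) x := by
  obtain ⟨φ', h1, h2⟩ := h
  obtain ⟨χ', h3, h4⟩ := h'
  exact ⟨φ' * χ', h1.mul h3, h2.mul h4⟩

theorem SmoothFunAt.congr {φ χ : N → ℝ} {x : N} (h : SmoothFunAt d j φ x) (h' : φ =ᶠ[𝓝 x] χ) :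
    SmoothFunAt d j χ x := by
  obtain ⟨φ', h1, h2⟩ := h
  exact ⟨φ', h1, h2.trans h'⟩

theorem SmoothFunAt.comp {Φ : N → N} {χ : N → ℝ} {x : N} (h : SmoothFunAt d j χ (Φ x))
    (h' : SmoothMapAt d j Φ x) (hc : ContinuousAt Φ x) : SmoothFunAt d j (χ ∘ Φ) x := by
  obtain ⟨χ', h1, h2⟩ := h
  obtain ⟨Φ', h3, h4⟩ := h'
  refine ⟨χ' ∘ Φ', ?_, ?_⟩
  · refine ContMDiffAt.comp (j x) ?_ h3
    have : Φ' (j x) = j (Φ x) := h4.self_of_nhds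
    rw [this]
    exact h1
  · filter_upwards [h4, hc.eventually h2] with y h5 h6
    exact (congrArg χ' h5).trans h6

theorem smoothFunAt_zero (x : N) : SmoothFunAt d j (0 : N → ℝ) x :=
  ⟨fun _ => 0, contMDiffAt_const, Eventually.of_forall fun _ => rfl⟩

/-- The product of a simple `H`-operator and a function that is smooth on its domain, restricted to
a smaller domain that still contains the support of the product. -/
theorem SimpleH.exists_mul (H : SimpleH d j) {χ : N → ℝ}
    (hχ : ∀ x ∈ H.Φ.source, SmoothFunAt d j χ x) {O : Set N} (hO : IsOpen O)
    (hχO : tsupport (fun x => χ x * H.φ x) ⊆ O) : ∃ H' : SimpleH d j,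
      H'.Φ.source = H.Φ.source ∩ O ∧ H'.Φ.target = H.Φ.target ∩ H.Φ.symm ⁻¹' O ∧
      ∀ f x, H'.toOp f x = χ x * H.toOp f x := by
  have hsub : tsupport (fun x => χ x * H.φ x) ⊆ tsupport H.φ := tsupport_mul_subset_right
  have hz : ∀ x ∉ tsupport (fun x => χ x * H.φ x), χ x * H.φ x = 0 := fun x hx =>
    image_eq_zero_of_notMem_tsupport (f := fun x => χ x * H.φ x) hx
  have hsrc : (H.Φ.restrOpen O hO).source = H.Φ.source ∩ O := H.Φ.restrOpen_source O hO
  refine ⟨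
    { Φ := H.Φ.restrOpen O hO
      φ := fun x => χ x * H.φ x
      smooth_map := fun x hx => H.smooth_map x (by rw [hsrc] at hx; exact hx.1)
      smooth_symm := fun x hx => H.smooth_symm x hx.1
      smooth_fun := fun x => ?_
      hasCompactSupport := H.hasCompactSupport.mono' ((subset_tsupport _).trans hsub)
      tsupport_subset := ?_ }, hsrc, rfl, fun f x => ?_⟩
  · by_cases hx : x ∈ tsupport H.φ
    · exact (hχ x (H.tsupport_subset hx)).mul (H.smooth_fun x)
    · refine (smoothFunAt_zero x).congr ?_
      filter_upwards [(isClosed_tsupport H.φ).isOpen_compl.mem_nhds hx] with y hy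
      rw [image_eq_zero_of_notMem_tsupport hy, mul_zero, Pi.zero_apply]
  · rw [hsrc]
    exact subset_inter (hsub.trans H.tsupport_subset) hχO
  · change (H.Φ.restrOpen O hO).source.indicator (fun x => χ x * H.φ x * f (H.Φ x)) x = _
    rw [hsrc, SimpleH.toOp]
    by_cases hx : x ∈ H.Φ.source
    · rw [indicator_of_mem hx]
      by_cases hxO : x ∈ O
      · rw [indicator_of_mem (show x ∈ H.Φ.source ∩ O from ⟨hx, hxO⟩), mul_assoc]
      · rw [indicator_of_notMem fun h => hxO h.2, ← mul_assoc, hz x fun h => hxO (hχO h), zero_mul]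
    · rw [indicator_of_notMem hx, indicator_of_notMem fun h => hx h.1, mul_zero]

theorem IsLocalizedHOp.smul (h : IsLocalizedHOp d j U T) (c : ℝ) :
    IsLocalizedHOp d j U (c • T) := by
  obtain ⟨n, H, hH, hT⟩ := h
  have hc : ∀ x, SmoothFunAt d j (fun _ : N => c) x := fun x =>
    ⟨fun _ => c, contMDiffAt_const, Eventually.of_forall fun _ => rfl⟩
  choose H' h1 h2 h3 using fun k => (H k).exists_mul (χ := fun _ => c) (fun x _ => hc x)
    isOpen_univ (subset_univ _)
  refine ⟨n, H', fun k => ?_, fun f x => ?_⟩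
  · rw [h1, h2]
    simpa using hH k
  · simp only [h3, ← Finset.mul_sum, ← hT]
    rfl

theorem IsLocalizedHOp.sub (h : IsLocalizedHOp d j U T) (h' : IsLocalizedHOp d j U T') :
    IsLocalizedHOp d j U (T - T') := by
  rw [sub_eq_add_neg, ← neg_one_smul ℝ T']
  exact h.add (h'.smul (-1))

/-- Multiplying by a smooth function on both sides localizes an `H`-operator on any neighbourhood of
the support of that function. -/
theorem IsLocalizedHOp.mul_mul (h : IsLocalizedHOp d j U T) {χ : N → ℝ}
    (hχ : ∀ x, SmoothFunAt d j χ x) {O : Set N} (hO : IsOpen O)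
    (hχO : tsupport χ ⊆ O) : IsLocalizedHOp d j (U ∩ O) fun f => χ * T (χ * f) := by
  obtain ⟨n, H, hH, hT⟩ := h
  have hsmooth : ∀ k, ∀ x ∈ (H k).Φ.source, SmoothFunAt d j (χ * χ ∘ (H k).Φ) x := fun k x hx =>
    (hχ x).mul ((hχ _).comp ((H k).smooth_map x hx) ((H k).Φ.continuousAt hx))
  have hsupp : ∀ k, tsupport (fun x => (χ * χ ∘ (H k).Φ) x * (H k).φ x) ⊆
      O ∩ ((H k).Φ.source ∩ (H k).Φ ⁻¹' O) := by
    intro k x hx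
    have h1 : x ∈ tsupport (H k).φ := tsupport_mul_subset_right hx
    have hxs := (H k).tsupport_subset h1
    refine ⟨hχO (tsupport_mul_subset_left (tsupport_mul_subset_left hx)), hxs, hχO ?_⟩
    have h2 : x ∈ closure ((H k).Φ ⁻¹' Function.support χ) := by
      refine closure_mono ?_ hx
      intro y hy hy0
      exact hy (by simp only [Pi.mul_apply, Function.comp_apply, hy0, mul_zero, zero_mul])
    exact mem_closure_iff_frequently.2
      (((H k).Φ.continuousAt hxs).tendsto.frequently (mem_closure_iff_frequently.1 h2))
  choose H' h1 h2 h3 using fun k => (H k).exists_mul (hsmooth k)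
    (hO.inter ((H k).Φ.isOpen_inter_preimage hO)) (hsupp k)
  refine ⟨n, H', fun k => ⟨?_, ?_⟩, fun f x => ?_⟩
  · rw [h1]
    exact fun x hx => ⟨(hH k).1 hx.1, hx.2.1⟩
  · rw [h2]
    rintro x ⟨hx1, -, -, hx2⟩
    refine ⟨(hH k).2 hx1, ?_⟩
    rwa [mem_preimage, (H k).Φ.right_inv hx1] at hx2
  · change χ x * T (χ * f) x = _
    rw [hT, Finset.mul_sum]
    refine Finset.sum_congr rfl fun k _ => ?_
    rw [h3]
    by_cases hx : x ∈ (H k).Φ.source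
    · simp only [SimpleH.toOp, indicator_of_mem hx, Pi.mul_apply, Function.comp_apply]
      ring
    · simp only [SimpleH.toOp, indicator_of_notMem hx, mul_zero]

end HOp

section HOpManifold

variable {d : ℕ} {M : Type u} [TopologicalSpace M] [ChartedSpace (EuclideanSpace ℝ (Fin d)) M]

/-- A weighted composition with a diffeomorphism is a simple `H`-operator if its weight vanishes off
a compact set. -/
theorem isLocalizedHOp_of_diffeo [T2Space M] {V V' O K : Set M} (hV : IsOpen V) (hV' : IsOpen V')
    {f f' : M → M} (hf : MapsTo f V V') (hf' : MapsTo f' V' V) (hl : LeftInvOn f' f V)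
    (hr : RightInvOn f' f V') (hfs : ContMDiffOn (𝓡 d) (𝓡 d) ∞ f V)
    (hfs' : ContMDiffOn (𝓡 d) (𝓡 d) ∞ f' V') {w : M → ℝ}
    (hw : ContMDiffOn (𝓡 d) 𝓘(ℝ, ℝ) ∞ w V) (hK : IsCompact K) (hKV : K ⊆ V)
    (hwK : ∀ x ∈ V, x ∉ K → w x = 0) (hVO : V ⊆ O) (hVO' : V' ⊆ O) {T : Op M}
    (hT : ∀ F, T F = V.indicator fun x => w x * F (f x)) : IsLocalizedHOp d (id : M → M) O T := by
  have h0 : ∀ x ∉ K, V.indicator w x = 0 := by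
    intro x hx
    by_cases hxV : x ∈ V
    · rw [indicator_of_mem hxV, hwK x hxV hx]
    · exact indicator_of_notMem hxV w
  have hsupp : tsupport (V.indicator w) ⊆ K :=
    closure_minimal (fun x hx => by_contra fun h => hx (h0 x h)) hK.isClosed
  let H : SimpleH d (id : M → M) :=
    { Φ :=
        { toFun := f
          invFun := f'
          source := V
          target := V'
          map_source' := hf
          map_target' := hf'
          left_inv' := hl
          right_inv' := hr
          open_source := hV
          open_target := hV'
          continuousOn_toFun := hfs.continuousOn
          continuousOn_invFun := hfs'.continuousOn }
      φ := V.indicator w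
      smooth_map := fun x hx => ⟨f, hfs.contMDiffAt (hV.mem_nhds hx), EventuallyEq.rfl⟩
      smooth_symm := fun x hx => ⟨f', hfs'.contMDiffAt (hV'.mem_nhds hx), EventuallyEq.rfl⟩
      smooth_fun := fun x => by
        by_cases hx : x ∈ V
        · refine ⟨w, hw.contMDiffAt (hV.mem_nhds hx), ?_⟩
          filter_upwards [hV.mem_nhds hx] with y hy
          rw [indicator_of_mem hy]
          rfl
        · refine (smoothFunAt_zero x).congr ?_
          filter_upwards [hK.isClosed.isOpen_compl.mem_nhds fun h => hx (hKV h)] with y hy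
          rw [h0 y hy, Pi.zero_apply]
      hasCompactSupport := hK.of_isClosed_subset (isClosed_tsupport _) hsupp
      tsupport_subset := hsupp.trans hKV }
  refine ⟨1, fun _ => H, fun _ => ⟨hVO, hVO'⟩, fun F x => ?_⟩
  rw [Finset.sum_const, Finset.card_univ, Fintype.card_fin, one_smul, hT]
  change _ = V.indicator (fun x => V.indicator w x * F (f x)) x
  by_cases hx : x ∈ V
  · rw [indicator_of_mem hx, indicator_of_mem hx, indicator_of_mem hx]
  · rw [indicator_of_notMem hx, indicator_of_notMem hx]

theorem SmoothFunAt.contMDiffAt {φ : M → ℝ} {x : M} (h : SmoothFunAt d (id : M → M) φ x) :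
    ContMDiffAt (𝓡 d) 𝓘(ℝ, ℝ) ∞ φ x := by
  obtain ⟨φ', h1, h2⟩ := h
  exact h1.congr_of_eventuallyEq h2.symm

theorem SmoothMapAt.contMDiffAt {Φ : M → M} {x : M} (h : SmoothMapAt d (id : M → M) Φ x) :
    ContMDiffAt (𝓡 d) (𝓡 d) ∞ Φ x := by
  obtain ⟨Φ', h1, h2⟩ := h
  exact h1.congr_of_eventuallyEq h2.symm

variable [IsManifold (𝓡 d) ∞ M] [SecondCountableTopology M] [MeasurableSpace M] [BorelSpace M]
  (g : Metric d M)

theorem SimpleH.absolutelyContinuous (H : SimpleH d (id : M → M)) :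
    ((riemannianMeasure g (id : M → M) d).restrict H.Φ.source).map H.Φ ≪
      riemannianMeasure g (id : M → M) d :=
  absolutelyContinuous_map_diffeo g H.Φ
    (fun x hx => (H.smooth_map x hx).contMDiffAt.contMDiffWithinAt)
    (fun x hx => (H.smooth_symm x hx).contMDiffAt.contMDiffWithinAt)

theorem IsLocalizedHOp.aestronglyMeasurable {U : Set M} {T : Op M}
    (h : IsLocalizedHOp d (id : M → M) U T) {f : M → ℝ}
    (hf : AEStronglyMeasurable f (riemannianMeasure g (id : M → M) d)) :
    AEStronglyMeasurable (T f) (riemannianMeasure g (id : M → M) d) := by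
  obtain ⟨n, H, hH, hT⟩ := h
  have e : T f = ∑ k, (H k).toOp f := by
    ext x; rw [hT, Finset.sum_apply]
  rw [e]
  refine Finset.aestronglyMeasurable_sum _ fun k _ => ?_
  rw [SimpleH.toOp, aestronglyMeasurable_indicator_iff (H k).Φ.open_source.measurableSet]
  refine AEStronglyMeasurable.mul ?_ ?_
  · have : Continuous (H k).φ := continuous_iff_continuousAt.2 fun x =>
      ((H k).smooth_fun x).contMDiffAt.continuousAt
    exact this.aestronglyMeasurable
  · exact (hf.mono_ac ((H k).absolutelyContinuous g)).comp_aemeasurable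
      (aemeasurable_of_diffeo (H k).Φ _)

theorem IsLocalizedHOp.ae_eq {U : Set M} {T : Op M} (h : IsLocalizedHOp d (id : M → M) U T)
    {f f' : M → ℝ} (hf : f =ᵐ[riemannianMeasure g (id : M → M) d] f') :
    T f =ᵐ[riemannianMeasure g (id : M → M) d] T f' := by
  obtain ⟨n, H, hH, hT⟩ := h
  have key : ∀ k, ∀ᵐ x ∂riemannianMeasure g (id : M → M) d, (H k).toOp f x = (H k).toOp f' x := by
    intro k
    have h1 := ae_of_ae_map (aemeasurable_of_diffeo (H k).Φ _)
      (((H k).absolutelyContinuous g).ae_le hf)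
    rw [ae_restrict_iff' (H k).Φ.open_source.measurableSet] at h1
    filter_upwards [h1] with x hx
    by_cases hxs : x ∈ (H k).Φ.source
    · simp only [SimpleH.toOp, indicator_of_mem hxs, hx hxs]
    · simp only [SimpleH.toOp, indicator_of_notMem hxs]
  filter_upwards [ae_all_iff.2 key] with x hx
  rw [hT, hT]
  exact Finset.sum_congr rfl fun k _ => hx k

/-- An `H`-operator with an `L^p` estimate induces a bounded operator on `L^p`. -/
theorem IsLocalizedHOp.exists_induces {p : ℝ≥0∞} [Fact (1 ≤ p)] {U : Set M} {T : Op M}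
    (h : IsLocalizedHOp d (id : M → M) U T) {c : ℝ} (hc : 0 ≤ c)
    (hb : ∀ f, MemLp f p (riemannianMeasure g (id : M → M) d) →
      eLpNorm (T f) p (riemannianMeasure g (id : M → M) d) ≤
        ENNReal.ofReal c * eLpNorm f p (riemannianMeasure g (id : M → M) d)) :
    ∃ A : Lp ℝ p (riemannianMeasure g (id : M → M) d) →L[ℝ]
      Lp ℝ p (riemannianMeasure g (id : M → M) d), Induces T A ∧ ‖A‖ ≤ c :=
  Hestenes.exists_induces hc h.isLocalOp.add h.isLocalOp.smul
    (fun _ hf => h.aestronglyMeasurable g hf) (fun _ _ hf => h.ae_eq g hf) hb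

end HOpManifold

/-! ### Localization of lifted operators -/

section Extend

set_option linter.unusedSectionVars false

variable {d : ℕ} {M : Type u} [TopologicalSpace M] [ChartedSpace (EuclideanSpace ℝ (Fin d)) M]
  {m : M → ℝ} {ϑ : ℝ}

/-- Extension of a map from a level set to itself by the identity. -/
def extendId (m : M → ℝ) (ϑ : ℝ) (Φ : level m ϑ → level m ϑ) : M → M :=
  Function.extend Subtype.val (Subtype.val ∘ Φ) id

theorem extendId_apply (Φ : level m ϑ → level m ϑ) (x : level m ϑ) :
    extendId m ϑ Φ x = Φ x := Subtype.val_injective.extend_apply _ _ _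

theorem extendZero_apply (φ : level m ϑ → ℝ) (x : level m ϑ) :
    extendZero m ϑ φ x = φ x := Subtype.val_injective.extend_apply _ _ _

variable {B : Type*} [TopologicalSpace B] {EB HB : Type*} [NormedAddCommGroup EB] [NormedSpace ℝ EB]
    [TopologicalSpace HB] {IB : ModelWithCorners ℝ EB HB} [ChartedSpace HB B]
    {F : B → M} {y : B} {x : level m ϑ}

theorem SmoothFunAt.contMDiffAt_extendZero {φ : level m ϑ → ℝ}
    (h : SmoothFunAt d (Subtype.val : level m ϑ → M) φ x) (hF : ContMDiffAt IB (𝓡 d) ∞ F y)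
    (hlev : ∀ᶠ z in 𝓝 y, F z ∈ level m ϑ) (hx : F y = x) :
    ContMDiffAt IB 𝓘(ℝ, ℝ) ∞ (fun z => extendZero m ϑ φ (F z)) y := by
  obtain ⟨φ', h1, h2⟩ := h
  rw [EventuallyEq, nhds_subtype_eq_comap, eventually_comap] at h2
  refine ((hx ▸ h1).comp y hF).congr_of_eventuallyEq ?_
  have h3 := hF.continuousAt.eventually (hx ▸ h2)
  filter_upwards [h3, hlev] with z h4 h5
  change _ = φ' (F z)
  rw [show F z = (⟨F z, h5⟩ : level m ϑ) from rfl, extendZero_apply, ← h4 ⟨F z, h5⟩ rfl]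
  rfl

theorem SmoothMapAt.contMDiffAt_extendId {Φ : level m ϑ → level m ϑ}
    (h : SmoothMapAt d (Subtype.val : level m ϑ → M) Φ x) (hF : ContMDiffAt IB (𝓡 d) ∞ F y)
    (hlev : ∀ᶠ z in 𝓝 y, F z ∈ level m ϑ) (hx : F y = x) :
    ContMDiffAt IB (𝓡 d) ∞ (fun z => extendId m ϑ Φ (F z)) y := by
  obtain ⟨φ', h1, h2⟩ := h
  rw [EventuallyEq, nhds_subtype_eq_comap, eventually_comap] at h2
  refine ((hx ▸ h1).comp y hF).congr_of_eventuallyEq ?_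
  have h3 := hF.continuousAt.eventually (hx ▸ h2)
  filter_upwards [h3, hlev] with z h4 h5
  change _ = φ' (F z)
  rw [show F z = (⟨F z, h5⟩ : level m ϑ) from rfl, extendId_apply]
  exact (h4 ⟨F z, h5⟩ rfl).symm

end Extend

section TubeMap

set_option linter.unusedSectionVars false

variable {d : ℕ} {M : Type u} [TopologicalSpace M] [ChartedSpace (EuclideanSpace ℝ (Fin d)) M]
  [IsManifold (𝓡 d) ∞ M] (g : Metric d M) {m : M → ℝ}

/-- The map `F_ϑ(t, x) ↦ F_ϑ(β(t), Φ(x))`. -/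
def tubeMap (m : M → ℝ) (ϑ : ℝ) (β : ℝ → ℝ) (Φ : level m ϑ → level m ϑ) (y : M) : M :=
  flow g m ϑ (β (m y)) (extendId m ϑ Φ (flow g m (m y) ϑ y))

/-- The function `F_ϑ(t, x) ↦ γ(t) φ(x) (ψ_ϑ(β(t), Φ(x)) / ψ_ϑ(t, x))^(1/p)`, up to a factor that
depends on `x` and `Φ(x)` only. -/
def tubeCoeff (m : M → ℝ) (p : ℝ≥0∞) (ϑ : ℝ) (β γ : ℝ → ℝ) (Φ : level m ϑ → level m ϑ)
    (φ : level m ϑ → ℝ) (y : M) : ℝ :=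
  γ (m y) * extendZero m ϑ φ (flow g m (m y) ϑ y) *
    (flowJac g m (β (m y) - ϑ) (extendId m ϑ Φ (flow g m (m y) ϑ y)) /
      flowJac g m (m y - ϑ) (flow g m (m y) ϑ y)) ^ (1 / p.toReal)

/-- The operator that is `γ(t)` times a simple `H`-operator on the level set, combined with the
reparametrization `β` of time, in the flow coordinates `(t, x)` with `t ∈ (n₁, n₂)`. -/
def tubePiece (m : M → ℝ) (p : ℝ≥0∞) (ϑ n₁ n₂ : ℝ) (β γ : ℝ → ℝ)
    (H : SimpleH d (Subtype.val : level m ϑ → M)) : Op M := fun f =>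
  (sweep g m ϑ n₁ n₂ H.Φ.source).indicator fun y =>
    tubeCoeff g m p ϑ β γ H.Φ H.φ y * f (tubeMap g m ϑ β H.Φ y)

variable {g} {p : ℝ≥0∞} {ϑ a b n₁ n₂ : ℝ} {T : Set (level m ϑ)} {f : M → ℝ} {β γ : ℝ → ℝ}
  {Φ : level m ϑ → level m ϑ} {φ : level m ϑ → ℝ}
  [T2Space M] [SecondCountableTopology M] [MeasurableSpace M] [BorelSpace M]
  (hm : ContMDiff (𝓡 d) 𝓘(ℝ, ℝ) ∞ m)

include hm

theorem tubeMap_flow {t : ℝ} {x : level m ϑ} (hr : FlowReaches g m ϑ t x) :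
    tubeMap g m ϑ β Φ (flow g m ϑ t x) = flow g m ϑ (β t) (Φ x) := by
  rw [tubeMap, m_flow_level g hm hr, (hr.symm hm).2, extendId_apply]

theorem tubeCoeff_flow {t : ℝ} {x : level m ϑ} (hr : FlowReaches g m ϑ t x) :
    tubeCoeff g m p ϑ β γ Φ φ (flow g m ϑ t x) = γ t * φ x *
      (flowJac g m (β t - ϑ) (Φ x) / flowJac g m (t - ϑ) x) ^ (1 / p.toReal) := by
  rw [tubeCoeff, m_flow_level g hm hr, (hr.symm hm).2, extendId_apply, extendZero_apply]

theorem contMDiffAt_flow_back {y : M} (hr : FlowReaches g m (m y) ϑ y) :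
    ContMDiffAt (𝓡 d) (𝓡 d) ∞ (fun z => flow g m (m z) ϑ z) y :=
  contMDiffAt_flow_comp g hm (hm y) contMDiffAt_const contMDiffAt_id hr

theorem eventually_flow_back_mem {y : M} (hr : FlowReaches g m (m y) ϑ y) :
    ∀ᶠ z in 𝓝 y, flow g m (m z) ϑ z ∈ level m ϑ := by
  filter_upwards [eventually_flowReaches g hm (ϑ := m) (t := fun _ => ϑ) (x := id)
    hm.continuous.continuousAt continuousAt_const continuousAt_id hr] with z hz
  have : m (flow g m (m z) ϑ z) = ϑ := by
    rw [FlowReaches.m_flow (x := z) hm hz, add_sub_cancel]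
  exact this

theorem contMDiffAt_tubeMap (hβ : ContDiff ℝ ∞ β) {t : ℝ} {x : level m ϑ}
    (hr : FlowReaches g m ϑ t x) (hΦ : SmoothMapAt d (Subtype.val : level m ϑ → M) Φ x)
    (hr' : FlowReaches g m ϑ (β t) (Φ x)) :
    ContMDiffAt (𝓡 d) (𝓡 d) ∞ (tubeMap g m ϑ β Φ) (flow g m ϑ t x) := by
  have hmy := m_flow_level g hm hr
  have hs := hr.symm hm
  have hb : FlowReaches g m (m (flow g m ϑ t x)) ϑ (flow g m ϑ t x) := by
    rw [hmy]; exact hs.1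
  have he : flow g m (m (flow g m ϑ t x)) ϑ (flow g m ϑ t x) = x := by
    rw [hmy]; exact hs.2
  refine contMDiffAt_flow_comp g hm contMDiffAt_const
    (hβ.contMDiff.contMDiffAt.comp _ (hm _))
    (hΦ.contMDiffAt_extendId (contMDiffAt_flow_back hm hb) (eventually_flow_back_mem hm hb) he) ?_
  rw [he, hmy, extendId_apply]
  exact hr'

theorem contMDiffAt_tubeCoeff (hβ : ContDiff ℝ ∞ β) (hγ : ContDiff ℝ ∞ γ) {t : ℝ} {x : level m ϑ}
    (hr : FlowReaches g m ϑ t x) (hΦ : SmoothMapAt d (Subtype.val : level m ϑ → M) Φ x)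
    (hφ : SmoothFunAt d (Subtype.val : level m ϑ → M) φ x)
    (hr' : FlowReaches g m ϑ (β t) (Φ x)) :
    ContMDiffAt (𝓡 d) 𝓘(ℝ, ℝ) ∞ (tubeCoeff g m p ϑ β γ Φ φ) (flow g m ϑ t x) := by
  have hmy := m_flow_level g hm hr
  have hs := hr.symm hm
  have hb : FlowReaches g m (m (flow g m ϑ t x)) ϑ (flow g m ϑ t x) := by
    rw [hmy]; exact hs.1
  have he : flow g m (m (flow g m ϑ t x)) ϑ (flow g m ϑ t x) = x := by
    rw [hmy]; exact hs.2
  have hback := contMDiffAt_flow_back hm hb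
  have hlev := eventually_flow_back_mem hm hb
  have q1 := (flowReaches_iff_zero hm).1 hr
  have q2 := (flowReaches_iff_zero hm).1 hr'
  have k1 : ContMDiffAt (𝓡 d) 𝓘(ℝ, ℝ) ∞ (fun y => flowJac g m (β (m y) - ϑ)
      (extendId m ϑ Φ (flow g m (m y) ϑ y))) (flow g m ϑ t x) := by
    refine contMDiffAt_flowJac_comp g hm
      (((hβ.contMDiff.contMDiffAt.comp _ (hm _))).sub contMDiffAt_const)
      (hΦ.contMDiffAt_extendId hback hlev he) ?_
    rw [he, hmy, extendId_apply]
    exact q2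
  have k2 : ContMDiffAt (𝓡 d) 𝓘(ℝ, ℝ) ∞ (fun y => flowJac g m (m y - ϑ)
      (flow g m (m y) ϑ y)) (flow g m ϑ t x) := by
    refine contMDiffAt_flowJac_comp g hm ((hm _).sub contMDiffAt_const) hback ?_
    rw [he, hmy]
    exact q1
  have k3 := hφ.contMDiffAt_extendZero hback hlev he
  have p1 := flowJac_pos g hm q1
  have p2 := flowJac_pos g hm q2
  have k4 : ContMDiffAt (𝓡 d) 𝓘(ℝ, ℝ) ∞ (fun y => (flowJac g m (β (m y) - ϑ)
      (extendId m ϑ Φ (flow g m (m y) ϑ y)) /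
      flowJac g m (m y - ϑ) (flow g m (m y) ϑ y)) ^ (1 / p.toReal)) (flow g m ϑ t x) := by
    have e : flowJac g m (m (flow g m ϑ t x) - ϑ)
        (flow g m (m (flow g m ϑ t x)) ϑ (flow g m ϑ t x)) = flowJac g m (t - ϑ) x := by
      rw [he, hmy]
    have e' : flowJac g m (β (m (flow g m ϑ t x)) - ϑ) (extendId m ϑ Φ
        (flow g m (m (flow g m ϑ t x)) ϑ (flow g m ϑ t x))) = flowJac g m (β t - ϑ) (Φ x) := by
      rw [he, hmy, extendId_apply]
    have k5 := k1.div₀ k2 (by rw [e]; exact p1.ne')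
    refine ContMDiffAt.comp (g := fun r : ℝ => r ^ (1 / p.toReal)) _
      (Real.contDiffAt_rpow_const_of_ne ?_).contMDiffAt k5
    rw [e, e']
    exact (div_pos p2 p1).ne'
  exact ((hγ.contMDiff.contMDiffAt.comp _ (hm _)).mul k3).mul k4

/-- A tube piece is an `H`-operator on `M`: its diffeomorphism is the product of `β` and the one of
the simple `H`-operator on the level set. -/
theorem IsTube.isLocalizedHOp_tubePiece (h : IsTube g m ϑ a b T) (hN : Ioo n₁ n₂ ⊆ Ioo a b)
    (hβ : ContDiff ℝ ∞ β) (hββ : ∀ t, β (β t) = t) (hβN : MapsTo β (Ioo n₁ n₂) (Ioo n₁ n₂))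
    (hγ : ContDiff ℝ ∞ γ) {c e : ℝ} (hce : Icc c e ⊆ Ioo n₁ n₂) (hγ0 : ∀ t ∉ Icc c e, γ t = 0)
    (H : SimpleH d (Subtype.val : level m ϑ → M)) {U : Set (level m ϑ)} (hU : U ⊆ T)
    (hH : H.Φ.source ⊆ U) (hH' : H.Φ.target ⊆ U) :
    IsLocalizedHOp d (id : M → M) (sweep g m ϑ n₁ n₂ U) (tubePiece g m p ϑ n₁ n₂ β γ H) := by
  have hr : ∀ x ∈ T, ∀ t ∈ Ioo n₁ n₂, FlowReaches g m ϑ t x := fun x hx t ht =>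
    h.reaches x hx t (hN ht)
  have hsT := hH.trans hU
  have htT := hH'.trans hU
  have hmono : ∀ {U' : Set (level m ϑ)}, U' ⊆ U → sweep g m ϑ n₁ n₂ U' ⊆ sweep g m ϑ n₁ n₂ U :=
    fun hU' => iUnion₂_mono fun r _ => image_mono (image_mono hU')
  have hmem : ∀ {U' : Set (level m ϑ)} {t : ℝ} {x : level m ϑ}, t ∈ Ioo n₁ n₂ → x ∈ U' →
      flow g m ϑ t x ∈ sweep g m ϑ n₁ n₂ U' := fun ht hx =>
    mem_iUnion₂.2 ⟨_, ht, _, mem_image_of_mem _ hx, rfl⟩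
  have hsm : ∀ x ∈ H.Φ.source, ∀ t ∈ Ioo n₁ n₂,
      ContMDiffAt (𝓡 d) (𝓡 d) ∞ (tubeMap g m ϑ β H.Φ) (flow g m ϑ t x) := fun x hx t ht =>
    contMDiffAt_tubeMap hm hβ (hr x (hsT hx) t ht) (H.smooth_map x hx)
      (hr _ (htT (H.Φ.map_source hx)) _ (hβN ht))
  have hsm' : ∀ x ∈ H.Φ.target, ∀ t ∈ Ioo n₁ n₂,
      ContMDiffAt (𝓡 d) (𝓡 d) ∞ (tubeMap g m ϑ β H.Φ.symm) (flow g m ϑ t x) := fun x hx t ht =>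
    contMDiffAt_tubeMap hm hβ (hr x (htT hx) t ht) (H.smooth_symm x hx)
      (hr _ (hsT (H.Φ.map_target hx)) _ (hβN ht))
  refine isLocalizedHOp_of_diffeo (V := sweep g m ϑ n₁ n₂ H.Φ.source)
    (V' := sweep g m ϑ n₁ n₂ H.Φ.target) (f := tubeMap g m ϑ β H.Φ)
    (f' := tubeMap g m ϑ β H.Φ.symm)
    (K := (fun q : ℝ × level m ϑ => flow g m ϑ q.1 q.2) '' (Icc c e ×ˢ tsupport H.φ))
    (isOpen_sweep g hm H.Φ.open_source fun x hx => hr x (hsT hx))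
    (isOpen_sweep g hm H.Φ.open_target fun x hx => hr x (htT hx))
    ?_ ?_ ?_ ?_ ?_ ?_ ?_ ?_ ?_ ?_ (hmono hH) (hmono hH') (fun f => rfl)
  · intro y hy
    obtain ⟨t, ht, _, ⟨x, hx, rfl⟩, rfl⟩ := mem_iUnion₂.1 hy
    rw [tubeMap_flow hm (hr x (hsT hx) t ht)]
    exact hmem (hβN ht) (H.Φ.map_source hx)
  · intro y hy
    obtain ⟨t, ht, _, ⟨x, hx, rfl⟩, rfl⟩ := mem_iUnion₂.1 hy
    rw [tubeMap_flow hm (hr x (htT hx) t ht)]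
    exact hmem (hβN ht) (H.Φ.map_target hx)
  · intro y hy
    obtain ⟨t, ht, _, ⟨x, hx, rfl⟩, rfl⟩ := mem_iUnion₂.1 hy
    rw [tubeMap_flow hm (hr x (hsT hx) t ht),
      tubeMap_flow hm (hr _ (htT (H.Φ.map_source hx)) _ (hβN ht)), hββ, H.Φ.left_inv hx]
  · intro y hy
    obtain ⟨t, ht, _, ⟨x, hx, rfl⟩, rfl⟩ := mem_iUnion₂.1 hy
    rw [tubeMap_flow hm (hr x (htT hx) t ht),
      tubeMap_flow hm (hr _ (hsT (H.Φ.map_target hx)) _ (hβN ht)), hββ, H.Φ.right_inv hx]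
  · intro y hy
    obtain ⟨t, ht, _, ⟨x, hx, rfl⟩, rfl⟩ := mem_iUnion₂.1 hy
    exact (hsm x hx t ht).contMDiffWithinAt
  · intro y hy
    obtain ⟨t, ht, _, ⟨x, hx, rfl⟩, rfl⟩ := mem_iUnion₂.1 hy
    exact (hsm' x hx t ht).contMDiffWithinAt
  · intro y hy
    obtain ⟨t, ht, _, ⟨x, hx, rfl⟩, rfl⟩ := mem_iUnion₂.1 hy
    exact (contMDiffAt_tubeCoeff hm hβ hγ (hr x (hsT hx) t ht) (H.smooth_map x hx) (H.smooth_fun x)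
      (hr _ (htT (H.Φ.map_source hx)) _ (hβN ht))).contMDiffWithinAt
  · refine (isCompact_Icc.prod H.hasCompactSupport).image_of_continuousOn ?_
    refine (continuousOn_flow g hm (ϑ := ϑ)).comp
      (f := fun q : ℝ × level m ϑ => (q.1, (q.2 : M)))
      (continuous_fst.prodMk (continuous_subtype_val.comp continuous_snd)).continuousOn ?_
    rintro ⟨t, x⟩ ⟨ht, hx⟩
    exact hr x (hsT (H.tsupport_subset hx)) t (hce ht)
  · rintro _ ⟨⟨t, x⟩, ⟨ht, hx⟩, rfl⟩
    exact hmem (hce ht) (H.tsupport_subset hx)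
  · intro y hy hyK
    obtain ⟨t, ht, _, ⟨x, hx, rfl⟩, rfl⟩ := mem_iUnion₂.1 hy
    rw [tubeCoeff_flow hm (hr x (hsT hx) t ht)]
    by_cases htc : t ∈ Icc c e
    · have hx' : x ∉ tsupport H.φ := fun hx' => hyK ⟨(t, x), ⟨htc, hx'⟩, rfl⟩
      rw [image_eq_zero_of_notMem_tsupport hx', mul_zero, zero_mul]
    · rw [hγ0 t htc, zero_mul, zero_mul]

end TubeMap

section Latitudinal

set_option linter.unusedSectionVars false

variable {d : ℕ} {M : Type u} [TopologicalSpace M] [ChartedSpace (EuclideanSpace ℝ (Fin d)) M]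
  [IsManifold (𝓡 d) ∞ M] {g : Metric d M} {m : M → ℝ}

/-- The conditions under which `Q = E_{ϑ₁} - E_{ϑ₂}` is a well-behaved latitudinal projection: the
slabs around the levels `ϑ₁` and `ϑ₂` are regular and do not overlap. Critical points between them
are allowed. -/
structure IsLatitudinal (d : ℕ) {M : Type u} [TopologicalSpace M]
    [ChartedSpace (EuclideanSpace ℝ (Fin d)) M] (m : M → ℝ) (s : ℝ → ℝ) (δ ϑ₁ ϑ₂ : ℝ) : Prop where
  cutoff : IsCutoff δ s
  pos : 0 < δ
  slab₁ : IsRegularSlab d m (ϑ₁ - δ) (ϑ₁ + δ)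
  slab₂ : IsRegularSlab d m (ϑ₂ - δ) (ϑ₂ + δ)
  le : ϑ₁ + δ ≤ ϑ₂ - δ
  compact : IsCompact (m ⁻¹' Icc (ϑ₁ - δ) (ϑ₂ + δ))

variable {p : ℝ≥0∞} {s : ℝ → ℝ} {δ δ' ϑ ϑ₀ ϑ₁ ϑ₂ a b n₁ n₂ : ℝ} {T U : Set (level m ϑ)} {f : M → ℝ}
  {β γ : ℝ → ℝ} {S : ℝ → Set M} {P : Op (level m ϑ)}

theorem IsLatitudinal.subset₁ (h : IsLatitudinal d m s δ ϑ₁ ϑ₂) :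
    Ioo (ϑ₁ - δ) (ϑ₁ + δ) ⊆ Ioo (ϑ₁ - δ) (ϑ₂ + δ) :=
  Ioo_subset_Ioo_right (by linarith [h.pos, h.le])

theorem IsLatitudinal.subset₂ (h : IsLatitudinal d m s δ ϑ₁ ϑ₂) :
    Ioo (ϑ₂ - δ) (ϑ₂ + δ) ⊆ Ioo (ϑ₁ - δ) (ϑ₂ + δ) :=
  Ioo_subset_Ioo_left (by linarith [h.pos, h.le])

theorem crossCoeff_eq_zero_of_notMem (h0 : ∀ t ≤ -δ', s t = 0) {t : ℝ} (ht : t ∉ Icc (-δ') δ') :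
    crossCoeff s t = 0 := by
  rw [mem_Icc, not_and_or, not_le, not_le] at ht
  rcases ht with h | h
  · rw [crossCoeff, h0 t h.le, zero_mul]
  · rw [crossCoeff, h0 (-t) (by linarith), mul_zero]

/-- If `s` vanishes up to `-δ'`, then the coefficient of `f` in `Q f` is supported in
`[ϑ₁ - δ', ϑ₂ + δ']`. -/
theorem IsLatitudinal.diff_eq_zero (h : IsLatitudinal d m s δ ϑ₁ ϑ₂)
    (h0 : ∀ t ≤ -δ', s t = 0) {t : ℝ} (ht : t ∉ Icc (ϑ₁ - δ') (ϑ₂ + δ')) :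
    s (t - ϑ₁) ^ 2 - s (t - ϑ₂) ^ 2 = 0 := by
  have h12 : ϑ₁ < ϑ₂ := by linarith [h.pos, h.le]
  rw [mem_Icc, not_and_or, not_le, not_le] at ht
  rcases ht with h' | h'
  · rw [h0 (t - ϑ₁) (by linarith), h0 (t - ϑ₂) (by linarith)]
    ring
  · have e : ∀ r, δ' ≤ r → s r ^ 2 = 1 := fun r hr => by
      have := h.cutoff.sq_add_sq r
      rw [h0 (-r) (by linarith)] at this
      simpa using this
    rw [e (t - ϑ₁) (by linarith), e (t - ϑ₂) (by linarith)]
    ring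

theorem IsLatitudinal.diff_eq_zero_of_notMem_Ioo (h : IsLatitudinal d m s δ ϑ₁ ϑ₂) {t : ℝ}
    (ht : t ∉ Ioo (ϑ₁ - δ) (ϑ₂ + δ)) : s (t - ϑ₁) ^ 2 - s (t - ϑ₂) ^ 2 = 0 := by
  have h12 : ϑ₁ < ϑ₂ := by linarith [h.pos, h.le]
  rw [mem_Ioo, not_and_or, not_lt, not_lt] at ht
  rcases ht with h' | h'
  · rw [h.cutoff.eq_zero (by linarith : t - ϑ₁ ≤ -δ), h.cutoff.eq_zero (by linarith)]
    ring
  · rw [h.cutoff.sq_eq_one (by linarith : δ ≤ t - ϑ₁), h.cutoff.sq_eq_one (by linarith)]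
    ring

theorem contDiff_crossCoeff (hs : IsCutoff δ s) (c : ℝ) :
    ContDiff ℝ ∞ (fun t => crossCoeff s (t - c)) :=
  (hs.smooth.comp (contDiff_id.sub contDiff_const)).mul
    (hs.smooth.comp (contDiff_id.sub contDiff_const).neg)

theorem contDiff_sq_sub_sq (hs : IsCutoff δ s) :
    ContDiff ℝ ∞ (fun t => s (t - ϑ₁) ^ 2 - s (t - ϑ₂) ^ 2) :=
  ((hs.smooth.comp (contDiff_id.sub contDiff_const)).pow 2).sub
    ((hs.smooth.comp (contDiff_id.sub contDiff_const)).pow 2)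

variable [T2Space M] (hm : ContMDiff (𝓡 d) 𝓘(ℝ, ℝ) ∞ m)

include hm

/-- The trace of a compact subset of a level set under the flow is relatively closed. -/
theorem isOpen_slab_diff_sweep {D : Set (level m ϑ)} (hD : IsCompact D)
    (hr : ∀ x ∈ D, ∀ t ∈ Ioo a b, FlowReaches g m ϑ t x) :
    IsOpen (m ⁻¹' Ioo a b \ sweep g m ϑ a b D) := by
  refine isOpen_iff_mem_nhds.2 fun y hy => ?_
  obtain ⟨c, hac, hcy⟩ := exists_between hy.1.1
  obtain ⟨e, hye, heb⟩ := exists_between hy.1.2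
  set K := (fun q : ℝ × level m ϑ => flow g m ϑ q.1 q.2) '' (Icc c e ×ˢ D) with hK
  have hKc : IsCompact K := by
    refine (isCompact_Icc.prod hD).image_of_continuousOn ?_
    refine (continuousOn_flow g hm (ϑ := ϑ)).comp
      (f := fun q : ℝ × level m ϑ => (q.1, (q.2 : M)))
      (continuous_fst.prodMk (continuous_subtype_val.comp continuous_snd)).continuousOn ?_
    rintro ⟨t, x⟩ ⟨ht, hx⟩
    exact hr x hx t ⟨hac.trans_le ht.1, ht.2.trans_lt heb⟩
  have hyK : y ∉ K := by
    rintro ⟨⟨t, x⟩, ⟨ht, hx⟩, hxy⟩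
    exact hy.2 (mem_iUnion₂.2 ⟨t, ⟨hac.trans_le ht.1, ht.2.trans_lt heb⟩, x,
      mem_image_of_mem _ hx, hxy⟩)
  filter_upwards [hKc.isClosed.isOpen_compl.mem_nhds hyK,
    (isOpen_Ioo.preimage hm.continuous).mem_nhds (show y ∈ m ⁻¹' Ioo c e from ⟨hcy, hye⟩)]
    with w hw1 hw2
  refine ⟨⟨hac.trans hw2.1, hw2.2.trans heb⟩, fun hw3 => ?_⟩
  obtain ⟨t, ht, _, ⟨x, hx, rfl⟩, rfl⟩ := mem_iUnion₂.1 hw3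
  rw [mem_preimage, m_flow_level g hm (hr x hx t ht)] at hw2
  exact hw1 ⟨(t, x), ⟨Ioo_subset_Icc_self hw2, hx⟩, rfl⟩

theorem contMDiffAt_reflection (hreg : IsRegularSlab d m (ϑ₀ - δ) (ϑ₀ + δ)) {y : M}
    (hy : m y ∈ Ioo (ϑ₀ - δ) (ϑ₀ + δ)) : FlowReaches g m 0 (2 * (ϑ₀ - m y)) y ∧
      ContMDiffAt (𝓡 d) (𝓡 d) ∞ (fun y => flow g m 0 (2 * (ϑ₀ - m y)) y) y ∧
      ContMDiffAt (𝓡 d) 𝓘(ℝ, ℝ) ∞ (fun y => flowJac g m (2 * (ϑ₀ - m y)) y ^ (1 / p.toReal)) y := by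
  have k2 := hreg.reaches (g := g) hm (Ioo_subset_Icc_self hy)
    (show 2 * ϑ₀ - m y ∈ Icc (ϑ₀ - δ) (ϑ₀ + δ) from ⟨by linarith [hy.2], by linarith [hy.1]⟩)
  have k3 : FlowReaches g m 0 (2 * (ϑ₀ - m y)) y := by
    rw [flowReaches_iff_zero hm] at k2
    convert k2 using 1; ring
  have k4 : ContMDiffAt (𝓡 d) 𝓘(ℝ, ℝ) ∞ (fun y => 2 * (ϑ₀ - m y)) y :=
    contMDiffAt_const.mul (contMDiffAt_const.sub (hm y))
  refine ⟨k3, contMDiffAt_flow_comp g hm contMDiffAt_const k4 contMDiffAt_id k3, ?_⟩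
  exact ContMDiffAt.comp (g := fun r : ℝ => r ^ (1 / p.toReal)) _
    (Real.contDiffAt_rpow_const_of_ne (flowJac_pos g hm k3).ne').contMDiffAt
    (contMDiffAt_flowJac_comp g hm k4 contMDiffAt_id k3)

/-- The reflected term of a latitudinal projection, multiplied by a function `h` with support in the
closed set `C`. -/
theorem isLocalizedHOp_reflection (hreg : IsRegularSlab d m (ϑ₀ - δ) (ϑ₀ + δ)) {O C : Set M}
    (hO : IsOpen O) (hOinv : ∀ y ∈ O, ∀ τ, m y ∈ Ioo (ϑ₀ - δ) (ϑ₀ + δ) →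
      m y + τ ∈ Ioo (ϑ₀ - δ) (ϑ₀ + δ) → FlowReaches g m 0 τ y → flow g m 0 τ y ∈ O)
    (hC : IsClosed C) (hCO : ∀ y ∈ C, m y ∈ Ioo (ϑ₀ - δ) (ϑ₀ + δ) → y ∈ O) {h : M → ℝ}
    (hh : ContMDiffOn (𝓡 d) 𝓘(ℝ, ℝ) ∞ h (m ⁻¹' Ioo (ϑ₀ - δ) (ϑ₀ + δ))) (hh0 : ∀ y ∉ C, h y = 0)
    (hγ : ContDiff ℝ ∞ γ) (hδ : δ' < δ) (hγ0 : ∀ t ∉ Icc (-δ') δ', γ (t + ϑ₀) = 0) :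
    IsLocalizedHOp d (id : M → M) O fun f y =>
      h y * (γ (m y) * shift g m p (2 * (ϑ₀ - m y)) f y) := by
  set N := Ioo (ϑ₀ - δ) (ϑ₀ + δ)
  have hNo : IsOpen (m ⁻¹' N) := isOpen_Ioo.preimage hm.continuous
  have hγ1 : ∀ y, m y ∉ Icc (ϑ₀ - δ') (ϑ₀ + δ') → γ (m y) = 0 := by
    intro y hy
    have := hγ0 (m y - ϑ₀) fun h' => hy ⟨by linarith [h'.1], by linarith [h'.2]⟩
    rwa [sub_add_cancel] at this
  have hmr : ∀ y, m y ∈ N → m (flow g m 0 (2 * (ϑ₀ - m y)) y) = 2 * ϑ₀ - m y := fun y hy => by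
    rw [(contMDiffAt_reflection (p := p) hm hreg hy).1.m_flow hm]; ring
  have hmaps : MapsTo (fun y => flow g m 0 (2 * (ϑ₀ - m y)) y) (m ⁻¹' N ∩ O) (m ⁻¹' N ∩ O) := by
    rintro y ⟨hy, hyO⟩
    have hy' : m y ∈ N := hy
    have h1 := (contMDiffAt_reflection (g := g) (p := p) hm hreg hy').1
    have h2 : 2 * ϑ₀ - m y ∈ N := ⟨by linarith [hy'.2], by linarith [hy'.1]⟩
    refine ⟨?_, hOinv y hyO _ hy' ?_ h1⟩
    · rw [mem_preimage, hmr y hy']; exact h2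
    · convert h2 using 1; ring
  have hinv : ∀ y ∈ m ⁻¹' N ∩ O, (fun y => flow g m 0 (2 * (ϑ₀ - m y)) y)
      ((fun y => flow g m 0 (2 * (ϑ₀ - m y)) y) y) = y := by
    rintro y ⟨hy, hyO⟩
    have h1 := (contMDiffAt_reflection (g := g) (p := p) hm hreg hy).1
    have h2 := (h1.symm hm).2
    rw [flow_eq_zero hm] at h2
    simp only [hmr y hy]
    convert h2 using 2
    ring
  have hsm : ContMDiffOn (𝓡 d) (𝓡 d) ∞ (fun y => flow g m 0 (2 * (ϑ₀ - m y)) y)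
      (m ⁻¹' N ∩ O) := fun y hy =>
    (contMDiffAt_reflection (p := p) hm hreg hy.1).2.1.contMDiffWithinAt
  have hw : ContMDiffOn (𝓡 d) 𝓘(ℝ, ℝ) ∞
      (fun y => h y * (γ (m y) * flowJac g m (2 * (ϑ₀ - m y)) y ^ (1 / p.toReal)))
      (m ⁻¹' N ∩ O) := fun y hy =>
    ((hh y hy.1).mono inter_subset_left).mul (((hγ.contMDiff.contMDiffAt.comp _ (hm _)).mul
      (contMDiffAt_reflection (p := p) hm hreg hy.1).2.2).contMDiffWithinAt)
  have hK : IsCompact (m ⁻¹' Icc (ϑ₀ - δ') (ϑ₀ + δ') ∩ C) :=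
    (hreg.compact.of_isClosed_subset (isClosed_Icc.preimage hm.continuous)
      (preimage_mono (Icc_subset_Icc (by linarith) (by linarith)))).inter_right hC
  refine isLocalizedHOp_of_diffeo (hNo.inter hO) (hNo.inter hO) hmaps hmaps hinv hinv hsm hsm hw hK
    ?_ ?_ inter_subset_right inter_subset_right (fun f => ?_)
  · rintro y ⟨hy, hyC⟩
    have : m y ∈ N := ⟨by linarith [hy.1], by linarith [hy.2]⟩
    exact ⟨this, hCO y hyC this⟩
  · intro y _ hyK
    by_cases hy : m y ∈ Icc (ϑ₀ - δ') (ϑ₀ + δ')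
    · rw [hh0 y fun h' => hyK ⟨hy, h'⟩, zero_mul]
    · rw [hγ1 y hy, zero_mul, mul_zero]
  · ext y
    by_cases hy : y ∈ m ⁻¹' N ∩ O
    · rw [indicator_of_mem hy, shift]
      ring
    · rw [indicator_of_notMem hy]
      by_cases hyN : m y ∈ N
      · rw [hh0 y fun h' => hy ⟨hyN, hCO y h' hyN⟩, zero_mul]
      · rw [hγ1 y fun h' => hyN ⟨by linarith [h'.1], by linarith [h'.2]⟩, zero_mul, mul_zero]

/-- A latitudinal projection, multiplied by a function `h` with support in the closed set `C`. -/
theorem IsLatitudinal.isLocalizedHOp_mul (hQ : IsLatitudinal d m s δ ϑ₁ ϑ₂) {O C : Set M}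
    (hO : IsOpen O) (hOinv : ∀ y ∈ O, ∀ τ, m y ∈ Ioo (ϑ₁ - δ) (ϑ₂ + δ) →
      m y + τ ∈ Ioo (ϑ₁ - δ) (ϑ₂ + δ) → FlowReaches g m 0 τ y → flow g m 0 τ y ∈ O)
    (hC : IsClosed C) (hCO : ∀ y ∈ C, m y ∈ Ioo (ϑ₁ - δ) (ϑ₂ + δ) → y ∈ O) {h : M → ℝ}
    (hh : ContMDiffOn (𝓡 d) 𝓘(ℝ, ℝ) ∞ h (m ⁻¹' Ioo (ϑ₁ - δ) (ϑ₂ + δ))) (hh0 : ∀ y ∉ C, h y = 0) :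
    IsLocalizedHOp d (id : M → M) O fun f => h * latitudinal g m p s δ ϑ₁ ϑ₂ f := by
  obtain ⟨δ', hδ'0, hδ', h0⟩ := hQ.cutoff.exists_lt hQ.pos
  set I := Ioo (ϑ₁ - δ) (ϑ₂ + δ)
  have hIo : IsOpen (m ⁻¹' I) := isOpen_Ioo.preimage hm.continuous
  have i1 := hQ.subset₁
  have i2 := hQ.subset₂
  have k1 := isLocalizedHOp_reflection (g := g) (p := p) hm hQ.slab₁ hO
    (fun y hy τ h1 h2 => hOinv y hy τ (i1 h1) (i1 h2)) hC (fun y hy h1 => hCO y hy (i1 h1))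
    (hh.mono (preimage_mono i1)) hh0 (contDiff_crossCoeff hQ.cutoff ϑ₁) hδ' (fun t ht => by
      rw [add_sub_cancel_right]; exact crossCoeff_eq_zero_of_notMem h0 ht)
  have k2 := isLocalizedHOp_reflection (g := g) (p := p) hm hQ.slab₂ hO
    (fun y hy τ h1 h2 => hOinv y hy τ (i2 h1) (i2 h2)) hC (fun y hy h1 => hCO y hy (i2 h1))
    (hh.mono (preimage_mono i2)) hh0 (contDiff_crossCoeff hQ.cutoff ϑ₂) hδ' (fun t ht => by
      rw [add_sub_cancel_right]; exact crossCoeff_eq_zero_of_notMem h0 ht)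
  have hK : IsCompact (m ⁻¹' Icc (ϑ₁ - δ') (ϑ₂ + δ') ∩ C) :=
    (hQ.compact.of_isClosed_subset (isClosed_Icc.preimage hm.continuous)
      (preimage_mono (Icc_subset_Icc (by linarith) (by linarith)))).inter_right hC
  have k0 : IsLocalizedHOp d (id : M → M) O fun f y =>
      h y * ((s (m y - ϑ₁) ^ 2 - s (m y - ϑ₂) ^ 2) * f y) := by
    refine isLocalizedHOp_of_diffeo (V := m ⁻¹' I ∩ O) (V' := m ⁻¹' I ∩ O) (f := id) (f' := id)
      (w := fun y => h y * (s (m y - ϑ₁) ^ 2 - s (m y - ϑ₂) ^ 2))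
      (hIo.inter hO) (hIo.inter hO) (mapsTo_id _) (mapsTo_id _) (fun _ _ => rfl) (fun _ _ => rfl)
      contMDiffOn_id contMDiffOn_id ?_ hK ?_ ?_ inter_subset_right inter_subset_right (fun f => ?_)
    · exact fun y hy => ((hh y hy.1).mono inter_subset_left).mul
        ((contDiff_sq_sub_sq hQ.cutoff).contMDiff.contMDiffAt.comp _ (hm _)).contMDiffWithinAt
    · rintro y ⟨hy, hyC⟩
      have : m y ∈ I := ⟨by linarith [hy.1], by linarith [hy.2]⟩
      exact ⟨this, hCO y hyC this⟩
    · intro y _ hyK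
      by_cases hy : m y ∈ Icc (ϑ₁ - δ') (ϑ₂ + δ')
      · rw [hh0 y fun h' => hyK ⟨hy, h'⟩, zero_mul]
      · rw [hQ.diff_eq_zero h0 hy, mul_zero]
    · ext y
      by_cases hy : y ∈ m ⁻¹' I ∩ O
      · rw [indicator_of_mem hy, id]
        ring
      · rw [indicator_of_notMem hy]
        by_cases hyN : m y ∈ I
        · rw [hh0 y fun h' => hy ⟨hyN, hCO y h' hyN⟩, zero_mul]
        · rw [hQ.diff_eq_zero h0 fun h' => hyN ⟨by linarith [h'.1], by linarith [h'.2]⟩, zero_mul,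
            mul_zero]
  convert (k0.add k1).sub k2 using 1
  ext f y
  simp only [Pi.mul_apply, Pi.sub_apply, Pi.add_apply]
  rw [latitudinal_apply hm hQ.cutoff hQ.slab₁ hQ.slab₂]
  ring

/-- A latitudinal projection is an `H`-operator. -/
theorem IsLatitudinal.isLocalizedHOp (hQ : IsLatitudinal d m s δ ϑ₁ ϑ₂) :
    IsLocalizedHOp d (id : M → M) (m ⁻¹' Ioo (ϑ₁ - δ) (ϑ₂ + δ))
      (latitudinal g m p s δ ϑ₁ ϑ₂) := by
  have := hQ.isLocalizedHOp_mul (g := g) (p := p) hm (O := m ⁻¹' Ioo (ϑ₁ - δ) (ϑ₂ + δ)) (C := univ)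
    (h := fun _ => 1) (isOpen_Ioo.preimage hm.continuous)
    (fun y _ τ _ h1 h2 => by rwa [mem_preimage, h2.m_flow hm, sub_zero]) isClosed_univ
    (fun y _ hy => hy) contMDiffOn_const (fun y hy => absurd (mem_univ y) hy)
  convert this using 1
  ext f y
  simp

variable [SecondCountableTopology M] [MeasurableSpace M] [BorelSpace M]

/-- In flow coordinates, a tube piece is the product of `H` on the level set and `f ↦ γ · (f ∘ β)`
in the time variable. -/
theorem IsTube.tubePiece_flow (h : IsTube g m ϑ a b T) (hN : Ioo n₁ n₂ ⊆ Ioo a b)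
    (hβN : MapsTo β (Ioo n₁ n₂) (Ioo n₁ n₂)) (hγ0 : ∀ t ∉ Ioo n₁ n₂, γ t = 0)
    (H : SimpleH d (Subtype.val : level m ϑ → M)) (hH : H.Φ.source ⊆ T) (hH' : H.Φ.target ⊆ T)
    {t : ℝ} (ht : t ∈ Ioo a b) {x : level m ϑ} (hx : x ∈ T) :
    flowJac g m (t - ϑ) x ^ (1 / p.toReal) *
      tubePiece g m p ϑ n₁ n₂ β γ H f (flow g m ϑ t x) =
      γ t * H.toOp (hat g m p ϑ T f (β t)) x := by
  have hr := h.reaches x hx t ht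
  have hmem : flow g m ϑ t x ∈ sweep g m ϑ n₁ n₂ H.Φ.source ↔ t ∈ Ioo n₁ n₂ ∧ x ∈ H.Φ.source := by
    rw [mem_sweep_iff g hm fun x hx t ht => h.reaches x (hH hx) t (hN ht), m_flow_level g hm hr,
      (hr.symm hm).2]
    simp only [(hr.symm hm).1, true_and, Subtype.val_injective.mem_set_image]
  rw [tubePiece, SimpleH.toOp]
  by_cases htN : t ∈ Ioo n₁ n₂
  · by_cases hxs : x ∈ H.Φ.source
    · have hx' := hH' (H.Φ.map_source hxs)
      have p1 := h.flowJac_pos hm ht hx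
      have p2 := h.flowJac_pos hm (hN (hβN htN)) hx'
      rw [indicator_of_mem (hmem.2 ⟨htN, hxs⟩), indicator_of_mem hxs, tubeCoeff_flow hm hr,
        tubeMap_flow hm hr, hat_of_mem hx', Real.div_rpow p2.le p1.le]
      have p3 := (Real.rpow_pos_of_pos p1 (1 / p.toReal)).ne'
      field_simp
    · rw [indicator_of_notMem (fun h' => hxs (hmem.1 h').2), indicator_of_notMem hxs, mul_zero,
        mul_zero]
  · rw [indicator_of_notMem (fun h' => htN (hmem.1 h').1), hγ0 t htN, mul_zero, zero_mul]

/-- The product of a lifted operator and the latitudinal projection is an `H`-operator on `M`. -/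
theorem IsTube.isLocalizedHOp_lift_latitudinal (h : IsTube g m ϑ a b T)
    (hS : ∀ y, (m y ∈ Ioo a b ∧ y ∈ S (m y)) ↔ y ∈ sweep g m ϑ a b T)
    (hQ : IsLatitudinal d m s δ ϑ₁ ϑ₂) (hI : Ioo (ϑ₁ - δ) (ϑ₂ + δ) ⊆ Ioo a b) (hU : U ⊆ T)
    (hP : IsLocalizedHOp d (Subtype.val : level m ϑ → M) U P) :
    IsLocalizedHOp d (id : M → M) (sweep g m ϑ (ϑ₁ - δ) (ϑ₂ + δ) U)
      (lift g m p a b S ϑ P ∘ latitudinal g m p s δ ϑ₁ ϑ₂) := by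
  have hloc := hP.isLocalOp.mono hU
  obtain ⟨n, H, hH, hPH⟩ := hP
  obtain ⟨δ', hδ'0, hδ', h0⟩ := hQ.cutoff.exists_lt hQ.pos
  have hsw : ∀ {n₁ n₂ : ℝ} {V V' : Set (level m ϑ)}, Ioo n₁ n₂ ⊆ Ioo (ϑ₁ - δ) (ϑ₂ + δ) → V ⊆ V' →
      sweep g m ϑ n₁ n₂ V ⊆ sweep g m ϑ (ϑ₁ - δ) (ϑ₂ + δ) V' := fun h1 h2 =>
    biUnion_mono h1 fun r _ => image_mono (image_mono h2)
  have hmap : ∀ c, MapsTo (fun t => 2 * c - t) (Ioo (c - δ) (c + δ)) (Ioo (c - δ) (c + δ)) :=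
    fun c t ht => ⟨by linarith [ht.2], by linarith [ht.1]⟩
  have hcoef : ∀ c, ∀ t ∉ Icc (c - δ') (c + δ'), crossCoeff s (t - c) = 0 := fun c t ht =>
    crossCoeff_eq_zero_of_notMem h0 fun h' => ht ⟨by linarith [h'.1], by linarith [h'.2]⟩
  have hcoef' : ∀ c, ∀ t ∉ Ioo (c - δ) (c + δ), crossCoeff s (t - c) = 0 := fun c t ht =>
    hQ.cutoff.crossCoeff_eq_zero fun h' => ht ⟨by linarith [h'.1], by linarith [h'.2]⟩
  have hsub : ∀ c, Icc (c - δ') (c + δ') ⊆ Ioo (c - δ) (c + δ) := fun c t ht =>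
    ⟨by linarith [ht.1], by linarith [ht.2]⟩
  have hβ : ∀ c : ℝ, ContDiff ℝ ∞ (fun t => 2 * c - t) := fun c => contDiff_const.sub contDiff_id
  let R₀ := fun k => tubePiece g m p ϑ (ϑ₁ - δ) (ϑ₂ + δ) id
    (fun t => s (t - ϑ₁) ^ 2 - s (t - ϑ₂) ^ 2) (H k)
  let R₁ := fun k => tubePiece g m p ϑ (ϑ₁ - δ) (ϑ₁ + δ) (fun t => 2 * ϑ₁ - t)
    (fun t => crossCoeff s (t - ϑ₁)) (H k)
  let R₂ := fun k => tubePiece g m p ϑ (ϑ₂ - δ) (ϑ₂ + δ) (fun t => 2 * ϑ₂ - t)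
    (fun t => crossCoeff s (t - ϑ₂)) (H k)
  have k0 : ∀ k, IsLocalizedHOp d (id : M → M) (sweep g m ϑ (ϑ₁ - δ) (ϑ₂ + δ) U) (R₀ k) := fun k =>
    h.isLocalizedHOp_tubePiece hm hI contDiff_id (fun _ => rfl) (mapsTo_id _)
      (contDiff_sq_sub_sq hQ.cutoff) (c := ϑ₁ - δ') (e := ϑ₂ + δ')
      (fun t ht => ⟨by linarith [ht.1], by linarith [ht.2]⟩) (fun t ht => hQ.diff_eq_zero h0 ht)
      (H k) hU (hH k).1 (hH k).2
  have k1 : ∀ k, IsLocalizedHOp d (id : M → M) (sweep g m ϑ (ϑ₁ - δ) (ϑ₂ + δ) U) (R₁ k) := fun k =>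
    (h.isLocalizedHOp_tubePiece hm (hQ.subset₁.trans hI) (hβ ϑ₁) (fun _ => by ring) (hmap ϑ₁)
      (contDiff_crossCoeff hQ.cutoff ϑ₁) (hsub ϑ₁) (hcoef ϑ₁)
      (H k) hU (hH k).1 (hH k).2).mono (hsw hQ.subset₁ Subset.rfl)
  have k2 : ∀ k, IsLocalizedHOp d (id : M → M) (sweep g m ϑ (ϑ₁ - δ) (ϑ₂ + δ) U) (R₂ k) := fun k =>
    (h.isLocalizedHOp_tubePiece hm (hQ.subset₂.trans hI) (hβ ϑ₂) (fun _ => by ring) (hmap ϑ₂)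
      (contDiff_crossCoeff hQ.cutoff ϑ₂) (hsub ϑ₂) (hcoef ϑ₂)
      (H k) hU (hH k).1 (hH k).2).mono (hsw hQ.subset₂ Subset.rfl)
  have key : lift g m p a b S ϑ P ∘ latitudinal g m p s δ ϑ₁ ϑ₂ = ∑ k, (R₀ k + R₁ k - R₂ k) := by
    ext1 f
    refine h.ext_hat (p := p) hm (fun y hy => ?_) fun t ht => ?_
    · rw [Function.comp_apply, h.lift_eq_zero hm hS hy, Finset.sum_apply, Finset.sum_apply]
      have hz : ∀ {n₁ n₂ : ℝ} {β γ : ℝ → ℝ} (k : Fin n), Ioo n₁ n₂ ⊆ Ioo (ϑ₁ - δ) (ϑ₂ + δ) →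
          tubePiece g m p ϑ n₁ n₂ β γ (H k) f y = 0 := fun k hn =>
        indicator_of_notMem (fun h' => hy (biUnion_mono (hn.trans hI)
          (fun r _ => image_mono (image_mono ((hH k).1.trans hU))) h')) _
      refine (Finset.sum_eq_zero fun k _ => ?_).symm
      simp only [Pi.sub_apply, Pi.add_apply, R₀, R₁, R₂]
      rw [hz k Subset.rfl, hz k hQ.subset₁, hz k hQ.subset₂]
      ring
    · rw [Function.comp_apply, h.hat_lift hm hS hloc ht, hat_latitudinal hm hQ.cutoff hQ.slab₁
        hQ.slab₂ h (hQ.subset₁.trans hI) (hQ.subset₂.trans hI) ht, hloc.add, hloc.add, hloc.smul,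
        hloc.smul, hloc.smul]
      ext x
      by_cases hx : x ∈ T
      · rw [hat_of_mem hx, Finset.sum_apply, Finset.sum_apply, Finset.mul_sum]
        simp only [Pi.add_apply, Pi.smul_apply, smul_eq_mul, hPH, Finset.mul_sum]
        rw [← Finset.sum_add_distrib, ← Finset.sum_add_distrib]
        refine Finset.sum_congr rfl fun k _ => ?_
        have hs' := (hH k).1.trans hU
        have ht' := (hH k).2.trans hU
        have e0 := h.tubePiece_flow (p := p) (f := f) hm hI (mapsTo_id _)
          (fun t ht => hQ.diff_eq_zero_of_notMem_Ioo ht) (H k) hs' ht' ht hx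
        have e1 := h.tubePiece_flow (p := p) (f := f) hm (hQ.subset₁.trans hI) (hmap ϑ₁)
          (hcoef' ϑ₁) (H k) hs' ht' ht hx
        have e2 := h.tubePiece_flow (p := p) (f := f) hm (hQ.subset₂.trans hI) (hmap ϑ₂)
          (hcoef' ϑ₂) (H k) hs' ht' ht hx
        simp only [Pi.sub_apply, Pi.add_apply, R₀, R₁, R₂]
        rw [mul_sub, mul_add, e0, e1, e2, id]
        ring
      · rw [hat_of_notMem hx]
        simp only [Pi.add_apply, Pi.smul_apply, smul_eq_mul, hloc.zero_off _ x hx]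
        ring
  rw [key]
  exact IsLocalizedHOp.sum _ fun k _ => ((k0 k).add (k1 k)).sub (k2 k)

end Latitudinal

/-! ### Norm estimates -/

section AwwConst

set_option linter.unusedSectionVars false

variable {p : ℝ≥0∞} [Fact (1 ≤ p)]

theorem continuous_norm_awwMatrix : Continuous fun ξ : Icc (0 : ℝ) 1 =>
    ‖(Matrix.toLpLin p p (awwMatrix ξ)).toContinuousLinearMap‖ := by
  have h1 : Continuous fun A : Matrix (Fin 2) (Fin 2) ℝ =>
      (Matrix.toLpLin p p A).toContinuousLinearMap :=
    (LinearMap.toContinuousLinearMap.toLinearMap ∘ₗ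
      (Matrix.toLpLin p p : Matrix (Fin 2) (Fin 2) ℝ ≃ₗ[ℝ] _).toLinearMap
      ).continuous_of_finiteDimensional
  have h2 : Continuous fun ξ : Icc (0 : ℝ) 1 => awwMatrix ξ := by
    refine continuous_matrix fun i k => ?_
    fin_cases i <;> fin_cases k <;> simp [awwMatrix] <;> fun_prop
  exact (h1.comp h2).norm

theorem norm_awwMatrix_le (ξ : Icc (0 : ℝ) 1) :
    ‖(Matrix.toLpLin p p (awwMatrix ξ)).toContinuousLinearMap‖ ≤ awwConst p :=
  le_ciSup (isCompact_range continuous_norm_awwMatrix).bddAbove ξ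

theorem norm_toLp_two_rpow (hp : 0 < p.toReal) (α β : ℝ) :
    ‖WithLp.toLp p ![α, β]‖ ^ p.toReal = |α| ^ p.toReal + |β| ^ p.toReal := by
  rw [PiLp.norm_eq_sum hp, ← Real.rpow_mul (Finset.sum_nonneg fun i _ =>
    Real.rpow_nonneg (norm_nonneg _) _), one_div_mul_cancel hp.ne', Real.rpow_one]
  simp [Fin.sum_univ_two]

theorem toLpLin_awwMatrix (ξ α β : ℝ) :
    Matrix.toLpLin p p (awwMatrix ξ) (WithLp.toLp p ![α, β]) =
      WithLp.toLp p ![ξ * α + Real.sqrt (ξ * (1 - ξ)) * β,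
        Real.sqrt (ξ * (1 - ξ)) * α + (1 - ξ) * β] := by
  rw [Matrix.toLpLin_toLp]
  congr 1
  ext i
  fin_cases i <;> simp [awwMatrix, Matrix.mulVec, dotProduct, Fin.sum_univ_two]

theorem awwConst_nonneg : 0 ≤ awwConst p :=
  (norm_nonneg _).trans (norm_awwMatrix_le (p := p) ⟨0, by simp⟩)

theorem awwMatrix_le (hp : 0 < p.toReal) {ξ : ℝ} (hξ : ξ ∈ Icc (0 : ℝ) 1) (α β : ℝ) :
    |ξ * α + Real.sqrt (ξ * (1 - ξ)) * β| ^ p.toReal +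
      |Real.sqrt (ξ * (1 - ξ)) * α + (1 - ξ) * β| ^ p.toReal ≤
      awwConst p ^ p.toReal * (|α| ^ p.toReal + |β| ^ p.toReal) := by
  have h1 := (Matrix.toLpLin p p (awwMatrix ξ)).toContinuousLinearMap.le_opNorm
    (WithLp.toLp p ![α, β])
  have h2 : ‖Matrix.toLpLin p p (awwMatrix ξ) (WithLp.toLp p ![α, β])‖ ≤
      awwConst p * ‖WithLp.toLp p ![α, β]‖ :=
    h1.trans (mul_le_mul_of_nonneg_right (norm_awwMatrix_le ⟨ξ, hξ⟩) (norm_nonneg _))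
  rw [← norm_toLp_two_rpow hp, ← norm_toLp_two_rpow hp, ← toLpLin_awwMatrix,
    ← Real.mul_rpow awwConst_nonneg (norm_nonneg _)]
  exact Real.rpow_le_rpow (norm_nonneg _) h2 hp.le

theorem one_le_awwConst (hp : 0 < p.toReal) : 1 ≤ awwConst p := by
  have h := awwMatrix_le hp (ξ := 1) (by simp) 1 0
  simp only [mul_zero, add_zero, mul_one, sub_self, Real.sqrt_zero, abs_one, Real.one_rpow,
    abs_zero, Real.zero_rpow hp.ne'] at h
  by_contra! h'
  exact absurd h (not_le.2 (Real.rpow_lt_one awwConst_nonneg h' hp))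

/-- The estimate for the matrices `A_ξ`, with either sign of the off-diagonal entries. -/
theorem enorm_aww_le (hp : 0 < p.toReal) {ξ c : ℝ} (hξ : ξ ∈ Icc (0 : ℝ) 1)
    (hc : c ^ 2 = ξ * (1 - ξ)) (α β : ℝ) :
    ‖ξ * α + c * β‖ₑ ^ p.toReal + ‖c * α + (1 - ξ) * β‖ₑ ^ p.toReal ≤
      ENNReal.ofReal (awwConst p) ^ p.toReal * (‖α‖ₑ ^ p.toReal + ‖β‖ₑ ^ p.toReal) := by
  have key : |ξ * α + c * β| ^ p.toReal + |c * α + (1 - ξ) * β| ^ p.toReal ≤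
      awwConst p ^ p.toReal * (|α| ^ p.toReal + |β| ^ p.toReal) := by
    have hs : Real.sqrt (ξ * (1 - ξ)) = |c| := by rw [← hc, Real.sqrt_sq_eq_abs]
    have h1 := awwMatrix_le hp hξ α β
    have h2 := awwMatrix_le hp hξ α (-β)
    rw [hs] at h1 h2
    rcases abs_choice c with h | h
    · rwa [h] at h1
    · rw [h, abs_neg β] at h2
      rw [show ξ * α + c * β = ξ * α + -c * -β by ring,
        ← abs_neg (c * α + (1 - ξ) * β),
        show -(c * α + (1 - ξ) * β) = -c * α + (1 - ξ) * -β by ring]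
      exact h2
  have e : ∀ r : ℝ, ‖r‖ₑ ^ p.toReal = ENNReal.ofReal (|r| ^ p.toReal) := fun r => by
    rw [Real.enorm_eq_ofReal_abs, ENNReal.ofReal_rpow_of_nonneg (abs_nonneg r) hp.le]
  have n : ∀ r : ℝ, 0 ≤ |r| ^ p.toReal := fun r => Real.rpow_nonneg (abs_nonneg r) _
  rw [e, e, e, e, ENNReal.ofReal_rpow_of_nonneg awwConst_nonneg hp.le,
    ← ENNReal.ofReal_add (n _) (n _), ← ENNReal.ofReal_add (n _) (n _),
    ← ENNReal.ofReal_mul (Real.rpow_nonneg awwConst_nonneg _)]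
  exact ENNReal.ofReal_le_ofReal key

/-- For `p = 2` the matrices `A_ξ` are orthogonal projections. -/
theorem awwConst_two_le : awwConst 2 ≤ 1 := by
  have hp : 0 < (2 : ℝ≥0∞).toReal := by simp
  have : Nonempty (Icc (0 : ℝ) 1) := ⟨⟨0, by simp⟩⟩
  refine ciSup_le fun ξ => ContinuousLinearMap.opNorm_le_bound _ zero_le_one fun v => ?_
  obtain ⟨α, β, rfl⟩ : ∃ α β, v = WithLp.toLp 2 ![α, β] := ⟨v 0, v 1, by
    ext i; fin_cases i <;> rfl⟩
  rw [one_mul, ← Real.rpow_le_rpow_iff (norm_nonneg _) (norm_nonneg _) hp]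
  change ‖Matrix.toLpLin 2 2 (awwMatrix ξ) _‖ ^ _ ≤ _
  rw [toLpLin_awwMatrix, norm_toLp_two_rpow hp, norm_toLp_two_rpow hp]
  have h0 : 0 ≤ (ξ : ℝ) * (1 - ξ) := mul_nonneg ξ.2.1 (by linarith [ξ.2.2])
  have hs := Real.sq_sqrt h0
  set c := Real.sqrt ((ξ : ℝ) * (1 - ξ))
  simp only [ENNReal.toReal_ofNat, Real.rpow_two, sq_abs]
  have h1 : 0 ≤ (1 - ξ) * α ^ 2 - 2 * c * α * β + ξ * β ^ 2 := by
    rcases eq_or_lt_of_le ξ.2.1 with h | h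
    · have : c = 0 := by
        have : c ^ 2 = 0 := by rw [hs, ← h, zero_mul]
        exact pow_eq_zero_iff two_ne_zero |>.1 this
      rw [this, ← h]; nlinarith [sq_nonneg α]
    · have : 0 ≤ ξ * ((1 - ξ) * α ^ 2 - 2 * c * α * β + ξ * β ^ 2) := by
        have : ξ * ((1 - ξ) * α ^ 2 - 2 * c * α * β + ξ * β ^ 2) = (c * α - ξ * β) ^ 2 := by
          linear_combination (-α ^ 2) * hs
        rw [this]; positivity
      exact nonneg_of_mul_nonneg_right this h
  have h2 : (ξ * α + c * β) ^ 2 + (c * α + (1 - ξ) * β) ^ 2 =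
      α ^ 2 + β ^ 2 - ((1 - ξ) * α ^ 2 - 2 * c * α * β + ξ * β ^ 2) := by
    linear_combination (α ^ 2 + β ^ 2) * hs
  rw [h2]
  linarith

end AwwConst

section ELpNorm

variable {X Y : Type*} [MeasurableSpace X] [MeasurableSpace Y] {μ : Measure X} {ν : Measure Y}
  {p : ℝ≥0∞} {F : X → ℝ} {f : Y → ℝ} {c : ℝ}

theorem eLpNorm_rpow_toReal (hp : 0 < p.toReal) :
    eLpNorm F p μ ^ p.toReal = ∫⁻ x, ‖F x‖ₑ ^ p.toReal ∂μ := by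
  have h := ENNReal.toReal_pos_iff.1 hp
  rw [eLpNorm_eq_lintegral_rpow_enorm_toReal h.1.ne' h.2.ne, ← ENNReal.rpow_mul,
    one_div_mul_cancel hp.ne', ENNReal.rpow_one]

theorem eLpNorm_le_iff_lintegral (hp : 0 < p.toReal) :
    eLpNorm F p μ ≤ ENNReal.ofReal c * eLpNorm f p ν ↔
      ∫⁻ x, ‖F x‖ₑ ^ p.toReal ∂μ ≤
        ENNReal.ofReal c ^ p.toReal * ∫⁻ y, ‖f y‖ₑ ^ p.toReal ∂ν := by
  rw [← eLpNorm_rpow_toReal hp, ← eLpNorm_rpow_toReal hp, ← ENNReal.mul_rpow_of_nonneg _ _ hp.le,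
    ENNReal.rpow_le_rpow_iff hp]

/-- An inequality of integrals that holds on two disjoint sets and pointwise off them. -/
theorem lintegral_le_of_pieces {Z₁ Z₂ : Set X} (h1 : MeasurableSet Z₁) (h2 : MeasurableSet Z₂)
    (h12 : Disjoint Z₁ Z₂) {G H : X → ℝ≥0∞} {k : ℝ≥0∞} (hk : k ≠ ⊤)
    (e1 : ∫⁻ x in Z₁, G x ∂μ ≤ k * ∫⁻ x in Z₁, H x ∂μ)
    (e2 : ∫⁻ x in Z₂, G x ∂μ ≤ k * ∫⁻ x in Z₂, H x ∂μ)
    (e3 : ∀ x ∉ Z₁ ∪ Z₂, G x ≤ k * H x) : ∫⁻ x, G x ∂μ ≤ k * ∫⁻ x, H x ∂μ := by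
  rw [← lintegral_add_compl G (h1.union h2), ← lintegral_add_compl H (h1.union h2),
    lintegral_union h2 h12, lintegral_union h2 h12, mul_add, mul_add]
  refine add_le_add (add_le_add e1 e2) ?_
  rw [← lintegral_const_mul' _ _ hk]
  exact setLIntegral_mono' (h1.union h2).compl e3

theorem setLIntegral_reflect (F : ℝ → ℝ≥0∞) (c δ : ℝ) :
    ∫⁻ t in Ioo (c - δ) (c + δ), F (2 * c - t) = ∫⁻ t in Ioo (c - δ) (c + δ), F t := by
  have h := (volume.measurePreserving_sub_left (2 * c) : MeasurePreserving (fun t => 2 * c - t)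
    volume volume).setLIntegral_comp_preimage_emb
    (MeasurableEquiv.subLeft (2 * c)).measurableEmbedding F (Ioo (c - δ) (c + δ))
  rw [← h]
  congr 2
  ext t
  simp only [mem_preimage, mem_Ioo]
  constructor <;> rintro ⟨h1, h2⟩ <;> constructor <;> linarith

end ELpNorm

section Norm

set_option linter.unusedSectionVars false

variable {d : ℕ} {M : Type u} [TopologicalSpace M] [ChartedSpace (EuclideanSpace ℝ (Fin d)) M]
  [IsManifold (𝓡 d) ∞ M] {g : Metric d M} {m : M → ℝ} {p : ℝ≥0∞} [Fact (1 ≤ p)] {s : ℝ → ℝ}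
  {δ ϑ ϑ₁ ϑ₂ a b : ℝ} {T : Set (level m ϑ)} {f F : M → ℝ} {S : ℝ → Set M}
  {P : Op (level m ϑ)} (hd : 1 ≤ d) (hp : p ≠ ⊤)
  [T2Space M] [SecondCountableTopology M] [MeasurableSpace M] [BorelSpace M]
  (hm : ContMDiff (𝓡 d) 𝓘(ℝ, ℝ) ∞ m)

include hd hp hm

/-- The norm of a lifted operator is at most the norm of the operator on the level set, since it
acts fibrewise. -/
theorem IsTube.eLpNorm_lift_le (h : IsTube g m ϑ a b T)
    (hS : ∀ y, (m y ∈ Ioo a b ∧ y ∈ S (m y)) ↔ y ∈ sweep g m ϑ a b T) (hP : IsLocalOp T P)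
    {A : Lp ℝ p (levelMeasure g m ϑ) →L[ℝ] Lp ℝ p (levelMeasure g m ϑ)} (hA : Induces P A)
    (hf : MemLp f p (riemannianMeasure g (id : M → M) d))
    (hLf : AEStronglyMeasurable (lift g m p a b S ϑ P f) (riemannianMeasure g (id : M → M) d)) :
    eLpNorm (lift g m p a b S ϑ P f) p (riemannianMeasure g (id : M → M) d) ≤
      ENNReal.ofReal ‖A‖ * eLpNorm f p (riemannianMeasure g (id : M → M) d) := by
  have hp0 := toReal_pos_of_fact hp
  have hsw : MeasurableSet (sweep g m ϑ a b T) :=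
    (isOpen_sweep g hm h.isOpen h.reaches).measurableSet
  rw [eLpNorm_le_iff_lintegral hp0]
  have e : ∫⁻ y, ‖lift g m p a b S ϑ P f y‖ₑ ^ p.toReal ∂riemannianMeasure g (id : M → M) d =
      ∫⁻ y in sweep g m ϑ a b T, ‖lift g m p a b S ϑ P f y‖ₑ ^ p.toReal
        ∂riemannianMeasure g (id : M → M) d := by
    rw [setLIntegral_eq_of_support_subset]
    intro y hy
    by_contra hy'
    refine hy ?_
    simp only [h.lift_eq_zero hm hS hy', enorm_zero, ENNReal.zero_rpow_of_pos hp0]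
  have htop : ENNReal.ofReal ‖A‖ ^ p.toReal ≠ ⊤ :=
    ENNReal.rpow_ne_top_of_nonneg hp0.le ENNReal.ofReal_ne_top
  calc _ = ∫⁻ t in Ioo a b, ∫⁻ x, ‖hat g m p ϑ T (lift g m p a b S ϑ P f) t x‖ₑ ^ p.toReal
        ∂levelMeasure g m ϑ := by rw [e, h.lintegral_rpow hd hm hp0 hLf]
    _ ≤ ∫⁻ t in Ioo a b, ENNReal.ofReal ‖A‖ ^ p.toReal *
        ∫⁻ x, ‖hat g m p ϑ T f t x‖ₑ ^ p.toReal ∂levelMeasure g m ϑ := by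
      refine lintegral_mono_ae ?_
      filter_upwards [h.memLp_fibre hd hm hp hf, ae_restrict_mem measurableSet_Ioo] with t ht htI
      rw [h.hat_lift hm hS hP htI, ← eLpNorm_le_iff_lintegral hp0]
      exact hA.eLpNorm_le ht
    _ = ENNReal.ofReal ‖A‖ ^ p.toReal * ∫⁻ y in sweep g m ϑ a b T, ‖f y‖ₑ ^ p.toReal
        ∂riemannianMeasure g (id : M → M) d := by
      rw [lintegral_const_mul' _ _ htop, h.lintegral_rpow hd hm hp0 hf.1]
    _ ≤ _ := by gcongr; exact Measure.restrict_le_self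

/-- The `L^p` estimate in the slab around a level, where a latitudinal projection is given by the
matrices `A_ξ` acting on the values at two points that are reflections of each other. -/
theorem IsTube.lintegral_zone_le {U : Set (level m ϑ)} (h : IsTube g m ϑ (ϑ - δ) (ϑ + δ) U)
    (hf : AEStronglyMeasurable f (riemannianMeasure g (id : M → M) d))
    (hF : AEStronglyMeasurable F (riemannianMeasure g (id : M → M) d)) {ξ c : ℝ → ℝ}
    (hξ : ∀ t, ξ t ∈ Icc (0 : ℝ) 1)
    (hξ' : ∀ t ∈ Ioo (ϑ - δ) (ϑ + δ), ξ (2 * ϑ - t) = 1 - ξ t)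
    (hc' : ∀ t, c (2 * ϑ - t) = c t)
    (hc : ∀ t ∈ Ioo (ϑ - δ) (ϑ + δ), c t ^ 2 = ξ t * (1 - ξ t))
    (hFf : ∀ t ∈ Ioo (ϑ - δ) (ϑ + δ), hat g m p ϑ U F t =
      ξ t • hat g m p ϑ U f t + c t • hat g m p ϑ U f (2 * ϑ - t)) :
    ∫⁻ y in sweep g m ϑ (ϑ - δ) (ϑ + δ) U, ‖F y‖ₑ ^ p.toReal ∂riemannianMeasure g (id : M → M) d ≤
      ENNReal.ofReal (awwConst p) ^ p.toReal *
        ∫⁻ y in sweep g m ϑ (ϑ - δ) (ϑ + δ) U, ‖f y‖ₑ ^ p.toReal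
          ∂riemannianMeasure g (id : M → M) d := by
  have := sigmaFinite_levelMeasure (g := g) hd hm h.regular
  have hp0 := toReal_pos_of_fact hp
  rw [h.lintegral_rpow hd hm hp0 hf, h.lintegral_rpow hd hm hp0 hF]
  set I := Ioo (ϑ - δ) (ϑ + δ) with hI
  set μ := levelMeasure g m ϑ
  have htop : ENNReal.ofReal (awwConst p) ^ p.toReal ≠ ⊤ :=
    ENNReal.rpow_ne_top_of_nonneg hp0.le ENNReal.ofReal_ne_top
  set u : ℝ → ℝ≥0∞ := fun t => ∫⁻ x, ‖hat g m p ϑ U f t x‖ₑ ^ p.toReal ∂μ with hu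
  set w : ℝ → ℝ≥0∞ := fun t => ∫⁻ x, ‖hat g m p ϑ U F t x‖ₑ ^ p.toReal ∂μ with hw
  have hum : AEMeasurable u (volume.restrict I) :=
    ((h.aestronglyMeasurable_hat hd hm hf).enorm.pow_const _).lintegral_prod_right'
  have hfib : ∀ᵐ t ∂volume.restrict I, w t + w (2 * ϑ - t) ≤
      ENNReal.ofReal (awwConst p) ^ p.toReal * (u t + u (2 * ϑ - t)) := by
    filter_upwards [h.aestronglyMeasurable_fibre (p := p) hd hm hf,
      ae_restrict_mem measurableSet_Ioo] with t ht htI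
    have htI' : 2 * ϑ - t ∈ I := ⟨by linarith [htI.2], by linarith [htI.1]⟩
    have ht' : AEMeasurable (fun x => ‖hat g m p ϑ U f t x‖ₑ ^ p.toReal) μ :=
      ht.enorm.pow_const _
    refine (le_lintegral_add _ _).trans ?_
    rw [hu]
    simp only []
    rw [← lintegral_add_left' ht', ← lintegral_const_mul' _ _ htop]
    refine lintegral_mono fun x => ?_
    have e1 := congrFun (hFf t htI) x
    have e2 := congrFun (hFf _ htI') x
    rw [sub_sub_cancel, hξ' t htI, hc'] at e2
    simp only [Pi.add_apply, Pi.smul_apply, smul_eq_mul] at e1 e2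
    rw [add_comm] at e2
    simp only []
    rw [e1, e2]
    exact enorm_aww_le hp0 (hξ t) (hc t htI) _ _
  have h2 : 2 * ∫⁻ t in I, w t ≤
      2 * (ENNReal.ofReal (awwConst p) ^ p.toReal * ∫⁻ t in I, u t) := by
    calc 2 * ∫⁻ t in I, w t = (∫⁻ t in I, w t) + ∫⁻ t in I, w (2 * ϑ - t) := by
          rw [setLIntegral_reflect, two_mul]
      _ ≤ ∫⁻ t in I, (w t + w (2 * ϑ - t)) := le_lintegral_add _ _
      _ ≤ ∫⁻ t in I, ENNReal.ofReal (awwConst p) ^ p.toReal * (u t + u (2 * ϑ - t)) :=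
          lintegral_mono_ae hfib
      _ = ENNReal.ofReal (awwConst p) ^ p.toReal * ((∫⁻ t in I, u t) + ∫⁻ t in I, u t) := by
          rw [lintegral_const_mul' _ _ htop, lintegral_add_left' hum, setLIntegral_reflect]
      _ = _ := by ring
  exact (ENNReal.mul_le_mul_iff_right two_ne_zero ENNReal.ofNat_ne_top).1 h2

theorem IsRegularSlab.isTube (h : IsRegularSlab d m (ϑ - δ) (ϑ + δ)) (hδ : 0 < δ) :
    IsTube g m ϑ (ϑ - δ) (ϑ + δ) univ ∧
      sweep g m ϑ (ϑ - δ) (ϑ + δ) univ = m ⁻¹' Ioo (ϑ - δ) (ϑ + δ) := by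
  have hϑ : ϑ ∈ Icc (ϑ - δ) (ϑ + δ) := ⟨by linarith, by linarith⟩
  have hr : ∀ x ∈ (univ : Set (level m ϑ)), ∀ t ∈ Ioo (ϑ - δ) (ϑ + δ), FlowReaches g m ϑ t x := by
    intro x _ t ht
    have hx : m x.1 = ϑ := x.2
    have := h.reaches (g := g) hm (x := x.1) (by rwa [hx]) (Ioo_subset_Icc_self ht)
    rwa [hx] at this
  refine ⟨⟨isOpen_univ, hr, fun x hx => h.regular x (by rwa [hx])⟩, ?_⟩
  ext y
  rw [mem_sweep_iff g hm hr]
  refine ⟨fun h' => h'.1, fun hy => ?_⟩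
  have k := h.reaches (g := g) hm (Ioo_subset_Icc_self hy) hϑ
  have e : m (flow g m (m y) ϑ y) = ϑ := by rw [k.m_flow hm, add_sub_cancel]
  exact ⟨hy, k, ⟨_, e⟩, mem_univ _, rfl⟩

/-- A latitudinal projection has norm at most `B_p`. -/
theorem IsLatitudinal.eLpNorm_le (hQ : IsLatitudinal d m s δ ϑ₁ ϑ₂)
    (hf : MemLp f p (riemannianMeasure g (id : M → M) d)) :
    eLpNorm (latitudinal g m p s δ ϑ₁ ϑ₂ f) p (riemannianMeasure g (id : M → M) d) ≤
      ENNReal.ofReal (awwConst p) * eLpNorm f p (riemannianMeasure g (id : M → M) d) := by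
  have hp0 := toReal_pos_of_fact hp
  have hle := hQ.le
  have hδ := hQ.pos
  have hs := hQ.cutoff
  have hQf := (hQ.isLocalizedHOp (g := g) (p := p) hm).aestronglyMeasurable g hf.1
  obtain ⟨t1, s1⟩ := hQ.slab₁.isTube (g := g) hd hp hm hδ
  obtain ⟨t2, s2⟩ := hQ.slab₂.isTube (g := g) hd hp hm hδ
  have htop : ENNReal.ofReal (awwConst p) ^ p.toReal ≠ ⊤ :=
    ENNReal.rpow_ne_top_of_nonneg hp0.le ENNReal.ofReal_ne_top
  have hone : 1 ≤ ENNReal.ofReal (awwConst p) ^ p.toReal :=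
    ENNReal.one_le_rpow (ENNReal.one_le_ofReal.2 (one_le_awwConst hp0)) hp0
  have hsq : ∀ t, s t ^ 2 ∈ Icc (0 : ℝ) 1 := fun t =>
    ⟨sq_nonneg _, pow_le_one₀ (hs.mem_Icc t).1 (hs.mem_Icc t).2⟩
  have hcc : ∀ t, crossCoeff s t ^ 2 = s t ^ 2 * (1 - s t ^ 2) := fun t => by
    rw [crossCoeff, mul_pow, hs.sq_neg]
  rw [eLpNorm_le_iff_lintegral hp0]
  have happ := fun y => latitudinal_apply (g := g) (p := p) (f := f) hm hs hQ.slab₁ hQ.slab₂ y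
  refine lintegral_le_of_pieces (Z₁ := m ⁻¹' Ioo (ϑ₁ - δ) (ϑ₁ + δ))
    (Z₂ := m ⁻¹' Ioo (ϑ₂ - δ) (ϑ₂ + δ)) (isOpen_Ioo.preimage hm.continuous).measurableSet
    (isOpen_Ioo.preimage hm.continuous).measurableSet ?_ htop ?_ ?_ ?_
  · refine disjoint_left.2 fun y hy1 hy2 => ?_
    linarith [hy1.2, hy2.1]
  · rw [← s1]
    refine t1.lintegral_zone_le (ξ := fun t => s (t - ϑ₁) ^ 2)
      (c := fun t => crossCoeff s (t - ϑ₁)) hd hp hm hf.1 hQf (fun t => hsq _) (fun t _ => ?_)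
      (fun t => ?_) (fun t _ => hcc _) fun t ht => ?_
    · rw [show 2 * ϑ₁ - t - ϑ₁ = -(t - ϑ₁) by ring, hs.sq_neg]
    · rw [show 2 * ϑ₁ - t - ϑ₁ = -(t - ϑ₁) by ring, crossCoeff_neg]
    · ext x
      have hmt := m_flow_level g hm (t1.reaches x (mem_univ x) t ht)
      simp only [Pi.add_apply, Pi.smul_apply, smul_eq_mul]
      rw [← hat_aww hm hs hQ.slab₁ t1 Subset.rfl ht x, hat_of_mem (mem_univ x),
        hat_of_mem (mem_univ x), latitudinal, Pi.sub_apply, Pi.sub_apply,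
        aww_eq_zero hm hs hQ.slab₂ (by rw [hmt]; linarith [ht.2]), sub_zero]
  · rw [← s2]
    refine t2.lintegral_zone_le (ξ := fun t => 1 - s (t - ϑ₂) ^ 2)
      (c := fun t => -crossCoeff s (t - ϑ₂)) hd hp hm hf.1 hQf (fun t => ?_) (fun t _ => ?_)
      (fun t => ?_) (fun t _ => ?_) fun t ht => ?_
    · have := hsq (t - ϑ₂)
      exact ⟨by linarith [this.2], by linarith [this.1]⟩
    · rw [show 2 * ϑ₂ - t - ϑ₂ = -(t - ϑ₂) by ring, hs.sq_neg]
    · rw [show 2 * ϑ₂ - t - ϑ₂ = -(t - ϑ₂) by ring, crossCoeff_neg]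
    · rw [neg_sq, hcc]; ring
    · ext x
      have hmt := m_flow_level g hm (t2.reaches x (mem_univ x) t ht)
      have e := hat_aww (p := p) (f := f) hm hs hQ.slab₂ t2 Subset.rfl ht x
      rw [hat_of_mem (mem_univ x)] at e
      simp only [Pi.add_apply, Pi.smul_apply, smul_eq_mul]
      rw [hat_of_mem (mem_univ x), latitudinal, Pi.sub_apply, Pi.sub_apply,
        aww_eq_self hm hs hQ.slab₁ (by rw [hmt]; linarith [ht.1]), mul_sub, e,
        ← hat_of_mem (mem_univ x)]
      ring
  · intro y hy
    have hn1 : m y - ϑ₁ ∉ Ioo (-δ) δ := fun h' =>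
      hy (Or.inl ⟨by linarith [h'.1], by linarith [h'.2]⟩)
    have hn2 : m y - ϑ₂ ∉ Ioo (-δ) δ := fun h' =>
      hy (Or.inr ⟨by linarith [h'.1], by linarith [h'.2]⟩)
    have h01 : ∀ t ∉ Ioo (-δ) δ, s t ^ 2 = 0 ∨ s t ^ 2 = 1 := fun t ht => by
      rw [mem_Ioo, not_and_or, not_lt, not_lt] at ht
      rcases ht with h' | h'
      · left; rw [hs.eq_zero h']; ring
      · right; exact hs.sq_eq_one h'
    have habs : |latitudinal g m p s δ ϑ₁ ϑ₂ f y| ≤ |f y| := by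
      rw [happ, hs.crossCoeff_eq_zero hn1, hs.crossCoeff_eq_zero hn2]
      rcases h01 _ hn1 with h1 | h1 <;> rcases h01 _ hn2 with h2 | h2 <;> rw [h1, h2] <;> simp
    have : ‖latitudinal g m p s δ ϑ₁ ϑ₂ f y‖ₑ ≤ ‖f y‖ₑ := by
      rw [Real.enorm_eq_ofReal_abs, Real.enorm_eq_ofReal_abs]
      exact ENNReal.ofReal_le_ofReal habs
    calc _ ≤ 1 * ‖f y‖ₑ ^ p.toReal := by rw [one_mul]; gcongr
      _ ≤ _ := by gcongr

/-- The operator induced by `Q` on `L^p(M)` has norm at most `B_p`. -/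
theorem IsLatitudinal.exists_induces (hQ : IsLatitudinal d m s δ ϑ₁ ϑ₂) :
    ∃ AQ : Lp ℝ p (riemannianMeasure g (id : M → M) d) →L[ℝ]
        Lp ℝ p (riemannianMeasure g (id : M → M) d),
      Induces (latitudinal g m p s δ ϑ₁ ϑ₂) AQ ∧ ‖AQ‖ ≤ awwConst p :=
  (hQ.isLocalizedHOp (g := g) (p := p) hm).exists_induces g awwConst_nonneg fun _ hf =>
    hQ.eLpNorm_le hd hp hm hf

/-- A lifted operator, composed with the latitudinal projection, induces a bounded operator on
`L^p(M)`. -/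
theorem IsTube.exists_induces_lift_latitudinal (h : IsTube g m ϑ a b T)
    (hS : ∀ y, (m y ∈ Ioo a b ∧ y ∈ S (m y)) ↔ y ∈ sweep g m ϑ a b T)
    (hQ : IsLatitudinal d m s δ ϑ₁ ϑ₂) (hI : Ioo (ϑ₁ - δ) (ϑ₂ + δ) ⊆ Ioo a b)
    {U : Set (level m ϑ)} (hU : U ⊆ T)
    (hP : IsLocalizedHOp d (Subtype.val : level m ϑ → M) U P)
    {A : Lp ℝ p (levelMeasure g m ϑ) →L[ℝ] Lp ℝ p (levelMeasure g m ϑ)} (hA : Induces P A) :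
    ∃ A' : Lp ℝ p (riemannianMeasure g (id : M → M) d) →L[ℝ]
        Lp ℝ p (riemannianMeasure g (id : M → M) d),
      Induces (lift g m p a b S ϑ P ∘ latitudinal g m p s δ ϑ₁ ϑ₂) A' ∧
        ‖A'‖ ≤ awwConst p * ‖A‖ := by
  have hH := h.isLocalizedHOp_lift_latitudinal (p := p) hm hS hQ hI hU hP
  refine hH.exists_induces g (mul_nonneg awwConst_nonneg (norm_nonneg _)) fun f hf => ?_
  have hQf : MemLp (latitudinal g m p s δ ϑ₁ ϑ₂ f) p (riemannianMeasure g (id : M → M) d) :=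
    (hQ.exists_induces (g := g) hd hp hm).choose_spec.1.memLp hf
  calc _ ≤ ENNReal.ofReal ‖A‖ * eLpNorm (latitudinal g m p s δ ϑ₁ ϑ₂ f) p
        (riemannianMeasure g (id : M → M) d) :=
        h.eLpNorm_lift_le hd hp hm hS (hP.isLocalOp.mono hU) hA hQf
          (hH.aestronglyMeasurable g hf.1)
    _ ≤ ENNReal.ofReal ‖A‖ * (ENNReal.ofReal (awwConst p) * eLpNorm f p
        (riemannianMeasure g (id : M → M) d)) := by
        gcongr
        exact hQ.eLpNorm_le hd hp hm hf
    _ = _ := by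
        rw [mul_comm (awwConst p), ENNReal.ofReal_mul (norm_nonneg _), mul_assoc]

end Norm

section Symmetric

variable {X : Type*} [MeasurableSpace X] {μ : Measure X} {T : Op X}
  {A : Lp ℝ 2 μ →L[ℝ] Lp ℝ 2 μ}

/-- A contractive projection of a Hilbert space is orthogonal. -/
theorem isSymmetric_of_isIdempotentElem_of_norm_le_one {E : Type*} [NormedAddCommGroup E]
    [InnerProductSpace ℝ E] {A : E →L[ℝ] E} (hA : A ∘L A = A) (h1 : ‖A‖ ≤ 1) :
    (A : E →ₗ[ℝ] E).IsSymmetric := by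
  have hi : ∀ x, A (A x) = A x := fun x => congrArg (fun B : E →L[ℝ] E => B x) hA
  have key : ∀ x y, inner ℝ (A x) (y - A y) = 0 := by
    intro x y
    have h2 : ∀ t : ℝ, 0 ≤ ‖y - A y‖ ^ 2 * (t * t) + 2 * inner ℝ (A x) (y - A y) * t + 0 := by
      intro t
      have h3 : A (A x + t • (y - A y)) = A x := by
        rw [map_add, map_smul, map_sub, hi, hi, sub_self, smul_zero, add_zero]
      have h4 : ‖A x‖ ≤ ‖A x + t • (y - A y)‖ := by
        have h5 := A.le_of_opNorm_le h1 (A x + t • (y - A y))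
        rwa [h3, one_mul] at h5
      have h6 := pow_le_pow_left₀ (norm_nonneg _) h4 2
      rw [norm_add_sq_real, real_inner_smul_right, norm_smul, mul_pow, Real.norm_eq_abs, sq_abs]
        at h6
      linarith
    have h7 := discrim_le_zero h2
    rw [discrim] at h7
    have : (2 * inner ℝ (A x) (y - A y)) ^ 2 = 0 := le_antisymm (by linarith) (sq_nonneg _)
    simpa using this
  intro x y
  have e1 := key x y
  have e2 := key y x
  rw [inner_sub_right, sub_eq_zero] at e1 e2
  change inner ℝ (A x) y = inner ℝ x (A y)
  rw [e1, real_inner_comm, ← e2, real_inner_comm]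

theorem Induces.isSymmetricL2_iff (h : Induces T A) :
    IsSymmetricL2 μ T ↔ (A : Lp ℝ 2 μ →ₗ[ℝ] Lp ℝ 2 μ).IsSymmetric := by
  have e : ∀ (f f' : X → ℝ) (hf : MemLp f 2 μ) (hf' : MemLp f' 2 μ),
      inner ℝ (hf.toLp f) (hf'.toLp f') = ∫ x, f x * f' x ∂μ := by
    intro f f' hf hf'
    rw [L2.inner_def]
    refine integral_congr_ae ?_
    filter_upwards [hf.coeFn_toLp, hf'.coeFn_toLp] with x h1 h2
    rw [h1, h2, RCLike.inner_apply, conj_trivial, mul_comm]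
  constructor
  · intro hT x y
    have k := hT x y (Lp.memLp x) (Lp.memLp y)
    rw [← e _ _ (h.memLp (Lp.memLp x)) (Lp.memLp y), ← e _ _ (Lp.memLp x) (h.memLp (Lp.memLp y)),
      h.toLp_eq (Lp.memLp x), h.toLp_eq (Lp.memLp y), Lp.toLp_coeFn, Lp.toLp_coeFn] at k
    exact k
  · intro hA f f' hf hf'
    have k := hA (hf.toLp f) (hf'.toLp f')
    change inner ℝ (A (hf.toLp f)) _ = inner ℝ _ (A (hf'.toLp f')) at k
    rwa [← h.toLp_eq hf, ← h.toLp_eq hf', e, e] at k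

theorem norm_le_one_of_isSymmetric {E : Type*} [NormedAddCommGroup E] [InnerProductSpace ℝ E]
    {A : E →L[ℝ] E} (hA : A ∘L A = A) (h : (A : E →ₗ[ℝ] E).IsSymmetric) : ‖A‖ ≤ 1 := by
  have hi : ∀ x, A (A x) = A x := fun x => congrArg (fun B : E →L[ℝ] E => B x) hA
  refine A.opNorm_le_bound zero_le_one fun x => ?_
  rw [one_mul]
  rcases (norm_nonneg (A x)).eq_or_lt with h0 | h0
  · rw [← h0]; exact norm_nonneg x
  · have h1 : ‖A x‖ * ‖A x‖ = inner ℝ (A x) x := by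
      have := h (A x) x
      change inner ℝ (A (A x)) x = inner ℝ (A x) (A x) at this
      rw [← real_inner_self_eq_norm_mul_norm, ← this, hi]
    have h2 := h1.trans_le (real_inner_le_norm (A x) x)
    exact le_of_mul_le_mul_left h2 h0

end Symmetric

/-! ### From identities in `L^p` to pointwise identities -/

section FiniteEval

variable {X : Type*} [TopologicalSpace X] {T T' : Op X}

/-- Operators that preserve continuity and whose values at a point depend on finitely many values
of the argument only. -/
structure IsFiniteEval (T : Op X) : Prop where
  continuous : ∀ f, Continuous f → Continuous (T f)
  finite : ∀ x, ∃ F : Set X, F.Finite ∧ ∀ f f', EqOn f f' F → T f x = T f' x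

theorem isFiniteEval_id : IsFiniteEval (id : Op X) :=
  ⟨fun _ h => h, fun x => ⟨{x}, finite_singleton x, fun _ _ h => h (mem_singleton x)⟩⟩

theorem isFiniteEval_zero : IsFiniteEval (0 : Op X) :=
  ⟨fun _ _ => continuous_zero, fun _ => ⟨∅, finite_empty, fun _ _ _ => rfl⟩⟩

theorem IsFiniteEval.comp (h : IsFiniteEval T) (h' : IsFiniteEval T') : IsFiniteEval (T ∘ T') := by
  refine ⟨fun f hf => h.continuous _ (h'.continuous f hf), fun x => ?_⟩
  obtain ⟨F, hF, hT⟩ := h.finite x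
  choose G hG hT' using h'.finite
  exact ⟨⋃ y ∈ F, G y, hF.biUnion fun y _ => hG y, fun f f' hff' => hT _ _ fun y hy =>
    hT' y f f' (hff'.mono (subset_biUnion_of_mem hy))⟩

theorem IsFiniteEval.add (h : IsFiniteEval T) (h' : IsFiniteEval T') : IsFiniteEval (T + T') := by
  refine ⟨fun f hf => (h.continuous f hf).add (h'.continuous f hf), fun x => ?_⟩
  obtain ⟨F, hF, hT⟩ := h.finite x
  obtain ⟨G, hG, hT'⟩ := h'.finite x
  exact ⟨F ∪ G, hF.union hG, fun f f' hff' => by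
    simp only [Pi.add_apply, hT f f' (hff'.mono subset_union_left),
      hT' f f' (hff'.mono subset_union_right)]⟩

theorem isFiniteEval_sum {ι : Type*} (s : Finset ι) {T : ι → Op X}
    (h : ∀ i ∈ s, IsFiniteEval (T i)) : IsFiniteEval (∑ i ∈ s, T i) := by
  classical
  induction s using Finset.induction_on with
  | empty => simpa using isFiniteEval_zero
  | insert i s hi ih =>
    rw [Finset.sum_insert hi]
    exact (h i (Finset.mem_insert_self i s)).add
      (ih fun k hk => h k (Finset.mem_insert_of_mem hk))

/-- Two such operators that induce the same operator on `L^p` are equal, since a function can be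
replaced by a continuous one that has the same values at finitely many points. -/
theorem IsFiniteEval.eq_of_induces [T2Space X] [CompactSpace X] [SecondCountableTopology X]
    [MeasurableSpace X] [BorelSpace X] {μ : Measure X} [IsFiniteMeasure μ] [μ.IsOpenPosMeasure]
    {p : ℝ≥0∞} [Fact (1 ≤ p)] {A : Lp ℝ p μ →L[ℝ] Lp ℝ p μ} (h : IsFiniteEval T)
    (h' : IsFiniteEval T') (hA : Induces T A) (hA' : Induces T' A) : T = T' := by
  have hcont : ∀ f, Continuous f → T f = T' f := by
    intro f hf
    have hfm : MemLp f p μ := hf.memLp_of_hasCompactSupport (HasCompactSupport.of_compactSpace f)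
    exact (Continuous.ae_eq_iff_eq μ (h.continuous f hf) (h'.continuous f hf)).1
      ((hA f hfm).symm.trans (hA' f hfm))
  ext f x
  obtain ⟨F, hF, hT⟩ := h.finite x
  obtain ⟨G, hG, hT'⟩ := h'.finite x
  have hfin := hF.union hG
  have := hfin.to_subtype
  have : DiscreteTopology ↥(F ∪ G) := Finite.instDiscreteTopology
  obtain ⟨f₀, hf₀⟩ := ContinuousMap.exists_restrict_eq hfin.isClosed
    (⟨fun y : ↥(F ∪ G) => f y, continuous_of_discreteTopology⟩ : C(↥(F ∪ G), ℝ))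
  have e : EqOn f f₀ (F ∪ G) := fun y hy => (DFunLike.congr_fun hf₀ ⟨y, hy⟩).symm
  rw [hT f f₀ (e.mono subset_union_left), hT' f f₀ (e.mono subset_union_right),
    hcont f₀ f₀.continuous]

end FiniteEval

section HOpCompact

variable {d : ℕ} {M : Type u} [TopologicalSpace M] [ChartedSpace (EuclideanSpace ℝ (Fin d)) M]
  {N : Type v} [TopologicalSpace N] {j : N → M} {U : Set N} {P : Op N}

theorem SmoothFunAt.continuousAt (hj : Continuous j) {φ : N → ℝ} {x : N}
    (h : SmoothFunAt d j φ x) : ContinuousAt φ x := by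
  obtain ⟨φ', h1, h2⟩ := h
  exact (ContinuousAt.comp (f := j) h1.continuousAt hj.continuousAt).congr h2

theorem IsLocalizedHOp.isFiniteEval (hj : Continuous j) (h : IsLocalizedHOp d j U P) :
    IsFiniteEval P := by
  obtain ⟨n, H, hH, hP⟩ := h
  have e : P = ∑ k, (H k).toOp := by
    ext f x
    rw [hP, Finset.sum_apply, Finset.sum_apply]
  rw [e]
  refine isFiniteEval_sum _ fun k _ => ⟨fun f hf => ?_, fun x => ⟨{(H k).Φ x}, finite_singleton _,
    fun f f' hff' => ?_⟩⟩
  · refine continuous_iff_continuousAt.2 fun x => ?_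
    by_cases hx : x ∈ tsupport (H k).φ
    · have hxs := (H k).tsupport_subset hx
      have h1 : ContinuousAt (fun x => (H k).φ x * f ((H k).Φ x)) x :=
        (((H k).smooth_fun x).continuousAt hj).mul
          (hf.continuousAt.comp ((H k).Φ.continuousAt hxs))
      refine h1.congr ?_
      filter_upwards [(H k).Φ.open_source.mem_nhds hxs] with y hy
      rw [SimpleH.toOp, indicator_of_mem hy]
    · refine (continuousAt_const (y := (0 : ℝ))).congr ?_
      filter_upwards [(isClosed_tsupport (H k).φ).isOpen_compl.mem_nhds hx] with y hy
      simp only [SimpleH.toOp, indicator, image_eq_zero_of_notMem_tsupport hy, zero_mul, ite_self]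
  · simp only [SimpleH.toOp, indicator, hff' (mem_singleton _)]

/-- An `H`-operator localized on `U` lives on a compact subset of `U`: the union of the supports of
the functions `φ` and of their images under `Φ`. -/
theorem IsLocalizedHOp.exists_compact (h : IsLocalizedHOp d j U P) :
    ∃ K, IsCompact K ∧ K ⊆ U ∧ IsLocalOp K P := by
  have hlin := h.isLocalOp
  obtain ⟨n, H, hH, hP⟩ := h
  have hK : ∀ k, IsCompact (tsupport (H k).φ ∪ (H k).Φ '' tsupport (H k).φ) := fun k =>
    (H k).hasCompactSupport.isCompact.union ((H k).hasCompactSupport.isCompact.image_of_continuousOn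
      ((H k).Φ.continuousOn.mono (H k).tsupport_subset))
  refine ⟨⋃ k, tsupport (H k).φ ∪ (H k).Φ '' tsupport (H k).φ, isCompact_iUnion hK,
    iUnion_subset fun k => union_subset ((H k).tsupport_subset.trans (hH k).1) ?_,
    fun f f' hff' => ?_, fun f x hx => ?_, hlin.add, hlin.smul⟩
  · rintro _ ⟨x, hx, rfl⟩
    exact (hH k).2 ((H k).Φ.map_source ((H k).tsupport_subset hx))
  · ext x
    rw [hP, hP]
    refine Finset.sum_congr rfl fun k _ => ?_
    by_cases hx : x ∈ tsupport (H k).φ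
    · simp only [SimpleH.toOp, indicator_of_mem ((H k).tsupport_subset hx),
        hff' (mem_iUnion.2 ⟨k, Or.inr (mem_image_of_mem _ hx)⟩)]
    · simp only [SimpleH.toOp, indicator, image_eq_zero_of_notMem_tsupport hx, zero_mul, ite_self]
  · rw [hP]
    refine Finset.sum_eq_zero fun k _ => ?_
    have hx' : x ∉ tsupport (H k).φ := fun h' => hx (mem_iUnion.2 ⟨k, Or.inl h'⟩)
    simp only [SimpleH.toOp, indicator, image_eq_zero_of_notMem_tsupport hx', zero_mul, ite_self]

end HOpCompact

/-! ### The complementary operator near the critical point -/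

section Complement

set_option linter.unusedSectionVars false

variable {d : ℕ} {M : Type u} [TopologicalSpace M] [ChartedSpace (EuclideanSpace ℝ (Fin d)) M]
  [IsManifold (𝓡 d) ∞ M] {g : Metric d M} {m : M → ℝ} {p : ℝ≥0∞} {s : ℝ → ℝ}
  {δ ϑ ϑ₁ ϑ₂ a b c e : ℝ} {T U₀ : Set (level m ϑ)} {S : ℝ → Set M} {P P₀ : Op (level m ϑ)}
  [T2Space M] [SecondCountableTopology M] [MeasurableSpace M] [BorelSpace M]
  (hm : ContMDiff (𝓡 d) 𝓘(ℝ, ℝ) ∞ m)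

include hm

theorem cosweep_eq (hr : ∀ x ∉ U₀, ∀ t ∈ Ioo c e, FlowReaches g m ϑ t x) :
    cosweep g m ϑ c e U₀ = m ⁻¹' Ioo c e \ sweep g m ϑ c e U₀ᶜ := by
  ext y
  simp only [cosweep, sweep, mem_iUnion, Set.mem_sdiff, exists_prop, not_exists, not_and]
  constructor
  · rintro ⟨r, hr', hy1, hy2⟩
    have hy1' : m y = r := hy1
    refine ⟨by rwa [mem_preimage, hy1'], fun t ht hy => ?_⟩
    obtain ⟨_, ⟨x, hx, rfl⟩, rfl⟩ := hy
    rw [m_flow_level g hm (hr x hx t ht)] at hy1'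
    subst hy1'
    exact hy2 ⟨x, mem_image_of_mem _ hx, rfl⟩
  · rintro ⟨h1, h2⟩
    exact ⟨m y, h1, rfl, h2 _ h1⟩

theorem isOpen_cosweep [CompactSpace (level m ϑ)] (hU₀ : IsOpen U₀)
    (hr : ∀ x ∉ U₀, ∀ t ∈ Ioo c e, FlowReaches g m ϑ t x) : IsOpen (cosweep g m ϑ c e U₀) := by
  rw [cosweep_eq hm hr]
  exact isOpen_slab_diff_sweep hm hU₀.isClosed_compl.isCompact hr

open scoped Classical in
/-- The function that is `χ²` along the flow lines of a tube and one elsewhere is smooth if `χ = 1`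
near the complement of the tube. -/
theorem IsTube.contMDiffOn_cutoff [CompactSpace (level m ϑ)] (h : IsTube g m ϑ a b T) {χ : M → ℝ}
    (hχ : ContMDiff (𝓡 d) 𝓘(ℝ, ℝ) ∞ χ) {W : Set M} (hW : IsOpen W) (hχ1 : ∀ x ∈ W, χ x = 1)
    (hTW : ∀ x : level m ϑ, x ∉ T → (x : M) ∈ W) :
    ContMDiffOn (𝓡 d) 𝓘(ℝ, ℝ) ∞
      (fun y => if y ∈ sweep g m ϑ a b T then χ (flow g m (m y) ϑ y) ^ 2 else 1)
      (m ⁻¹' Ioo a b) := by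
  intro y hy
  refine ContMDiffAt.contMDiffWithinAt ?_
  by_cases hys : y ∈ sweep g m ϑ a b T
  · have hb := ((mem_sweep_iff g hm h.reaches).1 hys).2.1
    have h1 : ContMDiffAt (𝓡 d) 𝓘(ℝ, ℝ) ∞ (fun y => χ (flow g m (m y) ϑ y) ^ 2) y :=
      (ContMDiffAt.comp y (hχ _) (contMDiffAt_flow_back hm hb)).pow 2
    refine h1.congr_of_eventuallyEq ?_
    filter_upwards [(isOpen_sweep g hm h.isOpen h.reaches).mem_nhds hys] with w hw
    rw [if_pos hw]
  · have hDT : (Subtype.val ⁻¹' W : Set (level m ϑ))ᶜ ⊆ T := fun x hx =>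
      by_contra fun hx' => hx (hTW x hx')
    have hD : IsCompact (Subtype.val ⁻¹' W : Set (level m ϑ))ᶜ :=
      (hW.preimage continuous_subtype_val).isClosed_compl.isCompact
    have ho := isOpen_slab_diff_sweep (a := a) (b := b) hm hD fun x hx t ht =>
      h.reaches x (hDT hx) t ht
    refine (contMDiffAt_const (c := (1 : ℝ))).congr_of_eventuallyEq ?_
    have hyD : y ∈ m ⁻¹' Ioo a b \ sweep g m ϑ a b (Subtype.val ⁻¹' W : Set (level m ϑ))ᶜ :=
      ⟨hy, fun h' => hys (biUnion_mono Subset.rfl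
        (fun r _ => image_mono (image_mono hDT)) h')⟩
    filter_upwards [ho.mem_nhds hyD] with w hw
    split_ifs with hws
    · obtain ⟨t, ht, _, ⟨x, hx, rfl⟩, rfl⟩ := mem_iUnion₂.1 hws
      have hr := h.reaches x hx t ht
      rw [m_flow_level g hm hr, (hr.symm hm).2, hχ1, one_pow]
      by_contra hxW
      exact hw.2 (mem_iUnion₂.2 ⟨t, ht, x, mem_image_of_mem _ hxW, rfl⟩)
    · rfl

/-- If `1 - P` is localized on a neighbourhood `U₀` of the complement of the tube, then the
difference of `Q` and the lift of `P` is localized on the complement of the trace of `J_ϑ \ U₀`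
under the flow. -/
theorem IsTube.isLocalizedHOp_complement [CompactSpace (level m ϑ)] (h : IsTube g m ϑ a b T)
    (hS : ∀ y, (m y ∈ Ioo a b ∧ y ∈ S (m y)) ↔ y ∈ sweep g m ϑ a b T)
    (hQ : IsLatitudinal d m s δ ϑ₁ ϑ₂) (hI : Ioo (ϑ₁ - δ) (ϑ₂ + δ) ⊆ Ioo a b) {V : Set M}
    (hV : IsOpen V) (hVT : ∀ x : level m ϑ, x ∉ T → (x : M) ∈ V)
    (hP : IsLocalizedHOp d (Subtype.val : level m ϑ → M) T P)
    (hP₀ : IsLocalizedHOp d (Subtype.val : level m ϑ → M) (Subtype.val ⁻¹' V) P₀)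
    (hPP₀ : P + P₀ = id) :
    IsLocalizedHOp d (id : M → M) (cosweep g m ϑ (ϑ₁ - δ) (ϑ₂ + δ) (Subtype.val ⁻¹' V))
      (latitudinal g m p s δ ϑ₁ ϑ₂ - lift g m p a b S ϑ P ∘ latitudinal g m p s δ ϑ₁ ϑ₂) := by
  classical
  set I := Ioo (ϑ₁ - δ) (ϑ₂ + δ) with hIdef
  set U₀ : Set (level m ϑ) := Subtype.val ⁻¹' V
  have hU₀ : IsOpen U₀ := hV.preimage continuous_subtype_val
  have hU₀T : U₀ᶜ ⊆ T := fun x hx => by_contra fun hx' => hx (hVT x hx')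
  have hr : ∀ x ∉ U₀, ∀ t ∈ I, FlowReaches g m ϑ t x := fun x hx t ht =>
    h.reaches x (hU₀T hx) t (hI ht)
  obtain ⟨K₀, hK₀, hK₀U, hloc₀⟩ := hP₀.exists_compact
  -- a cut-off function with support in `V` that is one near `K₀` and off the tube
  have := ChartedSpace.locallyCompactSpace (EuclideanSpace ℝ (Fin d)) M
  have := Manifold.metrizableSpace (𝓡 d) M
  have hK₁ : IsCompact (Subtype.val '' (K₀ ∪ Tᶜ) : Set M) :=
    (hK₀.union h.isOpen.isClosed_compl.isCompact).image continuous_subtype_val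
  have hK₁V : Subtype.val '' (K₀ ∪ Tᶜ) ⊆ V := by
    rintro _ ⟨x, hx | hx, rfl⟩
    exacts [hK₀U hx, hVT x hx]
  obtain ⟨χ, hχ0, hχ1, -⟩ := exists_contMDiffMap_zero_one_nhds_of_isClosed (𝓡 d) (n := ⊤)
    hV.isClosed_compl hK₁.isClosed (disjoint_compl_left_iff_subset.2 hK₁V)
  have hχs : ContMDiff (𝓡 d) 𝓘(ℝ, ℝ) ∞ χ := χ.contMDiff
  have hχV : tsupport χ ⊆ V := by
    intro x hx
    by_contra hxV
    exact (notMem_tsupport_iff_eventuallyEq.2 (hχ0.filter_mono (nhds_le_nhdsSet hxV))) hx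
  obtain ⟨W, hW, hKW, hχW⟩ := mem_nhdsSet_iff_exists.1 hχ1
  have hTW : ∀ x : level m ϑ, x ∉ T → (x : M) ∈ W := fun x hx => hKW ⟨x, Or.inr hx, rfl⟩
  have hχK : ∀ x ∈ K₀, χ (x : M) = 1 := fun x hx => hχW (hKW ⟨x, Or.inl hx, rfl⟩)
  set χ' : level m ϑ → ℝ := fun x => χ x with hχ'
  have hχ's : ∀ x, SmoothFunAt d (Subtype.val : level m ϑ → M) χ' x := fun x =>
    ⟨χ, hχs _, EventuallyEq.rfl⟩
  have hχ'U : tsupport χ' ⊆ U₀ := (tsupport_comp_subset_preimage χ continuous_subtype_val).trans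
    (preimage_mono hχV)
  -- the part of `P` that is localized near `z`
  have hP' := hP.mul_mul hχ's hU₀ hχ'U
  set P' : Op (level m ϑ) := fun f => χ' * P (χ' * f)
  have h1 := h.isLocalizedHOp_lift_latitudinal (p := p) hm hS hQ hI inter_subset_left hP'
  have h1' := h1.mono (U' := cosweep g m ϑ (ϑ₁ - δ) (ϑ₂ + δ) U₀) (by
    rw [cosweep_eq hm hr]
    intro y hy
    obtain ⟨t, ht, _, ⟨x, hx, rfl⟩, rfl⟩ := mem_iUnion₂.1 hy
    have hrx := h.reaches x hx.1 t (hI ht)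
    refine ⟨by rwa [mem_preimage, m_flow_level g hm hrx], fun hy' => ?_⟩
    have hy2 := ((mem_sweep_iff g hm (U := U₀ᶜ) hr).1 hy').2.2
    rw [m_flow_level g hm hrx, (hrx.symm hm).2, Subtype.val_injective.mem_set_image] at hy2
    exact hy2 hx.2)
  -- multiplication of `Q` by a function that is supported near `z`
  set η : M → ℝ := fun y => if y ∈ sweep g m ϑ a b T then χ (flow g m (m y) ϑ y) ^ 2 else 1
    with hη
  have hTχ : IsOpen (T \ tsupport χ') := h.isOpen.sdiff (isClosed_tsupport _)
  have hsw : ∀ {U : Set (level m ϑ)}, U ⊆ T → sweep g m ϑ a b U ⊆ sweep g m ϑ a b T := fun hU =>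
    biUnion_mono Subset.rfl fun r _ => image_mono (image_mono hU)
  have h2 : IsLocalizedHOp d (id : M → M) (cosweep g m ϑ (ϑ₁ - δ) (ϑ₂ + δ) U₀)
      fun f => η * latitudinal g m p s δ ϑ₁ ϑ₂ f := by
    refine hQ.isLocalizedHOp_mul hm (isOpen_cosweep hm hU₀ hr) ?_
      (C := (sweep g m ϑ a b (T \ tsupport χ'))ᶜ)
      (isOpen_sweep g hm hTχ fun x hx => h.reaches x hx.1).isClosed_compl ?_
      ((h.contMDiffOn_cutoff hm hχs hW (fun x hx => hχW hx) hTW).mono (preimage_mono hI)) ?_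
    · intro y hy τ hy1 hy2 hyr
      rw [cosweep_eq hm hr] at hy ⊢
      refine ⟨by rwa [mem_preimage, hyr.m_flow hm, sub_zero], fun h' => hy.2 ?_⟩
      exact (flow_mem_sweep_iff hm hr hy1 hy2 hyr).1 h'
    · intro y hyC hyI
      rw [cosweep_eq hm hr]
      refine ⟨hyI, fun hy' => hyC ?_⟩
      obtain ⟨t, ht, _, ⟨x, hx, rfl⟩, rfl⟩ := mem_iUnion₂.1 hy'
      exact mem_iUnion₂.2 ⟨t, hI ht, x,
        mem_image_of_mem _ ⟨hU₀T hx, fun h' => hx (hχ'U h')⟩, rfl⟩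
    · intro y hy
      have hy' := not_not.1 hy
      have hyT : y ∈ sweep g m ϑ a b T := hsw sdiff_subset hy'
      simp only [hη, if_pos hyT]
      obtain ⟨t, ht, _, ⟨x, hx, rfl⟩, rfl⟩ := mem_iUnion₂.1 hy'
      have hrx := h.reaches x hx.1 t ht
      rw [m_flow_level g hm hrx, (hrx.symm hm).2]
      have : χ' x = 0 := image_eq_zero_of_notMem_tsupport hx.2
      change χ' x ^ 2 = 0
      rw [this]; ring
  convert h2.sub h1' using 1
  ext1 f
  simp only [Pi.sub_apply, Function.comp_apply]
  set u := latitudinal g m p s δ ϑ₁ ϑ₂ f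
  refine h.ext_hat (p := p) hm (fun y hy => ?_) fun t ht => ?_
  · simp only [Pi.sub_apply, Pi.mul_apply, h.lift_eq_zero hm hS hy, hη, if_neg hy, one_mul]
  · ext x
    by_cases hx : x ∈ T
    · have hrx := h.reaches x hx t ht
      have k1 := congrFun (h.hat_lift (p := p) (f := u) hm hS hP.isLocalOp ht) x
      have k2 := congrFun (h.hat_lift (p := p) (f := u) hm hS
        (hP'.isLocalOp.mono inter_subset_left) ht) x
      have k3 : ∀ w, P w = w - P₀ w := fun w => by
        rw [eq_sub_iff_add_eq]; exact congrFun hPP₀ w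
      have k4 : P₀ (χ' * hat g m p ϑ T u t) = P₀ (hat g m p ϑ T u t) :=
        hloc₀.congr _ _ fun x hx => by
          rw [Pi.mul_apply, show χ' x = 1 from hχK x hx, one_mul]
      have k5 : χ' x * P₀ (hat g m p ϑ T u t) x = P₀ (hat g m p ϑ T u t) x := by
        by_cases hxK : x ∈ K₀
        · rw [show χ' x = 1 from hχK x hxK, one_mul]
        · rw [hloc₀.zero_off _ x hxK, mul_zero]
      have k6 : η (flow g m ϑ t x) = χ' x ^ 2 := by
        simp only [hη, if_pos (h.flow_mem_sweep hm ht hx)]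
        rw [m_flow_level g hm hrx, (hrx.symm hm).2]
      change _ = (χ' * P (χ' * hat g m p ϑ T u t)) x at k2
      rw [k3, Pi.mul_apply, k4] at k2
      rw [k3] at k1
      simp only [Pi.sub_apply, Pi.mul_apply] at k1 k2
      rw [hat_of_mem hx] at k1 k2 ⊢
      rw [hat_of_mem hx]
      simp only [Pi.sub_apply, Pi.mul_apply]
      rw [hat_of_mem (f := u) hx] at k1 k2
      rw [k6]
      linear_combination (-1 : ℝ) * k1 + k2 - k5
    · rw [hat_of_notMem hx, hat_of_notMem hx]

end Complement

/-! ### Families of lifted operators -/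

section Family

set_option linter.unusedSectionVars false

theorem Induces.lintegral_rpow {N : Type*} [MeasurableSpace N] {μ : Measure N} {p : ℝ≥0∞}
    [Fact (1 ≤ p)] {T : Op N} {A : Lp ℝ p μ →L[ℝ] Lp ℝ p μ} (h : Induces T A) (hp : 0 < p.toReal)
    {f : N → ℝ} (hf : MemLp f p μ) :
    ∫⁻ x, ‖T f x‖ₑ ^ p.toReal ∂μ = ENNReal.ofReal (‖A (hf.toLp f)‖ ^ p.toReal) := by
  rw [← eLpNorm_rpow_toReal hp, h.norm_eq hf, ← ENNReal.ofReal_rpow_of_nonneg ENNReal.toReal_nonneg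
    hp.le, ENNReal.ofReal_toReal (h.memLp hf).2.ne]

variable {d : ℕ} {M : Type u} [TopologicalSpace M] [ChartedSpace (EuclideanSpace ℝ (Fin d)) M]
  [IsManifold (𝓡 d) ∞ M] {g : Metric d M} {m : M → ℝ} {p : ℝ≥0∞} [Fact (1 ≤ p)] {s : ℝ → ℝ}
  {δ ϑ ϑ₁ ϑ₂ a b : ℝ} {T : Set (level m ϑ)} {f : M → ℝ} {S : ℝ → Set M}
  {P P' : Op (level m ϑ)} (hd : 1 ≤ d) (hp : p ≠ ⊤)
  [T2Space M] [SecondCountableTopology M] [MeasurableSpace M] [BorelSpace M]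
  (hm : ContMDiff (𝓡 d) 𝓘(ℝ, ℝ) ∞ m)

section

include hm

/-- The product of lifted operators. -/
theorem IsTube.lift_latitudinal_comp (h : IsTube g m ϑ a b T)
    (hS : ∀ y, (m y ∈ Ioo a b ∧ y ∈ S (m y)) ↔ y ∈ sweep g m ϑ a b T)
    (hQ : IsLatitudinal d m s δ ϑ₁ ϑ₂) (hI : Ioo (ϑ₁ - δ) (ϑ₂ + δ) ⊆ Ioo a b)
    (hP : IsLocalOp T P) (hP' : IsLocalOp T P') :
    (lift g m p a b S ϑ P ∘ latitudinal g m p s δ ϑ₁ ϑ₂) ∘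
      (lift g m p a b S ϑ P' ∘ latitudinal g m p s δ ϑ₁ ϑ₂) =
      lift g m p a b S ϑ (P ∘ P') ∘ latitudinal g m p s δ ϑ₁ ϑ₂ := by
  ext1 f
  simp only [Function.comp_apply]
  rw [← h.lift_latitudinal hm hS hP' hQ.cutoff hQ.slab₁ hQ.slab₂ (hQ.subset₁.trans hI)
    (hQ.subset₂.trans hI), latitudinal_latitudinal hm hQ.cutoff hQ.slab₁ hQ.slab₂ hQ.le,
    h.lift_comp hm hS hP hP']

end

include hd hp hm

/-- The `p`-th power of the `L^p` norm of a lifted function as an integral over the fibres. -/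
theorem IsTube.lintegral_lift (h : IsTube g m ϑ a b T)
    (hS : ∀ y, (m y ∈ Ioo a b ∧ y ∈ S (m y)) ↔ y ∈ sweep g m ϑ a b T) (hP : IsLocalOp T P)
    (hLf : AEStronglyMeasurable (lift g m p a b S ϑ P f) (riemannianMeasure g (id : M → M) d)) :
    AEMeasurable (fun t => ∫⁻ x, ‖P (hat g m p ϑ T f t) x‖ₑ ^ p.toReal ∂levelMeasure g m ϑ)
      (volume.restrict (Ioo a b)) ∧
    ∫⁻ y, ‖lift g m p a b S ϑ P f y‖ₑ ^ p.toReal ∂riemannianMeasure g (id : M → M) d =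
      ∫⁻ t in Ioo a b, ∫⁻ x, ‖P (hat g m p ϑ T f t) x‖ₑ ^ p.toReal ∂levelMeasure g m ϑ := by
  have := sigmaFinite_levelMeasure (g := g) hd hm h.regular
  have hp0 := toReal_pos_of_fact hp
  constructor
  · have h1 : AEMeasurable (fun t => ∫⁻ x, ‖hat g m p ϑ T (lift g m p a b S ϑ P f) t x‖ₑ ^ p.toReal
        ∂levelMeasure g m ϑ) (volume.restrict (Ioo a b)) :=
      ((h.aestronglyMeasurable_hat hd hm hLf).enorm.pow_const _).lintegral_prod_right'
    refine h1.congr ?_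
    filter_upwards [ae_restrict_mem measurableSet_Ioo] with t ht
    rw [h.hat_lift hm hS hP ht]
  · have e : ∫⁻ y, ‖lift g m p a b S ϑ P f y‖ₑ ^ p.toReal ∂riemannianMeasure g (id : M → M) d =
        ∫⁻ y in sweep g m ϑ a b T, ‖lift g m p a b S ϑ P f y‖ₑ ^ p.toReal
          ∂riemannianMeasure g (id : M → M) d := by
      rw [setLIntegral_eq_of_support_subset]
      intro y hy
      by_contra hy'
      refine hy ?_
      simp only [h.lift_eq_zero hm hS hy', enorm_zero, ENNReal.zero_rpow_of_pos hp0]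
    rw [e, h.lintegral_rpow hd hm hp0 hLf]
    refine setLIntegral_congr_fun measurableSet_Ioo fun t ht => ?_
    rw [h.hat_lift hm hS hP ht]

variable {κ : Type*} {t : Finset κ} {Pf : κ → Op (level m ϑ)}
  {A : κ → (Lp ℝ p (levelMeasure g m ϑ) →L[ℝ] Lp ℝ p (levelMeasure g m ϑ))}
  {AQ : Lp ℝ p (riemannianMeasure g (id : M → M) d) →L[ℝ]
    Lp ℝ p (riemannianMeasure g (id : M → M) d)}
  {A' : κ → (Lp ℝ p (riemannianMeasure g (id : M → M) d) →L[ℝ]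
    Lp ℝ p (riemannianMeasure g (id : M → M) d))} {C : ℝ}

/-- An upper bound for a family of operators on the level set passes to the lifted operators. -/
theorem IsTube.sum_norm_lift_le (h : IsTube g m ϑ a b T)
    (hS : ∀ y, (m y ∈ Ioo a b ∧ y ∈ S (m y)) ↔ y ∈ sweep g m ϑ a b T)
    (hP : ∀ i ∈ t, IsLocalOp T (Pf i)) (hA : ∀ i ∈ t, Induces (Pf i) (A i)) (hC : 0 ≤ C)
    (hAC : ∀ v, ∑ i ∈ t, ‖A i v‖ ^ p.toReal ≤ C ^ p.toReal * ‖v‖ ^ p.toReal)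
    (hAQ : Induces (latitudinal g m p s δ ϑ₁ ϑ₂) AQ)
    (hA' : ∀ i ∈ t, Induces (lift g m p a b S ϑ (Pf i) ∘ latitudinal g m p s δ ϑ₁ ϑ₂) (A' i))
    (f : Lp ℝ p (riemannianMeasure g (id : M → M) d)) :
    ∑ i ∈ t, ‖A' i f‖ ^ p.toReal ≤ C ^ p.toReal * ‖AQ f‖ ^ p.toReal := by
  have hp0 := toReal_pos_of_fact hp
  have hf := Lp.memLp f
  have hu := hAQ.memLp hf
  set u := latitudinal g m p s δ ϑ₁ ϑ₂ f
  have hCp : 0 ≤ C ^ p.toReal := Real.rpow_nonneg hC _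
  have hL : ∀ i ∈ t, AEStronglyMeasurable (lift g m p a b S ϑ (Pf i) u)
      (riemannianMeasure g (id : M → M) d) := fun i hi => ((hA' i hi).memLp hf).1
  rw [← ENNReal.ofReal_le_ofReal_iff (mul_nonneg hCp (Real.rpow_nonneg (norm_nonneg _) _)),
    ENNReal.ofReal_mul hCp, ENNReal.ofReal_sum_of_nonneg fun i _ =>
      Real.rpow_nonneg (norm_nonneg _) _]
  have e1 : ∀ i ∈ t, ENNReal.ofReal (‖A' i f‖ ^ p.toReal) = ∫⁻ r in Ioo a b,
      ∫⁻ x, ‖Pf i (hat g m p ϑ T u r) x‖ₑ ^ p.toReal ∂levelMeasure g m ϑ := by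
    intro i hi
    rw [← (h.lintegral_lift hd hp hm hS (hP i hi) (hL i hi)).2]
    have := (hA' i hi).lintegral_rpow hp0 hf
    rw [Lp.toLp_coeFn] at this
    exact this.symm
  have e2 : ENNReal.ofReal (‖AQ f‖ ^ p.toReal) =
      ∫⁻ y, ‖u y‖ₑ ^ p.toReal ∂riemannianMeasure g (id : M → M) d := by
    have := hAQ.lintegral_rpow hp0 hf
    rw [Lp.toLp_coeFn] at this
    exact this.symm
  rw [Finset.sum_congr rfl e1, e2, ← lintegral_finsetSum' _ fun i hi =>
    (h.lintegral_lift hd hp hm hS (hP i hi) (hL i hi)).1]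
  calc _ ≤ ∫⁻ r in Ioo a b, ENNReal.ofReal (C ^ p.toReal) *
        ∫⁻ x, ‖hat g m p ϑ T u r x‖ₑ ^ p.toReal ∂levelMeasure g m ϑ := by
        refine lintegral_mono_ae ?_
        filter_upwards [h.memLp_fibre hd hm hp hu] with r hr
        rw [Finset.sum_congr rfl fun i hi => (hA i hi).lintegral_rpow hp0 hr,
          ← ENNReal.ofReal_sum_of_nonneg fun i _ => Real.rpow_nonneg (norm_nonneg _) _,
          ← eLpNorm_rpow_toReal hp0, ← ENNReal.ofReal_toReal hr.2.ne, ← Lp.norm_toLp _ hr,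
          ENNReal.ofReal_rpow_of_nonneg (norm_nonneg _) hp0.le, ← ENNReal.ofReal_mul hCp]
        exact ENNReal.ofReal_le_ofReal (hAC _)
    _ = ENNReal.ofReal (C ^ p.toReal) * ∫⁻ y in sweep g m ϑ a b T, ‖u y‖ₑ ^ p.toReal
        ∂riemannianMeasure g (id : M → M) d := by
        rw [lintegral_const_mul' _ _ ENNReal.ofReal_ne_top, h.lintegral_rpow hd hm hp0 hu.1]
    _ ≤ _ := by gcongr; exact Measure.restrict_le_self

/-- A lower bound for a family of operators on the level set passes to the lifted operators. -/
theorem IsTube.norm_lift_le_sum (h : IsTube g m ϑ a b T)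
    (hS : ∀ y, (m y ∈ Ioo a b ∧ y ∈ S (m y)) ↔ y ∈ sweep g m ϑ a b T)
    (hP : ∀ i ∈ t, IsLocalOp T (Pf i)) (hA : ∀ i ∈ t, Induces (Pf i) (A i)) (hC : 0 ≤ C)
    (hPT : IsLocalOp T P) {AP : Lp ℝ p (levelMeasure g m ϑ) →L[ℝ] Lp ℝ p (levelMeasure g m ϑ)}
    (hAP : Induces P AP)
    (hAC : ∀ v, ‖AP v‖ ^ p.toReal ≤ C ^ p.toReal * ∑ i ∈ t, ‖A i v‖ ^ p.toReal)
    (hAQ : Induces (latitudinal g m p s δ ϑ₁ ϑ₂) AQ)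
    (hA' : ∀ i ∈ t, Induces (lift g m p a b S ϑ (Pf i) ∘ latitudinal g m p s δ ϑ₁ ϑ₂) (A' i))
    {AP' : Lp ℝ p (riemannianMeasure g (id : M → M) d) →L[ℝ]
      Lp ℝ p (riemannianMeasure g (id : M → M) d)}
    (hAP' : Induces (lift g m p a b S ϑ P ∘ latitudinal g m p s δ ϑ₁ ϑ₂) AP')
    (f : Lp ℝ p (riemannianMeasure g (id : M → M) d)) :
    ‖AP' f‖ ^ p.toReal ≤ C ^ p.toReal * ∑ i ∈ t, ‖A' i f‖ ^ p.toReal := by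
  have hp0 := toReal_pos_of_fact hp
  have hf := Lp.memLp f
  have hu := hAQ.memLp hf
  set u := latitudinal g m p s δ ϑ₁ ϑ₂ f
  have hCp : 0 ≤ C ^ p.toReal := Real.rpow_nonneg hC _
  have hn : ∀ i ∈ t, 0 ≤ ‖A' i f‖ ^ p.toReal := fun i _ => Real.rpow_nonneg (norm_nonneg _) _
  have hL : ∀ i ∈ t, AEStronglyMeasurable (lift g m p a b S ϑ (Pf i) u)
      (riemannianMeasure g (id : M → M) d) := fun i hi => ((hA' i hi).memLp hf).1
  rw [← ENNReal.ofReal_le_ofReal_iff (mul_nonneg hCp (Finset.sum_nonneg hn)),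
    ENNReal.ofReal_mul hCp, ENNReal.ofReal_sum_of_nonneg hn]
  have e1 : ∀ i ∈ t, ENNReal.ofReal (‖A' i f‖ ^ p.toReal) = ∫⁻ r in Ioo a b,
      ∫⁻ x, ‖Pf i (hat g m p ϑ T u r) x‖ₑ ^ p.toReal ∂levelMeasure g m ϑ := by
    intro i hi
    rw [← (h.lintegral_lift hd hp hm hS (hP i hi) (hL i hi)).2]
    have := (hA' i hi).lintegral_rpow hp0 hf
    rw [Lp.toLp_coeFn] at this
    exact this.symm
  have e2 : ENNReal.ofReal (‖AP' f‖ ^ p.toReal) = ∫⁻ r in Ioo a b,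
      ∫⁻ x, ‖P (hat g m p ϑ T u r) x‖ₑ ^ p.toReal ∂levelMeasure g m ϑ := by
    rw [← (h.lintegral_lift hd hp hm hS hPT (hAP'.memLp hf).1).2]
    have := hAP'.lintegral_rpow hp0 hf
    rw [Lp.toLp_coeFn] at this
    exact this.symm
  rw [Finset.sum_congr rfl e1, e2, ← lintegral_finsetSum' _ (fun i hi =>
    (h.lintegral_lift hd hp hm hS (hP i hi) (hL i hi)).1),
    ← lintegral_const_mul' _ _ ENNReal.ofReal_ne_top]
  refine lintegral_mono_ae ?_
  filter_upwards [h.memLp_fibre hd hm hp hu] with r hr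
  rw [Finset.sum_congr rfl fun i hi => (hA i hi).lintegral_rpow hp0 hr,
    ← ENNReal.ofReal_sum_of_nonneg (fun i _ => Real.rpow_nonneg (norm_nonneg _) _),
    hAP.lintegral_rpow hp0 hr, ← ENNReal.ofReal_mul hCp]
  exact ENNReal.ofReal_le_ofReal (hAC _)

end Family

/-! ### The estimates for the decomposition -/

section Bounds

variable {E κ : Type*} [NormedAddCommGroup E] [NormedSpace ℝ E] {t : Finset κ} {q C : ℝ}
  {Q T : E →L[ℝ] E} {B : κ → E →L[ℝ] E}

/-- If `0 < C` and `C⁻¹ X ≤ Y ≤ C X` for one positive `X`, then `1 ≤ C`. -/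
theorem one_le_of_bounds {X Y : ℝ} (hC : 0 < C) (hX : 0 < X) (h1 : 1 / C * X ≤ Y)
    (h2 : Y ≤ C * X) : 1 ≤ C := by
  have h3 : 1 / C ≤ C := le_of_mul_le_mul_right (h1.trans h2) hX
  rw [div_le_iff₀ hC] at h3
  nlinarith

/-- The bound for the distinguished member `Q - T` of the family, where `T` is the sum of the
others. -/
theorem norm_sub_le_of_bounds (hq : 0 < q) (hC : 0 ≤ C)
    (h1 : ∀ f, ∑ i ∈ t, ‖B i f‖ ^ q ≤ C ^ q * ‖Q f‖ ^ q)
    (h2 : ∀ f, ‖T f‖ ^ q ≤ C ^ q * ∑ i ∈ t, ‖B i f‖ ^ q) (f : E) :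
    ‖(Q - T) f‖ ≤ (C ^ 2 + 1) * ‖Q f‖ := by
  have h3 : ‖T f‖ ^ q ≤ (C ^ 2 * ‖Q f‖) ^ q := by
    rw [Real.mul_rpow (by positivity) (norm_nonneg _), sq, Real.mul_rpow hC hC, mul_assoc]
    exact (h2 f).trans (mul_le_mul_of_nonneg_left (h1 f) (Real.rpow_nonneg hC _))
  rw [Real.rpow_le_rpow_iff (norm_nonneg _) (by positivity) hq] at h3
  rw [sub_apply]
  linarith [norm_sub_le (Q f) (T f)]

/-- The lower bound for the whole family, which consists of `Q - T` and the `B i`. -/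
theorem norm_le_of_bounds (hq : 0 < q) (hC : 1 ≤ C)
    (h2 : ∀ f, ‖T f‖ ^ q ≤ C ^ q * ∑ i ∈ t, ‖B i f‖ ^ q) (f : E) :
    1 / (2 * C) * ‖Q f‖ ≤ (‖(Q - T) f‖ ^ q + ∑ i ∈ t, ‖B i f‖ ^ q) ^ (1 / q) := by
  have hC0 : 0 ≤ C := zero_le_one.trans hC
  have hn : 0 ≤ ∑ i ∈ t, ‖B i f‖ ^ q :=
    Finset.sum_nonneg fun i _ => Real.rpow_nonneg (norm_nonneg _) _
  have hn' : 0 ≤ ‖(Q - T) f‖ ^ q := Real.rpow_nonneg (norm_nonneg _) _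
  set X := (‖(Q - T) f‖ ^ q + ∑ i ∈ t, ‖B i f‖ ^ q) ^ (1 / q) with hX
  have hX0 : 0 ≤ X := Real.rpow_nonneg (add_nonneg hn' hn) _
  have hXq : X ^ q = ‖(Q - T) f‖ ^ q + ∑ i ∈ t, ‖B i f‖ ^ q := by
    rw [hX, ← Real.rpow_mul (add_nonneg hn' hn), one_div_mul_cancel hq.ne', Real.rpow_one]
  have k1 : ‖(Q - T) f‖ ≤ X := by
    rw [← Real.rpow_le_rpow_iff (norm_nonneg _) hX0 hq, hXq]
    linarith
  have k2 : ‖T f‖ ≤ C * X := by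
    rw [← Real.rpow_le_rpow_iff (norm_nonneg _) (by positivity) hq, Real.mul_rpow hC0 hX0, hXq]
    refine (h2 f).trans (mul_le_mul_of_nonneg_left ?_ (Real.rpow_nonneg hC0 _))
    linarith
  have k3 : ‖Q f‖ ≤ ‖(Q - T) f‖ + ‖T f‖ := by
    have : Q f = (Q - T) f + T f := by rw [sub_apply, sub_add_cancel]
    rw [this]
    exact norm_add_le _ _
  rw [one_div, inv_mul_le_iff₀ (by linarith)]
  nlinarith

/-- The upper bound for the whole family. The sum of the `B i`
is bounded with `C ^ q`, which is at most `C ^ (3 q)` as `1 ≤ C`. -/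
theorem sum_norm_le_of_bounds (hq : 0 < q) (hC : 1 ≤ C) {b : ℝ} (hb : 1 ≤ b)
    (h1 : ∀ f, ∑ i ∈ t, ‖B i f‖ ^ q ≤ C ^ q * ‖Q f‖ ^ q)
    (h2 : ∀ f, ‖T f‖ ^ q ≤ C ^ q * ∑ i ∈ t, ‖B i f‖ ^ q) (f : E) :
    (‖(Q - T) f‖ ^ q + ∑ i ∈ t, ‖B i f‖ ^ q) ^ (1 / q) ≤
      b * (C ^ (3 * q) + (C ^ 2 + 1) ^ q) ^ (1 / q) * ‖Q f‖ := by
  have hC0 : 0 ≤ C := zero_le_one.trans hC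
  have k1 := norm_sub_le_of_bounds hq hC0 h1 h2 f
  have k2 := Real.rpow_le_rpow (norm_nonneg _) k1 hq.le
  rw [Real.mul_rpow (by positivity) (norm_nonneg _)] at k2
  have k3 : C ^ q ≤ C ^ (3 * q) := Real.rpow_le_rpow_of_exponent_le hC (by linarith)
  have k4 : ‖(Q - T) f‖ ^ q + ∑ i ∈ t, ‖B i f‖ ^ q ≤
      (C ^ (3 * q) + (C ^ 2 + 1) ^ q) * ‖Q f‖ ^ q := by
    have := mul_le_mul_of_nonneg_right k3 (Real.rpow_nonneg (norm_nonneg (Q f)) q)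
    linarith [h1 f]
  have hK : 0 ≤ C ^ (3 * q) + (C ^ 2 + 1) ^ q :=
    add_nonneg (Real.rpow_nonneg hC0 _) (Real.rpow_nonneg (by positivity) _)
  have hn : 0 ≤ ∑ i ∈ t, ‖B i f‖ ^ q :=
    Finset.sum_nonneg fun i _ => Real.rpow_nonneg (norm_nonneg _) _
  have k5 := Real.rpow_le_rpow (add_nonneg (Real.rpow_nonneg (norm_nonneg _) _) hn) k4
    (one_div_pos.2 hq).le
  rw [Real.mul_rpow hK (Real.rpow_nonneg (norm_nonneg _) _), ← Real.rpow_mul (norm_nonneg _),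
    mul_one_div_cancel hq.ne', Real.rpow_one] at k5
  refine k5.trans (mul_le_mul_of_nonneg_right ?_ (norm_nonneg _))
  exact le_mul_of_one_le_left (Real.rpow_nonneg hK _) hb

/-- If `Q` is a projection and the `B i` are mutually annihilating projections with
`Q (B i) = (B i) Q = B i`, then `Q - ∑ B i` is a projection that annihilates the `B i`. -/
theorem complement_of_orthogonal (hQ : Q ∘L Q = Q) (hQB : ∀ i ∈ t, Q ∘L B i = B i)
    (hBQ : ∀ i ∈ t, B i ∘L Q = B i) (hB : ∀ i ∈ t, B i ∘L B i = B i)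
    (hBB : ∀ i ∈ t, ∀ k ∈ t, i ≠ k → B i ∘L B k = 0) :
    (Q - ∑ i ∈ t, B i) ∘L (Q - ∑ i ∈ t, B i) = Q - ∑ i ∈ t, B i ∧
      (∀ i ∈ t, (Q - ∑ k ∈ t, B k) ∘L B i = 0) ∧ ∀ i ∈ t, B i ∘L (Q - ∑ k ∈ t, B k) = 0 := by
  have e1 : ∀ i ∈ t, (∑ k ∈ t, B k) * B i = B i := fun i hi => by
    rw [Finset.sum_mul]
    exact (Finset.sum_eq_single (f := fun k => B k * B i) i
      (fun k hk hki => hBB k hk i hi hki) (fun h => absurd hi h)).trans (hB i hi)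
  have e2 : ∀ i ∈ t, B i * (∑ k ∈ t, B k) = B i := fun i hi => by
    rw [Finset.mul_sum]
    exact (Finset.sum_eq_single (f := fun k => B i * B k) i
      (fun k hk hki => hBB i hi k hk hki.symm) (fun h => absurd hi h)).trans (hB i hi)
  have e3 : (∑ k ∈ t, B k) * (∑ k ∈ t, B k) = ∑ k ∈ t, B k := by
    rw [Finset.mul_sum]
    exact Finset.sum_congr rfl e1
  have e4 : Q * (∑ k ∈ t, B k) = ∑ k ∈ t, B k := by
    rw [Finset.mul_sum]
    exact Finset.sum_congr rfl hQB
  have e5 : (∑ k ∈ t, B k) * Q = ∑ k ∈ t, B k := by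
    rw [Finset.sum_mul]
    exact Finset.sum_congr rfl hBQ
  refine ⟨?_, fun i hi => ?_, fun i hi => ?_⟩
  · change (Q - ∑ i ∈ t, B i) * (Q - ∑ i ∈ t, B i) = _
    rw [mul_sub, sub_mul, sub_mul, e3, e4, e5, show Q * Q = Q from hQ]
    abel
  · change (Q - ∑ k ∈ t, B k) * B i = 0
    rw [sub_mul, e1 i hi, show Q * B i = B i from hQB i hi, sub_self]
  · change B i * (Q - ∑ k ∈ t, B k) = 0
    rw [mul_sub, e2 i hi, show B i * Q = B i from hBQ i hi, sub_self]

end Bounds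

/-! ### Decompositions of identity on a compact level set -/

section Decomposition

set_option linter.unusedSectionVars false

variable {d : ℕ} {M : Type u} [TopologicalSpace M] [ChartedSpace (EuclideanSpace ℝ (Fin d)) M]
  {N : Type v} [TopologicalSpace N] [MeasurableSpace N] {j : N → M} {κ : Type w} [Fintype κ]
  {U : κ → Set N} {P : κ → Op N} {p : ℝ≥0∞} [Fact (1 ≤ p)] {μ : Measure N}
  {A : κ → (Lp ℝ p μ →L[ℝ] Lp ℝ p μ)} {C : ℝ}

theorem induces_id : Induces (id : Op N) (ContinuousLinearMap.id ℝ (Lp ℝ p μ)) :=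
  fun _ hf => hf.coeFn_toLp

theorem IsSmoothDecomposition.sum_norm_le (h : IsSmoothDecomposition d j U P p μ A C)
    (hp : 0 < p.toReal) (s : Finset κ) (v : Lp ℝ p μ) :
    ∑ i ∈ s, ‖A i v‖ ^ p.toReal ≤ C ^ p.toReal * ‖v‖ ^ p.toReal := by
  have hn : ∀ i, 0 ≤ ‖A i v‖ ^ p.toReal := fun i => Real.rpow_nonneg (norm_nonneg _) _
  have h1 := h.upper v
  rw [tsum_fintype, one_div, Real.rpow_inv_le_iff_of_pos (Finset.sum_nonneg fun i _ => hn i)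
    (mul_nonneg h.pos.le (norm_nonneg _)) hp, Real.mul_rpow h.pos.le (norm_nonneg _)] at h1
  exact (Finset.sum_le_sum_of_subset_of_nonneg (Finset.subset_univ s) fun i _ _ => hn i).trans h1

/-- The lower bound of the decomposition, applied to `(∑ A i) v`, bounds partial sums from above. -/
theorem IsSmoothDecomposition.norm_sum_le (h : IsSmoothDecomposition d j U P p μ A C)
    (hp : 0 < p.toReal) (s : Finset κ) (v : Lp ℝ p μ) :
    ‖(∑ i ∈ s, A i) v‖ ^ p.toReal ≤ C ^ p.toReal * ∑ i ∈ s, ‖A i v‖ ^ p.toReal := by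
  classical
  have hn : ∀ i v, 0 ≤ ‖A i v‖ ^ p.toReal := fun i v => Real.rpow_nonneg (norm_nonneg _) _
  have h1 := h.lower ((∑ i ∈ s, A i) v)
  rw [tsum_fintype, one_div, one_div, inv_mul_le_iff₀ h.pos] at h1
  have h2 := Real.rpow_le_rpow (norm_nonneg _) h1 hp.le
  rw [Real.mul_rpow h.pos.le (Real.rpow_nonneg (Finset.sum_nonneg fun i _ => hn i _) _),
    Real.rpow_inv_rpow (Finset.sum_nonneg fun i _ => hn i _) hp.ne'] at h2
  refine h2.trans_eq ?_
  congr 1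
  -- `A i` annihilates the other summands
  have e : ∀ i, A i ((∑ k ∈ s, A k) v) = if i ∈ s then A i v else 0 := by
    intro i
    have e1 : ∀ k, A i (A k v) = if i = k then A i v else 0 := by
      intro k
      split_ifs with hik
      · subst hik
        exact congrArg (fun B : Lp ℝ p μ →L[ℝ] Lp ℝ p μ => B v) (h.idempotent i)
      · exact congrArg (fun B : Lp ℝ p μ →L[ℝ] Lp ℝ p μ => B v) (h.orthogonal i k hik)
    rw [sum_apply, map_sum, Finset.sum_congr rfl fun k _ => e1 k, Finset.sum_ite_eq]
  rw [← Finset.sum_subset (Finset.subset_univ s) fun i _ hi => by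
    rw [e, if_neg hi, norm_zero, Real.zero_rpow hp.ne']]
  exact Finset.sum_congr rfl fun i hi => by rw [e, if_pos hi]

variable [T2Space N] [CompactSpace N] [SecondCountableTopology N] [BorelSpace N]
  [IsFiniteMeasure μ] [μ.IsOpenPosMeasure]

theorem IsSmoothDecomposition.one_le [Nonempty N] (h : IsSmoothDecomposition d j U P p μ A C) :
    1 ≤ C := by
  have hc : MemLp (fun _ : N => (1 : ℝ)) p μ := memLp_const 1
  refine one_le_of_bounds h.pos (X := ‖hc.toLp _‖) (norm_pos_iff.2 fun h0 => ?_) (h.lower _)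
    (h.upper _)
  have h1 := hc.coeFn_toLp
  rw [h0] at h1
  have h2 := (Continuous.ae_eq_iff_eq μ continuous_zero continuous_const).1
    ((Lp.coeFn_zero ℝ p μ).symm.trans h1)
  exact zero_ne_one (congrFun h2 (Classical.arbitrary N))

/-- The relations between the operators on `L^p` hold for their actions on all functions. -/
theorem IsSmoothDecomposition.pointwise (h : IsSmoothDecomposition d j U P p μ A C)
    (hj : Continuous j) :
    (∀ i, P i ∘ P i = P i) ∧ (∀ i k, i ≠ k → P i ∘ P k = 0) ∧ ∑ i, P i = id := by
  have he := fun i => (h.localized i).isFiniteEval hj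
  refine ⟨fun i => ((he i).comp (he i)).eq_of_induces (he i) ?_ (h.induces i), fun i k hik =>
    ((he i).comp (he k)).eq_of_induces isFiniteEval_zero ?_ (induces_zero (μ := μ) (p := p)),
    (isFiniteEval_sum _ fun i _ => he i).eq_of_induces isFiniteEval_id ?_
      (induces_id (μ := μ) (p := p))⟩
  · have := (h.induces i).comp (h.induces i)
    rwa [h.idempotent i] at this
  · have := (h.induces i).comp (h.induces k)
    rwa [h.orthogonal i k hik] at this
  · have := induces_sum Finset.univ fun i _ => h.induces i
    have e : ∑ i, A i = ContinuousLinearMap.id ℝ (Lp ℝ p μ) := by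
      ext1 f
      rw [sum_apply]
      exact (hasSum_fintype _).unique (h.hasSum f)
    rwa [e] at this

end Decomposition

/-! ### Symmetry of lifted projections -/

section SymmetricLp

variable {X : Type*} [MeasurableSpace X] {μ : Measure X} {p : ℝ≥0∞} [Fact (1 ≤ p)] {T T' : Op X}
  {A A' : Lp ℝ p μ →L[ℝ] Lp ℝ p μ}

theorem Induces.isSymmetricL2 (hp : p = 2) (h : Induces T A) (hA : A ∘L A = A) (h1 : ‖A‖ ≤ 1) :
    IsSymmetricL2 μ T := by
  subst hp
  exact h.isSymmetricL2_iff.2 (isSymmetric_of_isIdempotentElem_of_norm_le_one hA h1)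

theorem Induces.norm_le_one (hp : p = 2) (h : Induces T A) (hA : A ∘L A = A)
    (hT : IsSymmetricL2 μ T) : ‖A‖ ≤ 1 := by
  subst hp
  exact norm_le_one_of_isSymmetric hA (h.isSymmetricL2_iff.1 hT)

theorem Induces.isSymmetricL2_sub_sum (hp : p = 2) (h : Induces T A) (hT : IsSymmetricL2 μ T)
    {ι : Type*} (s : Finset ι) {R : ι → Op X} {B : ι → (Lp ℝ p μ →L[ℝ] Lp ℝ p μ)}
    (hB : ∀ i ∈ s, Induces (R i) (B i)) (hR : ∀ i ∈ s, IsSymmetricL2 μ (R i)) :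
    IsSymmetricL2 μ (T - ∑ i ∈ s, R i) := by
  subst hp
  refine (h.sub (induces_sum s hB)).isSymmetricL2_iff.2 fun x y => ?_
  have k1 : inner ℝ (A x) y = inner ℝ x (A y) := h.isSymmetricL2_iff.1 hT x y
  have k2 : ∀ i ∈ s, inner ℝ (B i x) y = inner ℝ x (B i y) := fun i hi =>
    (hB i hi).isSymmetricL2_iff.1 (hR i hi) x y
  change inner ℝ ((A - ∑ i ∈ s, B i) x) y = inner ℝ x ((A - ∑ i ∈ s, B i) y)
  rw [sub_apply, sub_apply, inner_sub_left, inner_sub_right, sum_apply, sum_apply, sum_inner,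
    inner_sum, k1, Finset.sum_congr rfl k2]

end SymmetricLp

/-! ### The lifted decomposition -/

theorem sum_liftedFamily {M : Type u} {κ : Type w} [Fintype κ] {i₀ : κ} {Q : Op M} {L : κ → Op M} :
    ∑ i, liftedFamily i₀ Q L i = Q := by
  classical
  rw [← Finset.sum_erase_add _ _ (Finset.mem_univ i₀), liftedFamily, if_pos rfl,
    Finset.filter_ne', Finset.sum_congr rfl (g := fun k => L k ∘ Q) fun i hi => by
      rw [liftedFamily, if_neg (Finset.ne_of_mem_erase hi)], add_sub_cancel]

section LiftedFamily

set_option linter.unusedSectionVars false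

variable {d : ℕ} {M : Type u} [TopologicalSpace M] [ChartedSpace (EuclideanSpace ℝ (Fin d)) M]
  [IsManifold (𝓡 d) ∞ M] {g : Metric d M} {m : M → ℝ} {p : ℝ≥0∞} [Fact (1 ≤ p)] {s : ℝ → ℝ}
  {δ ϑ ϑ₁ ϑ₂ a b : ℝ} {T : Set (level m ϑ)} {f : M → ℝ} {S : ℝ → Set M} {P : Op (level m ϑ)}
  [T2Space M] [SecondCountableTopology M] [MeasurableSpace M] [BorelSpace M]
  (hm : ContMDiff (𝓡 d) 𝓘(ℝ, ℝ) ∞ m)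

include hm

theorem IsTube.comp_self_of_induces_lift (h : IsTube g m ϑ a b T)
    (hS : ∀ y, (m y ∈ Ioo a b ∧ y ∈ S (m y)) ↔ y ∈ sweep g m ϑ a b T)
    (hQ : IsLatitudinal d m s δ ϑ₁ ϑ₂) (hI : Ioo (ϑ₁ - δ) (ϑ₂ + δ) ⊆ Ioo a b)
    (hP : IsLocalOp T P) (hPP : P ∘ P = P)
    {A' : Lp ℝ p (riemannianMeasure g (id : M → M) d) →L[ℝ]
      Lp ℝ p (riemannianMeasure g (id : M → M) d)}
    (hA' : Induces (lift g m p a b S ϑ P ∘ latitudinal g m p s δ ϑ₁ ϑ₂) A') : A' ∘L A' = A' := by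
  have := hA'.comp hA'
  rw [h.lift_latitudinal_comp hm hS hQ hI hP hP, hPP] at this
  exact this.unique hA'

variable {κ : Type w} [Fintype κ] {i₀ : κ} {U : κ → Set (level m ϑ)} {Pf : κ → Op (level m ϑ)}
  {A : κ → (Lp ℝ p (levelMeasure g m ϑ) →L[ℝ] Lp ℝ p (levelMeasure g m ϑ))} {C : ℝ} {V : Set M}

theorem liftedCover_subset (hI : Ioo (ϑ₁ - δ) (ϑ₂ + δ) ⊆ Ioo a b) (h : IsTube g m ϑ a b T)
    (hUT : ∀ i, i ≠ i₀ → U i ⊆ T) (i : κ) :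
    liftedCover g m ϑ (ϑ₁ - δ) (ϑ₂ + δ) i₀ U i ⊆ m ⁻¹' Ioo (ϑ₁ - δ) (ϑ₂ + δ) := by
  intro y hy
  rw [liftedCover] at hy
  split_ifs at hy with hi
  · obtain ⟨r, hr, hy1, -⟩ := mem_iUnion₂.1 hy
    have hy1' : m y = r := hy1
    rwa [mem_preimage, hy1']
  · exact ((mem_sweep_iff g hm fun x hx t ht => h.reaches x (hUT i hi hx) t (hI ht)).1 hy).1

/-- The sets `O(U)` cover the slab, since a flow line through `J_ϑ \ U₀` starts in
some other `U`. -/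
theorem iUnion_liftedCover (hI : Ioo (ϑ₁ - δ) (ϑ₂ + δ) ⊆ Ioo a b) (h : IsTube g m ϑ a b T)
    (hUT : ∀ i, i ≠ i₀ → U i ⊆ T) (hr : (U i₀)ᶜ ⊆ T) (hcover : ⋃ i, U i = univ) :
    ⋃ i, liftedCover g m ϑ (ϑ₁ - δ) (ϑ₂ + δ) i₀ U i = m ⁻¹' Ioo (ϑ₁ - δ) (ϑ₂ + δ) := by
  refine Subset.antisymm (iUnion_subset fun i => liftedCover_subset hm hI h hUT i) fun y hy => ?_
  by_cases hy0 : y ∈ sweep g m ϑ (ϑ₁ - δ) (ϑ₂ + δ) (U i₀)ᶜ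
  · obtain ⟨t, ht, _, ⟨x, hx, rfl⟩, rfl⟩ := mem_iUnion₂.1 hy0
    obtain ⟨i, hi⟩ := mem_iUnion.1 (hcover.ge (mem_univ x))
    have hi0 : i ≠ i₀ := by
      rintro rfl
      exact hx hi
    refine mem_iUnion.2 ⟨i, ?_⟩
    rw [liftedCover, if_neg hi0]
    exact mem_iUnion₂.2 ⟨t, ht, x, mem_image_of_mem _ hi, rfl⟩
  · refine mem_iUnion.2 ⟨i₀, ?_⟩
    rw [liftedCover, if_pos rfl, cosweep_eq hm fun x hx t ht => h.reaches x (hr hx) t (hI ht)]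
    exact ⟨hy, hy0⟩

theorem isOpen_liftedCover [CompactSpace (level m ϑ)] (hI : Ioo (ϑ₁ - δ) (ϑ₂ + δ) ⊆ Ioo a b)
    (h : IsTube g m ϑ a b T) (hU : ∀ i, IsOpen (U i)) (hUT : ∀ i, i ≠ i₀ → U i ⊆ T)
    (hr : (U i₀)ᶜ ⊆ T) (i : κ) : IsOpen (liftedCover g m ϑ (ϑ₁ - δ) (ϑ₂ + δ) i₀ U i) := by
  rw [liftedCover]
  split_ifs with hi
  · subst hi
    exact isOpen_cosweep hm (hU _) fun x hx t ht => h.reaches x (hr hx) t (hI ht)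
  · exact isOpen_sweep g hm (hU i) fun x hx t ht => h.reaches x (hUT i hi hx) t (hI ht)

open scoped Classical in
/-- The operators on `L^p(M)` that are induced by the lifted family, and their properties. -/
theorem IsTube.exists_lifted_family (hd : 1 ≤ d) (hp : p ≠ ⊤) [CompactSpace (level m ϑ)]
    [Nonempty (level m ϑ)] (h : IsTube g m ϑ a b T)
    (hS : ∀ y, (m y ∈ Ioo a b ∧ y ∈ S (m y)) ↔ y ∈ sweep g m ϑ a b T)
    (hQ : IsLatitudinal d m s δ ϑ₁ ϑ₂) (hI : Ioo (ϑ₁ - δ) (ϑ₂ + δ) ⊆ Ioo a b)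
    (hV : IsOpen V) (hVT : ∀ x : level m ϑ, x ∉ T → (x : M) ∈ V)
    (hU₀ : U i₀ = Subtype.val ⁻¹' V) (hUT : ∀ i, i ≠ i₀ → U i ⊆ T)
    (hdec : IsSmoothDecomposition d (Subtype.val : level m ϑ → M) U Pf p (levelMeasure g m ϑ) A C) :
    ∃ (AQ : Lp ℝ p (riemannianMeasure g (id : M → M) d) →L[ℝ]
        Lp ℝ p (riemannianMeasure g (id : M → M) d))
      (A' : κ → (Lp ℝ p (riemannianMeasure g (id : M → M) d) →L[ℝ]
        Lp ℝ p (riemannianMeasure g (id : M → M) d))),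
      Induces (latitudinal g m p s δ ϑ₁ ϑ₂) AQ ∧ AQ ∘L AQ = AQ ∧ ‖AQ‖ ≤ awwConst p ∧
      IsProjectionFamily d id (liftedCover g m ϑ (ϑ₁ - δ) (ϑ₂ + δ) i₀ U)
        (liftedFamily i₀ (latitudinal g m p s δ ϑ₁ ϑ₂) fun i => lift g m p a b S ϑ (Pf i)) p
        (riemannianMeasure g (id : M → M) d) A' ∧
      (∀ i, i ≠ i₀ → ‖A' i‖ ≤ awwConst p * ‖A i‖) ∧ ‖A' i₀‖ ≤ awwConst p * (C ^ 2 + 1) ∧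
      ∀ f : Lp ℝ p (riemannianMeasure g (id : M → M) d),
        1 / (2 * C) * ‖AQ f‖ ≤ (∑ i, ‖A' i f‖ ^ p.toReal) ^ (1 / p.toReal) ∧
        (∑ i, ‖A' i f‖ ^ p.toReal) ^ (1 / p.toReal) ≤
          awwConst p * (C ^ (3 * p.toReal) + (C ^ 2 + 1) ^ p.toReal) ^ (1 / p.toReal) *
            ‖AQ f‖ := by
  have hp0 := toReal_pos_of_fact hp
  have := isFiniteMeasure_levelMeasure (g := g) hd hm h.regular ‹_›
  have := isOpenPos_levelMeasure (g := g) hd hm h.regular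
  have hr : (U i₀)ᶜ ⊆ T := fun x hx => by
    by_contra hx'
    exact hx (hU₀ ▸ hVT x hx')
  obtain ⟨hPP, hPk, hsum⟩ := hdec.pointwise continuous_subtype_val
  set Q := latitudinal g m p s δ ϑ₁ ϑ₂ with hQdef
  set L := lift g m p a b S ϑ with hLdef
  set t : Finset κ := Finset.univ.filter (· ≠ i₀) with ht
  have hti : ∀ i ∈ t, i ≠ i₀ := fun i hi => (Finset.mem_filter.1 hi).2
  have hte : t = Finset.univ.erase i₀ := Finset.filter_ne' _ _
  have hloc : ∀ i, i ≠ i₀ → IsLocalOp T (Pf i) := fun i hi =>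
    (hdec.localized i).isLocalOp.mono (hUT i hi)
  have hQQ : ∀ f, Q (Q f) = Q f := fun f =>
    latitudinal_latitudinal hm hQ.cutoff hQ.slab₁ hQ.slab₂ hQ.le
  have hLQ : ∀ i, i ≠ i₀ → ∀ f, L (Pf i) (Q f) = Q (L (Pf i) f) := fun i hi f =>
    h.lift_latitudinal hm hS (hloc i hi) hQ.cutoff hQ.slab₁ hQ.slab₂ (hQ.subset₁.trans hI)
      (hQ.subset₂.trans hI)
  obtain ⟨AQ, hAQ, hAQn⟩ := hQ.exists_induces (g := g) hd hp hm
  have hex : ∀ i, ∃ B : Lp ℝ p (riemannianMeasure g (id : M → M) d) →L[ℝ]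
      Lp ℝ p (riemannianMeasure g (id : M → M) d),
      i ≠ i₀ → Induces (L (Pf i) ∘ Q) B ∧ ‖B‖ ≤ awwConst p * ‖A i‖ := by
    intro i
    by_cases hi : i = i₀
    · exact ⟨0, fun h' => absurd hi h'⟩
    · obtain ⟨B, hB⟩ := h.exists_induces_lift_latitudinal hd hp hm hS hQ hI (hUT i hi)
        (hdec.localized i) (hdec.induces i)
      exact ⟨B, fun _ => hB⟩
  choose B hB using hex
  have hBi : ∀ i ∈ t, Induces (L (Pf i) ∘ Q) (B i) := fun i hi => (hB i (hti i hi)).1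
  -- the sum of the operators other than the distinguished one
  set PT := ∑ i ∈ t, Pf i with hPT
  have hPT₀ : PT + Pf i₀ = id := by
    rw [hPT, hte, Finset.sum_erase_add _ _ (Finset.mem_univ i₀), hsum]
  have hPTloc : IsLocalOp T PT := IsLocalOp.sum t fun i hi => hloc i (hti i hi)
  have hLPT : L PT ∘ Q = ∑ i ∈ t, L (Pf i) ∘ Q := by
    ext1 f
    rw [Finset.sum_apply]
    exact h.lift_sum hm hS t
  have hL0 : L 0 ∘ Q = 0 := by
    ext1 f
    have := h.lift_sum hm hS (p := p) (f := Q f) (∅ : Finset κ) (P := Pf)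
    simpa using this
  have hAQ2 : AQ ∘L AQ = AQ := by
    have := hAQ.comp hAQ
    rw [show Q ∘ Q = Q from funext hQQ] at this
    exact this.unique hAQ
  have hBB : ∀ i ∈ t, ∀ k ∈ t, i ≠ k → B i ∘L B k = 0 := fun i hi k hk hik => by
    have := (hBi i hi).comp (hBi k hk)
    rw [h.lift_latitudinal_comp hm hS hQ hI (hloc i (hti i hi)) (hloc k (hti k hk)),
      hPk i k hik, hL0] at this
    exact this.unique induces_zero
  have hBB1 : ∀ i ∈ t, B i ∘L B i = B i := fun i hi =>
    h.comp_self_of_induces_lift hm hS hQ hI (hloc i (hti i hi)) (hPP i) (hBi i hi)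
  obtain ⟨c1, c2, c3⟩ := complement_of_orthogonal (t := t) (Q := AQ) (B := B) hAQ2
    (fun i hi => by
      have := hAQ.comp (hBi i hi)
      rw [show Q ∘ (L (Pf i) ∘ Q) = L (Pf i) ∘ Q from funext fun f => by
        simp only [Function.comp_apply, ← hLQ i (hti i hi), hQQ]] at this
      exact this.unique (hBi i hi))
    (fun i hi => by
      have := (hBi i hi).comp hAQ
      rw [show (L (Pf i) ∘ Q) ∘ Q = L (Pf i) ∘ Q from funext fun f => by
        simp only [Function.comp_apply, hQQ]] at this
      exact this.unique (hBi i hi))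
    hBB1 hBB
  have hmem : ∀ i, i ≠ i₀ → i ∈ t := fun i hi => Finset.mem_filter.2 ⟨Finset.mem_univ i, hi⟩
  have b1 := h.sum_norm_lift_le hd hp hm hS (fun i hi => hloc i (hti i hi))
    (fun i _ => hdec.induces i) hdec.pos.le (hdec.sum_norm_le hp0 t) hAQ hBi
  have b2 := h.norm_lift_le_sum hd hp hm hS (fun i hi => hloc i (hti i hi))
    (fun i _ => hdec.induces i) hdec.pos.le hPTloc (induces_sum t fun i _ => hdec.induces i)
    (hdec.norm_sum_le hp0 t) hAQ hBi (hLPT ▸ induces_sum t hBi)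
  have hsplit : ∀ f, ∑ i, ‖(if i = i₀ then AQ - ∑ k ∈ t, B k else B i) f‖ ^ p.toReal =
      ‖(AQ - ∑ k ∈ t, B k) f‖ ^ p.toReal + ∑ i ∈ t, ‖B i f‖ ^ p.toReal := by
    intro f
    rw [← Finset.add_sum_erase _ _ (Finset.mem_univ i₀), if_pos rfl, ← hte]
    congr 1
    exact Finset.sum_congr rfl fun i hi => by rw [if_neg (hti i hi)]
  refine ⟨AQ, fun i => if i = i₀ then AQ - ∑ k ∈ t, B k else B i, hAQ, hAQ2, hAQn,
    ⟨isOpen_liftedCover hm hI h hdec.isOpen hUT hr, fun i => ?_, fun K _ => Set.toFinite _,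
      fun i => ?_, fun i => ?_, fun i => ?_, fun i k hik => ?_⟩, fun i hi => ?_, ?_, fun f => ?_⟩
  · refine hQ.compact.of_isClosed_subset isClosed_closure (closure_minimal ?_ hQ.compact.isClosed)
    exact (liftedCover_subset hm hI h hUT i).trans (preimage_mono Ioo_subset_Icc_self)
  · by_cases hi : i = i₀
    · simp only [liftedCover, liftedFamily, if_pos hi]
      rw [hi, hU₀, ← hLPT]
      refine h.isLocalizedHOp_complement hm hS hQ hI hV hVT
        (IsLocalizedHOp.sum t fun i hi => (hdec.localized i).mono (hUT i (hti i hi)))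
        (hU₀ ▸ hdec.localized i₀) hPT₀
    · simp only [liftedCover, liftedFamily, if_neg hi]
      exact h.isLocalizedHOp_lift_latitudinal hm hS hQ hI (hUT i hi) (hdec.localized i)
  · by_cases hi : i = i₀
    · simp only [liftedFamily, if_pos hi]
      exact hAQ.sub (induces_sum t hBi)
    · simp only [liftedFamily, if_neg hi]
      exact hBi i (hmem i hi)
  · by_cases hi : i = i₀
    · simp only [if_pos hi]
      exact c1
    · simp only [if_neg hi]
      exact hBB1 i (hmem i hi)
  · by_cases hi : i = i₀
    · have hk : k ≠ i₀ := fun hk => hik (hi.trans hk.symm)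
      simp only [if_pos hi, if_neg hk]
      exact c2 k (hmem k hk)
    · by_cases hk : k = i₀
      · simp only [if_neg hi, if_pos hk]
        exact c3 i (hmem i hi)
      · simp only [if_neg hi, if_neg hk]
        exact hBB i (hmem i hi) k (hmem k hk) hik
  · simp only [if_neg hi]
    exact (hB i hi).2
  · simp only [if_true]
    refine ContinuousLinearMap.opNorm_le_bound _
      (mul_nonneg awwConst_nonneg (by positivity)) fun f => ?_
    calc _ ≤ (C ^ 2 + 1) * ‖AQ f‖ := norm_sub_le_of_bounds hp0 hdec.pos.le b1 b2 f
      _ ≤ (C ^ 2 + 1) * (awwConst p * ‖f‖) := by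
        gcongr
        exact AQ.le_of_opNorm_le hAQn f
      _ = _ := by ring
  · rw [hsplit]
    exact ⟨norm_le_of_bounds hp0 hdec.one_le b2 f,
      sum_norm_le_of_bounds hp0 hdec.one_le (one_le_awwConst hp0) b1 b2 f⟩

end LiftedFamily

/-! ### Passage of a critical level -/

section Passage

set_option linter.unusedSectionVars false

variable {d : ℕ} {M : Type u} [TopologicalSpace M] [ChartedSpace (EuclideanSpace ℝ (Fin d)) M]
  [IsManifold (𝓡 d) ∞ M] {g : Metric d M} {m : M → ℝ} {z : M} {Uz Vz : Set M}
  {a b δz ϑ ϑ₁ ϑ₂ δ : ℝ} {S : ℝ → Set M} {s : ℝ → ℝ}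

theorem IsMorse.nonneg (hm : IsMorse d m) (x : M) : 0 ≤ m x := by
  have hx : m x ∈ range m := mem_range_self x
  by_cases hc : CompactSpace M
  · rw [hm.range_compact hc] at hx
    exact hx.1
  · rw [hm.range_noncompact hc] at hx
    exact hx

theorem IsMorse.isCompact_preimage (hm : IsMorse d m) (c e : ℝ) : IsCompact (m ⁻¹' Icc c e) :=
  (hm.compact_preimage (max e 1) (by positivity)).of_isClosed_subset
    (isClosed_Icc.preimage hm.smooth.continuous)
    fun x hx => ⟨hm.nonneg x, hx.2.trans (le_max_left _ _)⟩

theorem IsMorse.compactSpace_level (hm : IsMorse d m) (t : ℝ) : CompactSpace (level m t) := by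
  have := hm.isCompact_preimage t t
  rw [Icc_self] at this
  exact isCompact_iff_compactSpace.1 this

theorem IsCriticalPassage.isLatitudinal (h : IsCriticalPassage g m z Uz a b S Vz δz)
    (hm : IsMorse d m) (hs : IsCutoff δ s) (hδ : 0 < δ) (h1 : m z - δz < ϑ₁ - δ)
    (h1z : ϑ₁ + δ < m z) (h2z : m z < ϑ₂ - δ) (h2 : ϑ₂ + δ < m z + δz) :
    IsLatitudinal d m s δ ϑ₁ ϑ₂ where
  cutoff := hs
  pos := hδ
  slab₁ := ⟨hm.isCompact_preimage _ _, fun x hx hc => by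
    rw [(h.crit_iff x (Ioo_subset_Icc_self (h.Icc_subset
      ⟨by linarith [hx.1], by linarith [hx.2, h.δz_pos]⟩))).1 hc] at hx
    linarith [hx.2]⟩
  slab₂ := ⟨hm.isCompact_preimage _ _, fun x hx hc => by
    rw [(h.crit_iff x (Ioo_subset_Icc_self (h.Icc_subset
      ⟨by linarith [hx.1, h.δz_pos], by linarith [hx.2]⟩))).1 hc] at hx
    linarith [hx.1]⟩
  le := by linarith
  compact := hm.isCompact_preimage _ _

theorem IsCriticalPassage.cosweep_subset (h : IsCriticalPassage g m z Uz a b S Vz δz)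
    (hϑ : ϑ ∈ Icc (m z - δz) (m z + δz)) (hI : Ioo (ϑ₁ - δ) (ϑ₂ + δ) ⊆ Icc (m z - δz) (m z + δz)) :
    cosweep g m ϑ (ϑ₁ - δ) (ϑ₂ + δ) (Subtype.val ⁻¹' Vz) ⊆ Uz := by
  refine iUnion₂_subset fun r hr y hy => h.flow_subset ϑ hϑ r (hI hr) ⟨hy.1, fun hy' => hy.2 ?_⟩
  obtain ⟨x, hx, rfl⟩ := hy'
  exact ⟨x, ⟨⟨x, hx.1⟩, hx.2, rfl⟩, rfl⟩

end Passage

end Hestenes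

end

theorem mainTheorem4 {d : ℕ} (hd : 2 ≤ d)
    {M : Type u} [TopologicalSpace M] [T2Space M] [SecondCountableTopology M] [ConnectedSpace M]
    [ChartedSpace (EuclideanSpace ℝ (Fin d)) M] [IsManifold (𝓡 d) ∞ M]
    [MeasurableSpace M] [BorelSpace M]
    (g : Hestenes.Metric d M)
    (m : M → ℝ) (hm : Hestenes.IsMorse d m)
    (z : M) (hz : Hestenes.IsCrit d m z)
    (Uz : Set M) (hUz : IsOpen Uz) (hzU : z ∈ Uz)
    (a b : ℝ) (S : ℝ → Set M) (Vz : Set M) (δz : ℝ)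
    (hpass : Hestenes.IsCriticalPassage g m z Uz a b S Vz δz)
    (ϑ ϑ₁ ϑ₂ δ : ℝ)
    (h₁ : m z - δz < ϑ₁) (h₁z : ϑ₁ < m z) (h₂z : m z < ϑ₂) (h₂ : ϑ₂ < m z + δz)
    (hϑ : ϑ ∈ Icc ϑ₁ ϑ₂) (hϑz : ϑ ≠ m z)
    (hδ : 0 < δ)
    (hδ' : δ < min (min |m z - ϑ₁| |m z - δz - ϑ₁|) (min |m z - ϑ₂| |m z + δz - ϑ₂|))
    (s : ℝ → ℝ) (hs : Hestenes.IsCutoff δ s)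
    (p : ℝ≥0∞) [Fact (1 ≤ p)] (hp : p ≠ ⊤) :
    let ν : Measure M := Hestenes.riemannianMeasure g id d
    let μ : Measure (Hestenes.level m ϑ) := Hestenes.levelMeasure g m ϑ
    let j : Hestenes.level m ϑ → M := Subtype.val
    let Q : Hestenes.Op M := Hestenes.latitudinal g m p s δ ϑ₁ ϑ₂
    let L : Hestenes.Op (Hestenes.level m ϑ) → Hestenes.Op M := Hestenes.lift g m p a b S ϑ
    let B : ℝ := Hestenes.awwConst p
    (∀ U : Set (Hestenes.level m ϑ), IsOpen U → U ⊆ j ⁻¹' S ϑ →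
      ∀ P : Hestenes.Op (Hestenes.level m ϑ), Hestenes.IsLocalizedHOp d j U P →
      ∀ A : Lp ℝ p μ →L[ℝ] Lp ℝ p μ, Hestenes.Induces P A → A ∘L A = A →
        L P ∘ Q = Q ∘ L P ∧
        IsOpen (Hestenes.sweep g m ϑ (ϑ₁ - δ) (ϑ₂ + δ) U) ∧
        Hestenes.IsLocalizedHOp d id (Hestenes.sweep g m ϑ (ϑ₁ - δ) (ϑ₂ + δ) U) (L P ∘ Q) ∧
        ∃ A' : Lp ℝ p ν →L[ℝ] Lp ℝ p ν,
          Hestenes.Induces (L P ∘ Q) A' ∧ A' ∘L A' = A' ∧ ‖A'‖ ≤ B * ‖A‖) ∧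
    (∀ (κ : Type w) [Fintype κ] (i₀ : κ) (U : κ → Set (Hestenes.level m ϑ))
      (P : κ → Hestenes.Op (Hestenes.level m ϑ)) (A : κ → (Lp ℝ p μ →L[ℝ] Lp ℝ p μ)) (C : ℝ),
      U i₀ = j ⁻¹' Vz → (∀ i, i ≠ i₀ → U i ⊆ j ⁻¹' S ϑ) →
      Hestenes.IsSmoothDecomposition d j U P p μ A C →
        let O : κ → Set M := Hestenes.liftedCover g m ϑ (ϑ₁ - δ) (ϑ₂ + δ) i₀ U
        let R : κ → Hestenes.Op M := Hestenes.liftedFamily i₀ Q fun i => L (P i)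
        O i₀ ⊆ Uz ∧
        (⋃ i, O i) = m ⁻¹' Ioo (ϑ₁ - δ) (ϑ₂ + δ) ∧
        (∑ i, R i) = Q ∧
        (∃ (AQ : Lp ℝ p ν →L[ℝ] Lp ℝ p ν) (A' : κ → (Lp ℝ p ν →L[ℝ] Lp ℝ p ν)),
          Hestenes.Induces Q AQ ∧
          Hestenes.IsProjectionFamily d id O R p ν A' ∧
          ‖A' i₀‖ ≤ B * (C ^ 2 + 1) ∧
          ∀ f : Lp ℝ p ν,
            1 / (2 * C) * ‖AQ f‖ ≤ (∑ i, ‖A' i f‖ ^ p.toReal) ^ (1 / p.toReal) ∧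
            (∑ i, ‖A' i f‖ ^ p.toReal) ^ (1 / p.toReal) ≤
              B * (C ^ (3 * p.toReal) + (C ^ 2 + 1) ^ p.toReal) ^ (1 / p.toReal) * ‖AQ f‖) ∧
        (p = 2 → (∀ i, Hestenes.IsSymmetricL2 μ (P i)) →
          ∀ i, Hestenes.IsSymmetricL2 ν (R i))) := by
  intro ν μ j Q L B
  have hd1 : 1 ≤ d := one_le_two.trans hd
  have hms := hm.smooth
  simp only [lt_min_iff, lt_abs] at hδ'
  obtain ⟨⟨k1, k2⟩, k3, k4⟩ := hδ'
  have e1 : ϑ₁ + δ < m z := by rcases k1 with k | k <;> linarith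
  have e2 : m z - δz < ϑ₁ - δ := by rcases k2 with k | k <;> linarith
  have e3 : m z < ϑ₂ - δ := by rcases k3 with k | k <;> linarith
  have e4 : ϑ₂ + δ < m z + δz := by rcases k4 with k | k <;> linarith
  have hI' : Ioo (ϑ₁ - δ) (ϑ₂ + δ) ⊆ Icc (m z - δz) (m z + δz) :=
    Ioo_subset_Icc_self.trans (Icc_subset_Icc e2.le e4.le)
  have hI := hI'.trans hpass.Icc_subset
  have hϑ' : ϑ ∈ Icc (m z - δz) (m z + δz) := ⟨h₁.le.trans hϑ.1, hϑ.2.trans h₂.le⟩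
  have hϑI := hpass.Icc_subset hϑ'
  have hQ := hpass.isLatitudinal hm hs hδ e2 e1 e3 e4
  have hT := hpass.isTube hms hϑI hϑz
  have hS := hpass.mem_sweep_iff hms hϑI
  have := hm.compactSpace_level ϑ
  have : Nonempty (Hestenes.level m ϑ) := by
    obtain ⟨x, hx⟩ := hpass.Ioo_subset hϑI
    exact ⟨⟨x, hx⟩⟩
  refine ⟨fun U hU hUS P hP A hA hAA => ?_, fun κ _ i₀ U P A C hU₀ hUS hdec => ?_⟩
  · have := Hestenes.isFiniteMeasure_levelMeasure (g := g) hd1 hms hT.regular ‹_›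
    have := Hestenes.isOpenPos_levelMeasure (g := g) hd1 hms hT.regular
    have hloc := hP.isLocalOp.mono hUS
    have he := hP.isFiniteEval continuous_subtype_val
    have hPP : P ∘ P = P := (he.comp he).eq_of_induces he (hAA ▸ hA.comp hA) hA
    obtain ⟨A', hA', hn⟩ := hT.exists_induces_lift_latitudinal hd1 hp hms hS hQ hI hUS hP hA
    exact ⟨funext fun f => hT.lift_latitudinal hms hS hloc hs hQ.slab₁ hQ.slab₂
        (hQ.subset₁.trans hI) (hQ.subset₂.trans hI),
      Hestenes.isOpen_sweep g hms hU fun x hx t ht => hT.reaches x (hUS hx) t (hI ht),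
      hT.isLocalizedHOp_lift_latitudinal hms hS hQ hI hUS hP, A', hA',
      hT.comp_self_of_induces_lift hms hS hQ hI hloc hPP hA', hn⟩
  · classical
    intro O R
    have hVT : ∀ x : Hestenes.level m ϑ, x ∉ j ⁻¹' S ϑ → (x : M) ∈ Vz := fun x hx =>
      hpass.diff_subset ϑ hϑ' ⟨x.2, hx⟩
    have hr : (U i₀)ᶜ ⊆ j ⁻¹' S ϑ := fun x hx => by
      by_contra hx'
      exact hx (hU₀ ▸ hVT x hx')
    obtain ⟨AQ, A', hAQ, hAQ2, hAQn, hfam, hn, hn₀, hb⟩ :=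
      hT.exists_lifted_family hms hd1 hp hS hQ hI hpass.isOpen_Vz hVT hU₀ hUS hdec
    refine ⟨?_, Hestenes.iUnion_liftedCover hms hI hT hUS hr hdec.cover,
      Hestenes.sum_liftedFamily, ⟨AQ, A', hAQ, hfam, hn₀, hb⟩, fun hp2 hsym => ?_⟩
    · simp only [O, Hestenes.liftedCover, if_true, hU₀]
      exact hpass.cosweep_subset hϑ' hI'
    · -- projections of norm at most one are orthogonal, and `B ≤ 1` for `p = 2`
      have hB : B ≤ 1 := by
        subst hp2
        exact Hestenes.awwConst_two_le
      have key : ∀ i, i ≠ i₀ → Hestenes.IsSymmetricL2 ν (R i) := fun i hi =>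
        (hfam.induces i).isSymmetricL2 hp2 (hfam.idempotent i) ((hn i hi).trans
          (mul_le_one₀ hB (norm_nonneg _)
            ((hdec.induces i).norm_le_one hp2 (hdec.idempotent i) (hsym i))))
      intro i
      by_cases hi : i = i₀
      · have e : R i = Q - ∑ k ∈ Finset.univ.filter (· ≠ i₀), R k := by
          simp only [R, Hestenes.liftedFamily, if_pos hi]
          congr 1
          exact Finset.sum_congr rfl fun k hk => by rw [if_neg (Finset.mem_filter.1 hk).2]
        rw [e]
        exact hAQ.isSymmetricL2_sub_sum hp2 (hAQ.isSymmetricL2 hp2 hAQ2 (hAQn.trans hB)) _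
          (fun k _ => hfam.induces k) fun k hk => key k (Finset.mem_filter.1 hk).2
      · exact key i hi
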